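/- **Notation.** Let $p$ be a prime, $F$ a number field with absolute Galois group $G_F$, and $w\nmid p$ a finite place of $F$, with decomposition group $G_w=\mathrm{Gal}(\overline F_w/F_w)$, Weil group $W_w$, inertia group $I_w$ and residue field of cardinality $q$. View $W_w\subset G_w\to G_F$ through an embedding $\overline F\hookrightarrow\overline F_w$ over $F$. For $\sigma\in W_w$ let $v(\sigma)\in\mathbb Z$ be the integer such that $\sigma$ acts on the residue field of $\overline F_w$ as the $v(\sigma)$-th power of the geometric Frobenius, and let $|\mathrm{Art}^{-1}|$ be the unramified character $\sigma\mapsto q^{-v(\sigma)}$ of $W_w$. Fix $\phi\in W_w$ with $v(\phi)=1$ and a compatible system $\zeta=(\zeta_{p^k})_k$ of primitive $p$-power roots of unity in $\overline F_w$; let $t_{\zeta,p}:I_w\to\mathbb Z_p$ be the character with $\sigma(\varpi^{1/p^k})=\zeta_{p^k}^{t_{\zeta,p}(\sigma)}\varpi^{1/p^k}$ for every uniformizer $\varpi$ of $F_w$ and every $k$. Representations are finite-dimensional (of finite free rank over a ring), without continuity conditions. For a domain $R$ containing $\mathbb Z_p$, let $\overline Q(R)$ be an algebraic closure of its fraction field,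 $R^{\rm intal}$ the integral closure of $R$ in $\overline Q(R)$, and $R^{\rm intal}[1/p]\subset\overline Q(R)$ the ring obtained by inverting $p$. A *lift* $f^\dagger$ of a homomorphism $f:R\to S$ of such domains is a ring homomorphism $R^{\rm intal}[1/p]\to S^{\rm intal}[1/p]$ extending $f$ (when $S$ is a field the target is $\overline S$). *Weil–Deligne representations.* Let $\Omega$ be an algebraically closed field of characteristic zero. - A Weil–Deligne representation over $\Omega$ is a pair $(r,N)$ consisting of a representation $r$ of $W_w$ with $r(I_w)$ finite and a nilpotent $N$ with $r(\sigma)Nr(\sigma)^{-1}=q^{-v(\sigma)}N$. Its Frobenius semisimplification $(r,N)^{\rm Frss}$ is $(\tilde r,N)$, where $\tilde r(\sigma)=r(\sigma)u^{-v(\sigma)}$ and $r(\phi)=su=us$ is the Jordan decomposition ($s$ semisimple, $u$ unipotent). - Let $\Omega$ be moreover a $\mathbb Z_p$-algebra. A representation $\rho$ of $W_w$ over $\Omega$ is *monodromic* if there are a nilpotent $N$ and a finite extension $K'/F_w$ in $\overline F_w$ with $\rho(\tau)=\exp(t_{\zeta,p}(\tau)N)$ for all $\tau\in I_{K'}$.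 Then $\mathrm{WD}(\rho)=(r,N)$ with $r(\sigma)=\rho(\sigma)\exp(-t_{\zeta,p}(\phi^{-v(\sigma)}\sigma)N)$. - For an integer $t\ge1$ and a representation $r$ with $r(I_w)$ finite, $\mathrm{Sp}_t(r)$ is the Weil–Deligne representation $\bigoplus_{j=0}^{t-1} r|\mathrm{Art}^{-1}|^{j}$ whose monodromy maps the $j$-th summand identically to the $(j+1)$-st and kills the last. - A representation of $W_w$ over a domain $A$ is *irreducible Frobenius-semisimple* if the image of $I_w$ is finite and, over $\overline Q(A)$, it is irreducible and $\phi$ acts semisimply. - A representation $\rho$ of $G_w$ over an algebraic closure of $\mathbb Q_p$ is *pure of weight $m$* if $\rho|_{W_w}$ is monodromic and, for every $i$, the eigenvalues of $\phi$ on the $i$-th graded piece of the monodromy filtration of $\mathrm{WD}(\rho|_{W_w})^{\rm Frss}$ are $q$-Weil numbers of weight $m+i$. **Setting.** Let $\mathscr O$ be a domain containing $\mathbb Z_p$ as a subalgebra and let $T:G_F\to\mathscr O$ be a pseudorepresentation with $T=T_1+\cdots+T_n$, $n\ge1$, where each $T_i:G_F\to\mathscr O$ is the trace of an irreducible representation $\sigma_i$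 of $G_F$ over $\overline Q(\mathscr O)$ such that $\sigma_i|_{W_w}$ is monodromic. The *irreducibility and purity locus* of $T_1,\dots,T_n$ is the collection of all tuples $(\mathcal O,\mathfrak p,\kappa,\mathrm{res},\rho_1,\dots,\rho_n)$ where $\mathcal O$ is a domain over $\mathbb Z_p$; $\mathfrak p$ is a prime ideal of $\mathcal O$ such that the Henselization $\mathcal O_{\mathfrak p}^h$ of $\mathcal O_{\mathfrak p}$ is Hausdorff for the topology of its maximal ideal; $\kappa=\mathcal O_{\mathfrak p}/\mathfrak p\mathcal O_{\mathfrak p}$ is an algebraic extension of $\mathbb Q_p$; $\mathrm{res}:\mathscr O\hookrightarrow\mathcal O$ is an injective $\mathbb Z_p$-algebra homomorphism; and each $\rho_i$ is an irreducible representation of $G_F$ over $\overline\kappa$ with trace $\pi_{\mathfrak p}\circ\mathrm{res}\circ T_i$, where $\pi_{\mathfrak p}:\mathcal O\to\kappa$ is the canonical map, such that $\rho_i|_{G_w}$ is pure (of some weight depending on $i$). Write $h_{\mathfrak p}:\mathcal O\to\mathcal O_{\mathfrak p}^h$ for the canonical map. **Theorem.** Suppose that the irreducibility and purity locus of $T_1,\dots,T_n$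 is nonempty. Then there exist positive integers $m$, $t_1\le t_2\le\cdots\le t_m$ and irreducible Frobenius-semisimple representations $r_1,\dots,r_m$ of $W_w$ with coefficients in $\mathscr O^{\rm intal}[1/p]$ such that the following hold. 1. $T|_{W_w}=\sum_{i=1}^m\sum_{j=1}^{t_i}\mathrm{tr}\, r_i\,|\mathrm{Art}^{-1}|^{j-1}$. 2. Let $(\mathcal O,\mathfrak p,\kappa,\mathrm{res},\rho_1,\dots,\rho_n)$ be any element of the locus. Let $\varrho_1,\dots,\varrho_n$ be any representations of $G_F$ over $\mathcal O_{\mathfrak p}^h$ with $\mathrm{tr}\,\varrho_i=h_{\mathfrak p}\circ\mathrm{res}\circ T_i$, let $\mathfrak a$ be any minimal prime of $\mathcal O_{\mathfrak p}^h$ with reduction map $\pi_{\mathfrak a}$, and let $\widetilde\rho_1,\dots,\widetilde\rho_n$ be any semisimple representations of $G_F$ over $\overline Q(\mathcal O)$ with $\mathrm{tr}\,\widetilde\rho_i=\mathrm{res}\circ T_i$. Then for any lifts $\mathrm{res}^\dagger$, $\pi_{\mathfrak p}^\dagger$, $(\pi_{\mathfrak a}\circ h_{\mathfrak p})^\dagger$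 of $\mathrm{res}$, $\pi_{\mathfrak p}$, $\pi_{\mathfrak a}\circ h_{\mathfrak p}$, the representations on the left below are monodromic on $W_w$ and there are isomorphisms of Weil–Deligne representations $$\mathrm{WD}\Big(\bigoplus_{i=1}^n\rho_i|_{W_w}\Big)^{\rm Frss}\simeq\bigoplus_{i=1}^m\mathrm{Sp}_{t_i}(\pi_{\mathfrak p}^\dagger\circ\mathrm{res}^\dagger\circ r_i),$$ $$\mathrm{WD}\Big(\bigoplus_{i=1}^n(\pi_{\mathfrak a}\circ\varrho_i)\otimes\overline Q(\mathcal O_{\mathfrak p}^h/\mathfrak a)|_{W_w}\Big)^{\rm Frss}\simeq\bigoplus_{i=1}^m\mathrm{Sp}_{t_i}((\pi_{\mathfrak a}\circ h_{\mathfrak p})^\dagger\circ\mathrm{res}^\dagger\circ r_i),$$ $$\mathrm{WD}\Big(\bigoplus_{i=1}^n\widetilde\rho_i|_{W_w}\Big)^{\rm Frss}\simeq\bigoplus_{i=1}^m\mathrm{Sp}_{t_i}(\mathrm{res}^\dagger\circ r_i),\qquad \mathrm{WD}\Big(\bigoplus_{i=1}^n\sigma_i|_{W_w}\Big)^{\rm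 Frss}\simeq\bigoplus_{i=1}^m\mathrm{Sp}_{t_i}(r_i).$$ The first isomorphism does not involve the choice of $\varrho_i,\mathfrak a,\widetilde\rho_i$, the second does not involve $\pi_{\mathfrak p}^\dagger,\widetilde\rho_i$, the third does not involve $\pi_{\mathfrak p}^\dagger,\varrho_i,\mathfrak a$, and the fourth involves no choice; each holds independently of the existence of the data it does not involve. -/

import Mathlib

open IsDedekindDomain NumberField Polynomial

universe u v

noncomputable section

namespace PurityFamilies

/-! ### Matrix representations and pseudorepresentations

A representation of a group `G` on the free module `A ^ ι` is a monoid homomorphism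
`G →* Matrix ι ι A`; its values are automatically invertible. -/

section Representations

/-- The representation on `ι → A` attached to a matrix representation. -/
def toRepresentation {G ι A : Type*} [Group G] [Fintype ι] [DecidableEq ι] [CommRing A]
    (ρ : G →* Matrix ι ι A) : Representation A G (ι → A) :=
  (Matrix.toLinAlgEquiv' : Matrix ι ι A ≃ₐ[A] ((ι → A) →ₗ[A] (ι → A))).toMonoidHom.comp ρ

/-- Irreducibility of a matrix representation over a field. -/
def IsIrred {G ι Ω : Type*} [Group G] [Fintype ι] [DecidableEq ι] [Field Ω]
    (ρ : G →* Matrix ι ι Ω) : Prop :=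
  (toRepresentation ρ).IsIrreducible

/-- Semisimplicity of a matrix representation over a field. -/
def IsSemisimpleRep {G ι Ω : Type*} [Group G] [Fintype ι] [DecidableEq ι] [Field Ω]
    (ρ : G →* Matrix ι ι Ω) : Prop :=
  (toRepresentation ρ).IsSemisimpleRepresentation

/-- Extension of scalars `f ∘ ρ` along a ring homomorphism `f`. -/
def mapRep {G ι A B : Type*} [Group G] [Fintype ι] [DecidableEq ι] [CommRing A] [CommRing B]
    (f : A →+* B) (ρ : G →* Matrix ι ι A) : G →* Matrix ι ι B :=
  (f.mapMatrix : Matrix ι ι A →+* Matrix ι ι B).toMonoidHom.comp ρ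

/-- The direct sum of finitely many matrix representations. -/
def sumRep {G I A : Type*} [Group G] [Fintype I] [DecidableEq I] [CommRing A]
    {ι : I → Type*} [∀ i, Fintype (ι i)] [∀ i, DecidableEq (ι i)]
    (ρ : ∀ i, G →* Matrix (ι i) (ι i) A) : G →* Matrix (Σ i, ι i) (Σ i, ι i) A :=
  (Matrix.blockDiagonal'RingHom ι A).toMonoidHom.comp (MonoidHom.pi ρ)

/-- For a permutation `σ` with cycles `(i, σ i, σ² i, …)`, the product over all cycles (fixed
points included) of `T (x_i x_{σ i} x_{σ² i} ⋯)`. Each cycle is counted at its least element. -/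
def cycleProduct {G A : Type*} [Group G] [CommRing A] (T : G → A) {k : ℕ}
    (σ : Equiv.Perm (Fin k)) (x : Fin k → G) : A :=
  open Classical in
  ∏ i ∈ Finset.univ.filter (fun i : Fin k => ∀ j : ℕ, i ≤ (σ ^ j) i),
    T ((List.range (Function.minimalPeriod σ i)).map fun j => x ((σ ^ j) i)).prod

/-- `T : G → A` is a pseudorepresentation of dimension `d`: it is central, `T 1 = d`, and it
satisfies the `d`-dimensional pseudo-character identity. -/
structure IsPseudorepresentation {G A : Type*} [Group G] [CommRing A] (d : ℕ) (T : G → A) :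
    Prop where
  map_one : T 1 = d
  central : ∀ g h, T (g * h) = T (h * g)
  identity : ∀ x : Fin (d + 1) → G,
    ∑ σ : Equiv.Perm (Fin (d + 1)), ((Equiv.Perm.sign σ : ℤ) : A) * cycleProduct T σ x = 0

end Representations

/-! ### Integral closures, lifts and Henselizations -/

section Rings

/-- The algebraic closure of the fraction field of a domain. -/
abbrev Qbar (R : Type*) [CommRing R] [IsDomain R] : Type _ := AlgebraicClosure (FractionRing R)

/-- The subring of `Qbar R` generated by `p⁻¹` and by the integral closure of `R` in `Qbar R`. -/
def intalSubring (p : ℕ) (R : Type*) [CommRing R] [IsDomain R] : Subring (Qbar R) :=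
  Subring.closure ((integralClosure R (Qbar R) : Set (Qbar R)) ∪ {((p : Qbar R))⁻¹})

/-- The ring obtained by inverting `p` in the integral closure of a domain `R` in the algebraic
closure of its fraction field. -/
def intal (p : ℕ) (R : Type*) [CommRing R] [IsDomain R] : Type _ := intalSubring p R

instance (p : ℕ) (R : Type*) [CommRing R] [IsDomain R] : CommRing (intal p R) :=
  inferInstanceAs (CommRing (intalSubring p R))

/-- The inclusion `intal p R → Qbar R`. -/
def intalVal (p : ℕ) (R : Type*) [CommRing R] [IsDomain R] : intal p R →+* Qbar R :=
  (intalSubring p R).subtype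

/-- The canonical map `R → intal p R`. -/
def intalOf (p : ℕ) (R : Type*) [CommRing R] [IsDomain R] : R →+* intal p R :=
  (algebraMap R (Qbar R)).codRestrict (intalSubring p R) fun x =>
    Subring.subset_closure (Or.inl (algebraMap_mem (integralClosure R (Qbar R)) x))

/-- `g` extends the ring homomorphism `f` from `R` to `intal p R`. -/
def IsLift {p : ℕ} {R B : Type*} [CommRing R] [IsDomain R] [CommRing B]
    (f : R →+* B) (g : intal p R →+* B) : Prop :=
  g.comp (intalOf p R) = f

/-- The data `(f, a)` of a monic polynomial over a local ring `A` together with a simple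
approximate root. -/
def HenselDatum (A : Type*) [CommRing A] [IsLocalRing A] : Type _ :=
  {x : A[X] × A // x.1.Monic ∧ x.1.eval x.2 ∈ IsLocalRing.maximalIdeal A ∧
    IsUnit (x.1.derivative.eval x.2)}

/-- The ring obtained from a local ring `A` by freely adjoining a root `x_(f,a)` of `f`
for every `(f, a)`; that is, the tensor product of all the rings `A[X] / (f)`. -/
abbrev HenselRing (A : Type*) [CommRing A] [IsLocalRing A] : Type _ :=
  MvPolynomial (HenselDatum A) A ⧸ Ideal.span (Set.range fun x : HenselDatum A =>
    aeval (MvPolynomial.X x : MvPolynomial (HenselDatum A) A) x.1.1)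

/-- The homomorphism to the residue field of `A` sending `x_(f,a)` to the class of `a`. -/
def HenselRing.toResidueField (A : Type*) [CommRing A] [IsLocalRing A] :
    HenselRing A →+* IsLocalRing.ResidueField A :=
  Ideal.Quotient.lift _
    (MvPolynomial.aeval fun x : HenselDatum A => IsLocalRing.residue A x.1.2).toRingHom (by
      intro a ha
      have : Ideal.span (Set.range fun x : HenselDatum A =>
          aeval (MvPolynomial.X x : MvPolynomial (HenselDatum A) A) x.1.1) ≤
          RingHom.ker (MvPolynomial.aeval (R := A)
            fun x : HenselDatum A => IsLocalRing.residue A x.1.2).toRingHom := by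
        rw [Ideal.span_le]
        rintro _ ⟨x, rfl⟩
        have h := x.2.2.1
        rw [← IsLocalRing.residue_eq_zero_iff] at h
        have h2 : IsLocalRing.residue A (x.1.1.eval x.1.2) =
            aeval (IsLocalRing.residue A x.1.2) x.1.1 := by
          have := Polynomial.aeval_algebraMap_apply_eq_algebraMap_eval
            (A := IsLocalRing.ResidueField A) x.1.2 x.1.1
          exact this.symm
        simp only [SetLike.mem_coe, RingHom.mem_ker, AlgHom.toRingHom_eq_coe, RingHom.coe_coe]
        rw [← Polynomial.aeval_algHom_apply, MvPolynomial.aeval_X, ← h2, h]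
      exact this ha)

/-- The prime of `HenselRing A` at which all approximate roots `a` become exact. -/
abbrev HenselRing.point (A : Type*) [CommRing A] [IsLocalRing A] : Ideal (HenselRing A) :=
  RingHom.ker (HenselRing.toResidueField A)

instance (A : Type*) [CommRing A] [IsLocalRing A] : (HenselRing.point A).IsPrime :=
  RingHom.ker_isPrime _

/-- The Henselization of a local ring `A`. It is the filtered colimit of the étale neighbourhoods
of the closed point of `A` (with trivial residue field extension). Every such neighbourhood is,
after localization, of the form `A[X] / (f)` localized at the point `X = a` with `f` monic and `a`
a simple root modulo the maximal ideal, and between two localized neighbourhoods there is at most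
one morphism. Hence the colimit is the tensor product of all the `A[X] / (f)`, localized at the
point `x_(f,a) = a`. -/
def Henselization (A : Type*) [CommRing A] [IsLocalRing A] : Type _ :=
  Localization.AtPrime (HenselRing.point A)

instance (A : Type*) [CommRing A] [IsLocalRing A] : CommRing (Henselization A) :=
  inferInstanceAs (CommRing (Localization.AtPrime (HenselRing.point A)))

instance (A : Type*) [CommRing A] [IsLocalRing A] : IsLocalRing (Henselization A) :=
  inferInstanceAs (IsLocalRing (Localization.AtPrime (HenselRing.point A)))

instance (S A : Type*) [CommRing S] [CommRing A] [IsLocalRing A] [Algebra S A] :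
    Algebra S (Henselization A) :=
  inferInstanceAs (Algebra S (Localization.AtPrime (HenselRing.point A)))

end Rings

/-! ### The Weil group of a finite place of a number field -/

section WeilGroup

variable (F : Type*) [Field F] [NumberField F] (w : HeightOneSpectrum (𝓞 F))

/-- An algebraic closure of the completion `F_w`. -/
abbrev Kbar : Type _ := AlgebraicClosure (w.adicCompletion F)

/-- The decomposition group `G_w`: the absolute Galois group of `F_w`. -/
abbrev GalLocal : Type _ := Kbar F w ≃ₐ[w.adicCompletion F] Kbar F w

/-- The absolute Galois group `G_F`. -/
abbrev GalGlobal : Type _ := AlgebraicClosure F ≃ₐ[F] AlgebraicClosure F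

/-- The ring of integers of `Kbar`. -/
abbrev OKbar : Subalgebra (w.adicCompletionIntegers F) (Kbar F w) :=
  integralClosure (w.adicCompletionIntegers F) (Kbar F w)

/-- The maximal ideal of the (local) ring of integers of `Kbar`. -/
abbrev maxBar : Ideal (OKbar F w) := Ideal.jacobson ⊥

/-- The cardinality `q` of the residue field at `w`. -/
abbrev resCard : ℕ := Ideal.absNorm w.asIdeal

instance : SMulCommClass (GalLocal F w) (w.adicCompletionIntegers F) (Kbar F w) where
  smul_comm σ a x := by
    rw [AlgEquiv.smul_def, AlgEquiv.smul_def, Algebra.smul_def, Algebra.smul_def, map_mul,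
      IsScalarTower.algebraMap_apply (w.adicCompletionIntegers F) (w.adicCompletion F) (Kbar F w),
      AlgEquiv.commutes]

variable {F w}

/-- `σ` acts on the residue field of `Kbar` as the `n`-th power of the geometric Frobenius,
that is, as `x ↦ x ^ (q ^ (-n))`. -/
def ActsAsFrobPow (σ : GalLocal F w) (n : ℤ) : Prop :=
  ∃ a b : ℕ, n = a - b ∧
    ∀ x : OKbar F w, (σ • x) ^ (resCard F w ^ a) - x ^ (resCard F w ^ b) ∈ maxBar F w

lemma actsAsFrobPow_one : ActsAsFrobPow (1 : GalLocal F w) 0 :=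
  ⟨0, 0, by simp, fun x => by simp⟩

lemma pow_sub_pow_mem {x y : OKbar F w} (h : x - y ∈ maxBar F w) (n : ℕ) :
    x ^ n - y ^ n ∈ maxBar F w :=
  Ideal.mem_of_dvd _ (sub_dvd_pow_sub_pow x y n) h

lemma ActsAsFrobPow.mul {σ τ : GalLocal F w} {m n : ℤ} (hσ : ActsAsFrobPow σ m)
    (hτ : ActsAsFrobPow τ n) : ActsAsFrobPow (σ * τ) (m + n) := by
  obtain ⟨a, b, rfl, hσ⟩ := hσ
  obtain ⟨c, d, rfl, hτ⟩ := hτ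
  refine ⟨a + c, b + d, by push_cast; ring, fun x => ?_⟩
  have h1 := pow_sub_pow_mem (hσ (τ • x)) (resCard F w ^ c)
  have h2 := pow_sub_pow_mem (hτ x) (resCard F w ^ b)
  simp only [← pow_mul, ← pow_add] at h1 h2
  rw [← mul_smul] at h1
  rw [add_comm c b, add_comm d b] at h2
  simpa using (maxBar F w).add_mem h1 h2

lemma ActsAsFrobPow.inv {σ : GalLocal F w} {n : ℤ} (hσ : ActsAsFrobPow σ n) :
    ActsAsFrobPow σ⁻¹ (-n) := by
  obtain ⟨a, b, rfl, hσ⟩ := hσ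
  refine ⟨b, a, by ring, fun x => ?_⟩
  have h := hσ (σ⁻¹ • x)
  rw [smul_inv_smul] at h
  have := (maxBar F w).neg_mem h
  simpa using this

lemma not_forall_pow_sub_pow_mem {m n : ℕ} (h : m < n) :
    ¬ ∀ x : OKbar F w, x ^ n - x ^ m ∈ maxBar F w := by
  intro hx
  have hmonic : ((X : (OKbar F w)[X]) ^ n - X ^ m + 1).Monic := by
    have h1 : ((X : (OKbar F w)[X]) ^ m - 1).degree < (n : ℕ) := by
      refine lt_of_le_of_lt (degree_sub_le _ _) (max_lt ?_ ?_)
      · exact lt_of_le_of_lt (degree_X_pow_le m) (by exact_mod_cast h)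
      · exact lt_of_le_of_lt degree_one_le (by exact_mod_cast (by omega : 0 < n))
    have h2 := monic_X_pow_sub h1
    rwa [← sub_add] at h2
  have hdeg : (((X : (OKbar F w)[X]) ^ n - X ^ m + 1).map
      (algebraMap (OKbar F w) (Kbar F w))).degree ≠ 0 := by
    rw [hmonic.degree_map]
    intro h0
    have h1 := hmonic.degree_le_zero_iff_eq_one.1 h0.le
    have h2 : (X : (OKbar F w)[X]) ^ n = X ^ m := sub_eq_zero.1 (add_eq_right.1 h1)
    have h3 := congrArg natDegree h2
    simp only [natDegree_X_pow] at h3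
    omega
  obtain ⟨y, hy⟩ := IsAlgClosed.exists_root _ hdeg
  rw [IsRoot.def, eval_map] at hy
  have hint : IsIntegral (OKbar F w) y := ⟨_, hmonic, hy⟩
  have hint' : IsIntegral (w.adicCompletionIntegers F) y := isIntegral_trans y hint
  have hz : (⟨y, hint'⟩ : OKbar F w) ^ n - (⟨y, hint'⟩ : OKbar F w) ^ m = -1 := by
    apply Subtype.ext
    have : y ^ n - y ^ m + 1 = 0 := by simpa using hy
    simpa using eq_neg_of_add_eq_zero_left this
  have h1 := hx ⟨y, hint'⟩
  rw [hz] at h1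
  have h2 : (1 : OKbar F w) ∈ maxBar F w := by simpa using (maxBar F w).neg_mem h1
  have h3 : maxBar F w = ⊤ := (Ideal.eq_top_iff_one _).2 h2
  rw [Ideal.jacobson_eq_top_iff] at h3
  exact bot_ne_top h3

lemma ActsAsFrobPow.unique {σ : GalLocal F w} {m n : ℤ} (hm : ActsAsFrobPow σ m)
    (hn : ActsAsFrobPow σ n) : m = n := by
  obtain ⟨a, b, rfl, h1⟩ := hm
  obtain ⟨c, d, rfl, h2⟩ := hn
  have hq : 1 < resCard F w := NumberField.HeightOneSpectrum.one_lt_absNorm w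
  have key : ∀ x : OKbar F w,
      x ^ (resCard F w ^ (a + d)) - x ^ (resCard F w ^ (b + c)) ∈ maxBar F w := fun x => by
    have h3 := pow_sub_pow_mem (h1 x) (resCard F w ^ c)
    have h4 := pow_sub_pow_mem (h2 x) (resCard F w ^ a)
    simp only [← pow_mul, ← pow_add] at h3 h4
    rw [add_comm c a, add_comm d a] at h4
    have := (maxBar F w).sub_mem h3 h4
    simpa using this
  have key' : ∀ x : OKbar F w,
      x ^ (resCard F w ^ (b + c)) - x ^ (resCard F w ^ (a + d)) ∈ maxBar F w := fun x => by
    simpa using (maxBar F w).neg_mem (key x)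
  rcases lt_trichotomy (a + d) (b + c) with h | h | h
  · exact absurd key' (not_forall_pow_sub_pow_mem (Nat.pow_lt_pow_right hq h))
  · omega
  · exact absurd key (not_forall_pow_sub_pow_mem (Nat.pow_lt_pow_right hq h))

variable (F w)

/-- The Weil group `W_w`: the elements of `G_w` acting on the residue field of `Kbar` as an
integral power of Frobenius. -/
def WeilGroup : Subgroup (GalLocal F w) where
  carrier := {σ | ∃ n : ℤ, ActsAsFrobPow σ n}
  mul_mem' := fun ⟨_, h⟩ ⟨_, h'⟩ => ⟨_, h.mul h'⟩
  one_mem' := ⟨0, actsAsFrobPow_one⟩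
  inv_mem' := fun ⟨_, h⟩ => ⟨_, h.inv⟩

/-- The inertia subgroup of the Weil group. -/
def inertia : Subgroup (WeilGroup F w) :=
  ((maxBar F w).inertia (GalLocal F w)).subgroupOf (WeilGroup F w)

variable {F w}

/-- The valuation `v : W_w → ℤ`: `σ` acts on the residue field as the `v σ`-th power of the
geometric Frobenius. -/
def frobVal (σ : WeilGroup F w) : ℤ := σ.2.choose

lemma frobVal_spec (σ : WeilGroup F w) : ActsAsFrobPow (σ : GalLocal F w) (frobVal σ) :=
  σ.2.choose_spec

lemma frobVal_mul (σ τ : WeilGroup F w) : frobVal (σ * τ) = frobVal σ + frobVal τ :=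
  (frobVal_spec (σ * τ)).unique ((frobVal_spec σ).mul (frobVal_spec τ))

lemma frobVal_one : frobVal (1 : WeilGroup F w) = 0 :=
  (frobVal_spec 1).unique actsAsFrobPow_one

lemma frobVal_eq_zero {σ : WeilGroup F w} (h : σ ∈ inertia F w) : frobVal σ = 0 :=
  (frobVal_spec σ).unique ⟨0, 0, by simp, fun x => by
    have h' : (σ : GalLocal F w) ∈ (maxBar F w).inertia (GalLocal F w) := h
    simpa using h' x⟩

variable (w) in
/-- The unramified character `|Art⁻¹|` of the Weil group with values in a field `Ω` in which `q` is
nonzero. The Artin map sends uniformizers to lifts of the geometric Frobenius and units to inertia,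
so this character is `σ ↦ q ^ (-v σ)`. (It is set to `1` when `q = 0` in `Ω`.) -/
def normChar (Ω : Type*) [Field Ω] : WeilGroup F w →* Ω :=
  open Classical in
  if h : (resCard F w : Ω) = 0 then 1 else
    { toFun := fun σ => (resCard F w : Ω) ^ (-frobVal σ)
      map_one' := by simp [frobVal_one]
      map_mul' := fun σ τ => by rw [frobVal_mul, neg_add, zpow_add₀ h] }

lemma normChar_of_mem {Ω : Type*} [Field Ω] {σ : WeilGroup F w} (hσ : σ ∈ inertia F w) :
    normChar w Ω σ = 1 := by
  unfold normChar
  split_ifs <;> simp [frobVal_eq_zero hσ]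

/-- The restriction homomorphism `G_w → G_F` given by an embedding of algebraic closures. -/
def decompHom (e : AlgebraicClosure F →ₐ[F] Kbar F w) : GalLocal F w →* GalGlobal F :=
  letI : Algebra (AlgebraicClosure F) (Kbar F w) := e.toRingHom.toAlgebra
  haveI : IsScalarTower F (AlgebraicClosure F) (Kbar F w) :=
    IsScalarTower.of_algebraMap_eq fun x => (e.commutes x).symm
  (AlgEquiv.restrictNormalHom (F := F) (K₁ := Kbar F w) (AlgebraicClosure F)).comp
    (AlgEquiv.restrictScalarsHom F)

/-- The homomorphism `W_w → G_F`. -/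
def weilToGlobal (e : AlgebraicClosure F →ₐ[F] Kbar F w) : WeilGroup F w →* GalGlobal F :=
  (decompHom e).comp (WeilGroup F w).subtype

end WeilGroup

/-! ### Weil-Deligne representations -/

section WeilDeligne

variable {F : Type*} [Field F] [NumberField F] {w : HeightOneSpectrum (𝓞 F)}

/-- A representation `r` of the Weil group on a finite free `A`-module such that the image of
inertia is finite. -/
structure InertiaFiniteRep (w : HeightOneSpectrum (𝓞 F)) (ι A : Type*) [Fintype ι]
    [DecidableEq ι] [CommRing A] where
  /-- The underlying representation. -/
  r : WeilGroup F w →* Matrix ι ι A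
  finite_inertia : (r '' (inertia F w : Set (WeilGroup F w))).Finite

/-- The representation `f ∘ r`. -/
def InertiaFiniteRep.map {ι A B : Type*} [Fintype ι] [DecidableEq ι] [CommRing A] [CommRing B]
    (f : A →+* B) (ρ : InertiaFiniteRep w ι A) : InertiaFiniteRep w ι B where
  r := mapRep f ρ.r
  finite_inertia := by
    have h := ρ.finite_inertia.image (f.mapMatrix : Matrix ι ι A →+* Matrix ι ι B)
    rw [Set.image_image] at h
    exact h

/-- Irreducible Frobenius-semisimple representations over an algebraically closed field:
irreducible, with finite image of inertia, and such that the Frobenius lift `φ` acts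
semisimply. -/
def InertiaFiniteRep.IsIrredFrobSemisimple {ι Ω : Type*} [Fintype ι] [DecidableEq ι] [Field Ω]
    (φ : WeilGroup F w) (ρ : InertiaFiniteRep w ι Ω) : Prop :=
  IsIrred ρ.r ∧ Module.End.IsSemisimple (Matrix.toLin' (ρ.r φ))

/-- A Weil-Deligne representation `(r, N)` of the Weil group on `Ω ^ ι`. -/
structure WeilDeligneRep (w : HeightOneSpectrum (𝓞 F)) (ι Ω : Type*) [Fintype ι]
    [DecidableEq ι] [Field Ω] extends InertiaFiniteRep w ι Ω where
  /-- The monodromy operator. -/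
  N : Matrix ι ι Ω
  nilpotent : IsNilpotent N
  /-- `r σ N (r σ)⁻¹ = q ^ (-v σ) N`. -/
  comm : ∀ σ, r σ * N = normChar w Ω σ • (N * r σ)

/-- The nilpotent shift matrix `e_j ↦ e_(j+1)` on `Ω ^ t`. -/
def shiftMatrix (t : ℕ) (Ω : Type*) [Field Ω] : Matrix (Fin t) (Fin t) Ω :=
  Matrix.of fun i j => if (i : ℕ) = j + 1 then 1 else 0

lemma shiftMatrix_nilpotent (t : ℕ) (Ω : Type*) [Field Ω] : IsNilpotent (shiftMatrix t Ω) := by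
  have h : ∀ (k : ℕ) (i j : Fin t), (i : ℕ) < j + k → (shiftMatrix t Ω ^ k) i j = 0 := by
    intro k
    induction k with
    | zero =>
      intro i j h
      rw [pow_zero, Matrix.one_apply_ne]
      rintro rfl
      omega
    | succ k ih =>
      intro i j h
      rw [pow_succ, Matrix.mul_apply]
      refine Finset.sum_eq_zero fun l _ => ?_
      by_cases hl : (l : ℕ) = j + 1
      · rw [ih i l (by omega), zero_mul]
      · simp [shiftMatrix, hl]
  refine ⟨t, ?_⟩
  ext i j
  exact h t i j (by omega)

/-- `Sp_t(r)`: the Weil-Deligne representation on `t` copies of the space of `r`, the `j`-th copy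
(`0 ≤ j < t`) being `r |Art⁻¹| ^ j`, whose monodromy maps the `j`-th copy identically onto the
`(j + 1)`-st one and kills the last one. -/
def sp {ι Ω : Type*} [Fintype ι] [DecidableEq ι] [Field Ω] (t : ℕ)
    (ρ : InertiaFiniteRep w ι Ω) : WeilDeligneRep w (Fin t × ι) Ω where
  r :=
    { toFun := fun σ => Matrix.kroneckerMap (· * ·)
        (Matrix.diagonal fun j : Fin t => normChar w Ω σ ^ (j : ℕ)) (ρ.r σ)
      map_one' := by simp
      map_mul' := fun σ τ => by
        rw [← Matrix.mul_kronecker_mul, Matrix.diagonal_mul_diagonal]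
        simp [mul_pow] }
  finite_inertia := by
    refine (ρ.finite_inertia.image
      (fun M => Matrix.kroneckerMap (· * ·) (1 : Matrix (Fin t) (Fin t) Ω) M)).subset ?_
    rintro _ ⟨σ, hσ, rfl⟩
    refine ⟨ρ.r σ, ⟨σ, hσ, rfl⟩, ?_⟩
    simp [normChar_of_mem hσ]
  N := Matrix.kroneckerMap (· * ·) (shiftMatrix t Ω) (1 : Matrix ι ι Ω)
  nilpotent := by
    obtain ⟨k, hk⟩ := shiftMatrix_nilpotent t Ω
    refine ⟨k, ?_⟩
    have h : ∀ n : ℕ, Matrix.kroneckerMap (· * ·) (shiftMatrix t Ω) (1 : Matrix ι ι Ω) ^ n =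
        Matrix.kroneckerMap (· * ·) (shiftMatrix t Ω ^ n) (1 : Matrix ι ι Ω) := by
      intro n
      induction n with
      | zero => simp
      | succ n ih => rw [pow_succ, ih, ← Matrix.mul_kronecker_mul, pow_succ, one_mul]
    rw [h, hk]
    simp
  comm := fun σ => by
    simp only [MonoidHom.coe_mk, OneHom.coe_mk]
    rw [← Matrix.mul_kronecker_mul, ← Matrix.mul_kronecker_mul, ← Matrix.smul_kronecker, one_mul,
      mul_one]
    congr 1
    ext i j
    simp only [shiftMatrix, Matrix.diagonal_mul, Matrix.mul_diagonal, Matrix.of_apply,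
      Matrix.smul_apply, smul_eq_mul]
    split_ifs with h
    · rw [h, pow_succ]
      ring
    · simp

/-- The direct sum of finitely many Weil-Deligne representations. -/
def sumWD {I Ω : Type*} [Fintype I] [DecidableEq I] [Field Ω] {ι : I → Type*}
    [∀ i, Fintype (ι i)] [∀ i, DecidableEq (ι i)] (D : ∀ i, WeilDeligneRep w (ι i) Ω) :
    WeilDeligneRep w (Σ i, ι i) Ω where
  r := sumRep fun i => (D i).r
  finite_inertia := by
    refine ((Set.Finite.pi' fun i => (D i).finite_inertia).image
      (Matrix.blockDiagonal' : (∀ i, Matrix (ι i) (ι i) Ω) → _)).subset ?_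
    rintro _ ⟨σ, hσ, rfl⟩
    exact ⟨fun i => (D i).r σ, fun i => ⟨σ, hσ, rfl⟩, rfl⟩
  N := Matrix.blockDiagonal' fun i => (D i).N
  nilpotent := by
    choose k hk using fun i => (D i).nilpotent
    refine ⟨∑ i, k i, ?_⟩
    rw [← Matrix.blockDiagonal'_pow]
    have : (fun i => (D i).N) ^ (∑ i, k i) = 0 := by
      funext i
      exact pow_eq_zero_of_le (Finset.single_le_sum (fun _ _ => Nat.zero_le _)
        (Finset.mem_univ i)) (hk i)
    rw [this, Matrix.blockDiagonal'_zero]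
  comm := fun σ => by
    change Matrix.blockDiagonal' (fun i => (D i).r σ) * _ =
      _ • (_ * Matrix.blockDiagonal' (fun i => (D i).r σ))
    rw [← Matrix.blockDiagonal'_mul, ← Matrix.blockDiagonal'_mul, ← Matrix.blockDiagonal'_smul]
    congr 1
    funext i
    exact (D i).comm σ

/-- Isomorphism of Weil-Deligne representations. -/
def WeilDeligneRep.IsIso {ι κ Ω : Type*} [Fintype ι] [DecidableEq ι] [Fintype κ] [DecidableEq κ]
    [Field Ω] (D : WeilDeligneRep w ι Ω) (E : WeilDeligneRep w κ Ω) : Prop :=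
  ∃ (P : Matrix ι κ Ω) (Q : Matrix κ ι Ω), P * Q = 1 ∧ Q * P = 1 ∧
    (∀ σ, P * E.r σ = D.r σ * P) ∧ P * E.N = D.N * P

/-- `D'` is the Frobenius semisimplification of `D`: if `r φ = s u = u s` is the Jordan
decomposition with `s` semisimple and `u` unipotent, then `r' σ = r σ u ^ (-v σ)` and
`N' = N`. -/
def WeilDeligneRep.IsFrobSemisimplification {ι Ω : Type*} [Fintype ι] [DecidableEq ι] [Field Ω]
    (φ : WeilGroup F w) (D D' : WeilDeligneRep w ι Ω) : Prop :=
  D'.N = D.N ∧ ∃ (s : Matrix ι ι Ω) (u : (Matrix ι ι Ω)ˣ),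
    D.r φ = s * u ∧ s * u = u * s ∧ Module.End.IsSemisimple (Matrix.toLin' s) ∧
    IsNilpotent ((u : Matrix ι ι Ω) - 1) ∧
    ∀ σ, D'.r σ = D.r σ * ((u ^ (-frobVal σ) : (Matrix ι ι Ω)ˣ) : Matrix ι ι Ω)

/-! #### Monodromic representations and their Weil-Deligne parametrizations -/

variable (p : ℕ) [Fact p.Prime]

/-- A compatible system of primitive `p`-power roots of unity in `Kbar`. -/
structure RootSystem (w : HeightOneSpectrum (𝓞 F)) where
  /-- The chosen primitive `p ^ k`-th roots of unity. -/
  ζ : ℕ → Kbar F w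
  primitive : ∀ k, IsPrimitiveRoot (ζ k) (p ^ k)
  compatible : ∀ k, ζ (k + 1) ^ p = ζ k

variable {p}

/-- The tame character `t_(ζ,p) : I → ℤ_p`, with
`σ (ϖ ^ (1 / p ^ k)) = ζ_k ^ (t σ mod p ^ k) ϖ ^ (1 / p ^ k)` for all uniformizers `ϖ` and all `k`.
(For `w` prime to `p`, a unique such value exists for each `σ` in the inertia group.) -/
def tameChar (z : RootSystem p w) (σ : WeilGroup F w) : ℤ_[p] :=
  Classical.epsilon fun t : ℤ_[p] => ∀ (k : ℕ) (ϖ : w.adicCompletionIntegers F) (y : Kbar F w),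
    Irreducible ϖ → y ^ (p ^ k) = algebraMap (w.adicCompletionIntegers F) (Kbar F w) ϖ →
      (σ : GalLocal F w) y = z.ζ k ^ (PadicInt.toZModPow k t).val * y

/-- The exponential of a nilpotent matrix over a field of characteristic zero. -/
def nilpExp {ι Ω : Type*} [Fintype ι] [DecidableEq ι] [Field Ω] (M : Matrix ι ι Ω) :
    Matrix ι ι Ω :=
  ∑ k ∈ Finset.range (Fintype.card ι), ((k.factorial : Ω)⁻¹) • M ^ k

/-- The representation `ρ` is monodromic with monodromy `N`: over some finite extension `K'` of
`F_w`, the inertia group acts through `τ ↦ exp (t τ N)`. -/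
def HasMonodromy {ι Ω : Type*} [Fintype ι] [DecidableEq ι] [Field Ω] [Algebra ℤ_[p] Ω]
    (z : RootSystem p w) (ρ : WeilGroup F w →* Matrix ι ι Ω) (N : Matrix ι ι Ω) : Prop :=
  IsNilpotent N ∧ ∃ K' : IntermediateField (w.adicCompletion F) (Kbar F w),
    FiniteDimensional (w.adicCompletion F) K' ∧
    ∀ τ ∈ inertia F w, (τ : GalLocal F w) ∈ K'.fixingSubgroup →
      ρ τ = nilpExp (algebraMap ℤ_[p] Ω (tameChar z τ) • N)

/-- The representation `ρ` is monodromic. -/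
def IsMonodromic {ι Ω : Type*} [Fintype ι] [DecidableEq ι] [Field Ω] [Algebra ℤ_[p] Ω]
    (z : RootSystem p w) (ρ : WeilGroup F w →* Matrix ι ι Ω) : Prop :=
  ∃ N, HasMonodromy z ρ N

/-- `D` is the Weil-Deligne parametrization `WD(ρ)` (with respect to the Frobenius lift `φ` and
the system `z`): `ρ` is monodromic with monodromy `N` and
`r σ = ρ σ exp (-t (φ ^ (-v σ) σ) N)`. -/
def IsWDParametrization {ι Ω : Type*} [Fintype ι] [DecidableEq ι] [Field Ω] [Algebra ℤ_[p] Ω]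
    (φ : WeilGroup F w) (z : RootSystem p w) (ρ : WeilGroup F w →* Matrix ι ι Ω)
    (D : WeilDeligneRep w ι Ω) : Prop :=
  HasMonodromy z ρ D.N ∧ ∀ σ, D.r σ =
    ρ σ * nilpExp (-(algebraMap ℤ_[p] Ω (tameChar z (φ ^ (-frobVal σ) * σ)) • D.N))

/-- `ρ` is monodromic and `WD(ρ)^Frss` is isomorphic to `E`. -/
def FrobSemisimpleWDIso {ι κ Ω : Type*} [Fintype ι] [DecidableEq ι] [Fintype κ] [DecidableEq κ]
    [Field Ω] [Algebra ℤ_[p] Ω] (φ : WeilGroup F w) (z : RootSystem p w)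
    (ρ : WeilGroup F w →* Matrix ι ι Ω) (E : WeilDeligneRep w κ Ω) : Prop :=
  ∃ D D' : WeilDeligneRep w ι Ω, IsWDParametrization φ z ρ D ∧
    D.IsFrobSemisimplification φ D' ∧ D'.IsIso E

/-! #### Purity -/

/-- `α` is a `q`-Weil number of weight `m`: an algebraic number such that `q ^ n α` is an algebraic
integer for some `n`, and `|e(α)| = q ^ (m / 2)` for every embedding `e` of `ℚ(α)` into `ℂ`. -/
def IsWeilNumber {Ω : Type*} [Field Ω] (q : ℕ) (m : ℤ) (α : Ω) : Prop :=
  IsAlgebraic ℤ α ∧ (∃ n : ℕ, IsIntegral ℤ ((q : Ω) ^ n * α)) ∧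
    ∀ e : Subfield.closure {α} →+* ℂ,
      ‖e ⟨α, Subfield.subset_closure rfl⟩‖ = (q : ℝ) ^ ((m : ℝ) / 2)

/-- The monodromy filtration of a nilpotent matrix `N`:
`M_i = ∑_j N ^ j (ker N ^ (i + 2 j + 1))`, the sum being over `j ≥ 0` with `i + 2 j + 1 ≥ 0`.
It is the unique increasing filtration with `N M_i ⊆ M_(i-2)` and
`N ^ k : Gr_k ≃ Gr_(-k)` for `k ≥ 0`. -/
def monodromyFiltration {ι Ω : Type*} [Fintype ι] [DecidableEq ι] [Field Ω] (N : Matrix ι ι Ω)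
    (i : ℤ) : Submodule Ω (ι → Ω) :=
  ⨆ j : ℕ, (LinearMap.ker (Matrix.toLin' N ^ (i + 2 * j + 1).toNat)).map (Matrix.toLin' N ^ j)

/-- A Weil-Deligne representation is pure of weight `m` if, for every `i`, the eigenvalues of the
Frobenius lift `φ` on the `i`-th graded piece of the monodromy filtration are `q`-Weil numbers of
weight `m + i`. -/
def WeilDeligneRep.IsPure {ι Ω : Type*} [Fintype ι] [DecidableEq ι] [Field Ω]
    (φ : WeilGroup F w) (m : ℤ) (D : WeilDeligneRep w ι Ω) : Prop :=
  ∀ (i : ℤ) (α : Ω) (x : ι → Ω), x ∈ monodromyFiltration D.N i →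
    x ∉ monodromyFiltration D.N (i - 1) →
    (D.r φ).mulVec x - α • x ∈ monodromyFiltration D.N (i - 1) →
    IsWeilNumber (resCard F w) (m + i) α

/-- A representation of the Weil group is pure of weight `m` if it is monodromic and the Frobenius
semisimplification of its Weil-Deligne parametrization is pure of weight `m`. -/
def IsPureRep {ι Ω : Type*} [Fintype ι] [DecidableEq ι] [Field Ω] [Algebra ℤ_[p] Ω]
    (φ : WeilGroup F w) (z : RootSystem p w) (m : ℤ) (ρ : WeilGroup F w →* Matrix ι ι Ω) : Prop :=
  ∃ D D' : WeilDeligneRep w ι Ω, IsWDParametrization φ z ρ D ∧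
    D.IsFrobSemisimplification φ D' ∧ D'.IsPure φ m

end WeilDeligne

/-! ### The irreducibility and purity locus -/

section Locus

variable {F : Type*} [Field F] [NumberField F] {w : HeightOneSpectrum (𝓞 F)}
  {p : ℕ} [Fact p.Prime] {𝒪 : Type u} [CommRing 𝒪] [Algebra ℤ_[p] 𝒪] {n : ℕ}

/-- The elements `(R, 𝔭, κ, res, ρ_1, …, ρ_n)` of the irreducibility and `w`-purity locus of
`T_1, …, T_n : G_F → 𝒪`. -/
structure PurityLocus (e : AlgebraicClosure F →ₐ[F] Kbar F w) (φ : WeilGroup F w)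
    (z : RootSystem p w) (T : Fin n → GalGlobal F → 𝒪) where
  /-- A domain over `ℤ_p`. -/
  R : Type v
  [commRing : CommRing R]
  [isDomain : IsDomain R]
  [algebra : Algebra ℤ_[p] R]
  /-- A prime ideal of `R`, with residue field `κ = 𝔭.ResidueField`. -/
  𝔭 : Ideal R
  [isPrime : 𝔭.IsPrime]
  /-- The Henselization of the localization at `𝔭` is Hausdorff. -/
  hausdorff : IsHausdorff (IsLocalRing.maximalIdeal (Henselization (Localization.AtPrime 𝔭)))
    (Henselization (Localization.AtPrime 𝔭))
  /-- The residue field `κ` is an algebraic extension of `ℚ_p`. -/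
  injective_residue : Function.Injective (algebraMap ℤ_[p] 𝔭.ResidueField)
  algebraic_residue : Algebra.IsAlgebraic ℤ_[p] 𝔭.ResidueField
  /-- An injective homomorphism of `ℤ_p`-algebras. -/
  res : 𝒪 →ₐ[ℤ_[p]] R
  res_injective : Function.Injective res
  /-- The dimensions of the `ρ_i`. -/
  d : Fin n → ℕ
  /-- The representations `ρ_i` over an algebraic closure of `κ`. -/
  ρ : ∀ i, GalGlobal F →* Matrix (Fin (d i)) (Fin (d i)) (AlgebraicClosure 𝔭.ResidueField)
  irreducible : ∀ i, IsIrred (ρ i)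
  trace : ∀ i g, algebraMap R (AlgebraicClosure 𝔭.ResidueField) (res (T i g)) = (ρ i g).trace
  pure : ∀ i, ∃ m : ℤ, IsPureRep φ z m ((ρ i).comp (weilToGlobal e))

attribute [instance] PurityLocus.commRing PurityLocus.isDomain PurityLocus.algebra
  PurityLocus.isPrime

variable {e : AlgebraicClosure F →ₐ[F] Kbar F w} {φ : WeilGroup F w}
  {z : RootSystem p w} {T : Fin n → GalGlobal F → 𝒪}

/-- The Henselization of the localization of `R` at `𝔭`. -/
abbrev PurityLocus.Rh (x : PurityLocus.{u, v, _} e φ z T) : Type v :=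
  Henselization (Localization.AtPrime x.𝔭)

/-- The canonical map from `R` to the Henselization of its localization at `𝔭`. -/
def PurityLocus.h (x : PurityLocus.{u, v, _} e φ z T) : x.R →+* x.Rh :=
  (algebraMap (Localization.AtPrime x.𝔭) x.Rh).comp (algebraMap x.R (Localization.AtPrime x.𝔭))

end Locus

end PurityFamilies
end

open PurityFamilies

/-!
The theorem rests on two facts. Generically, the Weil–Deligne representation of `σ_i` is a sum of
`Sp_t(r)` whose constituents `r` are defined over `intal p 𝒪`. And the sum can be specialized: at
specializations injective on `𝒪` because everything is an extension of scalars, at pure ones because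
purity leaves only one possibility.

*The generic decomposition.* The tame character is nontrivial on the inertia group of every finite
extension (`exists_tameChar_ne_zero`), so that the monodromy operator satisfies the required
commutation relation and a monodromic representation has a Weil–Deligne parametrization
(`HasMonodromy.exists_isWDParametrization`). Its Frobenius semisimplification exists and is a sum of
`Sp_t(r)` with `r` irreducible (`WeilDeligneRep.exists_isIso_sumWD_sp`), with the traces of the given
representation. On each `r`, some power of Frobenius acts by a scalar. The power sums of the
eigenvalues of such a power are traces, hence lie in `𝒪`, so the scalars and their inverses lie in the
integrally closed ring `intal p 𝒪` by Newton's identities (`isIntegral_of_power_sums`). After an unramified twist by an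
element of this ring, `r` has finite image, so it is defined over the algebraic numbers
(`IsFull.exists_descent`), and these are integral over `ℚ`. Thus `r` is defined over `intal p 𝒪`
(`exists_integral_models`, `IsMonodromic.exists_integral_strings`).

*Pure specializations.* Let `ρ` be irreducible and pure with the trace of `σ` specialized. Write its
Weil–Deligne representation as a sum of `Sp_t(r)` too. This sum and the specialized generic one have
the same traces, so they have the same irreducible constituents. The Weil numbers give every
constituent a degree: in the pure sum, the degrees along a string of length `t` are
`t - 1, t - 3, …, 1 - t`; in the specialized sum, they go down by two along each string. The second
moment of the degrees is the same for both sums, and for given lengths of the strings it is smallest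
if all strings are centred at zero. Conversely, ranks of elements of the group ring do not increase
under specialization to an irreducible representation (`IsFull.card_mul_rank_le`), and applied to
powers of `g - 1`, with `g` deep in inertia, this bounds the ranks of the powers of the monodromy
operator of the pure side by those of the other. Hence the second moment of the pure side is at most
that of the other with its strings centred. So the strings of the specialized sum are centred, and
strings centred at zero are determined by their constituents with degrees: the longest ones can be
split off one by one (`exists_string_matching`, `isIso_sumWD_sp_of_isPure`,
`specialize_of_isPureRep`).

*Injective specializations.* A homomorphism from `intal p 𝒪` to a field that is injective on `𝒪`
extends to `Qbar 𝒪`, so that a semisimple representation with the specialized trace is an extension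
of scalars of `σ` (`specialize_of_injective`). This applies to the fraction field of the base of an
element of the locus. It applies to the minimal primes `𝔞` of a Henselization as well, since a domain
injects into the quotient by `𝔞` (`PurityLocus.mk_comp_h_injective`); the representations modulo `𝔞`
are semisimple, and even irreducible, since their residual representations are
(`IsFull.of_specialization`).
-/

namespace PurityFamilies

/-! ### Absolutely irreducible matrix representations -/

section Full

variable {G ι κ : Type*} [Group G] [Fintype ι] [DecidableEq ι] [Fintype κ] [DecidableEq κ]

/-- A matrix representation is full if its values span the whole matrix algebra. Over an
algebraically closed field this is irreducibility in positive dimension (Burnside's theorem),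
but the notion also makes sense over a ring and is stable under every change of scalars. -/
def IsFull {A : Type*} [CommRing A] (ρ : G →* Matrix ι ι A) : Prop :=
  Submodule.span A (Set.range ρ) = ⊤

/-- The extension of a matrix representation to the group algebra. -/
noncomputable def algRep {A : Type*} [CommRing A] (ρ : G →* Matrix ι ι A) :
    MonoidAlgebra A G →ₐ[A] Matrix ι ι A :=
  MonoidAlgebra.lift A (Matrix ι ι A) G ρ

@[simp] lemma algRep_single {A : Type*} [CommRing A] (ρ : G →* Matrix ι ι A) (g : G) (c : A) :
    algRep ρ (MonoidAlgebra.single g c) = c • ρ g := by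
  simp [algRep]

lemma range_algRep {A : Type*} [CommRing A] (ρ : G →* Matrix ι ι A) :
    LinearMap.range (algRep ρ).toLinearMap = Submodule.span A (Set.range ρ) := by
  apply le_antisymm
  · rintro _ ⟨a, rfl⟩
    induction a using MonoidAlgebra.induction_linear with
    | zero => simp
    | add f g hf hg => rw [map_add]; exact Submodule.add_mem _ hf hg
    | single g c =>
      simpa using Submodule.smul_mem _ c (Submodule.subset_span (Set.mem_range_self g))
  · rw [Submodule.span_le]
    rintro _ ⟨g, rfl⟩
    exact ⟨MonoidAlgebra.single g 1, by simp⟩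

lemma isFull_of_surjective {A : Type*} [CommRing A] {ρ : G →* Matrix ι ι A}
    (h : Function.Surjective (algRep ρ)) : IsFull ρ := by
  rw [IsFull, ← range_algRep, LinearMap.range_eq_top]
  exact h

lemma asModule_smul {Ω : Type*} [Field Ω] (ρ : G →* Matrix ι ι Ω) (a : MonoidAlgebra Ω G)
    (v : ι → Ω) :
    (toRepresentation ρ).asModuleEquiv (a • (toRepresentation ρ).asModuleEquiv.symm v) =
      (algRep ρ a).mulVec v := by
  rw [Representation.asModuleEquiv_map_smul, LinearEquiv.apply_symm_apply]
  induction a using MonoidAlgebra.induction_linear with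
  | zero => simp
  | add f g hf hg => simp [hf, hg, Matrix.add_mulVec]
  | single g c => simp [toRepresentation, Matrix.smul_mulVec]

/-- A subspace stable under a group representation is a submodule over the group algebra, so that
an irreducible representation has no proper nonzero stable subspace. -/
lemma IsIrred.eq_bot_or_eq_top {Ω : Type*} [Field Ω] {ρ : G →* Matrix ι ι Ω} (h : IsIrred ρ)
    (U : Submodule Ω (ι → Ω)) (hU : ∀ g, ∀ v ∈ U, (ρ g).mulVec v ∈ U) : U = ⊥ ∨ U = ⊤ := by
  have h' : IsSimpleOrder (Subrepresentation (toRepresentation ρ)) := h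
  let S : Subrepresentation (toRepresentation ρ) := ⟨U, fun g v hv => hU g v hv⟩
  rcases IsSimpleOrder.eq_bot_or_eq_top S with h1 | h1
  · left; exact congrArg Subrepresentation.toSubmodule h1
  · right; exact congrArg Subrepresentation.toSubmodule h1

lemma IsIrred.nonempty {Ω : Type*} [Field Ω] {ρ : G →* Matrix ι ι Ω} (h : IsIrred ρ) :
    Nonempty ι := by
  by_contra hι
  rw [not_nonempty_iff] at hι
  have h' : IsSimpleOrder (Subrepresentation (toRepresentation ρ)) := h
  have : (⊥ : Subrepresentation (toRepresentation ρ)) ≠ ⊤ := bot_ne_top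
  apply this
  apply Subrepresentation.toSubmodule_injective
  exact Subsingleton.elim _ _

lemma isIrred_of_forall {Ω : Type*} [Field Ω] [Nonempty ι] {ρ : G →* Matrix ι ι Ω}
    (h : ∀ U : Submodule Ω (ι → Ω), (∀ g, ∀ v ∈ U, (ρ g).mulVec v ∈ U) → U = ⊥ ∨ U = ⊤) :
    IsIrred ρ := by
  unfold IsIrred
  have : Nontrivial (Subrepresentation (toRepresentation ρ)) := by
    refine ⟨⊥, ⊤, fun h0 => ?_⟩
    have := congrArg Subrepresentation.toSubmodule h0
    exact bot_ne_top (α := Submodule Ω (ι → Ω)) this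
  refine ⟨fun S => ?_⟩
  rcases h S.toSubmodule (fun g v hv => S.apply_mem_toSubmodule g hv) with h1 | h1
  · left; exact Subrepresentation.toSubmodule_injective h1
  · right; exact Subrepresentation.toSubmodule_injective h1

/-- **Burnside's theorem**, from the Jacobson density theorem and Schur's lemma. -/
theorem IsIrred.isFull {Ω : Type*} [Field Ω] [IsAlgClosed Ω] {ρ : G →* Matrix ι ι Ω}
    (h : IsIrred ρ) : IsFull ρ := by
  have hs : IsSimpleModule (MonoidAlgebra Ω G) (toRepresentation ρ).asModule :=
    (Representation.irreducible_iff_isSimpleModule_asModule _).1 h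
  have : FiniteDimensional Ω (toRepresentation ρ).asModule :=
    inferInstanceAs (FiniteDimensional Ω (ι → Ω))
  apply isFull_of_surjective
  intro M
  classical
  let e := (toRepresentation ρ).asModuleEquiv
  let f : Module.End (Module.End (MonoidAlgebra Ω G) (toRepresentation ρ).asModule)
      (toRepresentation ρ).asModule :=
    { toFun := fun x => e.symm (M.mulVec (e x))
      map_add' := fun x y => by simp [Matrix.mulVec_add]
      map_smul' := fun c x => by
        obtain ⟨c, rfl⟩ := (IsSimpleModule.algebraMap_end_bijective_of_isAlgClosed Ω).2 c
        simp [Matrix.mulVec_smul] }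
  obtain ⟨r, hr⟩ := jacobson_density f
    (Finset.univ.image fun i : ι => e.symm (Pi.single i 1))
  refine ⟨r, ?_⟩
  apply Matrix.toLin'.injective
  apply LinearMap.pi_ext'
  intro i
  ext1
  have h1 := congrArg e (hr (e.symm (Pi.single i 1)) (by simp))
  rw [asModule_smul] at h1
  simp only [LinearMap.comp_apply, LinearMap.single_apply, Matrix.toLin'_apply]
  rw [← h1]
  simp [f]

lemma IsFull.isIrred {Ω : Type*} [Field Ω] [Nonempty ι] {ρ : G →* Matrix ι ι Ω}
    (h : IsFull ρ) : IsIrred ρ := by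
  refine isIrred_of_forall fun U hU => ?_
  rw [or_iff_not_imp_left]
  intro hne
  obtain ⟨v, hv, hv0⟩ := U.ne_bot_iff.1 hne
  obtain ⟨i, hi⟩ := Function.ne_iff.1 hv0
  have hmem : ∀ M : Matrix ι ι Ω, M.mulVec v ∈ U := by
    intro M
    have hM : M ∈ Submodule.span Ω (Set.range ρ) := by rw [h]; trivial
    induction hM using Submodule.span_induction with
    | mem x hx => obtain ⟨g, rfl⟩ := hx; exact hU g v hv
    | zero => simp
    | add x y _ _ hx hy => rw [Matrix.add_mulVec]; exact U.add_mem hx hy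
    | smul c x _ hx => rw [Matrix.smul_mulVec]; exact U.smul_mem c hx
  rw [eq_top_iff]
  intro x _
  have := hmem (Matrix.vecMulVec x (Pi.single i (v i)⁻¹))
  have hx : (Matrix.vecMulVec x (Pi.single i (v i)⁻¹)).mulVec v = x := by
    ext j
    simp only [Matrix.mulVec, dotProduct, Matrix.vecMulVec_apply]
    rw [Finset.sum_eq_single i (fun b _ hb => by simp [hb]) (by simp)]
    simp only [Pi.single_eq_same]
    rw [mul_assoc, inv_mul_cancel₀ hi, mul_one]
  rwa [hx] at this

lemma mapRep_apply {A B : Type*} [CommRing A] [CommRing B] (f : A →+* B)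
    (ρ : G →* Matrix ι ι A) (g : G) : mapRep f ρ g = (ρ g).map f := rfl

lemma IsFull.mapRep {A B : Type*} [CommRing A] [CommRing B] (f : A →+* B)
    {ρ : G →* Matrix ι ι A} (h : IsFull ρ) : IsFull (mapRep f ρ) := by
  have key : ∀ M : Matrix ι ι A,
      M.map f ∈ Submodule.span B (Set.range (PurityFamilies.mapRep f ρ)) := by
    intro M
    have hM : M ∈ Submodule.span A (Set.range ρ) := by rw [h]; trivial
    induction hM using Submodule.span_induction with
    | mem x hx =>
      obtain ⟨g, rfl⟩ := hx
      exact Submodule.subset_span ⟨g, rfl⟩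
    | zero => simp
    | add x y _ _ hx hy =>
      rw [Matrix.map_add _ (map_add f)]
      exact Submodule.add_mem _ hx hy
    | smul c x _ hx =>
      rw [Matrix.map_smul' _ _ _ (map_mul f)]
      exact Submodule.smul_mem _ _ hx
  rw [IsFull, eq_top_iff]
  intro M _
  rw [Matrix.matrix_eq_sum_single M]
  refine Submodule.sum_mem _ fun i _ => Submodule.sum_mem _ fun j _ => ?_
  have := Submodule.smul_mem _ (M i j) (key (Matrix.single i j 1))
  simpa using this

/-- A linear map intertwining two full representations is zero or invertible. -/
lemma IsFull.exists_inverse {Ω : Type*} [Field Ω] {ρ : G →* Matrix ι ι Ω} {τ : G →* Matrix κ κ Ω}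
    (hρ : IsFull ρ) (hτ : IsFull τ) {P : Matrix ι κ Ω} (hP : ∀ g, P * τ g = ρ g * P)
    (h0 : P ≠ 0) : ∃ Q : Matrix κ ι Ω, P * Q = 1 ∧ Q * P = 1 := by
  have hne : Nonempty ι ∧ Nonempty κ := by
    obtain ⟨i, hi⟩ := Function.ne_iff.1 h0
    obtain ⟨j, hj⟩ := Function.ne_iff.1 hi
    exact ⟨⟨i⟩, ⟨j⟩⟩
  obtain ⟨_, _⟩ := hne
  have hk := hτ.isIrred.eq_bot_or_eq_top (LinearMap.ker P.mulVecLin) (fun g v hv => by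
    simp only [LinearMap.mem_ker, Matrix.mulVecLin_apply, Matrix.mulVec_mulVec] at hv ⊢
    rw [hP, ← Matrix.mulVec_mulVec, hv, Matrix.mulVec_zero])
  have hr := hρ.isIrred.eq_bot_or_eq_top (LinearMap.range P.mulVecLin) (fun g v hv => by
    obtain ⟨x, rfl⟩ := hv
    refine ⟨(τ g).mulVec x, ?_⟩
    simp only [Matrix.mulVecLin_apply, Matrix.mulVec_mulVec, hP])
  have hk' : LinearMap.ker P.mulVecLin = ⊥ := by
    refine hk.resolve_right fun h => h0 ?_
    rw [LinearMap.ker_eq_top] at h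
    rwa [← Matrix.toLin'_apply', LinearEquiv.map_eq_zero_iff] at h
  have hr' : LinearMap.range P.mulVecLin = ⊤ := by
    refine hr.resolve_left fun h => h0 ?_
    rw [LinearMap.range_eq_bot] at h
    rwa [← Matrix.toLin'_apply', LinearEquiv.map_eq_zero_iff] at h
  let E := LinearEquiv.ofBijective P.mulVecLin
    ⟨LinearMap.ker_eq_bot.1 hk', LinearMap.range_eq_top.1 hr'⟩
  refine ⟨LinearMap.toMatrix' E.symm.toLinearMap, ?_, ?_⟩
  · apply Matrix.toLin'.injective
    rw [Matrix.toLin'_mul, Matrix.toLin'_toMatrix', Matrix.toLin'_one]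
    apply LinearMap.ext
    intro y
    exact E.apply_symm_apply y
  · apply Matrix.toLin'.injective
    rw [Matrix.toLin'_mul, Matrix.toLin'_toMatrix', Matrix.toLin'_one]
    apply LinearMap.ext
    intro y
    exact E.symm_apply_apply y

end Full

/-! ### Traces determine semisimple representations -/

section Traces

variable {G ι κ Ω : Type*} [Group G] [Fintype ι] [DecidableEq ι] [Fintype κ] [DecidableEq κ]
  [Field Ω]

/-- Two matrix representations are isomorphic. -/
def RepIso (ρ : G →* Matrix ι ι Ω) (τ : G →* Matrix κ κ Ω) : Prop :=
  ∃ (P : Matrix ι κ Ω) (Q : Matrix κ ι Ω), P * Q = 1 ∧ Q * P = 1 ∧ ∀ g, P * τ g = ρ g * P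

lemma RepIso.symm {ρ : G →* Matrix ι ι Ω} {τ : G →* Matrix κ κ Ω} (h : RepIso ρ τ) :
    RepIso τ ρ := by
  obtain ⟨P, Q, h1, h2, h3⟩ := h
  refine ⟨Q, P, h2, h1, fun g => ?_⟩
  calc Q * ρ g = Q * (ρ g * P) * Q := by rw [Matrix.mul_assoc, Matrix.mul_assoc, h1, Matrix.mul_one]
    _ = τ g * Q := by rw [← h3, ← Matrix.mul_assoc, h2, Matrix.one_mul]

lemma RepIso.refl (ρ : G →* Matrix ι ι Ω) : RepIso ρ ρ := ⟨1, 1, by simp, by simp, by simp⟩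

lemma RepIso.eq_conj {ρ : G →* Matrix ι ι Ω} {τ : G →* Matrix κ κ Ω} {P : Matrix ι κ Ω}
    {Q : Matrix κ ι Ω} (h1 : P * Q = 1) (h3 : ∀ g, P * τ g = ρ g * P) (g : G) :
    ρ g = P * τ g * Q := by
  rw [h3, Matrix.mul_assoc, h1, Matrix.mul_one]

lemma RepIso.trace_eq {ρ : G →* Matrix ι ι Ω} {τ : G →* Matrix κ κ Ω} (h : RepIso ρ τ) (g : G) :
    (ρ g).trace = (τ g).trace := by
  obtain ⟨P, Q, h1, h2, h3⟩ := h
  rw [RepIso.eq_conj h1 h3, Matrix.mul_assoc, Matrix.trace_mul_comm, Matrix.mul_assoc, h2,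
    Matrix.mul_one]

lemma card_eq_of_inverse {P : Matrix ι κ Ω} {Q : Matrix κ ι Ω} (h1 : P * Q = 1) (h2 : Q * P = 1) :
    Fintype.card ι = Fintype.card κ := by
  have := (Matrix.toLin'OfInv h2 h1).finrank_eq
  simpa using this.symm

lemma RepIso.comp {H : Type*} [Group H] {ρ : G →* Matrix ι ι Ω} {τ : G →* Matrix κ κ Ω}
    (h : RepIso ρ τ) (f : H →* G) : RepIso (ρ.comp f) (τ.comp f) := by
  obtain ⟨P, Q, h1, h2, h3⟩ := h
  exact ⟨P, Q, h1, h2, fun g => h3 (f g)⟩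

lemma RepIso.algRep_mul {ρ : G →* Matrix ι ι Ω} {τ : G →* Matrix κ κ Ω} {P : Matrix ι κ Ω}
    (h3 : ∀ g, P * τ g = ρ g * P) (a : MonoidAlgebra Ω G) : P * algRep τ a = algRep ρ a * P := by
  induction a using MonoidAlgebra.induction_linear with
  | zero => simp
  | add f g hf hg => simp [Matrix.mul_add, Matrix.add_mul, hf, hg]
  | single g c => simp [h3]

lemma isSemisimpleModule_prod {R M N : Type*} [Ring R] [AddCommGroup M] [AddCommGroup N]
    [Module R M] [Module R N] [IsSemisimpleModule R M] [IsSemisimpleModule R N] :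
    IsSemisimpleModule R (M × N) := by
  have h3 := IsSemisimpleModule.sup (IsSemisimpleModule.range (LinearMap.inl R M N))
    (IsSemisimpleModule.range (LinearMap.inr R M N))
  rw [LinearMap.sup_range_inl_inr] at h3
  exact IsSemisimpleModule.congr (Submodule.topEquiv (R := R) (M := M × N)).symm

/-- If `s` is absolutely irreducible and does not embed into the semisimple representation `τ`, then
some element of the group algebra acts as the identity on `s` and as zero on `τ`. This is the
Jacobson density theorem for the projection `s ⊕ τ → s`, which commutes with all endomorphisms. -/
theorem IsFull.exists_separating {s : G →* Matrix ι ι Ω} {τ : G →* Matrix κ κ Ω} [Nonempty ι]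
    (hs : IsFull s) (hτ : IsSemisimpleRep τ)
    (h0 : ∀ P : Matrix κ ι Ω, (∀ g, P * s g = τ g * P) → P = 0) :
    ∃ a : MonoidAlgebra Ω G, algRep s a = 1 ∧ algRep τ a = 0 := by
  classical
  let R := MonoidAlgebra Ω G
  let S := (toRepresentation s).asModule
  let N := (toRepresentation τ).asModule
  have i1 : IsSimpleModule R S :=
    (Representation.irreducible_iff_isSimpleModule_asModule _).1 hs.isIrred
  have i2 : IsSemisimpleModule R N :=
    (Representation.isSemisimpleRepresentation_iff_isSemisimpleModule_asModule _).1 hτ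
  let eS := (toRepresentation s).asModuleEquiv
  let eN := (toRepresentation τ).asModuleEquiv
  -- There are no nonzero homomorphisms between `s` and `τ`, in either direction.
  have hSN : ∀ f : S →ₗ[R] N, f = 0 := by
    intro f
    let f' : (ι → Ω) →ₗ[Ω] (κ → Ω) :=
      eN.toLinearMap ∘ₗ (f.restrictScalars Ω) ∘ₗ eS.symm.toLinearMap
    have hf' : LinearMap.toMatrix' f' = 0 := by
      apply h0
      intro g
      apply Matrix.toLin'.injective
      rw [Matrix.toLin'_mul, Matrix.toLin'_mul, Matrix.toLin'_toMatrix']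
      apply LinearMap.ext
      intro v
      have h1 := asModule_smul s (MonoidAlgebra.single g 1) v
      have h2 := asModule_smul τ (MonoidAlgebra.single g 1) (f' v)
      rw [algRep_single, one_smul] at h1 h2
      simp only [LinearMap.comp_apply, Matrix.toLin'_apply]
      rw [← h1, ← h2]
      simp only [f', LinearMap.comp_apply, LinearEquiv.coe_coe, LinearMap.restrictScalars_apply,
        eS, eN, LinearEquiv.symm_apply_apply, map_smul]
    have hf'' : f' = 0 := by
      rwa [LinearEquiv.map_eq_zero_iff] at hf'
    ext x
    have := LinearMap.congr_fun hf'' (eS x)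
    simp only [f', LinearMap.comp_apply, LinearEquiv.coe_coe, LinearEquiv.symm_apply_apply,
      LinearMap.zero_apply, LinearEquiv.map_eq_zero_iff] at this
    exact this
  have i4 : Nontrivial S := IsSimpleModule.nontrivial R S
  have hNS : ∀ f : N →ₗ[R] S, f = 0 := by
    intro f
    by_contra hf
    have hsurj := f.surjective_of_ne_zero hf
    obtain ⟨g, hg⟩ := IsSemisimpleModule.lifting_property f hsurj LinearMap.id
    rw [hSN g, LinearMap.comp_zero] at hg
    obtain ⟨x, hx⟩ := exists_ne (0 : S)
    exact hx (LinearMap.congr_fun hg x).symm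
  -- The projection to `S` is linear over the endomorphism ring of `S × N`.
  let f : Module.End (Module.End R (S × N)) (S × N) :=
    { toFun := fun x => (x.1, 0)
      map_add' := fun x y => by simp
      map_smul' := fun c x => by
        have h1 : (c (0, x.2)).1 = 0 := LinearMap.congr_fun
          (hNS ((LinearMap.fst R S N).comp (c.comp (LinearMap.inr R S N)))) x.2
        have h2 : (c (x.1, 0)).2 = 0 := LinearMap.congr_fun
          (hSN ((LinearMap.snd R S N).comp (c.comp (LinearMap.inl R S N)))) x.1
        have h3 : c x = c (x.1, 0) + c (0, x.2) := by rw [← map_add]; simp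
        simp only [Module.End.smul_def, RingHom.id_apply]
        apply Prod.ext
        · rw [h3, Prod.fst_add, h1, add_zero]
        · exact h2.symm }
  have i3 : IsSemisimpleModule R (S × N) := isSemisimpleModule_prod
  -- An element of the group algebra agreeing with the projection on a basis of `S × N`.
  obtain ⟨a, ha⟩ := jacobson_density f
    ((Finset.univ.image fun i : ι => (eS.symm (Pi.single i 1), (0 : N))) ∪
      (Finset.univ.image fun i : κ => ((0 : S), eN.symm (Pi.single i 1))))
  refine ⟨a, ?_, ?_⟩
  · apply Matrix.toLin'.injective
    apply LinearMap.pi_ext'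
    intro i
    ext1
    have h1 := congrArg (fun z => eS z.1)
      (ha (eS.symm (Pi.single i 1), 0) (by simp))
    simp only [f, LinearMap.coe_mk, AddHom.coe_mk, Prod.smul_fst] at h1
    rw [asModule_smul] at h1
    simp only [LinearMap.comp_apply, LinearMap.single_apply, Matrix.toLin'_apply]
    rw [← h1, Matrix.one_mulVec]
    exact eS.apply_symm_apply _
  · apply Matrix.toLin'.injective
    apply LinearMap.pi_ext'
    intro i
    ext1
    have h1 := congrArg (fun z => eN z.2)
      (ha (0, eN.symm (Pi.single i 1)) (by simp))
    simp only [f, LinearMap.coe_mk, AddHom.coe_mk, Prod.smul_snd] at h1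
    rw [asModule_smul] at h1
    simp only [LinearMap.comp_apply, LinearMap.single_apply, Matrix.toLin'_apply]
    rw [← h1, Matrix.zero_mulVec]
    exact eN.map_zero

lemma IsIrred.isSemisimpleRep {ρ : G →* Matrix ι ι Ω} (h : IsIrred ρ) : IsSemisimpleRep ρ := by
  have h' : IsSimpleModule (MonoidAlgebra Ω G) (toRepresentation ρ).asModule :=
    (Representation.irreducible_iff_isSimpleModule_asModule _).1 h
  exact (Representation.isSemisimpleRepresentation_iff_isSemisimpleModule_asModule _).2
    inferInstance

lemma trace_algRep_eq {ρ : G →* Matrix ι ι Ω} {τ : G →* Matrix κ κ Ω}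
    (h : ∀ g, (ρ g).trace = (τ g).trace) (a : MonoidAlgebra Ω G) :
    (algRep ρ a).trace = (algRep τ a).trace := by
  induction a using MonoidAlgebra.induction_linear with
  | zero => simp
  | add f g hf hg => simp [hf, hg]
  | single g c => simp [h]

/-- A semisimple representation with the trace of an absolutely irreducible representation is
isomorphic to it. -/
theorem repIso_of_trace_eq [CharZero Ω] {s : G →* Matrix ι ι Ω} {τ : G →* Matrix κ κ Ω} [Nonempty ι]
    (hs : IsFull s) (hτ : IsSemisimpleRep τ) (h : ∀ g, (s g).trace = (τ g).trace) :
    RepIso τ s := by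
  -- Compare the traces of the identity.
  have hcard : Fintype.card ι = Fintype.card κ := by
    have := h 1
    simpa using this
  obtain ⟨P, hP, hP0⟩ : ∃ P : Matrix κ ι Ω, (∀ g, P * s g = τ g * P) ∧ P ≠ 0 := by
    by_contra! hcon
    obtain ⟨a, h1, h2⟩ := hs.exists_separating hτ hcon
    have := trace_algRep_eq h a
    rw [h1, h2] at this
    simp at this
  -- The kernel of the intertwiner `P ≠ 0` is stable, hence trivial.
  have hk := hs.isIrred.eq_bot_or_eq_top (LinearMap.ker P.mulVecLin) (fun g v hv => by
    simp only [LinearMap.mem_ker, Matrix.mulVecLin_apply, Matrix.mulVec_mulVec] at hv ⊢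
    rw [hP, ← Matrix.mulVec_mulVec, hv, Matrix.mulVec_zero])
  have hk' : LinearMap.ker P.mulVecLin = ⊥ := by
    refine hk.resolve_right fun h => hP0 ?_
    rw [LinearMap.ker_eq_top] at h
    rwa [← Matrix.toLin'_apply', LinearEquiv.map_eq_zero_iff] at h
  have hinj := LinearMap.ker_eq_bot.1 hk'
  let E := LinearEquiv.ofInjectiveOfFinrankEq P.mulVecLin hinj (by simpa using hcard)
  refine ⟨P, LinearMap.toMatrix' E.symm.toLinearMap, ?_, ?_, hP⟩
  · apply Matrix.toLin'.injective
    rw [Matrix.toLin'_mul, Matrix.toLin'_toMatrix', Matrix.toLin'_one]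
    apply LinearMap.ext
    intro y
    exact E.apply_symm_apply y
  · apply Matrix.toLin'.injective
    rw [Matrix.toLin'_mul, Matrix.toLin'_toMatrix', Matrix.toLin'_one]
    apply LinearMap.ext
    intro y
    exact E.symm_apply_apply y

/-- For finitely many absolutely irreducible representations `τ_j` not isomorphic to the absolutely
irreducible representation `s`, some element of the group algebra acts as the identity on `s` and
annihilates all the `τ_j`. -/
lemma IsFull.exists_separating_finset {s : G →* Matrix ι ι Ω} [Nonempty ι] (hs : IsFull s)
    {J : Type*} {c : J → ℕ} (τ : ∀ j, G →* Matrix (Fin (c j)) (Fin (c j)) Ω) (B : Finset J)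
    (hτ : ∀ j ∈ B, IsFull (τ j)) (hni : ∀ j ∈ B, ¬ RepIso (τ j) s) :
    ∃ a : MonoidAlgebra Ω G, algRep s a = 1 ∧ ∀ j ∈ B, algRep (τ j) a = 0 := by
  classical
  induction B using Finset.induction_on with
  | empty => exact ⟨1, by simp, by simp⟩
  | insert j B hj ih =>
    obtain ⟨a, h1, h2⟩ := ih (fun j hj => hτ j (Finset.mem_insert_of_mem hj))
      (fun j hj => hni j (Finset.mem_insert_of_mem hj))
    have hjB := Finset.mem_insert_self j B
    obtain ⟨b, h3, h4⟩ : ∃ b : MonoidAlgebra Ω G, algRep s b = 1 ∧ algRep (τ j) b = 0 := by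
      rcases isEmpty_or_nonempty (Fin (c j)) with he | he
      · exact ⟨1, by simp, Subsingleton.elim _ _⟩
      · refine hs.exists_separating (hτ j hjB).isIrred.isSemisimpleRep fun P hP => ?_
        by_contra hP0
        obtain ⟨Q, hQ⟩ := (hτ j hjB).exists_inverse hs hP hP0
        exact hni j hjB ⟨P, Q, hQ.1, hQ.2, hP⟩
    refine ⟨a * b, by rw [map_mul, h1, h3, mul_one], fun k hk => ?_⟩
    rw [map_mul]
    rcases Finset.mem_insert.1 hk with rfl | hk
    · rw [h4, mul_zero]
    · rw [h2 k hk, zero_mul]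

/-- Linear independence of irreducible characters, in the form of a matching: if two finite sums of
irreducible characters agree, every constituent of the first occurs in the second. -/
theorem exists_repIso_of_sum_trace_eq [CharZero Ω] {I J : Type*} {b : I → ℕ} {c : J → ℕ}
    (s : ∀ i, G →* Matrix (Fin (b i)) (Fin (b i)) Ω)
    (τ : ∀ j, G →* Matrix (Fin (c j)) (Fin (c j)) Ω) (A : Finset I) (B : Finset J)
    (hs : ∀ i ∈ A, IsFull (s i)) (hτ : ∀ j ∈ B, IsFull (τ j))
    (h : ∀ g, ∑ i ∈ A, (s i g).trace = ∑ j ∈ B, (τ j g).trace) {i₀ : I} (hi₀ : i₀ ∈ A)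
    (hb : 0 < b i₀) : ∃ j ∈ B, RepIso (τ j) (s i₀) := by
  classical
  by_contra! hcon
  have : Nonempty (Fin (b i₀)) := ⟨⟨0, hb⟩⟩
  obtain ⟨a, ha1, ha2⟩ := (hs i₀ hi₀).exists_separating_finset τ B hτ hcon
  -- `a * a'` annihilates every `τ_j` and every `s_i` not isomorphic to `s_(i₀)`, and acts as the
  -- identity on the others: its trace gives `0 = ∑ dim s_i` over the `s_i` isomorphic to `s_(i₀)`.
  obtain ⟨a', ha1', ha2'⟩ := (hs i₀ hi₀).exists_separating_finset s
    (A.filter fun i => ¬ RepIso (s i) (s i₀)) (fun i hi => hs i (Finset.mem_filter.1 hi).1)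
    (fun i hi => (Finset.mem_filter.1 hi).2)
  have htr : ∀ x : MonoidAlgebra Ω G,
      ∑ i ∈ A, (algRep (s i) x).trace = ∑ j ∈ B, (algRep (τ j) x).trace := by
    intro x
    induction x using MonoidAlgebra.induction_linear with
    | zero => simp
    | add f g hf hg => simp [Finset.sum_add_distrib, hf, hg]
    | single g c => simp [← Finset.mul_sum, h]
  have h1 := htr (a * a')
  rw [Finset.sum_eq_zero (s := B) (fun j hj => by rw [map_mul, ha2 j hj]; simp)] at h1
  have h2 : ∀ i ∈ A, (algRep (s i) (a * a')).trace =
      ((if RepIso (s i) (s i₀) then b i₀ else 0 : ℕ) : Ω) := by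
    intro i hi
    split_ifs with hiso
    · obtain ⟨P, Q, hPQ, hQP, hP⟩ := hiso
      have := RepIso.algRep_mul hP (a * a')
      rw [map_mul, ha1, ha1', mul_one, Matrix.mul_one] at this
      have h3 : algRep (s i) (a * a') = 1 := by
        calc algRep (s i) (a * a') = algRep (s i) (a * a') * (P * Q) := by rw [hPQ, Matrix.mul_one]
          _ = 1 := by rw [← Matrix.mul_assoc, ← this, hPQ]
      have hc := card_eq_of_inverse hPQ hQP
      simp only [Fintype.card_fin] at hc
      rw [h3, Matrix.trace_one, Fintype.card_fin, hc]
    · rw [map_mul, ha2' i (Finset.mem_filter.2 ⟨hi, hiso⟩)]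
      simp
  rw [Finset.sum_congr rfl h2, ← Nat.cast_sum, Nat.cast_eq_zero, Finset.sum_eq_zero_iff] at h1
  have := h1 i₀ hi₀
  rw [if_pos (RepIso.refl _)] at this
  omega

end Traces

/-! ### Semicontinuity of ranks through traces -/

section RankInequality

variable {G ι κ : Type*} [Group G] [Fintype ι] [DecidableEq ι] [Fintype κ] [DecidableEq κ]

/-- A family of vectors contains a basis of its span. -/
lemma exists_linearIndependent_fin {Ω V α : Type*} [Field Ω] [AddCommGroup V] [Module Ω V]
    [FiniteDimensional Ω V] (w : α → V) :
    ∃ g : Fin (Module.finrank Ω (Submodule.span Ω (Set.range w))) → α,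
      LinearIndependent Ω (w ∘ g) := by
  obtain ⟨β, a, -, hspan, hli⟩ := exists_linearIndependent' Ω w
  have : Finite β := hli.finite
  have : Fintype β := Fintype.ofFinite β
  have hc := finrank_span_eq_card hli
  rw [hspan] at hc
  let e : Fin (Module.finrank Ω (Submodule.span Ω (Set.range w))) ≃ β :=
    (finCongr hc).trans (Fintype.equivFin β).symm
  exact ⟨a ∘ e, hli.comp e e.injective⟩

/-- If the functionals `φ_g` span the dual space, linearly independent vectors are detected by a
nonvanishing determinant of values of these functionals. -/
lemma exists_det_ne_zero {Ω V α : Type*} [Field Ω] [AddCommGroup V] [Module Ω V]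
    [FiniteDimensional Ω V] {s : ℕ} {x : Fin s → V} (hx : LinearIndependent Ω x)
    (φ : α → Module.Dual Ω V) (hφ : Submodule.span Ω (Set.range φ) = ⊤) :
    ∃ g : Fin s → α, (Matrix.of fun i j => φ (g i) (x j)).det ≠ 0 := by
  let ev : Module.Dual Ω V →ₗ[Ω] (Fin s → Ω) := LinearMap.pi fun j => Module.Dual.eval Ω V (x j)
  have hev : Function.Surjective ev := by
    intro c
    let b := Module.Basis.span hx
    obtain ⟨ψ, hψ⟩ := LinearMap.exists_extend (b.constr Ω c)
    refine ⟨ψ, ?_⟩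
    ext j
    have h1 := LinearMap.congr_fun hψ (b j)
    rw [Module.Basis.constr_basis, LinearMap.comp_apply, Submodule.subtype_apply,
      Module.Basis.span_apply] at h1
    simpa [ev] using h1
  have hspan : Submodule.span Ω (Set.range fun g => ev (φ g)) = ⊤ := by
    have : (Set.range fun g => ev (φ g)) = ev '' Set.range φ := by
      rw [← Set.range_comp]; rfl
    rw [this, Submodule.span_image, hφ, Submodule.map_top, LinearMap.range_eq_top.2 hev]
  have hfr : Module.finrank Ω (Submodule.span Ω (Set.range fun g => ev (φ g))) = s := by
    rw [hspan, finrank_top, Module.finrank_fin_fun]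
  obtain ⟨g, hg⟩ := exists_linearIndependent_fin (Ω := Ω) fun g => ev (φ g)
  refine ⟨g ∘ finCongr hfr.symm, ?_⟩
  have hg' := hg.comp (finCongr hfr.symm) (finCongr hfr.symm).injective
  have h2 : LinearIndependent Ω
      (Matrix.of fun i j => φ ((g ∘ finCongr hfr.symm) i) (x j)).row := hg'
  rw [Matrix.linearIndependent_rows_iff_isUnit, Matrix.isUnit_iff_isUnit_det] at h2
  exact h2.ne_zero

/-- Left multiplication by `A` acts on the columns of a matrix separately. -/
lemma finrank_range_mulLeft {Ω : Type*} [Field Ω] (A : Matrix ι ι Ω) :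
    Module.finrank Ω (LinearMap.range (LinearMap.mulLeft Ω A)) = Fintype.card ι * A.rank := by
  let F : (ι → LinearMap.range A.mulVecLin) →ₗ[Ω] Matrix ι ι Ω :=
    { toFun := fun c => Matrix.of fun i j => (c j : ι → Ω) i
      map_add' := fun c d => by ext; simp
      map_smul' := fun c d => by ext; simp }
  have hF : Function.Injective F := by
    intro c d h
    funext j
    ext i
    exact congrFun (congrFun h i) j
  have hr : LinearMap.range F = LinearMap.range (LinearMap.mulLeft Ω A) := by
    ext M
    constructor
    · rintro ⟨c, rfl⟩
      choose y hy using fun j => (c j).2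
      refine ⟨Matrix.of fun i j => y j i, ?_⟩
      ext i j
      exact congrFun (hy j) i
    · rintro ⟨X, rfl⟩
      refine ⟨fun j => ⟨A.mulVecLin fun i => X i j, ⟨_, rfl⟩⟩, ?_⟩
      ext i j
      rfl
  rw [← hr, LinearMap.finrank_range_of_inj hF, Module.finrank_pi_fintype]
  simp [Matrix.rank]

/-- The functionals `X ↦ tr (ρ g X)` span the dual of the matrix algebra if `ρ` is full. -/
lemma IsFull.span_traceForm {Ω : Type*} [Field Ω] {ρ : G →* Matrix ι ι Ω} (h : IsFull ρ) :
    Submodule.span Ω (Set.range fun g =>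
      (Matrix.traceLinearMap ι Ω Ω).comp (LinearMap.mulLeft Ω (ρ g))) = ⊤ := by
  let F : Matrix ι ι Ω →ₗ[Ω] Module.Dual Ω (Matrix ι ι Ω) :=
    (LinearMap.mul Ω (Matrix ι ι Ω)).compr₂ (Matrix.traceLinearMap ι Ω Ω)
  have hinj : Function.Injective F := by
    rw [injective_iff_map_eq_zero]
    intro M hM
    ext i j
    have := LinearMap.congr_fun hM (Matrix.single j i 1)
    simpa [F, Matrix.trace_mul_single] using this
  have hsurj : Function.Surjective F :=
    (LinearMap.injective_iff_surjective_of_finrank_eq_finrank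
      (Subspace.dual_finrank_eq (K := Ω) (V := Matrix ι ι Ω)).symm).1 hinj
  have : (Set.range fun g => (Matrix.traceLinearMap ι Ω Ω).comp (LinearMap.mulLeft Ω (ρ g))) =
      F '' Set.range ρ := by
    rw [← Set.range_comp]; rfl
  rw [this, Submodule.span_image, h, Submodule.map_top, LinearMap.range_eq_top.2 hsurj]

/-- The ring homomorphism from the integral group ring attached to a representation. -/
noncomputable def intRep {A : Type*} [CommRing A] (ρ : G →* Matrix ι ι A) :
    MonoidAlgebra ℤ G →ₐ[ℤ] Matrix ι ι A :=
  MonoidAlgebra.lift ℤ (Matrix ι ι A) G ρ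

@[simp] lemma intRep_single {A : Type*} [CommRing A] (ρ : G →* Matrix ι ι A) (g : G) (c : ℤ) :
    intRep ρ (MonoidAlgebra.single g c) = c • ρ g := by
  simp [intRep]

/-- The additive extension of a function on a group to the integral group ring. -/
noncomputable def intTrace {A : Type*} [CommRing A] (T : G → A) : MonoidAlgebra ℤ G →+ A :=
  MonoidAlgebra.liftNC (Int.castAddHom A) T

lemma intTrace_spec {O A : Type*} [CommRing O] [CommRing A] {T : G → O} (f : O →+* A)
    {ρ : G →* Matrix ι ι A} (h : ∀ g, f (T g) = (ρ g).trace) (a : MonoidAlgebra ℤ G) :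
    f (intTrace T a) = (intRep ρ a).trace := by
  induction a using MonoidAlgebra.induction_linear with
  | zero => simp
  | add x y hx hy => simp [hx, hy]
  | single g c =>
    rw [intRep_single, Matrix.trace_smul]
    simp [intTrace, h]

variable {O K Ω : Type*} [CommRing O] [Field K] [Field Ω] {T : G → O}

/-- Let a function `T` with values in a domain be the trace of a representation `σ` generically and
of an absolutely irreducible representation `ρ` after a specialization `f`. The rank of `ρ a` is, up
to the factor `dim ρ`, the rank of the matrix `f (T (g a h))`, `g, h ∈ G`. A nonvanishing minor of
it lifts to a nonvanishing minor of `T (g a h)`. -/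
theorem IsFull.exists_linearIndependent (f : O →+* Ω) {i : O →+* K} (hi : Function.Injective i)
    {ρ : G →* Matrix ι ι Ω} {σ : G →* Matrix κ κ K} (hρ : IsFull ρ)
    (h1 : ∀ g, f (T g) = (ρ g).trace) (h2 : ∀ g, i (T g) = (σ g).trace) (a : MonoidAlgebra ℤ G) :
    ∃ h : Fin (Fintype.card ι * (intRep ρ a).rank) → G,
      LinearIndependent K fun k => intRep σ a * σ (h k) := by
  have hspan : Submodule.span Ω (Set.range fun g => intRep ρ a * ρ g) =
      LinearMap.range (LinearMap.mulLeft Ω (intRep ρ a)) := by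
    have : (Set.range fun g => intRep ρ a * ρ g) =
        LinearMap.mulLeft Ω (intRep ρ a) '' Set.range ρ := by
      rw [← Set.range_comp]; rfl
    rw [this, Submodule.span_image, hρ, Submodule.map_top]
  obtain ⟨h, hh⟩ := exists_linearIndependent_fin (Ω := Ω) fun g => intRep ρ a * ρ g
  obtain ⟨g, hg⟩ := exists_det_ne_zero hh _ hρ.span_traceForm
  -- The determinant is the image of one with entries in `O`, so the generic one does not vanish.
  let e : _ → _ → O := fun j k => intTrace T
    (MonoidAlgebra.single (g j) 1 * (a * MonoidAlgebra.single (h k) 1))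
  have hO : (Matrix.of e).det ≠ 0 := by
    intro h0
    apply hg
    rw [← map_zero f, ← h0, RingHom.map_det]
    congr 1
    ext j k
    simp [e, intTrace_spec f h1]
  have hK : (Matrix.of fun j k => i (e j k)).det ≠ 0 := by
    intro h0
    apply hO
    apply hi
    rw [map_zero, ← h0, RingHom.map_det]
    congr 1
  have hli : LinearIndependent K fun k => intRep σ a * σ (h k) := by
    rw [Fintype.linearIndependent_iff]
    intro c hc'
    have hmul : (Matrix.of fun j k => i (e j k)).mulVec c = 0 := by
      ext j
      have := congrArg (fun X => (σ (g j) * X).trace) hc'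
      simp only [Finset.mul_sum, Matrix.trace_sum, Matrix.mul_smul, Matrix.trace_smul,
        Matrix.mul_zero, Matrix.trace_zero] at this
      rw [Pi.zero_apply, ← this]
      simp only [Matrix.mulVec, dotProduct, Matrix.of_apply]
      refine Finset.sum_congr rfl fun k _ => ?_
      simp [e, intTrace_spec i h2, mul_comm]
    have := Matrix.eq_zero_of_mulVec_eq_zero hK hmul
    exact fun k => congrFun this k
  have hc : Module.finrank Ω (Submodule.span Ω (Set.range fun g => intRep ρ a * ρ g)) =
      Fintype.card ι * (intRep ρ a).rank := by
    rw [hspan, finrank_range_mulLeft]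
  exact ⟨h ∘ finCongr hc.symm, hli.comp _ (finCongr hc.symm).injective⟩

/-- **Semicontinuity of ranks**: the rank of an element of the group ring does not increase under
specialization to an absolutely irreducible representation. -/
theorem IsFull.card_mul_rank_le (f : O →+* Ω) {i : O →+* K} (hi : Function.Injective i)
    {ρ : G →* Matrix ι ι Ω} {σ : G →* Matrix κ κ K} (hρ : IsFull ρ)
    (h1 : ∀ g, f (T g) = (ρ g).trace) (h2 : ∀ g, i (T g) = (σ g).trace) (a : MonoidAlgebra ℤ G) :
    Fintype.card ι * (intRep ρ a).rank ≤ Fintype.card κ * (intRep σ a).rank := by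
  obtain ⟨h, hh⟩ := hρ.exists_linearIndependent f hi h1 h2 a
  have hli : LinearIndependent K fun k => (⟨intRep σ a * σ (h k), ⟨σ (h k), rfl⟩⟩ :
      LinearMap.range (LinearMap.mulLeft K (intRep σ a))) :=
    LinearIndependent.of_comp (Submodule.subtype _) hh
  have hle := hli.fintype_card_le_finrank
  rwa [Fintype.card_fin, finrank_range_mulLeft] at hle

lemma card_eq_of_trace [CharZero K] [CharZero Ω] (f : O →+* Ω) {i : O →+* K}
    (hi : Function.Injective i) {ρ : G →* Matrix ι ι Ω} {σ : G →* Matrix κ κ K}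
    (h1 : ∀ g, f (T g) = (ρ g).trace) (h2 : ∀ g, i (T g) = (σ g).trace) :
    Fintype.card ι = Fintype.card κ := by
  have hT : T 1 = Fintype.card κ := by
    apply hi
    rw [h2, map_natCast]
    simp
  have := h1 1
  rw [hT] at this
  simpa using this.symm

/-- The dimensions agree, as they are the values of the trace at the identity. -/
lemma IsFull.rank_le [CharZero K] [CharZero Ω] (f : O →+* Ω) {i : O →+* K}
    (hi : Function.Injective i) {ρ : G →* Matrix ι ι Ω} {σ : G →* Matrix κ κ K} (hρ : IsFull ρ)
    (h1 : ∀ g, f (T g) = (ρ g).trace) (h2 : ∀ g, i (T g) = (σ g).trace) (a : MonoidAlgebra ℤ G) :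
    (intRep ρ a).rank ≤ (intRep σ a).rank := by
  have h := hρ.card_mul_rank_le f hi h1 h2 a
  have hc := card_eq_of_trace f hi h1 h2
  rcases Nat.eq_zero_or_pos (Fintype.card ι) with h0 | h0
  · have := Matrix.rank_le_card_width (intRep ρ a)
    omega
  · rw [← hc] at h
    exact Nat.le_of_mul_le_mul_left h h0

/-- A representation whose trace specializes to the trace of an absolutely irreducible
representation is absolutely irreducible. -/
theorem IsFull.of_specialization [CharZero K] [CharZero Ω] (f : O →+* Ω) {i : O →+* K}
    (hi : Function.Injective i) {ρ : G →* Matrix ι ι Ω} {σ : G →* Matrix κ κ K} (hρ : IsFull ρ)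
    (h1 : ∀ g, f (T g) = (ρ g).trace) (h2 : ∀ g, i (T g) = (σ g).trace) : IsFull σ := by
  -- For `a = 1`, this gives `(dim σ) ^ 2` linearly independent values of `σ`.
  obtain ⟨h, hh⟩ := hρ.exists_linearIndependent f hi h1 h2 1
  have hc := card_eq_of_trace f hi h1 h2
  simp only [map_one, one_mul] at hh
  have := hh.span_eq_top_of_card_eq_finrank' (by
    rw [map_one, Matrix.rank_one, Fintype.card_fin, Module.finrank_matrix, hc]
    simp)
  rw [IsFull, eq_top_iff, ← this]
  refine Submodule.span_mono ?_
  rintro _ ⟨k, rfl⟩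
  exact ⟨h k, rfl⟩

end RankInequality

/-! ### Inertia and the tame character -/

section Local

variable {F : Type*} [Field F] [NumberField F] {w : HeightOneSpectrum (𝓞 F)}

instance charZero_adicCompletion : CharZero (w.adicCompletion F) :=
  charZero_of_injective_algebraMap (algebraMap F (w.adicCompletion F)).injective

lemma algebraMap_mem_maxBar {x : w.adicCompletionIntegers F}
    (hx : x ∈ IsLocalRing.maximalIdeal (w.adicCompletionIntegers F)) :
    algebraMap (w.adicCompletionIntegers F) (OKbar F w) x ∈ maxBar F w := by
  rw [maxBar, Ideal.jacobson, Submodule.mem_sInf]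
  rintro M ⟨-, hM⟩
  have := Ideal.isMaximal_comap_of_isIntegral_of_isMaximal
    (R := w.adicCompletionIntegers F) M
  rw [← IsLocalRing.eq_maximalIdeal this] at hx
  exact hx

lemma algebraMap_mem_maximalIdeal {x : 𝓞 F} (hx : x ∈ w.asIdeal) :
    algebraMap (𝓞 F) (w.adicCompletionIntegers F) x ∈
      IsLocalRing.maximalIdeal (w.adicCompletionIntegers F) := by
  rw [IsLocalRing.mem_maximalIdeal, mem_nonunits_iff,
    HeightOneSpectrum.adicCompletionIntegers.isUnit_iff_valued_eq_one]
  have := (HeightOneSpectrum.valuation_lt_one_iff_mem (K := F) w x).2 hx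
  apply ne_of_lt
  simpa using this

lemma isUnit_algebraMap {x : 𝓞 F} (hx : x ∉ w.asIdeal) :
    IsUnit (algebraMap (𝓞 F) (w.adicCompletionIntegers F) x) := by
  rw [HeightOneSpectrum.adicCompletionIntegers.isUnit_iff_valued_eq_one]
  have h1 := (HeightOneSpectrum.valuation_lt_one_iff_mem (K := F) w x).not.2 hx
  have h2 := HeightOneSpectrum.valuation_le_one (K := F) w x
  have h3 := le_antisymm h2 (not_lt.1 h1)
  simpa using h3

lemma one_notMem_maxBar : (1 : OKbar F w) ∉ maxBar F w := by
  intro h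
  have h3 : maxBar F w = ⊤ := (Ideal.eq_top_iff_one _).2 h
  rw [Ideal.jacobson_eq_top_iff] at h3
  exact bot_ne_top h3

lemma isUnit_of_sub_mem_maxBar {x y : OKbar F w} (hy : IsUnit y) (h : x - y ∈ maxBar F w) :
    IsUnit x := by
  obtain ⟨u, rfl⟩ := hy
  have h1 := Ideal.mem_jacobson_bot.1 h (↑u⁻¹ : OKbar F w)
  have h2 : (x - u) * ↑u⁻¹ + 1 = x * (↑u⁻¹ : OKbar F w) := by
    rw [sub_mul, Units.mul_inv, sub_add_cancel]
  rw [h2] at h1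
  exact isUnit_of_mul_isUnit_left h1

variable (w) in
lemma exists_residueChar :
    ∃ ℓ n : ℕ, ℓ.Prime ∧ resCard F w = ℓ ^ n ∧ CharP (𝓞 F ⧸ w.asIdeal) ℓ := by
  have hmax : w.asIdeal.IsMaximal := w.isMaximal
  let k := 𝓞 F ⧸ w.asIdeal
  let _ : Field k := Ideal.Quotient.field w.asIdeal
  have : Finite k := w.asIdeal.finiteQuotientOfFreeOfNeBot w.ne_bot
  let _ : Fintype k := Fintype.ofFinite k
  obtain ⟨ℓ, hℓ⟩ := CharP.exists k
  obtain ⟨n, hℓp, hn⟩ := FiniteField.card k ℓ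
  refine ⟨ℓ, n, hℓp, ?_, hℓ⟩
  rw [← hn, resCard, Ideal.absNorm_apply, Submodule.cardQuot_apply, Nat.card_eq_fintype_card]

lemma coprime_resCard {p : ℕ} [Fact p.Prime] (hw : (p : 𝓞 F) ∉ w.asIdeal) :
    Nat.Coprime p (resCard F w) := by
  obtain ⟨ℓ, n, hℓ, hq, hc⟩ := exists_residueChar w
  rw [hq]
  apply Nat.Coprime.pow_right
  rw [Nat.coprime_primes Fact.out hℓ]
  rintro rfl
  apply hw
  rw [← Ideal.Quotient.eq_zero_iff_mem, map_natCast]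
  exact CharP.cast_eq_zero _ p

/-- Taking `q`-power roots is injective modulo the maximal ideal, since the residue
characteristic is the prime dividing `q`. -/
lemma sub_mem_maxBar_of_pow {x y : OKbar F w} {a : ℕ}
    (h : x ^ (resCard F w ^ a) - y ^ (resCard F w ^ a) ∈ maxBar F w) : x - y ∈ maxBar F w := by
  have hmax : w.asIdeal.IsMaximal := w.isMaximal
  let k := 𝓞 F ⧸ w.asIdeal
  let _ : Field k := Ideal.Quotient.field w.asIdeal
  obtain ⟨ℓ, n, hℓp, hq, hℓ⟩ := exists_residueChar w
  let f0 : 𝓞 F →+* OKbar F w :=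
    (algebraMap (w.adicCompletionIntegers F) (OKbar F w)).comp
      (algebraMap (𝓞 F) (w.adicCompletionIntegers F))
  let f : k →+* OKbar F w ⧸ maxBar F w := Ideal.quotientMap (maxBar F w) f0 fun x hx =>
    algebraMap_mem_maxBar (algebraMap_mem_maximalIdeal hx)
  have : Nontrivial (OKbar F w ⧸ maxBar F w) :=
    Ideal.Quotient.nontrivial_iff.2 fun h => one_notMem_maxBar (h.symm ▸ Submodule.mem_top)
  have hc : CharP (OKbar F w ⧸ maxBar F w) ℓ := charP_of_injective_ringHom f.injective ℓ
  have : Fact ℓ.Prime := ⟨hℓp⟩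
  have hrad : (maxBar F w).IsRadical := Ideal.isRadical_jacobson _
  apply hrad
  refine ⟨resCard F w ^ a, ?_⟩
  rw [← Ideal.Quotient.eq_zero_iff_mem] at h ⊢
  rw [map_pow, map_sub]
  rw [map_sub, map_pow, map_pow] at h
  rw [hq, ← pow_mul] at h ⊢
  rw [sub_pow_char_pow, h]

lemma mem_inertia_of_frobVal {σ : WeilGroup F w} (h : frobVal σ = 0) : σ ∈ inertia F w := by
  obtain ⟨a, b, hab, hx⟩ := frobVal_spec σ
  rw [h] at hab
  have hab' : a = b := by omega
  subst hab'
  exact fun x => sub_mem_maxBar_of_pow (hx x)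

lemma mem_inertia_iff {σ : WeilGroup F w} : σ ∈ inertia F w ↔ frobVal σ = 0 :=
  ⟨frobVal_eq_zero, mem_inertia_of_frobVal⟩

lemma frobVal_inv (σ : WeilGroup F w) : frobVal σ⁻¹ = -frobVal σ := by
  have := frobVal_mul σ σ⁻¹
  rw [mul_inv_cancel, frobVal_one] at this
  omega

lemma frobVal_zpow (σ : WeilGroup F w) (n : ℤ) : frobVal (σ ^ n) = n * frobVal σ := by
  have hpow : ∀ n : ℕ, frobVal (σ ^ n) = n * frobVal σ := by
    intro n
    induction n with
    | zero => simp [frobVal_one]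
    | succ n ih => rw [pow_succ, frobVal_mul, ih]; push_cast; ring
  cases n with
  | ofNat n => simpa using hpow n
  | negSucc n => rw [zpow_negSucc, frobVal_inv, hpow]; push_cast [Int.negSucc_eq]; ring

lemma conj_mem_inertia {τ : WeilGroup F w} (hτ : τ ∈ inertia F w) (g : WeilGroup F w) :
    g * τ * g⁻¹ ∈ inertia F w := by
  rw [mem_inertia_iff] at hτ ⊢
  rw [frobVal_mul, frobVal_mul, frobVal_inv, hτ]
  ring

lemma zpow_mul_mem_inertia {φ : WeilGroup F w} (hφ : frobVal φ = 1) (σ : WeilGroup F w) :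
    φ ^ (-frobVal σ) * σ ∈ inertia F w := by
  rw [mem_inertia_iff, frobVal_mul, frobVal_zpow, hφ]
  ring

lemma isUnit_natCast_OKbar {p : ℕ} (hw : (p : 𝓞 F) ∉ w.asIdeal) : IsUnit (p : OKbar F w) := by
  have := (isUnit_algebraMap hw).map (algebraMap (w.adicCompletionIntegers F) (OKbar F w))
  simpa using this

/-- A `p`-power root of unity congruent to `1` is `1`, when `p` is a unit. -/
lemma eq_one_of_pow_eq_one {p : ℕ} (hw : (p : 𝓞 F) ∉ w.asIdeal) {x : OKbar F w} {k : ℕ}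
    (hx : x ^ p ^ k = 1) (h : x - 1 ∈ maxBar F w) : x = 1 := by
  have h1 : IsUnit (∑ i ∈ Finset.range (p ^ k), x ^ i) := by
    refine isUnit_of_sub_mem_maxBar (y := (p : OKbar F w) ^ k)
      ((isUnit_natCast_OKbar hw).pow k) ?_
    have : (∑ i ∈ Finset.range (p ^ k), x ^ i) - (p : OKbar F w) ^ k =
        ∑ i ∈ Finset.range (p ^ k), (x ^ i - 1 ^ i) := by
      rw [Finset.sum_sub_distrib]; simp
    rw [this]
    exact Ideal.sum_mem _ fun i _ => pow_sub_pow_mem h i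
  have h2 := mul_geom_sum x (p ^ k)
  rw [hx, sub_self] at h2
  have h3 := (h1.mul_left_eq_zero).1 h2
  exact sub_eq_zero.1 h3

/-- The prime-to-residue-characteristic roots of units are fixed by inertia. -/
lemma inertia_fix_root_unit {p : ℕ} [Fact p.Prime] (hw : (p : 𝓞 F) ∉ w.asIdeal) {σ : WeilGroup F w}
    (hσ : σ ∈ inertia F w) {u : w.adicCompletionIntegers F} (hu : IsUnit u) {k : ℕ} {y : Kbar F w}
    (hy : y ^ p ^ k = algebraMap (w.adicCompletionIntegers F) (Kbar F w) u) :
    (σ : GalLocal F w) y = y := by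
  have hpk : 0 < p ^ k := pow_pos (Fact.out : p.Prime).pos k
  have hint : y ∈ OKbar F w := by
    have : IsIntegral (w.adicCompletionIntegers F) (y ^ p ^ k) := hy ▸ isIntegral_algebraMap
    exact IsIntegral.of_pow hpk this
  let Y : OKbar F w := ⟨y, hint⟩
  have hY : Y ^ p ^ k = algebraMap (w.adicCompletionIntegers F) (OKbar F w) u :=
    Subtype.ext hy
  have hYu : IsUnit Y := by
    rw [← isUnit_pow_iff hpk.ne', hY]
    exact hu.map _
  obtain ⟨U, hU⟩ := hYu
  have h1 : (σ : GalLocal F w) • Y - Y ∈ maxBar F w := hσ Y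
  have hσY : ((σ : GalLocal F w) • Y) ^ p ^ k = Y ^ p ^ k := by
    rw [← smul_pow', hY]
    apply Subtype.ext
    change (σ : GalLocal F w) (algebraMap (w.adicCompletionIntegers F) (Kbar F w) u) =
      algebraMap (w.adicCompletionIntegers F) (Kbar F w) u
    rw [IsScalarTower.algebraMap_apply (w.adicCompletionIntegers F) (w.adicCompletion F) (Kbar F w),
      AlgEquiv.commutes]
  have h2 : ((σ : GalLocal F w) • Y) * ↑U⁻¹ = 1 := by
    apply eq_one_of_pow_eq_one hw (k := k)
    · rw [mul_pow, hσY, ← hU, ← mul_pow, Units.mul_inv, one_pow]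
    · have := (maxBar F w).mul_mem_right (↑U⁻¹ : OKbar F w) h1
      rw [sub_mul] at this
      nth_rewrite 2 [← hU] at this
      rwa [Units.mul_inv] at this
  have h3 : (σ : GalLocal F w) • Y = Y := by
    rw [Units.mul_inv_eq_iff_eq_mul, one_mul] at h2
    rw [h2, hU]
  exact congrArg Subtype.val h3

end Local

/-! ### The tame character -/

section Tame

variable {F : Type*} [Field F] [NumberField F] {w : HeightOneSpectrum (𝓞 F)}
  {p : ℕ} [Fact p.Prime]

lemma GalLocal.commutes_integers (σ : GalLocal F w) (x : w.adicCompletionIntegers F) :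
    σ (algebraMap (w.adicCompletionIntegers F) (Kbar F w) x) =
      algebraMap (w.adicCompletionIntegers F) (Kbar F w) x := by
  rw [IsScalarTower.algebraMap_apply (w.adicCompletionIntegers F) (w.adicCompletion F) (Kbar F w),
    AlgEquiv.commutes]

lemma algebraMap_integers_injective :
    Function.Injective (algebraMap (w.adicCompletionIntegers F) (Kbar F w)) := by
  rw [IsScalarTower.algebraMap_eq (w.adicCompletionIntegers F) (w.adicCompletion F) (Kbar F w)]
  exact (algebraMap (w.adicCompletion F) (Kbar F w)).injective.comp Subtype.val_injective

lemma inertia_fix_root_one (hw : (p : 𝓞 F) ∉ w.asIdeal) {σ : WeilGroup F w}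
    (hσ : σ ∈ inertia F w) {k : ℕ} {y : Kbar F w} (hy : y ^ p ^ k = 1) :
    (σ : GalLocal F w) y = y :=
  inertia_fix_root_unit hw hσ isUnit_one (k := k) (by rw [hy, map_one])

/-- `y` is a `p ^ k`-th root of some uniformizer. -/
def IsUnifRoot (p : ℕ) (k : ℕ) (y : Kbar F w) : Prop :=
  ∃ ϖ : w.adicCompletionIntegers F, Irreducible ϖ ∧
    y ^ p ^ k = algebraMap (w.adicCompletionIntegers F) (Kbar F w) ϖ

lemma IsUnifRoot.ne_zero {k : ℕ} {y : Kbar F w} (hy : IsUnifRoot p k y) : y ≠ 0 := by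
  obtain ⟨ϖ, hϖ, h⟩ := hy
  rintro rfl
  rw [zero_pow (pow_pos (Fact.out : p.Prime).pos k).ne'] at h
  exact hϖ.ne_zero (algebraMap_integers_injective (by rw [← h, map_zero]))

variable (F w p) in
lemma exists_isUnifRoot (k : ℕ) : ∃ y : Kbar F w, IsUnifRoot p k y := by
  obtain ⟨ϖ, hϖ⟩ := IsDiscreteValuationRing.exists_irreducible (w.adicCompletionIntegers F)
  obtain ⟨y, hy⟩ := IsAlgClosed.exists_pow_nat_eq
    (algebraMap (w.adicCompletionIntegers F) (Kbar F w) ϖ) (pow_pos (Fact.out : p.Prime).pos k)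
  exact ⟨y, ϖ, hϖ, hy⟩

omit [Fact p.Prime] in
lemma IsUnifRoot.map {k : ℕ} {y : Kbar F w} (hy : IsUnifRoot p k y) (σ : GalLocal F w) :
    IsUnifRoot p k (σ y) := by
  obtain ⟨ϖ, hϖ, h⟩ := hy
  exact ⟨ϖ, hϖ, by rw [← map_pow, h, GalLocal.commutes_integers]⟩

omit [Fact p.Prime] in
lemma IsUnifRoot.pow {k : ℕ} {y : Kbar F w} (hy : IsUnifRoot p (k + 1) y) :
    IsUnifRoot p k (y ^ p) := by
  obtain ⟨ϖ, hϖ, h⟩ := hy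
  exact ⟨ϖ, hϖ, by rw [← h, ← pow_mul, pow_succ']⟩

/-- The Kummer cocycle of an inertia element does not depend on the uniformizer nor on the root. -/
lemma IsUnifRoot.div_eq (hw : (p : 𝓞 F) ∉ w.asIdeal) {σ : WeilGroup F w}
    (hσ : σ ∈ inertia F w) {k : ℕ} {y y' : Kbar F w} (hy : IsUnifRoot p k y)
    (hy' : IsUnifRoot p k y') :
    (σ : GalLocal F w) y / y = (σ : GalLocal F w) y' / y' := by
  have h0 := hy.ne_zero
  have h0' := hy'.ne_zero
  obtain ⟨ϖ, hϖ, h⟩ := hy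
  obtain ⟨ϖ', hϖ', h'⟩ := hy'
  obtain ⟨u, hu⟩ := IsDiscreteValuationRing.associated_of_irreducible _ hϖ hϖ'
  have h1 : (σ : GalLocal F w) (y' / y) = y' / y := by
    refine inertia_fix_root_unit hw hσ u.isUnit (k := k) ?_
    rw [div_pow, h, h', ← hu, map_mul, mul_comm, mul_div_assoc, div_self, mul_one]
    rw [Ne, ← map_zero (algebraMap (w.adicCompletionIntegers F) (Kbar F w)),
      algebraMap_integers_injective.eq_iff]
    exact hϖ.ne_zero
  rw [map_div₀, div_eq_div_iff (by simpa using h0) h0] at h1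
  rw [div_eq_div_iff h0 h0', mul_comm, ← h1, mul_comm]

lemma IsUnifRoot.exists_zeta (z : RootSystem p w) {k : ℕ} {y : Kbar F w} (hy : IsUnifRoot p k y)
    (σ : GalLocal F w) : ∃ i : ℕ, σ y = z.ζ k ^ i * y := by
  have h0 := hy.ne_zero
  have hne : NeZero (p ^ k) := ⟨(pow_pos (Fact.out : p.Prime).pos k).ne'⟩
  obtain ⟨i, -, hi⟩ := (z.primitive k).eq_pow_of_pow_eq_one (ξ := σ y / y) (by
    obtain ⟨ϖ, hϖ, h⟩ := hy
    rw [div_pow, ← map_pow, h, GalLocal.commutes_integers, div_self]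
    rw [← h]
    exact pow_ne_zero _ h0)
  exact ⟨i, by rw [hi, div_mul_cancel₀ _ h0]⟩

lemma zeta_pow_eq_iff (z : RootSystem p w) (k i j : ℕ) :
    z.ζ k ^ i = z.ζ k ^ j ↔ (i : ZMod (p ^ k)) = j := by
  have hne : z.ζ k ≠ 0 := (z.primitive k).ne_zero (pow_pos (Fact.out : p.Prime).pos k).ne'
  have h1 : p ^ k = orderOf (Units.mk0 _ hne) := by
    rw [← orderOf_units, Units.val_mk0, ← (z.primitive k).eq_orderOf]
  have h2 : z.ζ k ^ i = z.ζ k ^ j ↔ Units.mk0 _ hne ^ i = Units.mk0 _ hne ^ j := by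
    rw [Units.ext_iff]; simp
  rw [ZMod.natCast_eq_natCast_iff, h2, pow_eq_pow_iff_modEq, ← h1]

lemma zeta_pow_val (z : RootSystem p w) (k i : ℕ) :
    z.ζ k ^ (i : ZMod (p ^ k)).val = z.ζ k ^ i := by
  have : NeZero (p ^ k) := ⟨(pow_pos (Fact.out : p.Prime).pos k).ne'⟩
  rw [zeta_pow_eq_iff, ZMod.natCast_val, ZMod.cast_natCast' ]

/-- A compatible system of residues defines a `p`-adic integer. -/
lemma exists_padicInt_of_compatible (n : ℕ → ℕ)
    (h : ∀ k, (n (k + 1) : ZMod (p ^ k)) = n k) :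
    ∃ t : ℤ_[p], ∀ k, PadicInt.toZModPow k t = n k := by
  have hstep : ∀ k, (n (k + 1) : ℤ_[p]) - n k ∈ Ideal.span {(p : ℤ_[p]) ^ k} := by
    intro k
    rw [← PadicInt.ker_toZModPow, RingHom.mem_ker, map_sub, map_natCast, map_natCast, h, sub_self]
  have hle : ∀ {k l : ℕ}, k ≤ l → (n l : ℤ_[p]) - n k ∈ Ideal.span {(p : ℤ_[p]) ^ k} := by
    intro k l hkl
    induction l, hkl using Nat.le_induction with
    | base => simp
    | succ l hkl ih =>
      have h1 : Ideal.span {(p : ℤ_[p]) ^ l} ≤ Ideal.span {(p : ℤ_[p]) ^ k} :=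
        Ideal.span_singleton_le_span_singleton.2 (pow_dvd_pow _ hkl)
      have := Ideal.add_mem _ (h1 (hstep l)) ih
      simpa using this
  have hprec := IsPrecomplete.prec' (I := IsLocalRing.maximalIdeal ℤ_[p]) (M := ℤ_[p])
    (fun k => (n k : ℤ_[p]))
  have hI : ∀ k, (IsLocalRing.maximalIdeal ℤ_[p] ^ k • ⊤ : Submodule ℤ_[p] ℤ_[p]) =
      Ideal.span {(p : ℤ_[p]) ^ k} := by
    intro k
    rw [PadicInt.maximalIdeal_eq_span_p, Ideal.span_singleton_pow]
    simp
  obtain ⟨t, ht⟩ := hprec (fun {k l} hkl => by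
    rw [SModEq.sub_mem, hI, ← neg_mem_iff, neg_sub]
    exact hle hkl)
  refine ⟨t, fun k => ?_⟩
  have h1 := ht k
  rw [SModEq.sub_mem, hI, ← PadicInt.ker_toZModPow, RingHom.mem_ker, map_sub, map_natCast] at h1
  exact (sub_eq_zero.1 h1).symm

/-- The tame character is well defined on inertia: this is the property it is chosen by. -/
theorem tameChar_spec (hw : (p : 𝓞 F) ∉ w.asIdeal) (z : RootSystem p w) {σ : WeilGroup F w}
    (hσ : σ ∈ inertia F w) {k : ℕ} {y : Kbar F w} (hy : IsUnifRoot p k y) :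
    (σ : GalLocal F w) y = z.ζ k ^ (PadicInt.toZModPow k (tameChar z σ)).val * y := by
  have hex : ∃ t : ℤ_[p], ∀ (k : ℕ) (ϖ : w.adicCompletionIntegers F) (y : Kbar F w),
      Irreducible ϖ → y ^ (p ^ k) = algebraMap (w.adicCompletionIntegers F) (Kbar F w) ϖ →
      (σ : GalLocal F w) y = z.ζ k ^ (PadicInt.toZModPow k t).val * y := by
    choose y hy using exists_isUnifRoot F w p
    choose n hn using fun k => (hy k).exists_zeta z (σ : GalLocal F w)
    obtain ⟨t, ht⟩ := exists_padicInt_of_compatible (p := p) n (fun k => by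
      rw [← zeta_pow_eq_iff z]
      have h1 := IsUnifRoot.div_eq hw hσ (hy (k + 1)).pow (hy k)
      rw [map_pow, hn, hn, mul_pow,
        mul_div_cancel_right₀ _ (pow_ne_zero _ (hy (k + 1)).ne_zero),
        mul_div_cancel_right₀ _ (hy k).ne_zero, ← pow_mul, mul_comm, pow_mul, z.compatible] at h1
      exact h1)
    refine ⟨t, fun k ϖ y' hϖ hy' => ?_⟩
    have h2 : IsUnifRoot p k y' := ⟨ϖ, hϖ, hy'⟩
    have h1 := IsUnifRoot.div_eq hw hσ h2 (hy k)
    rw [hn, mul_div_cancel_right₀ _ (hy k).ne_zero, div_eq_iff h2.ne_zero] at h1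
    rw [h1, ht, zeta_pow_val]
  obtain ⟨ϖ, hϖ, h⟩ := hy
  exact Classical.epsilon_spec hex k ϖ y hϖ h

/-- The root of unity `ζ_k ^ t` for a `p`-adic exponent `t`. -/
noncomputable def zetaPow (z : RootSystem p w) (k : ℕ) (t : ℤ_[p]) : Kbar F w :=
  z.ζ k ^ (PadicInt.toZModPow k t).val

lemma zetaPow_natCast (z : RootSystem p w) (k n : ℕ) : zetaPow z k n = z.ζ k ^ n := by
  rw [zetaPow, map_natCast, zeta_pow_val]

lemma zetaPow_add (z : RootSystem p w) (k : ℕ) (s t : ℤ_[p]) :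
    zetaPow z k (s + t) = zetaPow z k s * zetaPow z k t := by
  have : NeZero (p ^ k) := ⟨(pow_pos (Fact.out : p.Prime).pos k).ne'⟩
  unfold zetaPow
  rw [← pow_add, zeta_pow_eq_iff]
  push_cast
  rw [ZMod.natCast_zmod_val, ZMod.natCast_zmod_val, ZMod.natCast_zmod_val, map_add]

lemma zetaPow_natCast_mul (z : RootSystem p w) (k n : ℕ) (t : ℤ_[p]) :
    zetaPow z k (n * t) = zetaPow z k t ^ n := by
  have : NeZero (p ^ k) := ⟨(pow_pos (Fact.out : p.Prime).pos k).ne'⟩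
  unfold zetaPow
  rw [← pow_mul, zeta_pow_eq_iff]
  push_cast
  rw [ZMod.natCast_zmod_val, ZMod.natCast_zmod_val, map_mul, map_natCast, mul_comm]

lemma eq_of_zetaPow (z : RootSystem p w) {s t : ℤ_[p]}
    (h : ∀ k, zetaPow z k s = zetaPow z k t) : s = t := by
  rw [← PadicInt.ext_of_toZModPow]
  intro k
  have : NeZero (p ^ k) := ⟨(pow_pos (Fact.out : p.Prime).pos k).ne'⟩
  have h1 := h k
  unfold zetaPow at h1
  rw [zeta_pow_eq_iff, ZMod.natCast_zmod_val, ZMod.natCast_zmod_val] at h1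
  exact h1

lemma zetaPow_pow_eq_one (z : RootSystem p w) (k : ℕ) (t : ℤ_[p]) :
    zetaPow z k t ^ p ^ k = 1 := by
  rw [zetaPow, ← pow_mul, mul_comm, pow_mul, (z.primitive k).pow_eq_one, one_pow]

theorem tameChar_apply (hw : (p : 𝓞 F) ∉ w.asIdeal) (z : RootSystem p w) {σ : WeilGroup F w}
    (hσ : σ ∈ inertia F w) {k : ℕ} {y : Kbar F w} (hy : IsUnifRoot p k y) :
    (σ : GalLocal F w) y = zetaPow z k (tameChar z σ) * y :=
  tameChar_spec hw z hσ hy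

lemma tameChar_mul (hw : (p : 𝓞 F) ∉ w.asIdeal) (z : RootSystem p w) {σ τ : WeilGroup F w}
    (hσ : σ ∈ inertia F w) (hτ : τ ∈ inertia F w) :
    tameChar z (σ * τ) = tameChar z σ + tameChar z τ := by
  refine eq_of_zetaPow z fun k => ?_
  obtain ⟨y, hy⟩ := exists_isUnifRoot F w p k
  have h1 := tameChar_apply hw z (mul_mem hσ hτ) hy
  have h2 : ((σ * τ : WeilGroup F w) : GalLocal F w) y =
      (σ : GalLocal F w) ((τ : GalLocal F w) y) := rfl
  rw [h2, tameChar_apply hw z hτ hy, map_mul, tameChar_apply hw z hσ hy,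
    inertia_fix_root_one hw hσ (zetaPow_pow_eq_one z k _), ← mul_assoc] at h1
  rw [zetaPow_add, mul_comm (zetaPow z k (tameChar z σ))]
  exact (mul_right_cancel₀ hy.ne_zero h1).symm

lemma tameChar_one (hw : (p : 𝓞 F) ∉ w.asIdeal) (z : RootSystem p w) :
    tameChar z (1 : WeilGroup F w) = 0 := by
  have := tameChar_mul hw z (one_mem (inertia F w)) (one_mem (inertia F w))
  rw [one_mul] at this
  exact left_eq_add.1 this

/-- Elements acting as powers of Frobenius on the residue field act accordingly on `p`-power roots
of unity. -/
lemma ActsAsFrobPow.root_of_unity (hw : (p : 𝓞 F) ∉ w.asIdeal) {g : GalLocal F w} {a b : ℕ}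
    (h : ∀ x : OKbar F w, (g • x) ^ (resCard F w ^ a) - x ^ (resCard F w ^ b) ∈ maxBar F w)
    {k : ℕ} {x : Kbar F w} (hx : x ^ p ^ k = 1) :
    g x ^ (resCard F w ^ a) = x ^ (resCard F w ^ b) := by
  have hpk : 0 < p ^ k := pow_pos (Fact.out : p.Prime).pos k
  have hint : x ∈ OKbar F w := by
    have : IsIntegral (w.adicCompletionIntegers F) (x ^ p ^ k) := hx ▸ isIntegral_one
    exact IsIntegral.of_pow hpk this
  let X : OKbar F w := ⟨x, hint⟩
  have hX : X ^ p ^ k = 1 := Subtype.ext hx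
  have hgX : (g • X) ^ p ^ k = 1 := by rw [← smul_pow', hX, smul_one]
  have hXu : IsUnit X := IsUnit.of_pow_eq_one hX hpk.ne'
  obtain ⟨U, hU⟩ := hXu
  have h1 : (g • X) ^ (resCard F w ^ a) * (↑U⁻¹ : OKbar F w) ^ (resCard F w ^ b) = 1 := by
    apply eq_one_of_pow_eq_one hw (k := k)
    · have hU1 : (↑U⁻¹ : OKbar F w) ^ p ^ k = 1 := by
        have : (↑U⁻¹ : OKbar F w) ^ p ^ k * X ^ p ^ k = 1 := by
          rw [← mul_pow, ← hU, Units.inv_mul, one_pow]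
        rwa [hX, mul_one] at this
      rw [mul_pow, ← pow_mul, mul_comm, ← pow_mul, mul_comm (_ ^ b), mul_comm (_ ^ a), pow_mul,
        pow_mul _ (p ^ k), hU1, hgX, one_pow, one_pow, one_mul]
    · have := (maxBar F w).mul_mem_right ((↑U⁻¹ : OKbar F w) ^ (resCard F w ^ b)) (h X)
      rw [sub_mul] at this
      nth_rewrite 2 [← hU] at this
      rwa [← mul_pow _ _ (resCard F w ^ b), Units.mul_inv, one_pow] at this
  have h2 : (g • X) ^ (resCard F w ^ a) = X ^ (resCard F w ^ b) := by
    calc _ = (g • X) ^ (resCard F w ^ a) *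
          ((↑U⁻¹ : OKbar F w) ^ (resCard F w ^ b) * (U : OKbar F w) ^ (resCard F w ^ b)) := by
            rw [← mul_pow, Units.inv_mul, one_pow, mul_one]
      _ = _ := by rw [← mul_assoc, h1, one_mul, hU]
  exact congrArg Subtype.val h2

lemma tameChar_conj_pow (hw : (p : 𝓞 F) ∉ w.asIdeal) (z : RootSystem p w) {g τ : WeilGroup F w}
    (hτ : τ ∈ inertia F w) {a b : ℕ}
    (h : ∀ x : OKbar F w, ((g : GalLocal F w) • x) ^ (resCard F w ^ a) -
      x ^ (resCard F w ^ b) ∈ maxBar F w) :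
    (resCard F w ^ a : ℕ) * tameChar z (g * τ * g⁻¹) = (resCard F w ^ b : ℕ) * tameChar z τ := by
  refine eq_of_zetaPow z fun k => ?_
  obtain ⟨y, hy⟩ := exists_isUnifRoot F w p k
  have h1 := tameChar_apply hw z (conj_mem_inertia hτ g) hy
  have hy' := hy.map ((g : GalLocal F w)⁻¹)
  have h2 : ((g * τ * g⁻¹ : WeilGroup F w) : GalLocal F w) y =
      (g : GalLocal F w) ((τ : GalLocal F w) ((g : GalLocal F w)⁻¹ y)) := rfl
  have h3 : (g : GalLocal F w) ((g : GalLocal F w)⁻¹ y) = y :=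
    AlgEquiv.apply_symm_apply (g : GalLocal F w) y
  rw [h2, tameChar_apply hw z hτ hy', map_mul, h3] at h1
  have h4 := mul_right_cancel₀ hy.ne_zero h1
  rw [zetaPow_natCast_mul, zetaPow_natCast_mul, ← h4,
    ActsAsFrobPow.root_of_unity hw h (zetaPow_pow_eq_one z k _)]

/-- Conjugation acts on the tame character through `|Art⁻¹|`. -/
theorem tameChar_conj (hw : (p : 𝓞 F) ∉ w.asIdeal) (z : RootSystem p w) {Ω : Type*} [Field Ω]
    [CharZero Ω] [Algebra ℤ_[p] Ω] (g : WeilGroup F w) {τ : WeilGroup F w}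
    (hτ : τ ∈ inertia F w) :
    algebraMap ℤ_[p] Ω (tameChar z (g * τ * g⁻¹)) =
      normChar w Ω g * algebraMap ℤ_[p] Ω (tameChar z τ) := by
  have hq : (resCard F w : Ω) ≠ 0 := by
    have : 1 < resCard F w := NumberField.HeightOneSpectrum.one_lt_absNorm w
    exact_mod_cast (by omega : resCard F w ≠ 0)
  obtain ⟨a, b, hab, h⟩ := frobVal_spec g
  have h1 := congrArg (algebraMap ℤ_[p] Ω) (tameChar_conj_pow hw z hτ h)
  simp only [map_mul, map_natCast] at h1
  rw [normChar, dif_neg hq]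
  simp only [MonoidHom.coe_mk, OneHom.coe_mk]
  rw [hab, neg_sub, zpow_sub₀ hq, zpow_natCast, zpow_natCast, div_mul_eq_mul_div, eq_div_iff
    (pow_ne_zero _ hq), mul_comm]
  push_cast at h1
  exact h1

end Tame

/-! ### Nontriviality of the tame character -/

section TameNontrivial

variable {F : Type*} [Field F] [NumberField F] {w : HeightOneSpectrum (𝓞 F)}
  {p : ℕ} [Fact p.Prime]

/-- `maxBar` is the Jacobson radical, hence stable under automorphisms. -/
lemma smul_mem_maxBar (g : GalLocal F w) {x : OKbar F w} (hx : x ∈ maxBar F w) :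
    g • x ∈ maxBar F w := by
  rw [Ideal.mem_jacobson_bot] at hx ⊢
  intro y
  have h1 := (hx (g⁻¹ • y)).map (MulSemiringAction.toRingHom (GalLocal F w) (OKbar F w) g)
  simpa using h1

/-- A commutator with an element of the Weil group lies in inertia, because powers of Frobenius
commute with all automorphisms of the residue field. -/
lemma exists_commutator_mem_inertia (g : GalLocal F w) (h : WeilGroup F w) :
    ∃ c ∈ inertia F w, (c : GalLocal F w) = g * h * g⁻¹ * (h : GalLocal F w)⁻¹ := by
  obtain ⟨a, b, -, hx⟩ := frobVal_spec h
  have key : ∀ x : OKbar F w, (g * (h : GalLocal F w)) • x - ((h : GalLocal F w) * g) • x ∈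
      maxBar F w := by
    intro x
    apply sub_mem_maxBar_of_pow (a := a)
    have h1 := smul_mem_maxBar g (hx x)
    have h2 := hx (g • x)
    rw [smul_sub, smul_pow', smul_pow', ← mul_smul] at h1
    rw [← mul_smul] at h2
    have := (maxBar F w).sub_mem h1 h2
    simpa using this
  have hin : ∀ x : OKbar F w, (g * h * g⁻¹ * (h : GalLocal F w)⁻¹) • x - x ∈ maxBar F w := by
    intro x
    have := key (((h : GalLocal F w) * g)⁻¹ • x)
    rw [smul_inv_smul, ← mul_smul, mul_inv_rev] at this
    simpa [mul_assoc] using this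
  have hW : g * h * g⁻¹ * (h : GalLocal F w)⁻¹ ∈ WeilGroup F w :=
    ⟨0, 0, 0, by simp, fun x => by simpa using hin x⟩
  exact ⟨⟨_, hW⟩, hin, rfl⟩

/-- Some positive power of an element of the Galois group fixes a given finite extension. -/
lemma exists_pow_mem_fixingSubgroup (φ : GalLocal F w)
    (K' : IntermediateField (w.adicCompletion F) (Kbar F w))
    [FiniteDimensional (w.adicCompletion F) K'] : ∃ j > 0, φ ^ j ∈ K'.fixingSubgroup := by
  obtain ⟨m, n, hmn, h⟩ := Finite.exists_ne_map_eq_of_infinite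
    fun n : ℕ => ((φ ^ n : GalLocal F w) : Kbar F w →ₐ[w.adicCompletion F] Kbar F w).comp K'.val
  wlog hlt : m < n generalizing m n
  · exact this n m hmn.symm h.symm (by omega)
  refine ⟨n - m, by omega, ?_⟩
  rw [IntermediateField.mem_fixingSubgroup_iff]
  intro x hx
  have h1 : (φ ^ m) x = (φ ^ n) x := DFunLike.congr_fun h ⟨x, hx⟩
  apply (φ ^ m).injective
  rw [h1, ← AlgEquiv.mul_apply, ← pow_add]
  congr 2
  omega

/-- The tame character is nontrivial on the inertia group of every finite extension `K'`. Otherwise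
all commutators `[g, φ ^ (-j)]`, with `g` fixing `K'` and `φ ^ j` fixing `K'`, fix every
`p ^ k`-th root `y` of a uniformizer `ϖ`. Then `y ^ D` times a root of unity lies in `K'`, where
`D = q ^ j - 1`, so that `ϖ ^ D` is a `p ^ k`-th power in `K'`. Taking norms and valuations, this
is absurd for large `k`. -/
theorem exists_tameChar_ne_zero (hw : (p : 𝓞 F) ∉ w.asIdeal) (z : RootSystem p w)
    {φ : WeilGroup F w} (hφ : frobVal φ = 1)
    (K' : IntermediateField (w.adicCompletion F) (Kbar F w))
    [FiniteDimensional (w.adicCompletion F) K'] :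
    ∃ τ ∈ inertia F w, (τ : GalLocal F w) ∈ K'.fixingSubgroup ∧ tameChar z τ ≠ 0 := by
  by_contra! hcon
  have hfix : ∀ τ ∈ inertia F w, (τ : GalLocal F w) ∈ K'.fixingSubgroup →
      ∀ k (y : Kbar F w), IsUnifRoot p k y → (τ : GalLocal F w) y = y := by
    intro τ hτ hK k y hy
    rw [tameChar_apply hw z hτ hy, hcon τ hτ hK, ← Nat.cast_zero, zetaPow_natCast, pow_zero,
      one_mul]
  obtain ⟨j, hj, hjK⟩ := exists_pow_mem_fixingSubgroup (φ : GalLocal F w) K'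
  set h : WeilGroup F w := (φ ^ j)⁻¹ with hh
  have hhK : (h : GalLocal F w) ∈ K'.fixingSubgroup := by
    rw [hh]
    simpa using inv_mem hjK
  have hq : 1 < resCard F w := NumberField.HeightOneSpectrum.one_lt_absNorm w
  obtain ⟨a, b, hab, hact⟩ := frobVal_spec h
  have hb : b = a + j := by
    have : frobVal h = -j := by
      rw [hh, frobVal_inv, ← zpow_natCast, frobVal_zpow, hφ]; ring
    omega
  obtain ⟨ϖ, hϖ⟩ := IsDiscreteValuationRing.exists_irreducible (w.adicCompletionIntegers F)
  -- The action of `φ ^ (-j)` on `p`-power roots of unity.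
  have hroot : ∀ (k : ℕ) (x : Kbar F w), x ^ p ^ k = 1 →
      (h : GalLocal F w) x = x ^ (resCard F w ^ j) := by
    intro k x hx
    have h1 := ActsAsFrobPow.root_of_unity hw hact hx
    rw [hb, pow_add, mul_comm, pow_mul] at h1
    have hcop : Nat.Coprime (p ^ k) (resCard F w ^ a) := by
      exact Nat.Coprime.pow _ _ (coprime_resCard hw)
    have hx0 : x ≠ 0 := by
      rintro rfl
      rw [zero_pow (pow_pos (Fact.out : p.Prime).pos k).ne'] at hx
      exact zero_ne_one hx
    have h2 : ((h : GalLocal F w) x / x ^ (resCard F w ^ j)) = 1 := by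
      rw [← orderOf_eq_one_iff, ← Nat.dvd_one, ← hcop]
      apply Nat.dvd_gcd
      · apply orderOf_dvd_of_pow_eq_one
        rw [div_pow, ← map_pow, hx, map_one, ← pow_mul, mul_comm, pow_mul, hx, one_pow, div_one]
      · apply orderOf_dvd_of_pow_eq_one
        rw [div_pow, h1, div_self (pow_ne_zero _ (pow_ne_zero _ hx0))]
    rwa [div_eq_one_iff_eq (pow_ne_zero _ hx0)] at h2
  set D : ℕ := resCard F w ^ j - 1 with hD
  have hDpos : 0 < D := by
    have : 1 < resCard F w ^ j := Nat.one_lt_pow hj.ne' hq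
    omega
  -- For every `k`, the power `ϖ ^ D` is a `p ^ k`-th power in `K'`.
  have hpow : ∀ k : ℕ, ∃ x : K', x ^ p ^ k =
      algebraMap (w.adicCompletion F) K' ((ϖ : w.adicCompletion F) ^ D) := by
    intro k
    obtain ⟨y, hy⟩ := IsAlgClosed.exists_pow_nat_eq
      (algebraMap (w.adicCompletionIntegers F) (Kbar F w) ϖ)
      (pow_pos (Fact.out : p.Prime).pos k)
    have hyU : IsUnifRoot p k y := ⟨ϖ, hϖ, hy⟩
    have hy0 := hyU.ne_zero
    have hϖ0 : algebraMap (w.adicCompletionIntegers F) (Kbar F w) ϖ ≠ 0 := by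
      rw [← hy]; exact pow_ne_zero _ hy0
    have hμ : ∀ g : GalLocal F w, (g y / y) ^ p ^ k = 1 := by
      intro g
      rw [div_pow, ← map_pow, hy, GalLocal.commutes_integers, div_self hϖ0]
    set η := (h : GalLocal F w) y / y with hη
    have hη0 : η ≠ 0 := div_ne_zero ((_root_.map_ne_zero _).2 hy0) hy0
    -- For `g` fixing `K'`, the commutator of `g` and `h` lies in inertia and fixes `y`. If
    -- `g y = ξ y` and `h y = η y`, commutation gives `g η = ξ ^ D η`, so `g` fixes `y ^ D / η`.
    have hmem : y ^ D / η ∈ K' := by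
      have hgal : IsGalois (w.adicCompletion F) (Kbar F w) := {}
      rw [← InfiniteGalois.fixedField_fixingSubgroup K', IntermediateField.mem_fixedField_iff]
      intro g hg
      obtain ⟨c, hc, hceq⟩ := exists_commutator_mem_inertia g h
      have hcK : (c : GalLocal F w) ∈ K'.fixingSubgroup := by
        rw [hceq]
        exact mul_mem (mul_mem (mul_mem hg hhK) (inv_mem hg)) (inv_mem hhK)
      have h1 := hfix c hc hcK k ((h : GalLocal F w) (g y)) ((hyU.map g).map h)
      have h2 : g ((h : GalLocal F w) y) = (h : GalLocal F w) (g y) := by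
        rw [← h1, hceq, ← AlgEquiv.mul_apply, ← AlgEquiv.mul_apply, ← AlgEquiv.mul_apply]
        congr 1
        group
      set ξ := g y / y with hξ
      have hξ0 : ξ ≠ 0 := div_ne_zero ((_root_.map_ne_zero _).2 hy0) hy0
      have hgy : g y = ξ * y := by rw [hξ, div_mul_cancel₀ _ hy0]
      have hhy : (h : GalLocal F w) y = η * y := by rw [hη, div_mul_cancel₀ _ hy0]
      have hhξ := hroot k ξ (hμ g)
      rw [hhy, hgy, map_mul, map_mul, hgy, hhy, hhξ] at h2
      have h3 : g η = ξ ^ D * η := by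
        have hpow : ξ ^ (resCard F w ^ j) = ξ ^ D * ξ := by
          rw [← pow_succ]
          congr 1
          omega
        rw [hpow] at h2
        have : (g η) * (ξ * y) = (ξ ^ D * η) * (ξ * y) := by rw [h2]; ring
        exact mul_right_cancel₀ (mul_ne_zero hξ0 hy0) this
      rw [map_div₀, map_pow, hgy, h3, mul_pow]
      field_simp
    refine ⟨⟨_, hmem⟩, ?_⟩
    apply Subtype.ext
    change (y ^ D / η) ^ p ^ k = algebraMap (w.adicCompletion F) (Kbar F w) (_ ^ D)
    rw [div_pow, hμ, div_one, ← pow_mul, mul_comm, pow_mul, hy, map_pow]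
    rfl
  -- Taking norms for `k = D n`, the power `ϖ ^ (D n)` is a `p ^ (D n)`-th power, although its
  -- valuation `D n` is less than `p ^ (D n)`.
  set n := Module.finrank (w.adicCompletion F) K' with hn
  have hnpos : 0 < n := Module.finrank_pos
  obtain ⟨x, hx⟩ := hpow (D * n)
  have hnorm := congrArg (Algebra.norm (w.adicCompletion F)) hx
  rw [map_pow, Algebra.norm_algebraMap, ← pow_mul] at hnorm
  have hpk : p ^ (D * n) ≠ 0 := (pow_pos (Fact.out : p.Prime).pos _).ne'
  have hint : Algebra.norm (w.adicCompletion F) x ∈ w.adicCompletionIntegers F := by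
    rw [HeightOneSpectrum.mem_adicCompletionIntegers, ← pow_le_one_iff hpk, ← map_pow, hnorm,
      map_pow]
    exact pow_le_one' ϖ.2 _
  set A : w.adicCompletionIntegers F := ⟨_, hint⟩ with hA
  have hAϖ : A ^ p ^ (D * n) = ϖ ^ (D * n) := Subtype.ext hnorm
  have hDn : D * n ≠ 0 := (Nat.mul_pos hDpos hnpos).ne'
  have hdvd : ϖ ∣ A := hϖ.prime.dvd_of_dvd_pow (n := p ^ (D * n)) (by
    rw [hAϖ]; exact dvd_pow_self _ hDn)
  have h1 := pow_dvd_pow_of_dvd hdvd (p ^ (D * n))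
  rw [hAϖ, pow_dvd_pow_iff hϖ.ne_zero hϖ.not_isUnit] at h1
  exact absurd h1 (not_le.2 (Nat.lt_pow_self (Fact.out : p.Prime).one_lt))

end TameNontrivial

/-! ### Exponentials of nilpotent matrices -/

section NilpExp

variable {ι κ Ω : Type*} [Fintype ι] [DecidableEq ι] [Fintype κ] [DecidableEq κ] [Field Ω]

lemma pow_card_eq_zero {M : Matrix ι ι Ω} (h : IsNilpotent M) : M ^ Fintype.card ι = 0 := by
  have h1 := (Matrix.isNilpotent_charpoly_sub_pow_of_isNilpotent h).eq_zero
  have h2 := M.aeval_self_charpoly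
  rw [sub_eq_zero.1 h1] at h2
  simpa using h2

/-- The truncation of the exponential series is immaterial. -/
lemma nilpExp_eq_sum {M : Matrix ι ι Ω} (h : IsNilpotent M) {n : ℕ} (hn : M ^ n = 0) :
    nilpExp M = ∑ k ∈ Finset.range n, ((k.factorial : Ω)⁻¹) • M ^ k := by
  have h0 := pow_card_eq_zero h
  unfold nilpExp
  rcases le_total n (Fintype.card ι) with h1 | h1
  · refine (Finset.sum_subset (Finset.range_mono h1) fun k _ hk => ?_).symm
    rw [pow_eq_zero_of_le (by simpa using hk) hn, smul_zero]
  · refine Finset.sum_subset (Finset.range_mono h1) fun k _ hk => ?_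
    rw [pow_eq_zero_of_le (by simpa using hk) h0, smul_zero]

lemma nilpExp_eq_exp [CharZero Ω] {M : Matrix ι ι Ω} (h : IsNilpotent M) :
    nilpExp M = IsNilpotent.exp M := by
  have h0 := pow_card_eq_zero h
  rw [IsNilpotent.exp_eq_sum h0, nilpExp]
  refine Finset.sum_congr rfl fun k _ => ?_
  ext i j
  simp [Rat.smul_def]

lemma isNilpotent_smul {M : Matrix ι ι Ω} (h : IsNilpotent M) (c : Ω) : IsNilpotent (c • M) :=
  h.smul c

lemma nilpExp_add [CharZero Ω] {M M' : Matrix ι ι Ω} (h : IsNilpotent M) (h' : IsNilpotent M')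
    (hc : Commute M M') : nilpExp (M + M') = nilpExp M * nilpExp M' := by
  rw [nilpExp_eq_exp h, nilpExp_eq_exp h', nilpExp_eq_exp (hc.isNilpotent_add h h'),
    IsNilpotent.exp_add_of_commute hc h h']

lemma nilpExp_smul_add [CharZero Ω] {M : Matrix ι ι Ω} (h : IsNilpotent M) (a b : Ω) :
    nilpExp ((a + b) • M) = nilpExp (a • M) * nilpExp (b • M) := by
  rw [add_smul]
  exact nilpExp_add (isNilpotent_smul h a) (isNilpotent_smul h b)
    (((Commute.refl M).smul_left a).smul_right b)

lemma nilpExp_zero [CharZero Ω] : nilpExp (0 : Matrix ι ι Ω) = 1 := by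
  rw [nilpExp_eq_exp IsNilpotent.zero, IsNilpotent.exp_zero]

lemma nilpExp_mul_neg [CharZero Ω] {M : Matrix ι ι Ω} (h : IsNilpotent M) :
    nilpExp M * nilpExp (-M) = 1 := by
  rw [← nilpExp_add h h.neg (Commute.refl M).neg_right, add_neg_cancel, nilpExp_zero]

lemma nilpExp_neg_mul [CharZero Ω] {M : Matrix ι ι Ω} (h : IsNilpotent M) :
    nilpExp (-M) * nilpExp M = 1 := by
  rw [← nilpExp_add h.neg h (Commute.refl M).neg_left, neg_add_cancel, nilpExp_zero]

lemma conj_pow {P : Matrix ι κ Ω} {Q : Matrix κ ι Ω} (h2 : Q * P = 1) (M : Matrix κ κ Ω)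
    (h1 : P * Q = 1) (k : ℕ) : (P * M * Q) ^ k = P * M ^ k * Q := by
  induction k with
  | zero => simp [h1]
  | succ k ih =>
    rw [pow_succ, ih, pow_succ]
    calc P * M ^ k * Q * (P * M * Q) = P * M ^ k * (Q * P) * M * Q := by
          simp only [Matrix.mul_assoc]
      _ = P * (M ^ k * M) * Q := by rw [h2, Matrix.mul_one]; simp only [Matrix.mul_assoc]

lemma isNilpotent_conj {P : Matrix ι κ Ω} {Q : Matrix κ ι Ω} (h1 : P * Q = 1) (h2 : Q * P = 1)
    {M : Matrix κ κ Ω} (h : IsNilpotent M) : IsNilpotent (P * M * Q) := by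
  obtain ⟨k, hk⟩ := h
  exact ⟨k, by rw [conj_pow h2 M h1, hk]; simp⟩

lemma nilpExp_conj {P : Matrix ι κ Ω} {Q : Matrix κ ι Ω} (h1 : P * Q = 1) (h2 : Q * P = 1)
    {M : Matrix κ κ Ω} : nilpExp (P * M * Q) = P * nilpExp M * Q := by
  rw [nilpExp, nilpExp, Matrix.mul_sum, Matrix.sum_mul, card_eq_of_inverse h1 h2]
  refine Finset.sum_congr rfl fun k _ => ?_
  rw [conj_pow h2 M h1, Matrix.mul_smul, Matrix.smul_mul]

lemma nilpExp_natCast_smul [CharZero Ω] {M : Matrix ι ι Ω} (h : IsNilpotent M) (n : ℕ) :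
    nilpExp ((n : Ω) • M) = nilpExp M ^ n := by
  induction n with
  | zero => simp [nilpExp_zero]
  | succ n ih => rw [Nat.cast_succ, nilpExp_smul_add h, ih, one_smul, pow_succ]

/-- The exponential is injective on nilpotent matrices: the entries of `exp (n M)`, `n ∈ ℕ`, are
polynomial in `n`, with those of `M` as linear coefficients. -/
lemma nilpExp_injective [CharZero Ω] {M M' : Matrix ι ι Ω} (h : IsNilpotent M)
    (h' : IsNilpotent M') (he : nilpExp M = nilpExp M') : M = M' := by
  ext i j
  let coef : Matrix ι ι Ω → ℕ → Ω := fun X k => (k.factorial : Ω)⁻¹ * (X ^ k) i j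
  let n := Fintype.card ι + 2
  have hsum : ∀ {X : Matrix ι ι Ω}, IsNilpotent X → ∀ m : ℕ,
      nilpExp ((m : Ω) • X) i j = ∑ k ∈ Finset.range n, coef X k * (m : Ω) ^ k := by
    intro X hX m
    have h0 : ((m : Ω) • X) ^ n = 0 :=
      pow_eq_zero_of_le (by omega) (pow_card_eq_zero (isNilpotent_smul hX _))
    rw [nilpExp_eq_sum (isNilpotent_smul hX _) h0, Matrix.sum_apply]
    refine Finset.sum_congr rfl fun k _ => ?_
    simp only [_root_.smul_pow, Matrix.smul_apply, smul_eq_mul, coef]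
    ring
  let q : Polynomial Ω := ∑ k ∈ Finset.range n, C (coef M k - coef M' k) * X ^ k
  have hq : q = 0 := by
    apply Polynomial.eq_zero_of_infinite_isRoot
    refine (Set.infinite_range_of_injective (Nat.cast_injective (R := Ω))).mono ?_
    rintro _ ⟨m, rfl⟩
    simp only [Set.mem_ofPred_eq, IsRoot.def, q, eval_finsetSum, eval_mul, eval_C, eval_pow, eval_X,
      sub_mul, Finset.sum_sub_distrib]
    rw [← hsum h, ← hsum h', nilpExp_natCast_smul h, nilpExp_natCast_smul h', he, sub_self]
  have hc := congrArg (fun r => coeff r 1) hq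
  simp only [q, finsetSum_coeff, coeff_C_mul, coeff_X_pow, coeff_zero] at hc
  rw [Finset.sum_eq_single 1 (fun b _ hb => by simp [Ne.symm hb])
    (fun h => by simp [n] at h)] at hc
  simpa [coef, sub_eq_zero] using hc

/-- `exp M - 1` is `M` times an invertible matrix commuting with `M`. -/
lemma rank_nilpExp_sub_one_pow [CharZero Ω] {M : Matrix ι ι Ω} (h : IsNilpotent M) (k : ℕ) :
    ((nilpExp M - 1) ^ k).rank = (M ^ k).rank := by
  let n := Fintype.card ι
  let V : Matrix ι ι Ω := ∑ j ∈ Finset.range (n + 1), (((j + 1).factorial : Ω)⁻¹) • M ^ j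
  let V' : Matrix ι ι Ω := ∑ j ∈ Finset.range n, (((j + 2).factorial : Ω)⁻¹) • M ^ j
  have hV : nilpExp M - 1 = M * V := by
    rw [nilpExp_eq_sum h (n := n + 2) (pow_eq_zero_of_le (by omega) (pow_card_eq_zero h)),
      Finset.sum_range_succ']
    simp only [V, Finset.mul_sum, Matrix.mul_smul, pow_succ', pow_zero, Nat.factorial_zero,
      Nat.cast_one, inv_one, one_smul, add_sub_cancel_right]
  have hV' : V = M * V' + 1 := by
    simp only [V, V']
    rw [Finset.sum_range_succ']
    simp only [Finset.mul_sum, Matrix.mul_smul, pow_succ', pow_zero, zero_add,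
      Nat.factorial_one, Nat.cast_one, inv_one, one_smul]
  have hcom' : Commute M V' := Commute.sum_right _ _ _ fun j _ =>
    ((Commute.refl M).pow_right j).smul_right _
  have hcom : Commute M V := Commute.sum_right _ _ _ fun j _ =>
    ((Commute.refl M).pow_right j).smul_right _
  have hu : IsUnit V := by
    rw [hV']
    exact (hcom'.isNilpotent_mul_right h).isUnit_add_one
  rw [hV, hcom.mul_pow]
  exact Matrix.rank_mul_eq_left_of_isUnit_det _ _ ((Matrix.isUnit_iff_isUnit_det _).1 (hu.pow k))

lemma trace_eq_zero_of_isNilpotent {M : Matrix ι ι Ω} (h : IsNilpotent M) : M.trace = 0 :=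
  (Matrix.isNilpotent_trace_of_isNilpotent h).eq_zero

end NilpExp

/-! ### Semisimple matrices and Jordan decompositions -/

section Jordan

variable {ι κ Ω Ω' : Type*} [Fintype ι] [DecidableEq ι] [Fintype κ] [DecidableEq κ] [Field Ω]
  [Field Ω']

lemma isSemisimple_iff_squarefree {V : Type*} [AddCommGroup V] [Module Ω V] [FiniteDimensional Ω V]
    (f : Module.End Ω V) :
    f.IsSemisimple ↔ ∃ q : Polynomial Ω, Squarefree q ∧ aeval f q = 0 :=
  ⟨fun h => ⟨minpoly Ω f, h.minpoly_squarefree, minpoly.aeval _ _⟩, fun ⟨_, h1, h2⟩ =>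
    Module.End.isSemisimple_of_squarefree_aeval_eq_zero h1 h2⟩

lemma isSemisimple_toLin'_iff (M : Matrix ι ι Ω) :
    Module.End.IsSemisimple (Matrix.toLin' M) ↔
      ∃ q : Polynomial Ω, Squarefree q ∧ aeval M q = 0 := by
  rw [isSemisimple_iff_squarefree]
  have h : ∀ q : Polynomial Ω, aeval (Matrix.toLin' M) q = Matrix.toLin' (aeval M q) := fun q =>
    Polynomial.aeval_algHom_apply (Matrix.toLinAlgEquiv' : Matrix ι ι Ω ≃ₐ[Ω] _) M q
  simp only [h, LinearEquiv.map_eq_zero_iff]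

lemma isSemisimple_conj {P : Matrix ι κ Ω} {Q : Matrix κ ι Ω} (h1 : P * Q = 1) (h2 : Q * P = 1)
    {M : Matrix κ κ Ω} (h : Module.End.IsSemisimple (Matrix.toLin' M)) :
    Module.End.IsSemisimple (Matrix.toLin' (P * M * Q)) := by
  rw [isSemisimple_toLin'_iff] at h ⊢
  obtain ⟨q, hq, h0⟩ := h
  refine ⟨q, hq, ?_⟩
  have : aeval (P * M * Q) q = P * aeval M q * Q := by
    rw [aeval_eq_sum_range, aeval_eq_sum_range, Matrix.mul_sum, Matrix.sum_mul]
    exact Finset.sum_congr rfl fun k _ => by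
      rw [conj_pow h2 M h1, Matrix.mul_smul, Matrix.smul_mul]
  rw [this, h0]
  simp

lemma isSemisimple_map [CharZero Ω] (f : Ω →+* Ω') {M : Matrix ι ι Ω}
    (h : Module.End.IsSemisimple (Matrix.toLin' M)) :
    Module.End.IsSemisimple (Matrix.toLin' (f.mapMatrix M)) := by
  rw [isSemisimple_toLin'_iff] at h ⊢
  obtain ⟨q, hq, h0⟩ := h
  refine ⟨q.map f, ((PerfectField.separable_iff_squarefree.2 hq).map).squarefree, ?_⟩
  have : aeval (f.mapMatrix M) (q.map f) = f.mapMatrix (aeval M q) := by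
    rw [aeval_def, eval₂_map, aeval_def, hom_eval₂]
    congr 1
    ext a i j
    simp [Matrix.algebraMap_matrix_apply, apply_ite f]
  rw [this, h0, map_zero]

/-- The squarefree radical of the product of the annihilating polynomials annihilates all blocks. -/
lemma isSemisimple_blockDiagonal' {I : Type*} [Fintype I] [DecidableEq I] {ι : I → Type*}
    [∀ i, Fintype (ι i)] [∀ i, DecidableEq (ι i)] (M : ∀ i, Matrix (ι i) (ι i) Ω)
    (h : ∀ i, Module.End.IsSemisimple (Matrix.toLin' (M i))) :
    Module.End.IsSemisimple (Matrix.toLin' (Matrix.blockDiagonal' M)) := by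
  simp only [isSemisimple_toLin'_iff] at h ⊢
  choose q hq h0 using h
  obtain ⟨g, k, h1, -, h2⟩ := exists_squarefree_dvd_pow_of_ne_zero
    (Finset.prod_ne_zero_iff.2 fun i (_ : i ∈ Finset.univ) => (hq i).ne_zero)
  refine ⟨g, h1, ?_⟩
  have h3 : aeval (Matrix.blockDiagonal' M) g = Matrix.blockDiagonal' fun i => aeval (M i) g := by
    rw [aeval_eq_sum_range]
    simp only [aeval_eq_sum_range]
    have : (fun i => ∑ k ∈ Finset.range (g.natDegree + 1), g.coeff k • M i ^ k) =
        ∑ k ∈ Finset.range (g.natDegree + 1), g.coeff k • M ^ k := by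
      funext i; simp
    rw [this]
    refine Eq.trans ?_ (map_sum (Matrix.blockDiagonal'AddMonoidHom ι ι Ω) _ _).symm
    refine Finset.sum_congr rfl fun k _ => ?_
    rw [Matrix.blockDiagonal'AddMonoidHom_apply, Matrix.blockDiagonal'_smul,
      Matrix.blockDiagonal'_pow]
  have h4 : (fun i => aeval (M i) g) = 0 := by
    funext i
    have h5 : q i ∣ g := by
      by_cases hk : k = 0
      · subst hk
        exact ((Finset.dvd_prod_of_mem q (Finset.mem_univ i)).trans h2).trans (by simp)
      · exact ((hq i).isRadical k g ((Finset.dvd_prod_of_mem q (Finset.mem_univ i)).trans h2))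
    obtain ⟨c, hc⟩ := h5
    rw [hc, map_mul, h0 i, zero_mul]
    rfl
  rw [h3, h4, Matrix.blockDiagonal'_zero]

/-- In a commuting product of a semisimple and a unipotent operator, the unipotent factor fixes
every eigenvector with nonzero eigenvalue. -/
lemma unipotent_fix_eigenvector [CharZero Ω] {V : Type*} [AddCommGroup V] [Module Ω V]
    [FiniteDimensional Ω V] {A B : Module.End Ω V} (hA : A.IsSemisimple) (hAB : Commute A B)
    (hB : IsNilpotent (B - 1)) {v : V} {c : Ω} (hc : c ≠ 0) (hv : (A * B) v = c • v) :
    B v = v := by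
  by_cases hv0 : v = 0
  · rw [hv0, map_zero]
  obtain ⟨n, -, s, hs, hn, hss, hsum⟩ := (A * B).exists_isNilpotent_isSemisimple
  have hcomm : Commute A (B - 1) := hAB.sub_right (Commute.one_right A)
  have hns : Commute n s := by
    have h1 : n = A * B - s := by rw [hsum]; simp
    have hX : Commute (A * B) s :=
      Algebra.commute_of_mem_adjoin_self hs
    rw [h1]
    exact hX.sub_left (Commute.refl s)
  -- Uniqueness of the Jordan decomposition of `A B`: the semisimple part is `A`, a polynomial
  -- in `A B`.
  have hA' : A = s :=
    (Module.End.isNilpotent_isSemisimple_unique (hcomm.isNilpotent_mul_left hB) hA hn hss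
      ((Commute.refl A).mul_left hcomm.symm) hns (by rw [← hsum]; noncomm_ring)).2
  rw [← hA'] at hs
  obtain ⟨P, hP⟩ := (Algebra.adjoin_singleton_eq_range_aeval Ω (A * B) ▸ hs :
    A ∈ (aeval (A * B)).range)
  have h1 : A v = P.eval c • v := by
    rw [← hP]
    exact Module.End.aeval_apply_of_hasEigenvector
      (Module.End.hasEigenvector_iff.2 ⟨Module.End.mem_eigenspace_iff.2 hv, hv0⟩)
  set a := P.eval c
  have h2 : a • B v = c • v := by
    rw [← hv, hAB.eq, Module.End.mul_apply, h1, map_smul]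
  have ha : a ≠ 0 := by
    intro h
    rw [h, zero_smul] at h2
    exact (smul_ne_zero hc hv0) h2.symm
  -- So `v` is an eigenvector of `A` and `B`, and the eigenvalue of `B` can only be `1`.
  have h3 : B v = (a⁻¹ * c) • v := by
    rw [mul_smul, ← h2, inv_smul_smul₀ ha]
  obtain ⟨k, hk⟩ := hB
  have h4 : ((B - 1) ^ k) v = (a⁻¹ * c - 1) ^ k • v := by
    clear hk
    induction k with
    | zero => simp
    | succ k ih =>
      rw [pow_succ', Module.End.mul_apply, ih, map_smul, LinearMap.sub_apply, h3,
        Module.End.one_apply, pow_succ, mul_smul _ (a⁻¹ * c - 1) v, sub_smul _ _ v, one_smul]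
  rw [hk, LinearMap.zero_apply, eq_comm, smul_eq_zero, or_iff_left hv0] at h4
  rw [h3, sub_eq_zero.1 (eq_zero_of_pow_eq_zero h4), one_smul]

/-- A vector fixed by a positive power of a unipotent operator is fixed by the operator, as
`1 + B + ⋯ + B ^ (k - 1)` is invertible. -/
lemma unipotent_fix_of_pow [CharZero Ω] {V : Type*} [AddCommGroup V] [Module Ω V]
    {B : Module.End Ω V} (hB : IsNilpotent (B - 1)) {v : V} {k : ℕ} (hk : 0 < k)
    (hv : (B ^ k) v = v) : B v = v := by
  let g : Polynomial Ω := ∑ i ∈ Finset.range k, X ^ i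
  obtain ⟨q, hq⟩ : (X - C 1 : Polynomial Ω) ∣ g - C (k : Ω) := by
    rw [dvd_iff_isRoot]; simp [g, eval_finsetSum]
  have h1 : aeval B g = (k : Module.End Ω V) + (B - 1) * aeval B q := by
    rw [sub_eq_iff_eq_add.1 hq, add_comm]; simp
  have hu : IsUnit (aeval B g) := by
    rw [h1]
    have hc : Commute (B - 1) (aeval B q) :=
      ((Algebra.commute_of_mem_adjoin_self (aeval_mem_adjoin_singleton Ω B)).sub_left
        (Commute.one_left _))
    refine (hc.isNilpotent_mul_right hB).isUnit_add_left_of_commute ?_ (Nat.cast_commute _ _).symm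
    have := (IsUnit.mk0 (k : Ω) (by exact_mod_cast hk.ne')).map (algebraMap Ω (Module.End Ω V))
    simpa using this
  have h2 : aeval B g * (B - 1) = B ^ k - 1 := by
    have := geom_sum_mul B k
    simpa [g] using this
  have h3 : aeval B g ((B - 1) v) = 0 := by
    rw [← Module.End.mul_apply, h2, LinearMap.sub_apply, hv, Module.End.one_apply, sub_self]
  have h4 : (B - 1) v = 0 := by
    obtain ⟨y, hy⟩ := hu.exists_left_inv
    have := congrArg y h3
    rwa [← Module.End.mul_apply, hy, map_zero, Module.End.one_apply] at this
  exact sub_eq_zero.1 h4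

lemma isSemisimple_mulLeft {Y : Matrix ι ι Ω}
    (hY : Module.End.IsSemisimple (Matrix.toLin' Y)) :
    Module.End.IsSemisimple (LinearMap.mulLeft Ω Y) := by
  obtain ⟨q, hq, h0⟩ := (isSemisimple_toLin'_iff Y).1 hY
  refine Module.End.isSemisimple_of_squarefree_aeval_eq_zero hq ?_
  have : aeval (LinearMap.mulLeft Ω Y : Module.End Ω _) q = Algebra.lmul Ω _ (aeval Y q) :=
    Polynomial.aeval_algHom_apply (Algebra.lmul Ω (Matrix ι ι Ω)) Y q
  rw [this, h0, map_zero]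

lemma isSemisimple_mulRight {Y : Matrix ι ι Ω}
    (hY : Module.End.IsSemisimple (Matrix.toLin' Y)) :
    Module.End.IsSemisimple (LinearMap.mulRight Ω Y) := by
  obtain ⟨q, hq, h0⟩ := (isSemisimple_toLin'_iff Y).1 hY
  refine Module.End.isSemisimple_of_squarefree_aeval_eq_zero hq ?_
  have : aeval (LinearMap.mulRight Ω Y : Module.End Ω _) q = LinearMap.mulRight Ω (aeval Y q) := by
    refine LinearMap.ext fun Z => ?_
    rw [aeval_eq_sum_range, aeval_eq_sum_range, LinearMap.mulRight_apply, Matrix.mul_sum,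
      LinearMap.sum_apply]
    refine Finset.sum_congr rfl fun k _ => ?_
    rw [LinearMap.smul_apply, LinearMap.pow_mulRight, LinearMap.mulRight_apply, Matrix.mul_smul]
  rw [this, h0, LinearMap.mulRight_zero_eq_zero]

/-- The inverse of a matrix is a polynomial in it. -/
lemma isSemisimple_inv {s : (Matrix ι ι Ω)ˣ}
    (hs : Module.End.IsSemisimple (Matrix.toLin' (s : Matrix ι ι Ω))) :
    Module.End.IsSemisimple (Matrix.toLin' ((s⁻¹ : (Matrix ι ι Ω)ˣ) : Matrix ι ι Ω)) := by
  let S := Algebra.adjoin Ω {(s : Matrix ι ι Ω)}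
  let x : S := ⟨s, Algebra.self_mem_adjoin_singleton _ _⟩
  have hinj : Function.Injective (LinearMap.mulLeft Ω x) := by
    intro a b hab
    have h1 : (s : Matrix ι ι Ω) * a = s * b := congrArg Subtype.val hab
    exact Subtype.ext (s.isUnit.mul_left_cancel h1)
  obtain ⟨y, hy⟩ := LinearMap.surjective_of_injective hinj 1
  have hy' : (s : Matrix ι ι Ω) * y = 1 := congrArg Subtype.val hy
  have h2 : ((s⁻¹ : (Matrix ι ι Ω)ˣ) : Matrix ι ι Ω) = y :=
    (Units.inv_mul_eq_iff_eq_mul s).2 hy'.symm ▸ by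
    rw [mul_one]
  obtain ⟨P, hP⟩ := (Algebra.adjoin_singleton_eq_range_aeval Ω (s : Matrix ι ι Ω) ▸
    (show (y : Matrix ι ι Ω) ∈ Algebra.adjoin Ω {(s : Matrix ι ι Ω)} from y.2) :
    (y : Matrix ι ι Ω) ∈ (aeval (s : Matrix ι ι Ω)).range)
  have h3 : Matrix.toLin' (y : Matrix ι ι Ω) = aeval (Matrix.toLin' (s : Matrix ι ι Ω)) P := by
    rw [← hP]
    exact (Polynomial.aeval_algHom_apply (Matrix.toLinAlgEquiv' : Matrix ι ι Ω ≃ₐ[Ω] _) _ P).symm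
  rw [h2, h3]
  exact hs.aeval P

/-- Conjugation by invertible matrices, as linear operators on matrices. -/
def conjOp (Ω ι : Type*) [Fintype ι] [DecidableEq ι] [Field Ω] :
    (Matrix ι ι Ω)ˣ →* Module.End Ω (Matrix ι ι Ω) where
  toFun g := LinearMap.mulLeft Ω (g : Matrix ι ι Ω) *
    LinearMap.mulRight Ω ((g⁻¹ : (Matrix ι ι Ω)ˣ) : Matrix ι ι Ω)
  map_one' := by ext; simp
  map_mul' g h := by
    refine LinearMap.ext fun Y => ?_
    simp [mul_assoc]

lemma conjOp_apply (g : (Matrix ι ι Ω)ˣ) (Y : Matrix ι ι Ω) :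
    conjOp Ω ι g Y = g * Y * ((g⁻¹ : (Matrix ι ι Ω)ˣ) : Matrix ι ι Ω) := by
  simp [conjOp, mul_assoc]

/-- If `X = s u` is a Jordan decomposition and a power of `X` commutes with `M` up to a nonzero
scalar, then `u` commutes with `M`: indeed `M` is an eigenvector of conjugation by that power, whose
unipotent part is a power of conjugation by `u`. -/
lemma unipotent_commute [CharZero Ω] {s u : (Matrix ι ι Ω)ˣ} (hsu : Commute s u)
    (hs : Module.End.IsSemisimple (Matrix.toLin' (s : Matrix ι ι Ω)))
    (hu : IsNilpotent ((u : Matrix ι ι Ω) - 1)) {M : Matrix ι ι Ω} {k : ℕ} (hk : 0 < k) {c : Ω}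
    (hc : c ≠ 0) (hM : (((s * u) ^ k : (Matrix ι ι Ω)ˣ) : Matrix ι ι Ω) * M =
      c • (M * (((s * u) ^ k : (Matrix ι ι Ω)ˣ) : Matrix ι ι Ω))) :
    (u : Matrix ι ι Ω) * M = M * u := by
  have hA : (conjOp Ω ι s).IsSemisimple :=
    (isSemisimple_mulLeft hs).mul_of_commute (LinearMap.commute_mulLeft_right _ _)
      (isSemisimple_mulRight (isSemisimple_inv hs))
  have hB : IsNilpotent (conjOp Ω ι u - 1) := by
    have h1 : conjOp Ω ι u - 1 =
        LinearMap.mulLeft Ω ((u : Matrix ι ι Ω) - 1) * LinearMap.mulRight Ω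
            ((u⁻¹ : (Matrix ι ι Ω)ˣ) : Matrix ι ι Ω) -
          LinearMap.mulRight Ω
            (((u⁻¹ : (Matrix ι ι Ω)ˣ) : Matrix ι ι Ω) * ((u : Matrix ι ι Ω) - 1)) := by
      refine LinearMap.ext fun Y => ?_
      simp [conjOp_apply, mul_sub, sub_mul, mul_assoc]
    have hc1 : Commute ((u⁻¹ : (Matrix ι ι Ω)ˣ) : Matrix ι ι Ω) ((u : Matrix ι ι Ω) - 1) :=
      (Commute.units_val (Commute.inv_left (Commute.refl u))).sub_right (Commute.one_right _)
    have h2 : IsNilpotent (LinearMap.mulLeft Ω ((u : Matrix ι ι Ω) - 1) : Module.End Ω _) :=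
      (LinearMap.isNilpotent_mulLeft_iff _ _).2 hu
    have h3 : IsNilpotent (LinearMap.mulRight Ω
        (((u⁻¹ : (Matrix ι ι Ω)ˣ) : Matrix ι ι Ω) * ((u : Matrix ι ι Ω) - 1)) : Module.End Ω _) :=
      (LinearMap.isNilpotent_mulRight_iff _ _).2 (hc1.isNilpotent_mul_left hu)
    rw [h1]
    refine Commute.isNilpotent_sub (Commute.mul_left (LinearMap.commute_mulLeft_right _ _) ?_)
      (Commute.isNilpotent_mul_right (LinearMap.commute_mulLeft_right _ _) h2) h3
    refine LinearMap.ext fun Y => ?_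
    have := (Commute.mul_right (Commute.refl _) hc1).eq
    simp only [Module.End.mul_apply, LinearMap.mulRight_apply, mul_assoc]
    simp only [mul_assoc] at this
    rw [this]
  have hAB : Commute (conjOp Ω ι s) (conjOp Ω ι u) := hsu.map _
  have hBk : IsNilpotent (conjOp Ω ι u ^ k - 1) := by
    obtain ⟨Y, hY⟩ : ∃ Y, conjOp Ω ι u ^ k - 1 = (conjOp Ω ι u - 1) * Y ∧
      Commute (conjOp Ω ι u - 1) Y := ⟨∑ i ∈ Finset.range k, conjOp Ω ι u ^ i,
        (mul_geom_sum _ _).symm, Commute.sum_right _ _ _ fun i _ =>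
          ((Commute.refl _).pow_right i).sub_left (Commute.one_left _)⟩
    rw [hY.1]
    exact hY.2.isNilpotent_mul_right hB
  have h1 : (conjOp Ω ι s ^ k * conjOp Ω ι u ^ k) M = c • M := by
    rw [← hAB.mul_pow, ← map_mul, ← map_pow, conjOp_apply, hM, Matrix.smul_mul, mul_assoc,
      Units.mul_inv, mul_one]
  have h2 := unipotent_fix_of_pow hB hk
    (unipotent_fix_eigenvector (hA.pow k) (hAB.pow_pow k k) hBk hc h1)
  rw [conjOp_apply] at h2
  conv_rhs => rw [← h2]
  rw [mul_assoc, mul_assoc, Units.inv_mul, mul_one]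

end Jordan

/-! ### Weil-Deligne parametrizations -/

section WD

variable {F : Type*} [Field F] [NumberField F] {w : HeightOneSpectrum (𝓞 F)}
  {ι κ Ω Ω' : Type*} [Fintype ι] [DecidableEq ι] [Fintype κ] [DecidableEq κ] [Field Ω]
  [Field Ω']

lemma resCard_ne_zero [CharZero Ω] : (resCard F w : Ω) ≠ 0 := by
  have : 1 < resCard F w := NumberField.HeightOneSpectrum.one_lt_absNorm w
  exact_mod_cast (by omega : resCard F w ≠ 0)

lemma normChar_apply [CharZero Ω] (g : WeilGroup F w) :
    normChar w Ω g = (resCard F w : Ω) ^ (-frobVal g) := by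
  rw [normChar, dif_neg resCard_ne_zero]
  rfl

lemma normChar_ne_zero (g : WeilGroup F w) : normChar w Ω g ≠ 0 := by
  intro h
  have h1 : normChar w Ω g * normChar w Ω g⁻¹ = 1 := by rw [← map_mul, mul_inv_cancel, map_one]
  rw [h, zero_mul] at h1
  exact zero_ne_one h1

lemma map_normChar [CharZero Ω] [CharZero Ω'] (f : Ω →+* Ω') (g : WeilGroup F w) :
    f (normChar w Ω g) = normChar w Ω' g := by
  rw [normChar_apply, normChar_apply, map_zpow₀, map_natCast]

lemma pow_mul_of_comm {R M : Matrix ι ι Ω} {c : Ω} (h : M * R = c • (R * M)) (k : ℕ) :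
    M ^ k * R = c ^ k • (R * M ^ k) := by
  induction k with
  | zero => simp
  | succ k ih =>
    rw [pow_succ', mul_assoc, ih, Matrix.mul_smul, ← mul_assoc, h, Matrix.smul_mul, smul_smul,
      mul_assoc, ← pow_succ]

lemma mul_nilpExp_of_comm {R M : Matrix ι ι Ω} {c : Ω} (h : M * R = c • (R * M)) (a : Ω) :
    nilpExp (a • M) * R = R * nilpExp ((a * c) • M) := by
  rw [nilpExp, nilpExp, Matrix.sum_mul, Matrix.mul_sum]
  refine Finset.sum_congr rfl fun k _ => ?_
  rw [_root_.smul_pow, _root_.smul_pow, Matrix.smul_mul, Matrix.smul_mul, pow_mul_of_comm h,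
    Matrix.mul_smul,
    Matrix.mul_smul, smul_smul (a ^ k), ← mul_pow]

lemma rank_nilpExp_sub_one_smul_pow [CharZero Ω] {M : Matrix ι ι Ω} (h : IsNilpotent M) {c : Ω}
    (hc : c ≠ 0) (k : ℕ) : ((nilpExp (c • M) - 1) ^ k).rank = (M ^ k).rank := by
  rw [rank_nilpExp_sub_one_pow (isNilpotent_smul h c), _root_.smul_pow,
    Matrix.rank_smul_of_mem_nonZeroDivisors _ (mem_nonZeroDivisors_of_ne_zero (pow_ne_zero k hc))]

section Monodromy

variable {p : ℕ} [Fact p.Prime] [Algebra ℤ_[p] Ω] [Algebra ℤ_[p] Ω'] {z : RootSystem p w}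
  {φ : WeilGroup F w}

/-- The relation `ρ(g) N ρ(g)⁻¹ = |Art⁻¹|(g) N`: both sides have the same exponential after
scaling by `t(τ) ≠ 0` for a `τ` deep enough in inertia. -/
theorem HasMonodromy.comm [CharZero Ω] (hw : (p : 𝓞 F) ∉ w.asIdeal) (hφ : frobVal φ = 1)
    (hinj : Function.Injective (algebraMap ℤ_[p] Ω)) {ρ : WeilGroup F w →* Matrix ι ι Ω}
    {N : Matrix ι ι Ω} (h : HasMonodromy z ρ N) (g : WeilGroup F w) :
    ρ g * N = normChar w Ω g • (N * ρ g) := by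
  obtain ⟨hN, K', hfin, hK⟩ := h
  -- `L` is such that both `τ` and `g τ g⁻¹` fix `K'` if `τ` fixes `L`.
  let L := K' ⊔ K'.map ((g : GalLocal F w)⁻¹ : GalLocal F w).toAlgHom
  have : FiniteDimensional (w.adicCompletion F)
      (K'.map ((g : GalLocal F w)⁻¹ : GalLocal F w).toAlgHom) :=
    IntermediateField.finiteDimensional_map _
  have : FiniteDimensional (w.adicCompletion F) L := IntermediateField.finiteDimensional_sup _ _
  obtain ⟨τ, hτ, hτL, ht⟩ := exists_tameChar_ne_zero hw z hφ L
  have h1 := hK τ hτ (IntermediateField.fixingSubgroup_le (le_sup_left) hτL)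
  have h2 := hK (g * τ * g⁻¹) (conj_mem_inertia hτ g) (by
    rw [IntermediateField.mem_fixingSubgroup_iff] at hτL ⊢
    intro x hx
    have := hτL ((g : GalLocal F w)⁻¹ x)
      ((le_sup_right : _ ≤ L) ⟨x, hx, rfl⟩)
    change (g : GalLocal F w) ((τ : GalLocal F w) ((g : GalLocal F w)⁻¹ x)) = x
    rw [this, ← AlgEquiv.mul_apply, mul_inv_cancel, AlgEquiv.one_apply])
  set c := algebraMap ℤ_[p] Ω (tameChar z τ)
  have hc : c ≠ 0 := by
    rwa [Ne, ← map_zero (algebraMap ℤ_[p] Ω), hinj.eq_iff]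
  have e1 : ρ g * ρ g⁻¹ = 1 := by rw [← map_mul, mul_inv_cancel, map_one]
  have e2 : ρ g⁻¹ * ρ g = 1 := by rw [← map_mul, inv_mul_cancel, map_one]
  rw [tameChar_conj hw z g hτ, map_mul, map_mul, h1, ← nilpExp_conj e1 e2] at h2
  have h3 := nilpExp_injective (isNilpotent_conj e1 e2 (isNilpotent_smul hN c))
    (isNilpotent_smul hN _) h2
  have h4 : c • (ρ g * N) = c • (normChar w Ω g • (N * ρ g)) := by
    have := congrArg (· * ρ g) h3
    simp only [mul_assoc, e2, mul_one, Matrix.smul_mul, Matrix.mul_smul] at this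
    rw [this, smul_smul, mul_comm]
  exact smul_right_injective _ hc h4

lemma WeilDeligneRep.mul_N_comm (D : WeilDeligneRep w ι Ω) (g : WeilGroup F w) :
    D.N * D.r g = (normChar w Ω g)⁻¹ • (D.r g * D.N) := by
  rw [D.comm g, smul_smul, inv_mul_cancel₀ (normChar_ne_zero g), one_smul]

/-- The tame character of the inertial part of an element is a cocycle. -/
lemma tameChar_cocycle [CharZero Ω] (hw : (p : 𝓞 F) ∉ w.asIdeal) (hφ : frobVal φ = 1)
    (g h : WeilGroup F w) :
    algebraMap ℤ_[p] Ω (tameChar z (φ ^ (-frobVal (g * h)) * (g * h))) =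
      (normChar w Ω h)⁻¹ * algebraMap ℤ_[p] Ω (tameChar z (φ ^ (-frobVal g) * g)) +
        algebraMap ℤ_[p] Ω (tameChar z (φ ^ (-frobVal h) * h)) := by
  have h1 : φ ^ (-frobVal (g * h)) * (g * h) =
      (φ ^ (-frobVal h) * (φ ^ (-frobVal g) * g) * (φ ^ (-frobVal h))⁻¹) *
        (φ ^ (-frobVal h) * h) := by
    rw [frobVal_mul, neg_add_rev, zpow_add]
    group
  rw [h1, tameChar_mul hw z (conj_mem_inertia (zpow_mul_mem_inertia hφ g) _)
    (zpow_mul_mem_inertia hφ h), map_add, tameChar_conj hw z _ (zpow_mul_mem_inertia hφ g)]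
  congr 2
  rw [normChar_apply, normChar_apply, frobVal_zpow, hφ, ← zpow_neg]
  simp

/-- A monodromic representation has a Weil-Deligne parametrization. -/
theorem HasMonodromy.exists_isWDParametrization [CharZero Ω] (hw : (p : 𝓞 F) ∉ w.asIdeal)
    (hφ : frobVal φ = 1) (hinj : Function.Injective (algebraMap ℤ_[p] Ω))
    {ρ : WeilGroup F w →* Matrix ι ι Ω} {N : Matrix ι ι Ω} (h : HasMonodromy z ρ N) :
    ∃ D : WeilDeligneRep w ι Ω, IsWDParametrization φ z ρ D := by
  have hcomm := h.comm hw hφ hinj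
  have hcomm' : ∀ g, N * ρ g = (normChar w Ω g)⁻¹ • (ρ g * N) := fun g => by
    rw [hcomm g, smul_smul, inv_mul_cancel₀ (normChar_ne_zero g), one_smul]
  let tt : WeilGroup F w → Ω := fun g => algebraMap ℤ_[p] Ω (tameChar z (φ ^ (-frobVal g) * g))
  have hN := h.1
  let r : WeilGroup F w →* Matrix ι ι Ω :=
    { toFun := fun g => ρ g * nilpExp (-(tt g • N))
      map_one' := by
        have : tt 1 = 0 := by
          change algebraMap ℤ_[p] Ω (tameChar z (φ ^ (-frobVal 1) * 1)) = 0
          rw [frobVal_one, neg_zero, zpow_zero, one_mul, tameChar_one hw, map_zero]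
        rw [this, zero_smul, neg_zero, nilpExp_zero, map_one, one_mul]
      map_mul' := fun g h => by
        simp only [← neg_smul]
        rw [mul_assoc, ← mul_assoc (nilpExp _) (ρ h), mul_nilpExp_of_comm (hcomm' h),
          mul_assoc, ← nilpExp_smul_add hN, ← mul_assoc, ← map_mul]
        congr 3
        change -algebraMap ℤ_[p] Ω (tameChar z (φ ^ (-frobVal (g * h)) * (g * h))) = _
        rw [tameChar_cocycle hw hφ]
        simp only [tt]
        ring }
  have hr : ∀ g, r g = ρ g * nilpExp (-(tt g • N)) := fun g => rfl
  obtain ⟨-, K', hfin, hK⟩ := h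
  have hfix : ∀ τ ∈ inertia F w, (τ : GalLocal F w) ∈ K'.fixingSubgroup → r τ = 1 := by
    intro τ hτ hτK
    have : tt τ = algebraMap ℤ_[p] Ω (tameChar z τ) := by
      simp only [tt, frobVal_eq_zero hτ, neg_zero, zpow_zero, one_mul]
    rw [hr, hK τ hτ hτK, this, nilpExp_mul_neg (isNilpotent_smul hN _)]
  refine ⟨{ r := r, N := N, nilpotent := hN, finite_inertia := ?_, comm := fun g => ?_ },
    ⟨hN, K', hfin, hK⟩, fun g => rfl⟩
  · -- On inertia, `r` factors through the finitely many embeddings of `K'`.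
    let rest : inertia F w → (K' →ₐ[w.adicCompletion F] Kbar F w) := fun τ =>
      ((τ : WeilGroup F w) : GalLocal F w).toAlgHom.comp K'.val
    have hfac : ∀ a b : inertia F w, rest a = rest b → r a = r b := by
      intro a b hab
      have h1 : r ((a : WeilGroup F w)⁻¹ * b) = 1 := by
        refine hfix _ (mul_mem (inv_mem a.2) b.2) ?_
        rw [IntermediateField.mem_fixingSubgroup_iff]
        intro x hx
        have := DFunLike.congr_fun hab ⟨x, hx⟩
        change ((a : WeilGroup F w) : GalLocal F w) x =
          ((b : WeilGroup F w) : GalLocal F w) x at this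
        change ((a : WeilGroup F w) : GalLocal F w)⁻¹ (((b : WeilGroup F w) : GalLocal F w) x) = x
        rw [← this, ← AlgEquiv.mul_apply, inv_mul_cancel, AlgEquiv.one_apply]
      rw [← mul_one (r a), ← h1, ← map_mul, mul_inv_cancel_left]
    have hfin2 : Finite (K' →ₐ[w.adicCompletion F] Kbar F w) := inferInstance
    refine (Set.finite_range (fun f : Set.range rest => r (f.2.choose : WeilGroup F w))).subset ?_
    rintro _ ⟨τ, hτ, rfl⟩
    have hm : rest ⟨τ, hτ⟩ ∈ Set.range rest := ⟨_, rfl⟩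
    exact ⟨⟨_, hm⟩, hfac _ _ hm.choose_spec⟩
  · have h1 : N * nilpExp (-(tt g • N)) = nilpExp (-(tt g • N)) * N := by
      have := mul_nilpExp_of_comm (R := N) (M := N) (c := 1) (one_smul _ _).symm (-tt g)
      rw [mul_one, neg_smul] at this
      exact this.symm
    rw [hr, mul_assoc, ← h1, ← mul_assoc, hcomm, Matrix.smul_mul, mul_assoc]

/-- The ranks of the powers of the monodromy operators of two monodromic representations can be
read off from one element of inertia. -/
lemma HasMonodromy.exists_rank_pow [CharZero Ω] [CharZero Ω'] (hw : (p : 𝓞 F) ∉ w.asIdeal)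
    (hφ : frobVal φ = 1) (hinj : Function.Injective (algebraMap ℤ_[p] Ω))
    (hinj' : Function.Injective (algebraMap ℤ_[p] Ω'))
    {ρ : WeilGroup F w →* Matrix ι ι Ω} {ρ' : WeilGroup F w →* Matrix κ κ Ω'} {N : Matrix ι ι Ω}
    {N' : Matrix κ κ Ω'} (h : HasMonodromy z ρ N) (h' : HasMonodromy z ρ' N') :
    ∃ τ, ∀ k : ℕ, (N ^ k).rank = ((ρ τ - 1) ^ k).rank ∧ (N' ^ k).rank = ((ρ' τ - 1) ^ k).rank := by
  obtain ⟨hN, K, hfin, hK⟩ := h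
  obtain ⟨hN', K', hfin', hK'⟩ := h'
  have : FiniteDimensional (w.adicCompletion F) ↥(K ⊔ K') :=
    IntermediateField.finiteDimensional_sup _ _
  obtain ⟨τ, hτ, hτL, ht⟩ := exists_tameChar_ne_zero hw z hφ (K ⊔ K')
  have hc : algebraMap ℤ_[p] Ω (tameChar z τ) ≠ 0 := by
    rwa [Ne, ← map_zero (algebraMap ℤ_[p] Ω), hinj.eq_iff]
  have hc' : algebraMap ℤ_[p] Ω' (tameChar z τ) ≠ 0 := by
    rwa [Ne, ← map_zero (algebraMap ℤ_[p] Ω'), hinj'.eq_iff]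
  refine ⟨τ, fun k => ⟨?_, ?_⟩⟩
  · rw [hK τ hτ (IntermediateField.fixingSubgroup_le (le_sup_left) hτL),
      rank_nilpExp_sub_one_smul_pow hN hc]
  · rw [hK' τ hτ (IntermediateField.fixingSubgroup_le (le_sup_right) hτL),
      rank_nilpExp_sub_one_smul_pow hN' hc']

end Monodromy

end WD

/-! ### Frobenius semisimplification -/

section Frobenius

variable {F : Type*} [Field F] [NumberField F] {w : HeightOneSpectrum (𝓞 F)}
  {ι κ Ω Ω' : Type*} [Fintype ι] [DecidableEq ι] [Fintype κ] [DecidableEq κ] [Field Ω]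
  [Field Ω']

/-- The multiplicative Jordan decomposition of an invertible matrix. -/
lemma exists_jordan [CharZero Ω] (X : (Matrix ι ι Ω)ˣ) :
    ∃ s u : (Matrix ι ι Ω)ˣ, X = s * u ∧ Commute s u ∧
      Module.End.IsSemisimple (Matrix.toLin' (s : Matrix ι ι Ω)) ∧
      IsNilpotent ((u : Matrix ι ι Ω) - 1) := by
  let E : Matrix ι ι Ω ≃ₐ[Ω] Module.End Ω (ι → Ω) := Matrix.toLinAlgEquiv'
  obtain ⟨n, hn, s, hs, hnn, hss, hsum⟩ := (E X).exists_isNilpotent_isSemisimple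
  have hXn : Commute (E X) n := Algebra.commute_of_mem_adjoin_self hn
  have hXs : Commute (E X) s := Algebra.commute_of_mem_adjoin_self hs
  have hs' : s = E X + -n := by rw [hsum]; simp
  have hsu : IsUnit s := by
    rw [hs']
    exact hnn.neg.isUnit_add_left_of_commute (X.isUnit.map E) hXn.symm.neg_left
  obtain ⟨s', hs1⟩ : IsUnit (E.symm s) := hsu.map E.symm
  have hEs : E (s' : Matrix ι ι Ω) = s := by rw [hs1, AlgEquiv.apply_symm_apply]
  have hXs' : Commute X s' := by
    refine Units.ext (E.injective ?_)
    simp only [Units.val_mul, map_mul, hEs]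
    exact hXs
  refine ⟨s', s'⁻¹ * X, by simp, ?_, ?_, ?_⟩
  · exact (Commute.inv_right (Commute.refl s')).mul_right hXs'.symm
  · exact (show Matrix.toLin' (s' : Matrix ι ι Ω) = s from hEs) ▸ hss
  · have h1 : (X : Matrix ι ι Ω) = E.symm n + s' := by
      apply E.injective
      rw [map_add, hEs, AlgEquiv.apply_symm_apply, hsum]
    have h2 : ((s'⁻¹ * X : (Matrix ι ι Ω)ˣ) : Matrix ι ι Ω) - 1 =
        ((s'⁻¹ : (Matrix ι ι Ω)ˣ) : Matrix ι ι Ω) * E.symm n := by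
      rw [Units.val_mul, h1, mul_add, Units.inv_mul, add_sub_cancel_right]
    have h3 : Commute (s' : Matrix ι ι Ω) (E.symm n) := by
      apply E.injective
      rw [map_mul, map_mul, hEs, AlgEquiv.apply_symm_apply, hs']
      exact (hXn.add_left (Commute.refl n).neg_left)
    rw [h2]
    exact (Commute.units_inv_left h3).isNilpotent_mul_left (hnn.map E.symm)

/-- The invertible matrix by which a group element acts. -/
noncomputable def unitOf {G : Type*} [Group G] (ρ : G →* Matrix ι ι Ω) (g : G) : (Matrix ι ι Ω)ˣ :=
  ρ.toHomUnits g

@[simp] lemma coe_unitOf {G : Type*} [Group G] (ρ : G →* Matrix ι ι Ω) (g : G) :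
    (unitOf ρ g : Matrix ι ι Ω) = ρ g := rfl

lemma unitOf_pow {G : Type*} [Group G] (ρ : G →* Matrix ι ι Ω) (g : G) (k : ℕ) :
    unitOf ρ g ^ k = unitOf ρ (g ^ k) := (map_pow ρ.toHomUnits g k).symm

/-- Some positive power of any element commutes with a given element of inertia, in a representation
with finite inertial image. -/
lemma InertiaFiniteRep.exists_pow_commute {A : Type*} [CommRing A] (r : InertiaFiniteRep w ι A)
    (g : WeilGroup F w) {τ : WeilGroup F w} (hτ : τ ∈ inertia F w) :
    ∃ k : ℕ, 0 < k ∧ r.r (g ^ k) * r.r τ = r.r τ * r.r (g ^ k) := by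
  let S := r.r '' (inertia F w : Set (WeilGroup F w))
  have hfin : Finite S := r.finite_inertia
  let f : ℕ → S := fun k => ⟨r.r (g ^ k * τ * (g ^ k)⁻¹), _, conj_mem_inertia hτ _, rfl⟩
  obtain ⟨i, j, hij, h⟩ := Finite.exists_ne_map_eq_of_infinite f
  wlog hlt : i < j generalizing i j
  · exact this j i hij.symm h.symm (lt_of_le_of_ne (not_lt.1 hlt) hij.symm)
  refine ⟨j - i, by omega, ?_⟩
  have h1 : r.r (g ^ i * τ * (g ^ i)⁻¹) = r.r (g ^ j * τ * (g ^ j)⁻¹) := congrArg Subtype.val h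
  have h2 := congrArg (fun M => r.r (g ^ i)⁻¹ * M * r.r (g ^ j)) h1
  simp only [← map_mul] at h2
  rw [← map_mul, ← map_mul]
  have e1 : (g ^ i)⁻¹ * (g ^ i * τ * (g ^ i)⁻¹) * g ^ j = τ * g ^ (j - i) := by
    rw [pow_sub g hlt.le, (Commute.refl g).pow_pow _ _ |>.inv_right.eq]; group
  have e2 : (g ^ i)⁻¹ * (g ^ j * τ * (g ^ j)⁻¹) * g ^ j = g ^ (j - i) * τ := by
    rw [pow_sub g hlt.le, (Commute.refl g).pow_pow _ _ |>.inv_right.eq]; group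
  rw [e1, e2] at h2
  exact h2.symm

/-- Frobenius semisimplifications exist: the unipotent part `u` of `r φ` commutes with `N` and with
the finite group `r(I)`, since a power of `r φ` centralizes the latter. -/
theorem WeilDeligneRep.exists_isFrobSemisimplification [CharZero Ω] {φ : WeilGroup F w}
    (hφ : frobVal φ = 1) (D : WeilDeligneRep w ι Ω) :
    ∃ D' : WeilDeligneRep w ι Ω, D.IsFrobSemisimplification φ D' := by
  obtain ⟨s, u, hX, hsu, hs, hu⟩ := exists_jordan (unitOf D.r φ)
  have huN : (u : Matrix ι ι Ω) * D.N = D.N * u := by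
    refine unipotent_commute hsu hs hu one_pos (normChar_ne_zero (Ω := Ω) φ) ?_
    rw [← hX, pow_one, coe_unitOf, D.comm]
  have huI : ∀ τ ∈ inertia F w, Commute u (unitOf D.r τ) := by
    intro τ hτ
    obtain ⟨k, hk, h⟩ := D.exists_pow_commute φ hτ
    refine Units.ext (unipotent_commute hsu hs hu hk one_ne_zero ?_)
    rw [← hX, unitOf_pow, coe_unitOf, coe_unitOf, one_smul, h]
  have huφ : Commute u (unitOf D.r φ) := by
    rw [hX]; exact hsu.symm.mul_right (Commute.refl u)
  have hu_all : ∀ g, Commute u (unitOf D.r g) := by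
    intro g
    have h1 : unitOf D.r g = unitOf D.r φ ^ (frobVal g) * unitOf D.r (φ ^ (-frobVal g) * g) := by
      change D.r.toHomUnits g = D.r.toHomUnits φ ^ (frobVal g) * D.r.toHomUnits _
      rw [← map_zpow, ← map_mul, ← mul_assoc, ← zpow_add]
      simp
    rw [h1]
    exact (huφ.zpow_right _).mul_right (huI _ (zpow_mul_mem_inertia hφ g))
  let r' : WeilGroup F w →* Matrix ι ι Ω :=
    { toFun := fun g => D.r g * ((u ^ (-frobVal g) : (Matrix ι ι Ω)ˣ) : Matrix ι ι Ω)
      map_one' := by simp [frobVal_one]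
      map_mul' := fun g h => by
        have h1 := (hu_all h).zpow_left (-frobVal g)
        have h2 : ((u ^ (-frobVal g) : (Matrix ι ι Ω)ˣ) : Matrix ι ι Ω) * D.r h =
          D.r h * ((u ^ (-frobVal g) : (Matrix ι ι Ω)ˣ) : Matrix ι ι Ω) := congrArg Units.val h1.eq
        rw [mul_assoc, ← mul_assoc _ (D.r h), h2, mul_assoc, ← Units.val_mul, ← zpow_add, map_mul,
          frobVal_mul, neg_add, mul_assoc] }
  have hI : ∀ τ ∈ inertia F w, r' τ = D.r τ := by
    intro τ hτ
    change D.r τ * _ = _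
    rw [frobVal_eq_zero hτ]
    simp
  have huNz : ∀ k : ℤ, ((u ^ k : (Matrix ι ι Ω)ˣ) : Matrix ι ι Ω) * D.N =
      D.N * ((u ^ k : (Matrix ι ι Ω)ˣ) : Matrix ι ι Ω) := fun k =>
    (Commute.units_zpow_left (show Commute (u : Matrix ι ι Ω) D.N from huN) k)
  refine ⟨{ r := r', N := D.N, nilpotent := D.nilpotent, finite_inertia := ?_, comm := ?_ },
    rfl, s, u, ?_, congrArg Units.val hsu.eq, hs, hu, fun g => rfl⟩
  · refine D.finite_inertia.subset ?_
    rintro _ ⟨τ, hτ, rfl⟩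
    exact ⟨τ, hτ, (hI τ hτ).symm⟩
  · intro g
    change D.r g * _ * D.N = _ • (D.N * (D.r g * _))
    rw [mul_assoc, huNz, ← mul_assoc, D.comm, Matrix.smul_mul, mul_assoc]
  · exact congrArg Units.val hX

lemma WeilDeligneRep.IsFrobSemisimplification.isSemisimple {φ : WeilGroup F w}
    (hφ : frobVal φ = 1) {D D' : WeilDeligneRep w ι Ω} (h : D.IsFrobSemisimplification φ D') :
    Module.End.IsSemisimple (Matrix.toLin' (D'.r φ)) := by
  obtain ⟨-, s, u, h1, h2, h3, h4, h5⟩ := h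
  have : D'.r φ = s := by
    rw [h5, h1, hφ, zpow_neg, zpow_one, mul_assoc, Units.mul_inv, mul_one]
  rwa [this]

lemma trace_mul_unipotent {R : Matrix ι ι Ω} {u : (Matrix ι ι Ω)ˣ}
    (hu : IsNilpotent ((u : Matrix ι ι Ω) - 1)) (hc : Commute R (u : Matrix ι ι Ω)) :
    (R * u).trace = R.trace := by
  have h : (R * ((u : Matrix ι ι Ω) - 1)).trace = 0 :=
    trace_eq_zero_of_isNilpotent
      ((hc.sub_right (Commute.one_right R)).isNilpotent_mul_left hu)
  rwa [mul_sub, mul_one, Matrix.trace_sub, sub_eq_zero] at h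

lemma isNilpotent_zpow_sub_one {u : (Matrix ι ι Ω)ˣ}
    (hu : IsNilpotent ((u : Matrix ι ι Ω) - 1)) (k : ℤ) :
    IsNilpotent (((u ^ k : (Matrix ι ι Ω)ˣ) : Matrix ι ι Ω) - 1) := by
  have hnat : ∀ (v : (Matrix ι ι Ω)ˣ), IsNilpotent ((v : Matrix ι ι Ω) - 1) → ∀ k : ℕ,
      IsNilpotent (((v ^ k : (Matrix ι ι Ω)ˣ) : Matrix ι ι Ω) - 1) := by
    intro v hv k
    rw [Units.val_pow_eq_pow_val, ← mul_geom_sum]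
    exact (Commute.sum_right _ _ _ fun i _ =>
          ((Commute.refl _).pow_right i).sub_left (Commute.one_left _)).isNilpotent_mul_right hv
  obtain ⟨n, rfl | rfl⟩ := k.eq_nat_or_neg
  · rw [zpow_natCast]; exact hnat u hu n
  · rw [zpow_neg, zpow_natCast, ← inv_pow]
    refine hnat _ ?_ n
    have h1 : ((u⁻¹ : (Matrix ι ι Ω)ˣ) : Matrix ι ι Ω) - 1 =
        -(((u⁻¹ : (Matrix ι ι Ω)ˣ) : Matrix ι ι Ω) * ((u : Matrix ι ι Ω) - 1)) := by
      rw [mul_sub, Units.inv_mul, mul_one, neg_sub]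
    rw [h1]
    have hc1 : Commute ((u⁻¹ : (Matrix ι ι Ω)ˣ) : Matrix ι ι Ω) ((u : Matrix ι ι Ω) - 1) :=
      (Commute.units_val (Commute.inv_left (Commute.refl u))).sub_right (Commute.one_right _)
    exact (hc1.isNilpotent_mul_left hu).neg

lemma WeilDeligneRep.IsFrobSemisimplification.trace_eq {φ : WeilGroup F w}
    (hφ : frobVal φ = 1) {D D' : WeilDeligneRep w ι Ω} (h : D.IsFrobSemisimplification φ D')
    (g : WeilGroup F w) : (D'.r g).trace = (D.r g).trace := by
  obtain ⟨-, s, u, h1, h2, h3, h4, h5⟩ := h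
  -- comparing `r' (φ g)` with `r' φ * r' g` shows that `u` commutes with every `r g`
  have hc : Commute (unitOf D.r g) u := by
    have e1 : unitOf D.r φ * unitOf D.r g * (u⁻¹ * u ^ (-frobVal g)) =
        unitOf D.r φ * u⁻¹ * (unitOf D.r g * u ^ (-frobVal g)) := by
      refine Units.ext ?_
      have := map_mul D'.r φ g
      rw [h5, h5, h5, frobVal_mul, hφ, map_mul, neg_add, zpow_add, zpow_neg u 1, zpow_one] at this
      exact this
    rw [mul_assoc, mul_assoc, mul_left_cancel_iff, ← mul_assoc, ← mul_assoc,
      mul_right_cancel_iff] at e1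
    exact (Commute.inv_right_iff (a := unitOf D.r g) (b := u)).1 e1
  rw [h5]
  exact trace_mul_unipotent (isNilpotent_zpow_sub_one h4 _)
    (congrArg Units.val (hc.zpow_right (-frobVal g)).eq)

lemma mul_pow_of_comm {R M : Matrix ι ι Ω} {c : Ω} (h : M * R = c • (R * M)) (j : ℕ) :
    ∃ a : Ω, (R * M) ^ j = a • (R ^ j * M ^ j) := by
  induction j with
  | zero => exact ⟨1, by simp⟩
  | succ j ih =>
    obtain ⟨a, ha⟩ := ih
    refine ⟨a * c ^ j, ?_⟩
    rw [pow_succ, ha, Matrix.smul_mul, mul_assoc, ← mul_assoc (M ^ j), pow_mul_of_comm h,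
      Matrix.smul_mul,
      Matrix.mul_smul, smul_smul, mul_assoc R, ← mul_assoc, pow_succ, pow_succ]

lemma trace_mul_nilpExp [CharZero Ω] {R M : Matrix ι ι Ω} (hM : IsNilpotent M) {c : Ω}
    (h : M * R = c • (R * M)) : (R * nilpExp M).trace = R.trace := by
  have h0 : M ^ (Fintype.card ι + 1) = 0 := by rw [pow_succ, pow_card_eq_zero hM, zero_mul]
  rw [nilpExp_eq_sum hM h0, Finset.sum_range_succ', mul_add, Matrix.trace_add, Matrix.mul_sum,
    Matrix.trace_sum, Finset.sum_eq_zero, zero_add]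
  · simp
  · intro k _
    rw [Matrix.mul_smul, Matrix.trace_smul]
    obtain ⟨a, ha⟩ := mul_pow_of_comm (pow_mul_of_comm h (k + 1)) (Fintype.card ι)
    rw [trace_eq_zero_of_isNilpotent, smul_zero]
    refine ⟨Fintype.card ι, ?_⟩
    rw [ha, ← pow_mul, mul_comm, pow_mul, pow_card_eq_zero hM, zero_pow (by omega), mul_zero,
      smul_zero]

variable {p : ℕ} [Fact p.Prime] [Algebra ℤ_[p] Ω] {z : RootSystem p w} {φ : WeilGroup F w}

lemma IsWDParametrization.trace_eq [CharZero Ω] {ρ : WeilGroup F w →* Matrix ι ι Ω}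
    {D : WeilDeligneRep w ι Ω} (h : IsWDParametrization φ z ρ D) (g : WeilGroup F w) :
    (ρ g).trace = (D.r g).trace := by
  have h1 : ρ g =
      D.r g * nilpExp (algebraMap ℤ_[p] Ω (tameChar z (φ ^ (-frobVal g) * g)) • D.N) := by
    rw [h.2, mul_assoc, nilpExp_neg_mul (isNilpotent_smul D.nilpotent _), mul_one]
  rw [h1, trace_mul_nilpExp (isNilpotent_smul D.nilpotent _) (c := (normChar w Ω g)⁻¹)]
  rw [Matrix.smul_mul, D.mul_N_comm, Matrix.mul_smul, smul_comm]

/-! #### Isomorphisms of Weil-Deligne representations -/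

variable {μ : Type*} [Fintype μ] [DecidableEq μ]

lemma WeilDeligneRep.IsIso.symm {D : WeilDeligneRep w ι Ω} {E : WeilDeligneRep w κ Ω}
    (h : D.IsIso E) : E.IsIso D := by
  obtain ⟨P, Q, h1, h2, h3, h4⟩ := h
  have key : ∀ {A : Matrix ι ι Ω} {B : Matrix κ κ Ω}, P * B = A * P → Q * A = B * Q := by
    intro A B hAB
    calc Q * A = Q * A * (P * Q) := by rw [h1, Matrix.mul_one]
      _ = Q * (A * P) * Q := by simp only [Matrix.mul_assoc]
      _ = B * Q := by rw [← hAB, ← Matrix.mul_assoc Q, h2, Matrix.one_mul]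
  exact ⟨Q, P, h2, h1, fun g => key (h3 g), key h4⟩

lemma WeilDeligneRep.IsIso.trans {D : WeilDeligneRep w ι Ω} {E : WeilDeligneRep w κ Ω}
    {E' : WeilDeligneRep w μ Ω} (h : D.IsIso E) (h' : E.IsIso E') : D.IsIso E' := by
  obtain ⟨P, Q, h1, h2, h3, h4⟩ := h
  obtain ⟨P', Q', h1', h2', h3', h4'⟩ := h'
  have key : ∀ {A : Matrix ι ι Ω} {B : Matrix κ κ Ω} {C : Matrix μ μ Ω}, P * B = A * P →
      P' * C = B * P' → P * P' * C = A * (P * P') := by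
    intro A B C hAB hBC
    rw [Matrix.mul_assoc, hBC, ← Matrix.mul_assoc, hAB, Matrix.mul_assoc]
  refine ⟨P * P', Q' * Q, ?_, ?_, fun g => key (h3 g) (h3' g), key h4 h4'⟩
  · rw [Matrix.mul_assoc, ← Matrix.mul_assoc P', h1', Matrix.one_mul, h1]
  · rw [Matrix.mul_assoc, ← Matrix.mul_assoc Q, h2, Matrix.one_mul, h2']

/-- Weil-Deligne representations agreeing up to a bijection of the bases are isomorphic. -/
lemma WeilDeligneRep.isIso_of_equiv {D : WeilDeligneRep w ι Ω} {E : WeilDeligneRep w κ Ω}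
    (e : ι ≃ κ) (hr : ∀ g a b, E.r g (e a) (e b) = D.r g a b)
    (hN : ∀ a b, E.N (e a) (e b) = D.N a b) : D.IsIso E := by
  have key : ∀ {A : Matrix ι ι Ω} {B : Matrix κ κ Ω}, (∀ a b, B (e a) (e b) = A a b) →
      (1 : Matrix κ κ Ω).submatrix e id * B = A * (1 : Matrix κ κ Ω).submatrix e id := by
    intro A B h
    have hB : B = A.submatrix e.symm e.symm := by
      ext a b
      rw [Matrix.submatrix_apply, ← h, Equiv.apply_symm_apply, Equiv.apply_symm_apply]
    have hA : A = B.submatrix e e := by ext a b; exact (h a b).symm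
    rw [← Matrix.submatrix_id_id B, ← Matrix.submatrix_mul _ _ _ _ _ Function.bijective_id,
      Matrix.one_mul]
    conv_rhs => rw [hA, ← Matrix.submatrix_mul _ _ _ _ _ e.bijective, Matrix.mul_one]
  refine ⟨(1 : Matrix κ κ Ω).submatrix e id, (1 : Matrix κ κ Ω).submatrix id e, ?_, ?_,
    fun g => key (hr g), key hN⟩
  · rw [← Matrix.submatrix_mul _ _ _ _ _ Function.bijective_id, Matrix.one_mul,
      Matrix.submatrix_one _ e.injective]
  · rw [← Matrix.submatrix_mul _ _ _ _ _ e.bijective, Matrix.one_mul, Matrix.submatrix_id_id]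

lemma WeilDeligneRep.isIso_of_eq {D E : WeilDeligneRep w ι Ω} (hr : ∀ g, D.r g = E.r g)
    (hN : D.N = E.N) : D.IsIso E :=
  WeilDeligneRep.isIso_of_equiv (Equiv.refl _) (fun g a b => by rw [hr]; rfl)
    (fun a b => by rw [hN]; rfl)

lemma WeilDeligneRep.IsIso.repIso {D : WeilDeligneRep w ι Ω} {E : WeilDeligneRep w κ Ω}
    (h : D.IsIso E) : RepIso D.r E.r := by
  obtain ⟨P, Q, h1, h2, h3, -⟩ := h
  exact ⟨P, Q, h1, h2, h3⟩

/-- Transport of a Weil-Deligne representation along an isomorphism of vector spaces. -/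
noncomputable def WeilDeligneRep.conj (D : WeilDeligneRep w ι Ω) (P : Matrix κ ι Ω)
    (Q : Matrix ι κ Ω) (h1 : P * Q = 1) (h2 : Q * P = 1) : WeilDeligneRep w κ Ω where
  r :=
    { toFun := fun g => P * D.r g * Q
      map_one' := by rw [map_one, Matrix.mul_one, h1]
      map_mul' := fun g h => by
        rw [map_mul]
        calc _ = P * D.r g * (Q * P) * D.r h * Q := by
              rw [h2]; simp only [Matrix.mul_assoc, Matrix.one_mul]
          _ = _ := by simp only [Matrix.mul_assoc] }
  finite_inertia := by
    have := D.finite_inertia.image fun M => P * M * Q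
    rw [Set.image_image] at this
    exact this
  N := P * D.N * Q
  nilpotent := isNilpotent_conj h1 h2 D.nilpotent
  comm := fun g => by
    change P * D.r g * Q * (P * D.N * Q) = _ • (P * D.N * Q * (P * D.r g * Q))
    have key : ∀ A B : Matrix ι ι Ω, P * A * Q * (P * B * Q) = P * (A * B) * Q := by
      intro A B
      calc _ = P * A * (Q * P) * B * Q := by simp only [Matrix.mul_assoc]
        _ = _ := by rw [h2]; simp only [Matrix.mul_assoc, Matrix.one_mul]
    rw [key, key, D.comm, Matrix.mul_smul, Matrix.smul_mul]

lemma WeilDeligneRep.isIso_conj (D : WeilDeligneRep w ι Ω) (P : Matrix κ ι Ω) (Q : Matrix ι κ Ω)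
    (h1 : P * Q = 1) (h2 : Q * P = 1) : (D.conj P Q h1 h2).IsIso D := by
  have key : ∀ A : Matrix ι ι Ω, P * A = P * A * Q * P := fun A => by
    rw [Matrix.mul_assoc (P * A), h2, Matrix.mul_one]
  exact ⟨P, Q, h1, h2, fun g => key _, key _⟩

lemma WeilDeligneRep.IsFrobSemisimplification.conj {D D' : WeilDeligneRep w ι Ω}
    (h : D.IsFrobSemisimplification φ D') (P : Matrix κ ι Ω) (Q : Matrix ι κ Ω)
    (h1 : P * Q = 1) (h2 : Q * P = 1) :
    (D.conj P Q h1 h2).IsFrobSemisimplification φ (D'.conj P Q h1 h2) := by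
  obtain ⟨hN, s, u, e1, e2, e3, e4, e5⟩ := h
  have key : ∀ A B : Matrix ι ι Ω, P * A * Q * (P * B * Q) = P * (A * B) * Q := by
    intro A B
    calc _ = P * A * (Q * P) * B * Q := by simp only [Matrix.mul_assoc]
      _ = _ := by rw [h2]; simp only [Matrix.mul_assoc, Matrix.one_mul]
  let c : (Matrix ι ι Ω)ˣ →* (Matrix κ κ Ω)ˣ := Units.map
    { toFun := fun A => P * A * Q
      map_one' := by rw [Matrix.mul_one, h1]
      map_mul' := fun A B => (key A B).symm }
  have hc : ∀ v : (Matrix ι ι Ω)ˣ, (c v : Matrix κ κ Ω) = P * (v : Matrix ι ι Ω) * Q := fun v => rfl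
  refine ⟨congrArg (fun M => P * M * Q) hN, P * (s : Matrix ι ι Ω) * Q, c u, ?_, ?_,
    isSemisimple_conj h1 h2 e3, ?_,
    fun g => ?_⟩
  · rw [hc, key, ← e1]; rfl
  · rw [hc, key, key, e2]
  · have : (c u : Matrix κ κ Ω) - 1 = P * ((u : Matrix ι ι Ω) - 1) * Q := by
      rw [hc, Matrix.mul_sub, Matrix.sub_mul, Matrix.mul_one, h1]
    rw [this]
    exact isNilpotent_conj h1 h2 e4
  · rw [← map_zpow, hc]
    change P * D'.r g * Q = P * D.r g * Q * _
    rw [key, e5]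

lemma HasMonodromy.conj {ρ : WeilGroup F w →* Matrix ι ι Ω} {ρ' : WeilGroup F w →* Matrix κ κ Ω}
    {N : Matrix ι ι Ω} (h : HasMonodromy z ρ N) {P : Matrix κ ι Ω} {Q : Matrix ι κ Ω}
    (h1 : P * Q = 1) (h2 : Q * P = 1) (hρ : ∀ g, ρ' g = P * ρ g * Q) :
    HasMonodromy z ρ' (P * N * Q) := by
  obtain ⟨hN, K', hfin, hK⟩ := h
  refine ⟨isNilpotent_conj h1 h2 hN, K', hfin, fun τ hτ hτK => ?_⟩
  rw [hρ, hK τ hτ hτK, ← nilpExp_conj h1 h2, Matrix.mul_smul, Matrix.smul_mul]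

lemma IsWDParametrization.conj {ρ : WeilGroup F w →* Matrix ι ι Ω}
    {ρ' : WeilGroup F w →* Matrix κ κ Ω}
    {D : WeilDeligneRep w ι Ω} (h : IsWDParametrization φ z ρ D) {P : Matrix κ ι Ω}
    {Q : Matrix ι κ Ω} (h1 : P * Q = 1) (h2 : Q * P = 1) (hρ : ∀ g, ρ' g = P * ρ g * Q) :
    IsWDParametrization φ z ρ' (D.conj P Q h1 h2) := by
  refine ⟨h.1.conj h1 h2 hρ, fun g => ?_⟩
  change P * D.r g * Q = _ * nilpExp (-(_ • (P * D.N * Q)))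
  have e1 : ∀ c : Ω, -(c • (P * D.N * Q)) = P * -(c • D.N) * Q := fun c => by
    rw [Matrix.mul_neg, Matrix.neg_mul, Matrix.mul_smul, Matrix.smul_mul]
  rw [e1, nilpExp_conj h1 h2, hρ, h.2]
  have key : ∀ A B : Matrix ι ι Ω, P * (A * B) * Q = P * A * Q * (P * B * Q) := by
    intro A B
    calc _ = P * A * (Q * P) * B * Q := by rw [h2]; simp only [Matrix.mul_assoc, Matrix.one_mul]
      _ = _ := by simp only [Matrix.mul_assoc]
  exact key _ _

theorem FrobSemisimpleWDIso.of_repIso {ρ : WeilGroup F w →* Matrix ι ι Ω}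
    {ρ' : WeilGroup F w →* Matrix κ κ Ω} {E : WeilDeligneRep w μ Ω}
    (h : FrobSemisimpleWDIso φ z ρ E) (hρ : RepIso ρ' ρ) : FrobSemisimpleWDIso φ z ρ' E := by
  obtain ⟨D, D', hD, hD', hE⟩ := h
  obtain ⟨P, Q, h1, h2, h3⟩ := hρ
  refine ⟨D.conj P Q h1 h2, D'.conj P Q h1 h2, hD.conj h1 h2 fun g => ?_, hD'.conj P Q h1 h2,
    (D'.isIso_conj P Q h1 h2).trans hE⟩
  rw [h3, Matrix.mul_assoc, h1, Matrix.mul_one]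

theorem FrobSemisimpleWDIso.trans {ν : Type*} [Fintype ν] [DecidableEq ν]
    {ρ : WeilGroup F w →* Matrix ι ι Ω} {E : WeilDeligneRep w μ Ω} {E' : WeilDeligneRep w ν Ω}
    (h : FrobSemisimpleWDIso φ z ρ E) (hE : E.IsIso E') : FrobSemisimpleWDIso φ z ρ E' := by
  obtain ⟨D, D', hD, hD', h'⟩ := h
  exact ⟨D, D', hD, hD', h'.trans hE⟩

end Frobenius

/-! ### Direct sums and base change of Weil-Deligne representations -/

section Sums

variable {F : Type*} [Field F] [NumberField F] {w : HeightOneSpectrum (𝓞 F)}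
  {Ω Ω' : Type*} [Field Ω] [Field Ω'] {p : ℕ} [Fact p.Prime] [Algebra ℤ_[p] Ω] [Algebra ℤ_[p] Ω']
  {z : RootSystem p w} {φ : WeilGroup F w}
  {I : Type*} [Fintype I] [DecidableEq I] {ι κ : I → Type*}
  [∀ i, Fintype (ι i)] [∀ i, DecidableEq (ι i)] [∀ i, Fintype (κ i)] [∀ i, DecidableEq (κ i)]

lemma nilpExp_blockDiagonal' [CharZero Ω] {M : ∀ i, Matrix (ι i) (ι i) Ω}
    (h : ∀ i, IsNilpotent (M i)) :
    nilpExp (Matrix.blockDiagonal' M) = Matrix.blockDiagonal' fun i => nilpExp (M i) := by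
  choose k hk using h
  set n := ∑ i, k i
  have hn : ∀ i, M i ^ n = 0 := fun i =>
    pow_eq_zero_of_le (Finset.single_le_sum (fun _ _ => Nat.zero_le _) (Finset.mem_univ i)) (hk i)
  have hn' : Matrix.blockDiagonal' M ^ n = 0 := by
    rw [← Matrix.blockDiagonal'_pow, show M ^ n = 0 from funext hn, Matrix.blockDiagonal'_zero]
  rw [nilpExp_eq_sum ⟨n, hn'⟩ hn']
  have : (fun i => nilpExp (M i)) = ∑ k ∈ Finset.range n, ((k.factorial : Ω)⁻¹) • M ^ k := by
    funext i
    rw [nilpExp_eq_sum ⟨n, hn i⟩ (hn i)]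
    simp
  rw [this]
  refine Eq.trans ?_ (map_sum (Matrix.blockDiagonal'AddMonoidHom ι ι Ω) _ _).symm
  refine Finset.sum_congr rfl fun k _ => ?_
  rw [Matrix.blockDiagonal'AddMonoidHom_apply, Matrix.blockDiagonal'_smul,
    Matrix.blockDiagonal'_pow]

lemma sumRep_apply {G A : Type*} [Group G] [CommRing A] (ρ : ∀ i, G →* Matrix (ι i) (ι i) A)
    (g : G) : sumRep ρ g = Matrix.blockDiagonal' fun i => ρ i g := rfl

lemma HasMonodromy.sum [CharZero Ω] {ρ : ∀ i, WeilGroup F w →* Matrix (ι i) (ι i) Ω}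
    {N : ∀ i, Matrix (ι i) (ι i) Ω} (h : ∀ i, HasMonodromy z (ρ i) (N i)) :
    HasMonodromy z (sumRep ρ) (Matrix.blockDiagonal' N) := by
  choose hN K' hfin hK using h
  refine ⟨?_, ⨆ i, K' i, IntermediateField.finiteDimensional_iSup_of_finite, fun τ hτ hτK => ?_⟩
  · choose k hk using hN
    refine ⟨∑ i, k i, ?_⟩
    have : N ^ (∑ i, k i) = 0 := funext fun i =>
      pow_eq_zero_of_le (Finset.single_le_sum (fun _ _ => Nat.zero_le _) (Finset.mem_univ i)) (hk i)
    rw [← Matrix.blockDiagonal'_pow, this, Matrix.blockDiagonal'_zero]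
  · rw [← Matrix.blockDiagonal'_smul, sumRep_apply,
      nilpExp_blockDiagonal' (M := algebraMap ℤ_[p] Ω (tameChar z τ) • N)
        fun i => isNilpotent_smul (hN i) _]
    congr 1
    funext i
    exact hK i τ hτ (IntermediateField.fixingSubgroup_le (le_iSup K' i) hτK)

omit [∀ i, DecidableEq (ι i)] [∀ i, DecidableEq (κ i)] in
lemma blockDiagonal'_intertwine {R : Type*} [CommRing R] {P : ∀ i, Matrix (ι i) (κ i) R}
    {A : ∀ i, Matrix (ι i) (ι i) R}
    {B : ∀ i, Matrix (κ i) (κ i) R} (h : ∀ i, P i * B i = A i * P i) :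
    Matrix.blockDiagonal' P * Matrix.blockDiagonal' B =
      Matrix.blockDiagonal' A * Matrix.blockDiagonal' P := by
  rw [← Matrix.blockDiagonal'_mul, ← Matrix.blockDiagonal'_mul]
  congr 1
  funext i
  exact h i

omit [∀ i, Fintype (ι i)] [∀ i, DecidableEq (κ i)] in
lemma blockDiagonal'_inverse {R : Type*} [CommRing R] {P : ∀ i, Matrix (ι i) (κ i) R}
    {Q : ∀ i, Matrix (κ i) (ι i) R} (h : ∀ i, P i * Q i = 1) :
    Matrix.blockDiagonal' P * Matrix.blockDiagonal' Q = 1 := by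
  rw [← Matrix.blockDiagonal'_mul, ← Matrix.blockDiagonal'_one]
  congr 1
  funext i
  exact h i

lemma WeilDeligneRep.IsIso.sum {D : ∀ i, WeilDeligneRep w (ι i) Ω}
    {E : ∀ i, WeilDeligneRep w (κ i) Ω} (h : ∀ i, (D i).IsIso (E i)) :
    (sumWD D).IsIso (sumWD E) := by
  choose P Q h1 h2 h3 h4 using h
  exact ⟨Matrix.blockDiagonal' P, Matrix.blockDiagonal' Q, blockDiagonal'_inverse h1,
    blockDiagonal'_inverse h2, fun g => blockDiagonal'_intertwine fun i => h3 i g,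
    blockDiagonal'_intertwine h4⟩

/-- Weil-Deligne parametrization and Frobenius semisimplification commute with direct sums. -/
theorem FrobSemisimpleWDIso.sum [CharZero Ω] {ρ : ∀ i, WeilGroup F w →* Matrix (ι i) (ι i) Ω}
    {E : ∀ i, WeilDeligneRep w (κ i) Ω} (h : ∀ i, FrobSemisimpleWDIso φ z (ρ i) (E i)) :
    FrobSemisimpleWDIso φ z (sumRep ρ) (sumWD E) := by
  choose D D' hD hD' hE using h
  refine ⟨sumWD D, sumWD D', ⟨HasMonodromy.sum fun i => (hD i).1, fun g => ?_⟩,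
    ⟨?_, ?_⟩, WeilDeligneRep.IsIso.sum hE⟩
  · change Matrix.blockDiagonal' (fun i => (D i).r g) =
      Matrix.blockDiagonal' (fun i => ρ i g) *
        nilpExp (-(_ • Matrix.blockDiagonal' fun i => (D i).N))
    rw [← Matrix.blockDiagonal'_smul, ← Matrix.blockDiagonal'_neg, nilpExp_blockDiagonal',
      ← Matrix.blockDiagonal'_mul]
    · congr 1
      funext i
      exact (hD i).2 g
    · exact fun i => (isNilpotent_smul (D i).nilpotent _).neg
  · exact congrArg Matrix.blockDiagonal' (funext fun i => (hD' i).1)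
  · choose s u e1 e2 e3 e4 e5 using fun i => (hD' i).2
    let c : (∀ i, (Matrix (ι i) (ι i) Ω)ˣ) →* (Matrix (Σ i, ι i) (Σ i, ι i) Ω)ˣ :=
      (Units.map (Matrix.blockDiagonal'RingHom ι Ω).toMonoidHom).comp
        MulEquiv.piUnits.symm.toMonoidHom
    have hc : ∀ v : ∀ i, (Matrix (ι i) (ι i) Ω)ˣ,
        (c v : Matrix (Σ i, ι i) (Σ i, ι i) Ω) =
          Matrix.blockDiagonal' fun i => (v i : Matrix (ι i) (ι i) Ω) := fun v => rfl
    refine ⟨Matrix.blockDiagonal' s, c u, ?_, ?_, isSemisimple_blockDiagonal' s e3, ?_, fun g => ?_⟩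
    · rw [hc, ← Matrix.blockDiagonal'_mul]
      exact congrArg Matrix.blockDiagonal' (funext fun i => e1 i)
    · rw [hc, ← Matrix.blockDiagonal'_mul, ← Matrix.blockDiagonal'_mul]
      exact congrArg Matrix.blockDiagonal' (funext fun i => e2 i)
    · choose k hk using e4
      refine ⟨∑ i, k i, ?_⟩
      rw [hc, ← Matrix.blockDiagonal'_one, ← Matrix.blockDiagonal'_sub,
        ← Matrix.blockDiagonal'_pow]
      have : ((fun i => (u i : Matrix (ι i) (ι i) Ω)) - 1) ^ (∑ i, k i) = 0 := funext fun i =>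
        pow_eq_zero_of_le
          (Finset.single_le_sum (fun _ _ => Nat.zero_le _) (Finset.mem_univ i)) (hk i)
      rw [this, Matrix.blockDiagonal'_zero]
    · rw [← map_zpow, hc]
      change Matrix.blockDiagonal' (fun i => (D' i).r g) =
        Matrix.blockDiagonal' (fun i => (D i).r g) * _
      rw [← Matrix.blockDiagonal'_mul]
      exact congrArg Matrix.blockDiagonal' (funext fun i => e5 i g)

/-- Reindexing a direct sum. -/
lemma sumWD_reindex {J : Type*} [Fintype J] [DecidableEq J] (e : J ≃ I)
    (E : ∀ i, WeilDeligneRep w (ι i) Ω) : (sumWD fun j => E (e j)).IsIso (sumWD E) := by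
  have key : ∀ (M : ∀ i, Matrix (ι i) (ι i) Ω) (a b : Σ j, ι (e j)),
      Matrix.blockDiagonal' M (Equiv.sigmaCongrLeft e a) (Equiv.sigmaCongrLeft e b) =
        Matrix.blockDiagonal' (fun j => M (e j)) a b := by
    rintro M ⟨j, x⟩ ⟨j', y⟩
    by_cases h : j = j'
    · subst h
      simp [Equiv.sigmaCongrLeft]
    · rw [Matrix.blockDiagonal'_apply_ne _ _ _ h]
      exact Matrix.blockDiagonal'_apply_ne _ _ _ (fun h' => h (e.injective h'))
  exact WeilDeligneRep.isIso_of_equiv (Equiv.sigmaCongrLeft e)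
    (fun g a b => key (fun i => (E i).r g) a b) (fun a b => key (fun i => (E i).N) a b)

/-- A direct sum of direct sums is a direct sum. -/
lemma sumWD_sigma {L : I → Type*} [∀ i, Fintype (L i)] [∀ i, DecidableEq (L i)]
    {ν : ∀ i, L i → Type*} [∀ i l, Fintype (ν i l)] [∀ i l, DecidableEq (ν i l)]
    (E : ∀ i l, WeilDeligneRep w (ν i l) Ω) :
    (sumWD fun i => sumWD (E i)).IsIso (sumWD fun x : Σ i, L i => E x.1 x.2) := by
  have key : ∀ (M : ∀ i l, Matrix (ν i l) (ν i l) Ω) (a b : Σ i, Σ l, ν i l),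
      Matrix.blockDiagonal' (fun x : Σ i, L i => M x.1 x.2)
        ((Equiv.sigmaAssoc ν).symm a) ((Equiv.sigmaAssoc ν).symm b) =
        Matrix.blockDiagonal' (fun i => Matrix.blockDiagonal' (M i)) a b := by
    rintro M ⟨i, l, x⟩ ⟨i', l', y⟩
    by_cases h : i = i'
    · subst h
      rw [Matrix.blockDiagonal'_apply_eq]
      by_cases hl : l = l'
      · subst hl
        rw [Matrix.blockDiagonal'_apply_eq]
        exact Matrix.blockDiagonal'_apply_eq (fun x : Σ i, L i => M x.1 x.2) ⟨i, l⟩ x y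
      · rw [Matrix.blockDiagonal'_apply_ne _ _ _ hl]
        refine Matrix.blockDiagonal'_apply_ne (fun x : Σ i, L i => M x.1 x.2) (k := ⟨i, l⟩)
          (k' := ⟨i, l'⟩) _ _ ?_
        intro h
        exact hl (by simpa using h)
    · rw [Matrix.blockDiagonal'_apply_ne _ _ _ h]
      refine Matrix.blockDiagonal'_apply_ne (fun x : Σ i, L i => M x.1 x.2) (k := ⟨i, l⟩)
        (k' := ⟨i', l'⟩) _ _ ?_
      intro h'
      exact h (congrArg Sigma.fst h')
  exact WeilDeligneRep.isIso_of_equiv (Equiv.sigmaAssoc ν).symm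
    (fun g a b => key (fun i l => (E i l).r g) a b) (fun a b => key (fun i l => (E i l).N) a b)

end Sums

section BaseChange

variable {F : Type*} [Field F] [NumberField F] {w : HeightOneSpectrum (𝓞 F)}
  {Ω Ω' : Type*} [Field Ω] [Field Ω'] {p : ℕ} [Fact p.Prime] [Algebra ℤ_[p] Ω] [Algebra ℤ_[p] Ω']
  {z : RootSystem p w} {φ : WeilGroup F w}
  {ι κ : Type*} [Fintype ι] [DecidableEq ι] [Fintype κ] [DecidableEq κ]

/-- `Sp_t` of isomorphic representations. -/
lemma sp_isIso (t : ℕ) {r : InertiaFiniteRep w ι Ω} {r' : InertiaFiniteRep w κ Ω}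
    (h : RepIso r.r r'.r) : (sp t r).IsIso (sp t r') := by
  obtain ⟨P, Q, h1, h2, h3⟩ := h
  refine ⟨Matrix.kroneckerMap (· * ·) (1 : Matrix (Fin t) (Fin t) Ω) P,
    Matrix.kroneckerMap (· * ·) (1 : Matrix (Fin t) (Fin t) Ω) Q, ?_, ?_, fun g => ?_, ?_⟩
  · rw [← Matrix.mul_kronecker_mul, h1]; simp
  · rw [← Matrix.mul_kronecker_mul, h2]; simp
  · change Matrix.kroneckerMap (· * ·) 1 P * Matrix.kroneckerMap (· * ·) _ (r'.r g) =
      Matrix.kroneckerMap (· * ·) _ (r.r g) * Matrix.kroneckerMap (· * ·) 1 P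
    rw [← Matrix.mul_kronecker_mul, ← Matrix.mul_kronecker_mul, h3, Matrix.one_mul, Matrix.mul_one]
  · change Matrix.kroneckerMap (· * ·) 1 P * Matrix.kroneckerMap (· * ·) _ 1 =
      Matrix.kroneckerMap (· * ·) _ 1 * Matrix.kroneckerMap (· * ·) 1 P
    rw [← Matrix.mul_kronecker_mul, ← Matrix.mul_kronecker_mul, Matrix.one_mul, Matrix.mul_one,
      Matrix.one_mul, Matrix.mul_one]

lemma nilpExp_map (f : Ω →+* Ω') (M : Matrix ι ι Ω) :
    f.mapMatrix (nilpExp M) = nilpExp (f.mapMatrix M) := by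
  rw [nilpExp, nilpExp, map_sum]
  refine Finset.sum_congr rfl fun k _ => ?_
  rw [← map_pow]
  ext i j
  simp

lemma mapMatrix_smul (f : Ω →+* Ω') (c : Ω) (M : Matrix ι ι Ω) :
    f.mapMatrix (c • M) = f c • f.mapMatrix M := by
  ext i j
  simp

/-- Extension of scalars of a Weil-Deligne representation. -/
noncomputable def WeilDeligneRep.baseChange [CharZero Ω] [CharZero Ω'] (f : Ω →+* Ω')
    (D : WeilDeligneRep w ι Ω) : WeilDeligneRep w ι Ω' where
  toInertiaFiniteRep := D.toInertiaFiniteRep.map f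
  N := f.mapMatrix D.N
  nilpotent := D.nilpotent.map f.mapMatrix
  comm := fun g => by
    change f.mapMatrix (D.r g) * _ = _ • (_ * f.mapMatrix (D.r g))
    rw [← map_mul, D.comm, ← map_mul, ← map_normChar f, mapMatrix_smul]

/-- Weil-Deligne parametrization and Frobenius semisimplification commute with extension of
scalars. -/
theorem FrobSemisimpleWDIso.baseChange [CharZero Ω] [CharZero Ω'] (f : Ω →+* Ω')
    (hf : f.comp (algebraMap ℤ_[p] Ω) = algebraMap ℤ_[p] Ω')
    {ρ : WeilGroup F w →* Matrix ι ι Ω} {E : WeilDeligneRep w κ Ω}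
    (h : FrobSemisimpleWDIso φ z ρ E) :
    FrobSemisimpleWDIso φ z (mapRep f ρ) (E.baseChange f) := by
  have hf' : ∀ a, f (algebraMap ℤ_[p] Ω a) = algebraMap ℤ_[p] Ω' a :=
    fun a => RingHom.congr_fun hf a
  obtain ⟨D, D', ⟨⟨hN, K', hfin, hK⟩, hD⟩, ⟨e0, s, u, e1, e2, e3, e4, e5⟩,
    P, Q, h1, h2, h3, h4⟩ := h
  let c : (Matrix ι ι Ω)ˣ →* (Matrix ι ι Ω')ˣ := Units.map f.mapMatrix.toMonoidHom
  have hc : ∀ v : (Matrix ι ι Ω)ˣ, (c v : Matrix ι ι Ω') = f.mapMatrix (v : Matrix ι ι Ω) :=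
    fun v => rfl
  refine ⟨D.baseChange f, D'.baseChange f, ⟨⟨hN.map f.mapMatrix, K', hfin, fun τ hτ hτK => ?_⟩,
    fun g => ?_⟩, ⟨congrArg f.mapMatrix e0, f.mapMatrix s, c u, ?_, ?_, isSemisimple_map f e3, ?_,
      fun g => ?_⟩, P.map f, Q.map f, ?_, ?_, fun g => ?_, ?_⟩
  · change f.mapMatrix (ρ τ) = nilpExp (_ • f.mapMatrix D.N)
    rw [hK τ hτ hτK, nilpExp_map, mapMatrix_smul, hf']
  · change f.mapMatrix (D.r g) = f.mapMatrix (ρ g) * nilpExp (-(_ • f.mapMatrix D.N))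
    rw [hD, map_mul, nilpExp_map, map_neg, mapMatrix_smul, hf']
  · rw [hc, ← map_mul, ← e1]; rfl
  · rw [hc, ← map_mul, e2, map_mul]
  · have := e4.map f.mapMatrix
    rwa [map_sub, map_one] at this
  · rw [← map_zpow, hc]
    change f.mapMatrix (D'.r g) = f.mapMatrix (D.r g) * _
    rw [← map_mul, e5]
  · rw [← Matrix.map_mul, h1, Matrix.map_one _ (map_zero f) (map_one f)]
  · rw [← Matrix.map_mul, h2, Matrix.map_one _ (map_zero f) (map_one f)]
  · change P.map f * (E.r g).map f = (D'.r g).map f * P.map f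
    rw [← Matrix.map_mul, h3, Matrix.map_mul]
  · change P.map f * E.N.map f = D'.N.map f * P.map f
    rw [← Matrix.map_mul, h4, Matrix.map_mul]

lemma baseChange_sumWD_sp [CharZero Ω] [CharZero Ω'] (f : Ω →+* Ω') {I : Type*} [Fintype I]
    [DecidableEq I] {ι : I → Type*} [∀ i, Fintype (ι i)] [∀ i, DecidableEq (ι i)] (t : I → ℕ)
    (r : ∀ i, InertiaFiniteRep w (ι i) Ω) :
    ((sumWD fun i => sp (t i) (r i)).baseChange f).IsIso
      (sumWD fun i => sp (t i) ((r i).map f)) := by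
  refine WeilDeligneRep.isIso_of_eq (fun g => ?_) ?_
  · change (Matrix.blockDiagonal' fun i => Matrix.kroneckerMap (· * ·)
        (Matrix.diagonal fun j : Fin (t i) => normChar w Ω g ^ (j : ℕ)) ((r i).r g)).map f =
      Matrix.blockDiagonal' fun i => Matrix.kroneckerMap (· * ·)
        (Matrix.diagonal fun j : Fin (t i) => normChar w Ω' g ^ (j : ℕ)) (((r i).r g).map f)
    rw [Matrix.blockDiagonal'_map _ _ (map_zero f)]
    congr 1
    funext i
    ext ⟨j, x⟩ ⟨j', y⟩
    by_cases h : j = j'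
    · subst h; simp [map_normChar f]
    · simp [h]
  · change (Matrix.blockDiagonal' fun i => Matrix.kroneckerMap (· * ·)
        (shiftMatrix (t i) Ω) (1 : Matrix (ι i) (ι i) Ω)).map f =
      Matrix.blockDiagonal' fun i => Matrix.kroneckerMap (· * ·)
        (shiftMatrix (t i) Ω') (1 : Matrix (ι i) (ι i) Ω')
    rw [Matrix.blockDiagonal'_map _ _ (map_zero f)]
    congr 1
    funext i
    ext ⟨j, x⟩ ⟨j', y⟩
    by_cases h : x = y
    · subst h; simp [shiftMatrix, apply_ite f]
    · simp [h]

end BaseChange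

/-! ### Strings of a nilpotent operator -/

section Strings

variable {G Ω V : Type*} [Group G] [Field Ω] [AddCommGroup V] [Module Ω V]
  [FiniteDimensional Ω V]

/-- Stability of a subspace under a group action. -/
def IsStable (ρ : G →* Module.End Ω V) (U : Submodule Ω V) : Prop :=
  ∀ g, ∀ v ∈ U, ρ g v ∈ U

omit [FiniteDimensional Ω V] in
lemma IsStable.inf {ρ : G →* Module.End Ω V} {U U' : Submodule Ω V} (h : IsStable ρ U)
    (h' : IsStable ρ U') : IsStable ρ (U ⊓ U') :=
  fun g v hv => ⟨h g v hv.1, h' g v hv.2⟩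

omit [FiniteDimensional Ω V] in
lemma exists_minimal_stable (ρ : G →* Module.End Ω V) {U : Submodule Ω V}
    [FiniteDimensional Ω U] (hU : IsStable ρ U)
    (h0 : U ≠ ⊥) : ∃ C ≤ U, IsStable ρ C ∧ C ≠ ⊥ ∧
      ∀ C' ≤ C, IsStable ρ C' → C' = ⊥ ∨ C' = C := by
  obtain ⟨C, ⟨h1, h2, h3⟩, hmin⟩ := (measure fun C : Submodule Ω V => Module.finrank Ω C).wf.has_min
    {C : Submodule Ω V | C ≤ U ∧ IsStable ρ C ∧ C ≠ ⊥} ⟨U, le_rfl, hU, h0⟩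
  refine ⟨C, h1, h2, h3, fun C' hle hst => ?_⟩
  by_contra! hcon
  refine hmin C' ⟨hle.trans h1, hst, hcon.1⟩ ?_
  have : FiniteDimensional Ω C := Submodule.finiteDimensional_of_le h1
  exact Submodule.finrank_lt_finrank_of_lt (lt_of_le_of_ne hle hcon.2)

omit [FiniteDimensional Ω V] in
lemma pow_semicomm {ρ : G →* Module.End Ω V} {N : Module.End Ω V} {χ : G → Ω}
    (hN : ∀ g, ρ g * N = χ g • (N * ρ g)) (l : ℕ) (g : G) (v : V) :
    ρ g ((N ^ l) v) = χ g ^ l • (N ^ l) (ρ g v) := by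
  induction l generalizing v with
  | zero => simp
  | succ l ih =>
    have h1 : ρ g (N v) = χ g • N (ρ g v) := LinearMap.congr_fun (hN g) v
    rw [pow_succ, Module.End.mul_apply, ih, h1, map_smul, smul_smul, Module.End.mul_apply, pow_succ]

/-- A decomposition of a subspace `U` into strings: `U` has a basis `N ^ l b_(i,y)` with `l < t_i`,
where `N ^ t_i b_(i,y) = 0` and the `b_(i,y)` with `i` fixed form a basis of an irreducible stable
subspace. -/
structure StringBasis (ρ : G →* Module.End Ω V) (N : Module.End Ω V) (U : Submodule Ω V)
    {I : Type} (t d : I → ℕ) (b : ∀ i, Fin (d i) → V) : Prop where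
  t_pos : ∀ i, 0 < t i
  d_pos : ∀ i, 0 < d i
  stable : ∀ i, IsStable ρ (Submodule.span Ω (Set.range (b i)))
  irred : ∀ i, ∀ C ≤ Submodule.span Ω (Set.range (b i)), IsStable ρ C →
    C = ⊥ ∨ C = Submodule.span Ω (Set.range (b i))
  pow_eq_zero : ∀ i y, (N ^ t i) (b i y) = 0
  linearIndependent : LinearIndependent Ω
    fun x : Σ i, Fin (t i) × Fin (d i) => (N ^ (x.2.1 : ℕ)) (b x.1 x.2.2)
  span_eq : Submodule.span Ω (Set.range
    fun x : Σ i, Fin (t i) × Fin (d i) => (N ^ (x.2.1 : ℕ)) (b x.1 x.2.2)) = U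

/-- The existence of a string decomposition. A string of maximal length `t` generated by an
irreducible `C` splits off: if `X` is a stable complement of `N ^ (t - 1) C`, the vectors all of
whose images under powers of `N` lie in `X` form a complement. -/
theorem exists_stringBasis (ρ : G →* Module.End Ω V) (N : Module.End Ω V) (χ : G → Ω)
    (hN : ∀ g, ρ g * N = χ g • (N * ρ g)) (hχ : ∀ g, χ g ≠ 0) (hnil : IsNilpotent N)
    (hcp : ∀ U : Submodule Ω V, IsStable ρ U → ∃ U', IsStable ρ U' ∧ IsCompl U U')
    (n : ℕ) (U : Submodule Ω V) (hn : Module.finrank Ω U = n) (hU : IsStable ρ U)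
    (hUN : ∀ v ∈ U, N v ∈ U) :
    ∃ (I : Type) (_ : Fintype I) (t d : I → ℕ) (b : ∀ i, Fin (d i) → V),
      StringBasis ρ N U t d b := by
  induction n using Nat.strong_induction_on generalizing U with
  | _ n ih =>
  by_cases hU0 : U = ⊥
  · refine ⟨Empty, inferInstance, Empty.elim, Empty.elim, fun i => i.elim, fun i => i.elim,
      fun i => i.elim, fun i => i.elim, fun i => i.elim, fun i => i.elim,
      linearIndependent_empty_type, ?_⟩
    rw [hU0, Set.range_eq_empty, Submodule.span_empty]
  have hUNk : ∀ k, ∀ v ∈ U, (N ^ k) v ∈ U := fun k => by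
    induction k with
    | zero => intro v hv; simpa using hv
    | succ k ih => intro v hv; rw [pow_succ', Module.End.mul_apply]; exact hUN _ (ih v hv)
  -- the exact order of nilpotency of `N` on `U`
  have hex : ∃ t, ∀ v ∈ U, (N ^ t) v = 0 := by
    obtain ⟨k, hk⟩ := hnil
    exact ⟨k, fun v _ => by rw [hk]; rfl⟩
  classical
  obtain ⟨s, hs⟩ : ∃ s, Nat.find hex = s + 1 := by
    refine ⟨Nat.find hex - 1, (Nat.succ_pred_eq_of_pos ?_).symm⟩
    rw [Nat.find_pos]
    intro h
    exact hU0 ((Submodule.eq_bot_iff _).2 fun v hv => by simpa using h v hv)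
  have hs1 : ∀ v ∈ U, (N ^ (s + 1)) v = 0 := by have := Nat.find_spec hex; rwa [hs] at this
  have hs0 : ¬ ∀ v ∈ U, (N ^ s) v = 0 := Nat.find_min hex (by omega)
  have hge : ∀ k, s < k → ∀ v ∈ U, (N ^ k) v = 0 := fun k hk v hv => by
    obtain ⟨j, rfl⟩ := Nat.exists_eq_add_of_le hk
    rw [add_comm, pow_add, Module.End.mul_apply, hs1 v hv, map_zero]
  have hker : IsStable ρ (LinearMap.ker (N ^ s)) := by
    intro g v hv
    rw [LinearMap.mem_ker] at hv ⊢
    have := pow_semicomm hN s g v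
    rw [hv, map_zero] at this
    exact (smul_eq_zero.1 this.symm).resolve_left (pow_ne_zero _ (hχ g))
  -- `C` is an irreducible subspace of `U` on which `N ^ s` is injective.
  obtain ⟨Y, hY, hYc⟩ := hcp _ (hker.inf hU)
  have hYU : Y ⊓ U ≠ ⊥ := by
    intro h
    apply hs0
    intro v hv
    obtain ⟨a, ha, y, hy, rfl⟩ := Submodule.mem_sup.1
      (hYc.sup_eq_top ▸ Submodule.mem_top : v ∈ (LinearMap.ker (N ^ s) ⊓ U) ⊔ Y)
    have h1 : y ∈ Y ⊓ U := ⟨hy, (U.add_mem_iff_right ha.2).1 hv⟩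
    rw [h, Submodule.mem_bot] at h1
    rw [h1, add_zero]
    exact ha.1
  obtain ⟨C, hCY, hC, hC0, hCmin⟩ := exists_minimal_stable ρ (hY.inf hU) hYU
  have hCU : C ≤ U := hCY.trans inf_le_right
  have hCinj : ∀ c ∈ C, (N ^ s) c = 0 → c = 0 := by
    intro c hc h
    have := hYc.disjoint
    rw [Submodule.disjoint_def] at this
    exact this c ⟨h, hCU hc⟩ (hCY hc).1
  have hDst : IsStable ρ (C.map (N ^ s)) := by
    rintro g _ ⟨c, hc, rfl⟩
    rw [pow_semicomm hN]
    exact Submodule.smul_mem _ _ ⟨_, hC g c hc, rfl⟩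
  obtain ⟨X, hX, hXc⟩ := hcp _ hDst
  let X' : Submodule Ω V := U ⊓ ⨅ j : ℕ, X.comap (N ^ j)
  have hX' : ∀ v, v ∈ X' ↔ v ∈ U ∧ ∀ j : ℕ, (N ^ j) v ∈ X := fun v => by
    simp [X', Submodule.mem_iInf]
  have hX's : IsStable ρ X' := by
    intro g v hv
    rw [hX'] at hv ⊢
    refine ⟨hU g v hv.1, fun j => ?_⟩
    have h1 := hX g _ (hv.2 j)
    rw [pow_semicomm hN] at h1
    exact (Submodule.smul_mem_iff _ (pow_ne_zero _ (hχ g))).1 h1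
  have hX'N : ∀ v ∈ X', N v ∈ X' := by
    intro v hv
    rw [hX'] at hv ⊢
    refine ⟨hUN v hv.1, fun j => ?_⟩
    rw [← Module.End.mul_apply, ← pow_succ]
    exact hv.2 _
  -- independence of the string and `X'`
  have hind : ∀ (c : ℕ → V) (x : V), (∀ l, c l ∈ C) → x ∈ X' →
      ∑ l ∈ Finset.range (s + 1), (N ^ l) (c l) + x = 0 → ∀ l ≤ s, c l = 0 := by
    intro c x hc hx hsum l
    induction l using Nat.strong_induction_on with
    | _ l ihl =>
    intro hl
    have h1 := congrArg (N ^ (s - l)) hsum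
    rw [map_add, map_sum, map_zero, Finset.sum_eq_single l] at h1
    · rw [← Module.End.mul_apply, ← pow_add, Nat.sub_add_cancel hl] at h1
      have h2 : (N ^ s) (c l) ∈ X := by
        rw [eq_neg_of_add_eq_zero_left h1]
        exact X.neg_mem (((hX' x).1 hx).2 _)
      have h3 := hXc.disjoint
      rw [Submodule.disjoint_def] at h3
      exact hCinj _ (hc l) (h3 _ ⟨c l, hc l, rfl⟩ h2)
    · intro k hk hkl
      rcases lt_or_gt_of_ne hkl with h | h
      · rw [ihl k h (by omega), map_zero, map_zero]
      · rw [← Module.End.mul_apply, ← pow_add]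
        exact hge _ (by omega) _ (hCU (hc k))
    · intro h; simp at h; omega
  -- the string and `X'` span `U`: the components `c l` are found one by one, `N ^ (s - k) v`
  -- determining the component `c k` modulo `X`
  have hspan : ∀ v ∈ U, ∀ k ≤ s + 1, ∃ c : ℕ → V, (∀ l, c l ∈ C) ∧
      ∀ j, s + 1 ≤ j + k → (N ^ j) (v - ∑ l ∈ Finset.range k, (N ^ l) (c l)) ∈ X := by
    intro v hv k
    induction k with
    | zero =>
      intro _
      refine ⟨0, fun l => C.zero_mem, fun j hj => ?_⟩
      rw [Finset.range_zero, Finset.sum_empty, sub_zero, hge j (by omega) v hv]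
      exact X.zero_mem
    | succ k ihk =>
      intro hk
      obtain ⟨c, hc, h⟩ := ihk (by omega)
      set v' := v - ∑ l ∈ Finset.range k, (N ^ l) (c l)
      obtain ⟨_, ⟨a, ha, rfl⟩, x, hx, hax⟩ := Submodule.mem_sup.1
        (hXc.sup_eq_top ▸ Submodule.mem_top : (N ^ (s - k)) v' ∈ C.map (N ^ s) ⊔ X)
      refine ⟨Function.update c k a, fun l => ?_, fun j hj => ?_⟩
      · by_cases hl : l = k
        · subst hl; simpa using ha
        · simpa [hl] using hc l
      have h1 : v - ∑ l ∈ Finset.range (k + 1), (N ^ l) (Function.update c k a l) =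
          v' - (N ^ k) a := by
        rw [Finset.sum_range_succ, Function.update_self, ← sub_sub]
        congr 2
        exact Finset.sum_congr rfl fun l hl => by
          rw [Function.update_of_ne (Finset.mem_range.1 hl).ne]
      rw [h1, map_sub, ← Module.End.mul_apply, ← pow_add]
      by_cases hj' : s + 1 ≤ j + k
      · rw [hge _ (by omega) a (hCU ha), sub_zero]
        exact h j hj'
      · obtain rfl : j = s - k := by omega
        rw [Nat.sub_add_cancel (by omega), ← hax, add_sub_cancel_left]
        exact hx
  have hdecomp : ∀ v ∈ U, ∃ c : ℕ → V, (∀ l, c l ∈ C) ∧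
      v - ∑ l ∈ Finset.range (s + 1), (N ^ l) (c l) ∈ X' := by
    intro v hv
    obtain ⟨c, hc, h⟩ := hspan v hv (s + 1) le_rfl
    refine ⟨c, hc, (hX' _).2 ⟨?_, fun j => h j (by omega)⟩⟩
    exact U.sub_mem hv (U.sum_mem fun l _ => hUNk l _ (hCU (hc l)))
  have hlt : Module.finrank Ω X' < n := by
    rw [← hn]
    refine Submodule.finrank_lt_finrank_of_lt (lt_of_le_of_ne inf_le_left fun h => ?_)
    obtain ⟨c, hc, hc0⟩ := C.ne_bot_iff.1 hC0
    have h1 : c ∈ X' := h ▸ hCU hc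
    refine hc0 ?_
    have := hind (fun l => if l = 0 then -c else 0) c
      (fun l => by split_ifs; exacts [C.neg_mem hc, C.zero_mem]) h1 (by
        rw [Finset.sum_eq_single 0] <;> simp +contextual) 0 (by omega)
    simpa using this
  -- Prepend the string generated by `C` to a decomposition of `X'`.
  obtain ⟨I, _, t, d, b, hb⟩ := ih _ hlt X' rfl hX's hX'N
  let bC := Module.finBasis Ω C
  let t' : Option I → ℕ := fun o => o.elim (s + 1) t
  let d' : Option I → ℕ := fun o => o.elim (Module.finrank Ω C) d
  let b' : ∀ o, Fin (d' o) → V := fun o => match o with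
    | none => fun y => (bC y : V)
    | some i => b i
  have hspC : Submodule.span Ω (Set.range (b' none)) = C := by
    have : Set.range (b' none) = C.subtype '' Set.range bC := by rw [← Set.range_comp]; rfl
    rw [this, Submodule.span_image, bC.span_eq, Submodule.map_top, Submodule.range_subtype]
  refine ⟨Option I, inferInstance, t', d', b', ?_⟩
  refine ⟨?_, ?_, ?_, ?_, ?_, ?_, ?_⟩
  · rintro (_ | i)
    · exact Nat.succ_pos s
    · exact hb.t_pos i
  · rintro (_ | i)
    · exact Nat.pos_of_ne_zero fun h => hC0 (Submodule.finrank_eq_zero.1 h)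
    · exact hb.d_pos i
  · rintro (_ | i)
    · rw [hspC]; exact hC
    · exact hb.stable i
  · rintro (_ | i)
    · rw [hspC]; exact hCmin
    · exact hb.irred i
  · rintro (_ | i) y
    · exact hs1 _ (hCU (bC y).2)
    · exact hb.pow_eq_zero i y
  · rw [Fintype.linearIndependent_iff]
    intro a ha
    rw [Fintype.sum_sigma, Fintype.sum_option] at ha
    let c : ℕ → V := fun l => if h : l < s + 1 then
      ∑ y : Fin (Module.finrank Ω C), a ⟨none, ⟨l, h⟩, y⟩ • (bC y : V) else 0
    have hcl : ∀ l : Fin (s + 1),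
        c l = ∑ y : Fin (Module.finrank Ω C), a ⟨none, l, y⟩ • (bC y : V) := fun l => dif_pos l.2
    have hc : ∀ l, c l ∈ C := fun l => by
      simp only [c]
      split_ifs
      · exact C.sum_mem fun y _ => C.smul_mem _ (bC y).2
      · exact C.zero_mem
    have h1 : (∑ x : Fin (t' none) × Fin (d' none), a ⟨none, x⟩ • (N ^ (x.1 : ℕ)) (b' none x.2)) =
        ∑ l ∈ Finset.range (s + 1), (N ^ l) (c l) := by
      rw [Fintype.sum_prod_type, Finset.sum_range]
      refine Finset.sum_congr rfl fun l _ => ?_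
      rw [hcl l, map_sum]
      exact Finset.sum_congr rfl fun y _ => (map_smul _ _ _).symm
    have hx : (∑ i : I, ∑ x : Fin (t' (some i)) × Fin (d' (some i)),
        a ⟨some i, x⟩ • (N ^ (x.1 : ℕ)) (b' (some i) x.2)) ∈ X' := by
      rw [← hb.span_eq]
      exact Submodule.sum_mem _ fun i _ => Submodule.sum_mem _ fun x _ =>
        Submodule.smul_mem _ _ (Submodule.subset_span ⟨⟨i, x⟩, rfl⟩)
    rw [h1] at ha
    have h2 := hind c _ hc hx ha
    have h3 : ∑ l ∈ Finset.range (s + 1), (N ^ l) (c l) = 0 :=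
      Finset.sum_eq_zero fun l hl => by rw [h2 l (by simpa [Nat.lt_succ_iff] using hl), map_zero]
    rw [h3, zero_add] at ha
    have h4 := Fintype.linearIndependent_iff.1 hb.linearIndependent (fun x => a ⟨some x.1, x.2⟩)
      (by rw [Fintype.sum_sigma]; exact ha)
    rintro ⟨_ | i, x⟩
    · obtain ⟨l, y⟩ := x
      have h5 := h2 l (Nat.lt_succ_iff.1 l.2)
      rw [hcl l] at h5
      have h6 : ∑ y : Fin (Module.finrank Ω C), a ⟨none, l, y⟩ • bC y = 0 := by
        apply Subtype.ext
        simpa using h5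
      exact Fintype.linearIndependent_iff.1 bC.linearIndependent _ h6 y
    · exact h4 ⟨i, x⟩
  · apply le_antisymm
    · rw [Submodule.span_le]
      rintro _ ⟨⟨_ | i, x⟩, rfl⟩
      · exact hUNk _ _ (hCU (bC x.2).2)
      · have : (N ^ (x.1 : ℕ)) (b i x.2) ∈ X' := by
          rw [← hb.span_eq]; exact Submodule.subset_span ⟨⟨i, x⟩, rfl⟩
        exact this.1
    · intro v hv
      obtain ⟨c, hc, hx⟩ := hdecomp v hv
      rw [← sub_add_cancel v (∑ l ∈ Finset.range (s + 1), (N ^ l) (c l))]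
      refine Submodule.add_mem _ ?_ (Submodule.sum_mem _ fun l hl => ?_)
      · rw [← hb.span_eq] at hx
        refine Submodule.span_mono ?_ hx
        rintro _ ⟨⟨i, x⟩, rfl⟩
        exact ⟨⟨some i, x⟩, rfl⟩
      · have h1 : c l ∈ Submodule.span Ω (Set.range (b' none)) := hspC.symm ▸ hc l
        have h2 := Submodule.mem_map_of_mem (f := N ^ l) h1
        rw [Submodule.map_span] at h2
        refine Submodule.span_mono ?_ h2
        rintro _ ⟨_, ⟨y, rfl⟩, rfl⟩
        exact ⟨⟨none, ⟨l, Finset.mem_range.1 hl⟩, y⟩, rfl⟩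

end Strings

/-! ### Decomposition into sums of `Sp_t(r)` -/

section Classification

variable {F : Type*} [Field F] [NumberField F] {w : HeightOneSpectrum (𝓞 F)}
  {ι Ω : Type*} [Fintype ι] [DecidableEq ι] [Field Ω] {φ : WeilGroup F w}

/-- The action of a group on column vectors. -/
def endRep {G : Type*} [Group G] (ρ : G →* Matrix ι ι Ω) : G →* Module.End Ω (ι → Ω) :=
  (Matrix.toLinAlgEquiv' : Matrix ι ι Ω ≃ₐ[Ω] _).toMonoidHom.comp ρ

lemma endRep_apply {G : Type*} [Group G] (ρ : G →* Matrix ι ι Ω) (g : G) (v : ι → Ω) :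
    endRep ρ g v = (ρ g).mulVec v := rfl

/-- Stable subspaces have stable complements, if inertia acts through a finite group and Frobenius
acts semisimply: average a Frobenius-equivariant projection over the image of inertia. -/
theorem InertiaFiniteRep.exists_stable_compl [CharZero Ω] (hφ : frobVal φ = 1)
    (r : InertiaFiniteRep w ι Ω) (hss : Module.End.IsSemisimple (Matrix.toLin' (r.r φ)))
    (U : Submodule Ω (ι → Ω)) (hU : IsStable (endRep r.r) U) :
    ∃ U', IsStable (endRep r.r) U' ∧ IsCompl U U' := by
  obtain ⟨Y, hY, hYc⟩ := Module.End.isSemisimple_iff.1 hss U (fun v hv => hU φ v hv)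
  -- A `φ`-equivariant projection onto `U`.
  let π₀ : Module.End Ω (ι → Ω) := U.subtype ∘ₗ U.projectionOnto Y hYc
  have hπ₀U : ∀ v, π₀ v ∈ U := fun v => Subtype.mem _
  have hπ₀1 : ∀ v ∈ U, π₀ v = v := fun v hv => by
    simpa [π₀] using congrArg Subtype.val (Submodule.projectionOnto_apply_left hYc ⟨v, hv⟩)
  have hπ₀Y : ∀ v ∈ Y, π₀ v = 0 := fun v hv => by
    simpa [π₀] using congrArg Subtype.val (Submodule.projectionOnto_apply_right hYc ⟨v, hv⟩)
  let R : WeilGroup F w →* (Module.End Ω (ι → Ω))ˣ := (endRep r.r).toHomUnits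
  have hR : ∀ g v, (R g : Module.End Ω (ι → Ω)) v = endRep r.r g v := fun g v => rfl
  have hφπ : (R φ : Module.End Ω (ι → Ω)) * π₀ = π₀ * R φ := by
    refine LinearMap.ext fun v => ?_
    obtain ⟨a, ha, y, hy, rfl⟩ := Submodule.mem_sup.1
      (hYc.sup_eq_top ▸ Submodule.mem_top : v ∈ U ⊔ Y)
    have h1 : (R φ : Module.End Ω (ι → Ω)) y ∈ Y := hY hy
    have h2 : (R φ : Module.End Ω (ι → Ω)) a ∈ U := hU φ a ha
    rw [Module.End.mul_apply, Module.End.mul_apply, map_add, map_add, map_add, map_add, hπ₀1 a ha,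
      hπ₀Y y hy, hπ₀1 _ h2, hπ₀Y _ h1, map_zero]
  let H : Subgroup (Module.End Ω (ι → Ω))ˣ := (inertia F w).map R
  have hHfin : Finite H := by
    have h1 : ((fun x : (Module.End Ω (ι → Ω))ˣ => (x : Module.End Ω (ι → Ω))) ''
        (H : Set (Module.End Ω (ι → Ω))ˣ)).Finite := by
      refine (r.finite_inertia.image (Matrix.toLinAlgEquiv' : Matrix ι ι Ω ≃ₐ[Ω] _)).subset ?_
      rintro _ ⟨_, ⟨τ, hτ, rfl⟩, rfl⟩
      exact ⟨_, ⟨τ, hτ, rfl⟩, rfl⟩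
    exact (Set.Finite.of_finite_image h1 (Units.val_injective.injOn)).to_subtype
  let _ : Fintype H := Fintype.ofFinite H
  have hHU : ∀ h : H, ∀ v ∈ U, ((h : (Module.End Ω (ι → Ω))ˣ) : Module.End Ω (ι → Ω)) v ∈ U := by
    rintro ⟨_, ⟨τ, hτ, rfl⟩⟩ v hv
    exact hU τ v hv
  -- The sum of its conjugates under `H = r(I)`, equal to `card H` on `U`.
  let π : Module.End Ω (ι → Ω) := ∑ h : H, ((h : (Module.End Ω (ι → Ω))ˣ) : Module.End Ω (ι → Ω)) *
    π₀ * (((h : (Module.End Ω (ι → Ω))ˣ)⁻¹ : (Module.End Ω (ι → Ω))ˣ) : Module.End Ω (ι → Ω))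
  have hπH : ∀ τ ∈ inertia F w, (R τ : Module.End Ω (ι → Ω)) * π = π * R τ := by
    intro τ hτ
    let k : H := ⟨R τ, ⟨τ, hτ, rfl⟩⟩
    rw [Finset.mul_sum, Finset.sum_mul]
    refine Fintype.sum_equiv (Equiv.mulLeft k) _ _ fun h => ?_
    simp only [Equiv.coe_mulLeft, Subgroup.coe_mul, Units.val_mul, mul_inv_rev, k, mul_assoc]
    rw [Units.inv_mul, mul_one]
  have hπφ : (R φ : Module.End Ω (ι → Ω)) * π = π * R φ := by
    -- Frobenius normalizes `H`, so that conjugation by it permutes the summands.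
    have hnorm : ∀ h : H, R φ * h * (R φ)⁻¹ ∈ H := by
      rintro ⟨_, ⟨τ, hτ, rfl⟩⟩
      exact ⟨φ * τ * φ⁻¹, conj_mem_inertia hτ φ, by simp⟩
    have hinj : Function.Injective fun h : H => (⟨R φ * h * (R φ)⁻¹, hnorm h⟩ : H) := by
      intro a b hab
      have := congrArg Subtype.val hab
      exact Subtype.ext (mul_left_cancel (mul_right_cancel this))
    rw [Finset.mul_sum, Finset.sum_mul]
    refine Fintype.sum_bijective _ (Finite.injective_iff_bijective.1 hinj) _ _ fun h => ?_
    have h2 : (((R φ)⁻¹ : (Module.End Ω (ι → Ω))ˣ) : Module.End Ω (ι → Ω)) * π₀ = π₀ *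
        (((R φ)⁻¹ : (Module.End Ω (ι → Ω))ˣ) : Module.End Ω (ι → Ω)) :=
      (Commute.units_inv_left (show Commute (R φ : Module.End Ω (ι → Ω)) π₀ from hφπ)).eq
    simp only [Units.val_mul, mul_inv_rev, inv_inv, mul_assoc]
    rw [Units.inv_mul, mul_one, ← mul_assoc _ π₀ (_ * _), h2]
    simp only [mul_assoc]
    rw [← mul_assoc _ (R φ : Module.End Ω (ι → Ω)), Units.inv_mul, one_mul]
  have hπ_all : ∀ g, (R g : Module.End Ω (ι → Ω)) * π = π * R g := by
    intro g
    have h1 : R g = R φ ^ (frobVal g) * R (φ ^ (-frobVal g) * g) := by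
      rw [← map_zpow, ← map_mul, ← mul_assoc, ← zpow_add]
      simp
    rw [h1, Units.val_mul]
    exact (Commute.mul_left (Commute.units_zpow_left
      (show Commute (R φ : Module.End Ω (ι → Ω)) π from hπφ) _)
      (show Commute _ π from hπH _ (zpow_mul_mem_inertia hφ g))).eq
  have hπU : ∀ v, π v ∈ U := fun v => by
    rw [LinearMap.sum_apply]
    exact U.sum_mem fun h _ => hHU h _ (hπ₀U _)
  have hπ1 : ∀ v ∈ U, π v = (Fintype.card H : Ω) • v := fun v hv => by
    rw [LinearMap.sum_apply, Finset.sum_congr rfl (g := fun _ => v), Finset.sum_const,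
      Finset.card_univ, Nat.cast_smul_eq_nsmul]
    intro h _
    have h1 := hHU h⁻¹ v hv
    rw [Subgroup.coe_inv] at h1
    rw [Module.End.mul_apply, Module.End.mul_apply, hπ₀1 _ h1, ← Module.End.mul_apply,
      Units.mul_inv, Module.End.one_apply]
  have hcard : (Fintype.card H : Ω) ≠ 0 := by exact_mod_cast Fintype.card_ne_zero
  refine ⟨LinearMap.ker π, fun g v hv => ?_, ?_, ?_⟩
  · rw [LinearMap.mem_ker] at hv ⊢
    have := LinearMap.congr_fun (hπ_all g) v
    rw [Module.End.mul_apply, Module.End.mul_apply, hv, map_zero] at this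
    exact this.symm
  · rw [Submodule.disjoint_def]
    intro v hv h0
    rw [LinearMap.mem_ker, hπ1 v hv, smul_eq_zero] at h0
    exact h0.resolve_left hcard
  · rw [codisjoint_iff, eq_top_iff]
    intro v _
    have h1 : v = (Fintype.card H : Ω)⁻¹ • π v + (v - (Fintype.card H : Ω)⁻¹ • π v) := by simp
    rw [h1]
    refine Submodule.add_mem_sup (U.smul_mem _ (hπU v)) ?_
    rw [LinearMap.mem_ker, map_sub, map_smul, hπ1 _ (hπU v), inv_smul_smul₀ hcard, sub_self]

section Coordinates

variable {G V : Type*} [Group G] [AddCommGroup V] [Module Ω V] {d : ℕ}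

/-- The matrix representation on a stable subspace with a given basis. -/
lemma exists_coordinates (ρ : G →* Module.End Ω V) {b : Fin d → V} (hb : LinearIndependent Ω b)
    (hst : IsStable ρ (Submodule.span Ω (Set.range b))) :
    ∃ R : G →* Matrix (Fin d) (Fin d) Ω, ∀ g c,
      ρ g (∑ y, c y • b y) = ∑ x, (R g).mulVec c x • b x := by
  have hcoef : ∀ g y, ∃ R : Fin d → Ω, ρ g (b y) = ∑ x, R x • b x := by
    intro g y
    obtain ⟨R, hR⟩ := (Submodule.mem_span_range_iff_exists_fun Ω).1
      (hst g _ (Submodule.subset_span ⟨y, rfl⟩))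
    exact ⟨R, hR.symm⟩
  choose R hR using hcoef
  have hRu : ∀ c c' : Fin d → Ω, ∑ x, c x • b x = ∑ x, c' x • b x → c = c' := by
    intro c c' h
    have := Fintype.linearIndependent_iff.1 hb (fun x => c x - c' x)
      (by simp only [sub_smul, Finset.sum_sub_distrib, h, sub_self])
    exact funext fun x => sub_eq_zero.1 (this x)
  have hRv : ∀ g (c : Fin d → Ω), ρ g (∑ y, c y • b y) =
      ∑ x, ((Matrix.of fun x y => R g y x).mulVec c) x • b x := by
    intro g c
    rw [map_sum]
    simp only [map_smul, hR, Finset.smul_sum, Matrix.mulVec, dotProduct, Matrix.of_apply,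
      Finset.sum_smul]
    rw [Finset.sum_comm]
    refine Finset.sum_congr rfl fun x _ => Finset.sum_congr rfl fun y _ => ?_
    rw [smul_smul, mul_comm]
  refine ⟨{ toFun := fun g => Matrix.of fun x y => R g y x, map_one' := ?_, map_mul' := ?_ }, hRv⟩
  · refine Matrix.ext_of_mulVec_single fun y => ?_
    apply hRu
    rw [← hRv, map_one, Module.End.one_apply, Matrix.one_mulVec]
  · intro g h
    refine Matrix.ext_of_mulVec_single fun y => ?_
    apply hRu
    rw [← hRv, map_mul, Module.End.mul_apply, hRv, hRv, Matrix.mulVec_mulVec]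

lemma isIrred_of_coordinates {ρ : G →* Module.End Ω V} {b : Fin d → V} (hd : 0 < d)
    (hb : LinearIndependent Ω b)
    (hirr : ∀ C ≤ Submodule.span Ω (Set.range b), IsStable ρ C →
      C = ⊥ ∨ C = Submodule.span Ω (Set.range b)) {R : G →* Matrix (Fin d) (Fin d) Ω}
    (hR : ∀ g c, ρ g (∑ y, c y • b y) = ∑ x, (R g).mulVec c x • b x) : IsIrred R := by
  have : Nonempty (Fin d) := ⟨⟨0, hd⟩⟩
  refine isIrred_of_forall fun T hT => ?_
  let L : (Fin d → Ω) →ₗ[Ω] V := Fintype.linearCombination Ω b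
  have hL : ∀ c, L c = ∑ x, c x • b x := fun c => Fintype.linearCombination_apply Ω b c
  have hLinj : Function.Injective L := by
    refine LinearMap.ker_eq_bot.1 (LinearMap.ker_eq_bot'.2 fun c hc => funext fun x => ?_)
    exact Fintype.linearIndependent_iff.1 hb c (by rw [← hL, hc]) x
  have hrange : LinearMap.range L = Submodule.span Ω (Set.range b) :=
    Fintype.range_linearCombination Ω b
  rcases hirr (T.map L) (hrange ▸ LinearMap.map_le_range) (by
    rintro g _ ⟨c, hc, rfl⟩
    exact ⟨_, hT g c hc, by rw [hL, hL, hR]⟩) with h | h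
  · left
    exact Submodule.map_injective_of_injective hLinj (h.trans (Submodule.map_bot L).symm)
  · right
    rw [← hrange, ← Submodule.map_top] at h
    exact Submodule.map_injective_of_injective hLinj h

end Coordinates

lemma sp_r_apply {κ : Type*} [Fintype κ] [DecidableEq κ] (t : ℕ) (ρ : InertiaFiniteRep w κ Ω)
    (g : WeilGroup F w) (l l' : Fin t) (x y : κ) :
    (sp t ρ).r g (l', x) (l, y) = if l' = l then normChar w Ω g ^ (l : ℕ) * ρ.r g x y else 0 := by
  change Matrix.diagonal (fun j : Fin t => normChar w Ω g ^ (j : ℕ)) l' l * ρ.r g x y = _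
  by_cases h : l' = l
  · subst h; simp
  · simp [h]

lemma sp_N_apply {κ : Type*} [Fintype κ] [DecidableEq κ] (t : ℕ) (ρ : InertiaFiniteRep w κ Ω)
    (l l' : Fin t) (x y : κ) :
    (sp t ρ).N (l', x) (l, y) = if (l' : ℕ) = l + 1 ∧ x = y then 1 else 0 := by
  change shiftMatrix t Ω l' l * (1 : Matrix κ κ Ω) x y = _
  rw [Matrix.one_apply]
  by_cases h : (l' : ℕ) = l + 1 <;> by_cases h' : x = y <;> simp [shiftMatrix, h, h']

/-- A basis `N ^ l b_(i,y)` exhibits a Weil-Deligne representation as a sum of `Sp_t(r)`. -/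
lemma WeilDeligneRep.isIso_of_basis (D : WeilDeligneRep w ι Ω) {I : Type*} [Fintype I]
    [DecidableEq I] {t d : I → ℕ} (b : ∀ i, Fin (d i) → ι → Ω)
    (r : ∀ i, InertiaFiniteRep w (Fin (d i)) Ω)
    (hr : ∀ i g y, (D.r g).mulVec (b i y) = ∑ x, (r i).r g x y • b i x)
    (hN : ∀ i y, (D.N ^ t i).mulVec (b i y) = 0)
    (B : Module.Basis (Σ i, Fin (t i) × Fin (d i)) Ω (ι → Ω))
    (hB : ∀ i l y, B ⟨i, l, y⟩ = (D.N ^ (l : ℕ)).mulVec (b i y)) :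
    D.IsIso (sumWD fun i => sp (t i) (r i)) := by
  let P : Matrix ι (Σ i, Fin (t i) × Fin (d i)) Ω := Matrix.of fun v x => B x v
  let Q : Matrix (Σ i, Fin (t i) × Fin (d i)) ι Ω :=
    LinearMap.toMatrix (Pi.basisFun Ω ι) B LinearMap.id
  have hP : P = LinearMap.toMatrix B (Pi.basisFun Ω ι) LinearMap.id := by
    ext v x
    simp [P, LinearMap.toMatrix_apply]
  have hPM : ∀ (M : ∀ i, Matrix (Fin (t i) × Fin (d i)) (Fin (t i) × Fin (d i)) Ω)
      (A : Matrix ι ι Ω),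
      (∀ i l y, A.mulVec (B ⟨i, l, y⟩) = ∑ l', ∑ x, M i (l', x) (l, y) • B ⟨i, l', x⟩) →
      P * Matrix.blockDiagonal' M = A * P := by
    intro M A h
    ext v ⟨i, l, y⟩
    have h1 : (A * P) v ⟨i, l, y⟩ = A.mulVec (B ⟨i, l, y⟩) v := by
      rw [Matrix.mul_apply, Matrix.mulVec, dotProduct]; rfl
    rw [h1, h, Matrix.mul_apply, Fintype.sum_sigma, Finset.sum_eq_single i, Fintype.sum_prod_type,
      Finset.sum_apply]
    · refine Finset.sum_congr rfl fun l' _ => ?_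
      rw [Finset.sum_apply]
      refine Finset.sum_congr rfl fun x _ => ?_
      rw [Matrix.blockDiagonal'_apply_eq, mul_comm]; rfl
    · intro j _ hj
      refine Finset.sum_eq_zero fun x _ => ?_
      rw [Matrix.blockDiagonal'_apply_ne _ _ _ hj, mul_zero]
    · simp
  refine ⟨P, Q, ?_, ?_, fun g => hPM (fun i => (sp (t i) (r i)).r g) (D.r g) fun i l y => ?_,
    hPM (fun i => (sp (t i) (r i)).N) D.N fun i l y => ?_⟩
  · rw [hP, ← LinearMap.toMatrix_comp, LinearMap.id_comp, LinearMap.toMatrix_id]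
  · rw [hP, ← LinearMap.toMatrix_comp, LinearMap.id_comp, LinearMap.toMatrix_id]
  · have hcomm := pow_semicomm (ρ := endRep D.r) (N := Matrix.toLinAlgEquiv' D.N)
      (χ := fun g => normChar w Ω g) (fun g => by
        change Matrix.toLinAlgEquiv' (D.r g) * _ = _ • (_ * Matrix.toLinAlgEquiv' (D.r g))
        rw [← map_mul, D.comm, map_smul, map_mul]) l g (b i y)
    rw [← map_pow] at hcomm
    have h2 : (D.r g).mulVec ((D.N ^ (l : ℕ)).mulVec (b i y)) =
      normChar w Ω g ^ (l : ℕ) • (D.N ^ (l : ℕ)).mulVec ((D.r g).mulVec (b i y)) := hcomm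
    rw [hB, h2, hr, Finset.sum_eq_single l, Matrix.mulVec_sum, Finset.smul_sum]
    · refine Finset.sum_congr rfl fun x _ => ?_
      rw [sp_r_apply, if_pos rfl, hB, Matrix.mulVec_smul, smul_smul]
    · intro l' _ hl'
      refine Finset.sum_eq_zero fun x _ => ?_
      rw [sp_r_apply, if_neg hl', zero_smul]
    · simp
  · rw [hB, Matrix.mulVec_mulVec, ← pow_succ']
    by_cases hl : (l : ℕ) + 1 < t i
    · rw [Finset.sum_eq_single ⟨l + 1, hl⟩, Finset.sum_eq_single y]
      · rw [sp_N_apply, if_pos ⟨rfl, rfl⟩, one_smul, hB]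
      · intro x _ hx
        rw [sp_N_apply, if_neg (fun h => hx h.2), zero_smul]
      · simp
      · intro l' _ hl'
        refine Finset.sum_eq_zero fun x _ => ?_
        rw [sp_N_apply, if_neg (fun h => hl' (Fin.ext h.1)), zero_smul]
      · simp
    · have h1 : (l : ℕ) + 1 = t i := by have := l.2; omega
      rw [h1, hN]
      refine (Finset.sum_eq_zero fun l' _ => Finset.sum_eq_zero fun x _ => ?_).symm
      rw [sp_N_apply, if_neg (fun h => by have := l'.2; omega), zero_smul]

/-- A Frobenius-semisimple Weil-Deligne representation over a field of characteristic zero is a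
direct sum of `Sp_t(r)` with `r` irreducible. -/
theorem WeilDeligneRep.exists_isIso_sumWD_sp [CharZero Ω] (hφ : frobVal φ = 1)
    (D : WeilDeligneRep w ι Ω) (hss : Module.End.IsSemisimple (Matrix.toLin' (D.r φ))) :
    ∃ (m : ℕ) (t d : Fin m → ℕ) (r : ∀ i, InertiaFiniteRep w (Fin (d i)) Ω),
      (∀ i, 0 < t i) ∧ (∀ i, IsIrred (r i).r) ∧ D.IsIso (sumWD fun i => sp (t i) (r i)) := by
  let Nl : Module.End Ω (ι → Ω) := Matrix.toLinAlgEquiv' D.N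
  have hNl : ∀ (k : ℕ) v, (Nl ^ k) v = (D.N ^ k).mulVec v := fun k v => by
    rw [← map_pow]; rfl
  obtain ⟨I, _, t, d, b, hb⟩ := exists_stringBasis (endRep D.r) Nl (fun g => normChar w Ω g)
    (fun g => by
      change Matrix.toLinAlgEquiv' (D.r g) * Nl = _ • (Nl * Matrix.toLinAlgEquiv' (D.r g))
      rw [← map_mul, D.comm, map_smul, map_mul])
    (fun g => normChar_ne_zero g) (D.nilpotent.map Matrix.toLinAlgEquiv')
    (D.exists_stable_compl hφ hss) _ ⊤ rfl (fun _ _ _ => trivial) (fun _ _ => trivial)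
  classical
  let e := Fintype.equivFin I
  have hbi : ∀ i, LinearIndependent Ω (b i) := fun i => by
    have := hb.linearIndependent.comp (fun y : Fin (d i) => (⟨i, ⟨0, hb.t_pos i⟩, y⟩ :
      Σ i, Fin (t i) × Fin (d i))) (fun a c h => by simpa using h)
    simpa [Function.comp_def] using this
  choose R hR using fun i => exists_coordinates (endRep D.r) (hbi i) (hb.stable i)
  have hRb : ∀ i g y, (D.r g).mulVec (b i y) = ∑ x, R i g x y • b i x := by
    intro i g y
    have := hR i g (Pi.single y 1)
    rw [Finset.sum_eq_single y (by intro x _ hx; simp [hx]) (by simp)] at this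
    simpa [endRep_apply] using this
  -- The matrix `R i τ` depends on `D.r τ` only, so inertia has finite image in `R i`.
  let r : ∀ i, InertiaFiniteRep w (Fin (d i)) Ω := fun i =>
    { r := R i
      finite_inertia := by
        have hex : ∀ M ∈ (D.r '' (inertia F w : Set (WeilGroup F w))), ∃ g, D.r g = M := by
          rintro _ ⟨g, -, rfl⟩; exact ⟨g, rfl⟩
        choose! s hs using hex
        refine (D.finite_inertia.image fun M => R i (s M)).subset ?_
        rintro _ ⟨τ, hτ, rfl⟩
        refine ⟨D.r τ, ⟨τ, hτ, rfl⟩, ?_⟩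
        ext x y
        have h1 := hRb i (s (D.r τ)) y
        rw [hs _ ⟨τ, hτ, rfl⟩, hRb] at h1
        have h2 := Fintype.linearIndependent_iff.1 (hbi i)
          (fun x => R i (s (D.r τ)) x y - R i τ x y)
          (by simp only [sub_smul, Finset.sum_sub_distrib, h1, sub_self])
        exact sub_eq_zero.1 (h2 x) }
  have hiso : D.IsIso (sumWD fun i => sp (t i) (r i)) :=
    D.isIso_of_basis b r hRb (fun i y => by rw [← hNl]; exact hb.pow_eq_zero i y)
      (Module.Basis.mk hb.linearIndependent hb.span_eq.ge) (fun i l y => by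
        rw [Module.Basis.mk_apply, hNl])
  exact ⟨Fintype.card I, fun i => t (e.symm i), fun i => d (e.symm i), fun i => r (e.symm i),
    fun i => hb.t_pos _,
    fun i => isIrred_of_coordinates (hb.d_pos _) (hbi _) (hb.irred _) (hR _),
    hiso.trans (sumWD_reindex e.symm (fun i => sp (t i) (r i))).symm⟩

end Classification

/-! ### Integrality of eigenvalues -/

section Integrality

variable {K : Type*} [Field K] [CharZero K]

/-- If the power sums of a finite family lie in a subring over which positive integers are
invertible, the members of the family are integral over it (Newton's identities). -/
theorem isIntegral_of_power_sums (A : Subring K) (hA : ∀ n : ℕ, 0 < n → (n : K)⁻¹ ∈ A)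
    {X : Type*} [Fintype X] (β : X → K) (h : ∀ j : ℕ, 0 < j → ∑ x, β x ^ j ∈ A) (x : X) :
    IsIntegral A (β x) := by
  -- The elementary symmetric functions lie in `A`, by Newton's identities. The signs are chosen
  -- such that they are the coefficients of the polynomial `f` with roots `β x`.
  have hes : ∀ k : ℕ, MvPolynomial.aeval (fun x => -β x) (MvPolynomial.esymm X K k) ∈ A := by
    intro k
    induction k using Nat.strong_induction_on with
    | _ k ih =>
    rcases Nat.eq_zero_or_pos k with rfl | hk
    · simp
    have h1 := congrArg (MvPolynomial.aeval (fun x => -β x)) (MvPolynomial.mul_esymm_eq_sum X K k)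
    have h2 : (k : K) * MvPolynomial.aeval (fun x => -β x) (MvPolynomial.esymm X K k) ∈ A := by
      rw [map_mul, map_natCast] at h1
      rw [h1, map_mul, map_pow, map_neg, map_one, map_sum]
      refine A.mul_mem (A.pow_mem (A.neg_mem A.one_mem) _) (A.sum_mem fun a ha => ?_)
      rw [Finset.mem_filter, Finset.HasAntidiagonal.mem_antidiagonal] at ha
      rw [map_mul, map_mul, map_pow, map_neg, map_one]
      refine A.mul_mem (A.mul_mem (A.pow_mem (A.neg_mem A.one_mem) _) (ih _ ha.2)) ?_
      have h3 : MvPolynomial.aeval (fun x => -β x) (MvPolynomial.psum X K a.2) =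
          (-1) ^ a.2 * ∑ x, β x ^ a.2 := by
        rw [MvPolynomial.psum, map_sum, Finset.mul_sum]
        refine Finset.sum_congr rfl fun y _ => ?_
        rw [map_pow, MvPolynomial.aeval_X, neg_pow]
      rw [h3]
      exact A.mul_mem (A.pow_mem (A.neg_mem A.one_mem) _) (h _ (by omega))
    have h4 := A.mul_mem (hA k hk) h2
    rwa [inv_mul_cancel_left₀ (by exact_mod_cast hk.ne')] at h4
  let f : Polynomial K := ∏ y : X, (Polynomial.X + C (-β y))
  have hmonic : f.Monic := monic_prod_of_monic _ _ fun y _ => monic_X_add_C _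
  have hf : f = (∏ y : X, (Polynomial.X + C (MvPolynomial.X y : MvPolynomial X K))).map
      (MvPolynomial.aeval (fun x => -β x)).toRingHom := by
    rw [Polynomial.map_prod]
    refine Finset.prod_congr rfl fun y _ => ?_
    simp
  have hlift : f ∈ lifts A.subtype := by
    rw [lifts_iff_coeff_lifts]
    intro k
    by_cases hk : k ≤ Fintype.card X
    · rw [hf, coeff_map, MvPolynomial.prod_X_add_C_coeff _ _ _ hk]
      exact ⟨⟨_, hes _⟩, rfl⟩
    · rw [coeff_eq_zero_of_natDegree_lt]
      · exact ⟨0, map_zero _⟩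
      · rw [natDegree_prod_of_monic _ _ fun y _ => monic_X_add_C _]
        simp only [natDegree_X_add_C]
        simpa using hk
  obtain ⟨g, hg, -, hgm⟩ := lifts_and_natDegree_eq_and_monic hlift hmonic
  refine ⟨g, hgm, ?_⟩
  have h5 : eval₂ (algebraMap A K) (β x) g = eval (β x) f := by
    rw [← hg, eval_map]; rfl
  rw [h5, eval_prod]
  exact Finset.prod_eq_zero (Finset.mem_univ x) (by simp)

end Integrality

/-! ### The ring `intal p R` -/

section Intal

variable {p : ℕ} {R : Type*} [CommRing R] [IsDomain R]

/-- Elements of `intal p R` become integral over `R` after multiplication by a power of `p`. -/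
lemma mem_intalSubring_iff (hp : (p : Qbar R) ≠ 0) {x : Qbar R} :
    x ∈ intalSubring p R ↔ ∃ M : ℕ, IsIntegral R ((p : Qbar R) ^ M * x) := by
  have hpint : ∀ M : ℕ, IsIntegral R ((p : Qbar R) ^ M) := fun M =>
    ((isIntegral_natCast (a := p)).pow M)
  constructor
  · intro hx
    induction hx using Subring.closure_induction with
    | mem x hx =>
      rcases hx with hx | hx
      · exact ⟨0, by rw [pow_zero, one_mul]; exact hx⟩
      · refine ⟨1, ?_⟩
        rw [Set.mem_singleton_iff.1 hx, pow_one, mul_inv_cancel₀ hp]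
        exact isIntegral_one
    | zero => exact ⟨0, by simpa using isIntegral_zero⟩
    | one => exact ⟨0, by simpa using isIntegral_one⟩
    | add x y _ _ hx hy =>
      obtain ⟨M, hM⟩ := hx
      obtain ⟨M', hM'⟩ := hy
      refine ⟨M + M', ?_⟩
      have : (p : Qbar R) ^ (M + M') * (x + y) = (p : Qbar R) ^ M' * ((p : Qbar R) ^ M * x) +
          (p : Qbar R) ^ M * ((p : Qbar R) ^ M' * y) := by ring
      rw [this]
      exact ((hpint _).mul hM).add ((hpint _).mul hM')
    | neg x _ hx =>
      obtain ⟨M, hM⟩ := hx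
      exact ⟨M, by rw [mul_neg]; exact hM.neg⟩
    | mul x y _ _ hx hy =>
      obtain ⟨M, hM⟩ := hx
      obtain ⟨M', hM'⟩ := hy
      refine ⟨M + M', ?_⟩
      have : (p : Qbar R) ^ (M + M') * (x * y) = ((p : Qbar R) ^ M * x) *
          ((p : Qbar R) ^ M' * y) := by ring
      rw [this]
      exact hM.mul hM'
  · rintro ⟨M, hM⟩
    have h1 : x = ((p : Qbar R)⁻¹) ^ M * ((p : Qbar R) ^ M * x) := by
      rw [← mul_assoc, ← mul_pow, inv_mul_cancel₀ hp, one_pow, one_mul]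
    rw [h1]
    exact mul_mem (pow_mem (show (p : Qbar R)⁻¹ ∈ intalSubring p R from
      Subring.subset_closure (Or.inr rfl)) _)
      (Subring.subset_closure (Or.inl hM))

/-- The ring `intal p R` is integrally closed. -/
theorem mem_intalSubring_of_isIntegral (hp : (p : Qbar R) ≠ 0) {x : Qbar R}
    (hx : IsIntegral (intalSubring p R) x) : x ∈ intalSubring p R := by
  obtain ⟨f, hf, h0⟩ := hx
  have hpint : ∀ M : ℕ, IsIntegral R ((p : Qbar R) ^ M) := fun M =>
    ((isIntegral_natCast (a := p)).pow M)
  choose M hM using fun i => (mem_intalSubring_iff hp).1 (f.coeff i).2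
  -- `p ^ m` is a common denominator of the coefficients of the integral equation of `x`, so that
  -- `p ^ m * x` is integral over `R`.
  let m := ∑ i ∈ Finset.range (f.natDegree + 1), M i
  have hm : ∀ i ≤ f.natDegree, IsIntegral R ((p : Qbar R) ^ m * f.coeff i) := by
    intro i hi
    obtain ⟨c, hc⟩ := Nat.exists_eq_add_of_le (Finset.single_le_sum (f := M)
      (fun _ _ => Nat.zero_le _) (Finset.mem_range.2 (Nat.lt_succ_of_le hi)))
    have h1 : m = c + M i := by rw [add_comm]; exact hc
    rw [h1, pow_add, mul_assoc]
    exact (hpint c).mul (hM i)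
  let g : Polynomial (Qbar R) := scaleRoots (f.map (intalSubring p R).subtype) ((p : Qbar R) ^ m)
  have hgm : g.Monic := (monic_scaleRoots_iff _).2 (hf.map _)
  have hglift : g ∈ lifts (algebraMap (integralClosure R (Qbar R)) (Qbar R)) := by
    rw [lifts_iff_coeff_lifts]
    intro i
    have h1 : IsIntegral R (g.coeff i) := by
      rw [coeff_scaleRoots, coeff_map, hf.natDegree_map]
      rcases lt_trichotomy i f.natDegree with h | h | h
      · obtain ⟨c, hc⟩ := Nat.exists_eq_add_of_lt h
        have h2 : f.natDegree - i = c + 1 := by omega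
        rw [h2, pow_succ, mul_left_comm, mul_comm ((intalSubring p R).subtype _)]
        exact ((hpint m).pow c).mul (hm i h.le)
      · rw [h, hf.coeff_natDegree, map_one, one_mul]
        exact (hpint m).pow _
      · rw [coeff_eq_zero_of_natDegree_lt h, map_zero, zero_mul]
        exact isIntegral_zero
    exact ⟨⟨_, h1⟩, rfl⟩
  obtain ⟨h, hh, -, hhm⟩ := lifts_and_natDegree_eq_and_monic hglift hgm
  have hroot : eval ((p : Qbar R) ^ m * x) g = 0 := by
    have := scaleRoots_aeval_eq_zero (R := Qbar R) (A := Qbar R) (a := x) (r := (p : Qbar R) ^ m)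
      (p := f.map (intalSubring p R).subtype) (by
        rw [aeval_def, eval₂_map]; exact h0)
    exact this
  have h2 : IsIntegral (integralClosure R (Qbar R)) ((p : Qbar R) ^ m * x) := by
    refine ⟨h, hhm, ?_⟩
    rw [← eval_map, hh, hroot]
  exact (mem_intalSubring_iff hp).2 ⟨m, isIntegral_trans _ h2⟩

variable [Fact p.Prime] [Algebra ℤ_[p] R]

lemma natCast_ne_zero_of_injective {S : Type*} [CommRing S] [Algebra ℤ_[p] S]
    (hinj : Function.Injective (algebraMap ℤ_[p] S)) {n : ℕ} (hn : 0 < n) : (n : S) ≠ 0 := by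
  rw [← map_natCast (algebraMap ℤ_[p] S), Ne, ← map_zero (algebraMap ℤ_[p] S), hinj.eq_iff]
  exact_mod_cast hn.ne'

lemma charZero_of_injective {S : Type*} [CommRing S] [IsDomain S] [Algebra ℤ_[p] S]
    (hinj : Function.Injective (algebraMap ℤ_[p] S)) : CharZero S :=
  charZero_of_inj_zero fun n hn => by
    by_contra h
    exact natCast_ne_zero_of_injective hinj (Nat.pos_of_ne_zero h) hn

lemma algebraMap_Qbar_injective : Function.Injective (algebraMap R (Qbar R)) := by
  rw [IsScalarTower.algebraMap_eq R (FractionRing R) (Qbar R)]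
  exact (algebraMap (FractionRing R) (Qbar R)).injective.comp (IsFractionRing.injective R _)

/-- Positive integers are invertible in `intal p R`, for `R` a domain containing `ℤ_p`: the part
prime to `p` is a unit of `ℤ_p`. -/
lemma natCast_inv_mem_intalSubring (hinj : Function.Injective (algebraMap ℤ_[p] R)) {n : ℕ}
    (hn : 0 < n) : (n : Qbar R)⁻¹ ∈ intalSubring p R := by
  have hR0 : ∀ {m : ℕ}, 0 < m → (m : Qbar R) ≠ 0 := fun hm => by
    rw [← map_natCast (algebraMap R (Qbar R)), Ne, ← map_zero (algebraMap R (Qbar R)),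
      algebraMap_Qbar_injective.eq_iff]
    exact natCast_ne_zero_of_injective hinj hm
  obtain ⟨a, m, hm, rfl⟩ := Nat.exists_eq_pow_mul_and_not_dvd hn.ne' p (Fact.out : p.Prime).ne_one
  have hmu : IsUnit (m : ℤ_[p]) := by
    rw [PadicInt.isUnit_iff, ← Int.cast_natCast, PadicInt.norm_intCast_eq_one_iff]
    rw [Int.isCoprime_iff_gcd_eq_one, Int.gcd_natCast_natCast]
    exact ((Fact.out : p.Prime).coprime_iff_not_dvd.2 hm).symm
  obtain ⟨u, hu⟩ := hmu
  have h1 : ((m : Qbar R))⁻¹ = algebraMap R (Qbar R) (algebraMap ℤ_[p] R (u⁻¹ : ℤ_[p]ˣ)) := by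
    refine (eq_inv_of_mul_eq_one_left ?_).symm
    rw [← map_natCast (algebraMap R (Qbar R)), ← map_natCast (algebraMap ℤ_[p] R), ← hu, ← map_mul,
      ← map_mul, Units.inv_mul, map_one, map_one]
  rw [Nat.cast_mul, mul_inv, Nat.cast_pow, ← inv_pow, h1]
  exact mul_mem (pow_mem (show (p : Qbar R)⁻¹ ∈ intalSubring p R from
      Subring.subset_closure (Or.inr rfl)) _)
    (Subring.subset_closure (Or.inl (algebraMap_mem _ _)))

end Intal

/-! ### Unramified twists and finiteness of the image -/

section Twist

variable {F : Type*} [Field F] [NumberField F] {w : HeightOneSpectrum (𝓞 F)} {φ : WeilGroup F w}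
  {ι κ : Type*} [Fintype ι] [DecidableEq ι] [Fintype κ] [DecidableEq κ]

/-- The twist of `r` by the unramified character sending the geometric Frobenius to `a`. -/
noncomputable def InertiaFiniteRep.twist {A : Type*} [CommRing A] (a : Aˣ)
    (r : InertiaFiniteRep w ι A) :
    InertiaFiniteRep w ι A where
  r :=
    { toFun := fun g => ((a ^ frobVal g : Aˣ) : A) • r.r g
      map_one' := by simp [frobVal_one]
      map_mul' := fun g h => by
        rw [frobVal_mul, zpow_add, map_mul, Units.val_mul, smul_mul_smul_comm] }
  finite_inertia := by
    refine r.finite_inertia.subset ?_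
    rintro _ ⟨g, hg, rfl⟩
    refine ⟨g, hg, ?_⟩
    simp [frobVal_eq_zero hg]

lemma InertiaFiniteRep.twist_apply {A : Type*} [CommRing A] (a : Aˣ) (r : InertiaFiniteRep w ι A)
    (g : WeilGroup F w) : (r.twist a).r g = ((a ^ frobVal g : Aˣ) : A) • r.r g := rfl

lemma InertiaFiniteRep.twist_inv_twist {A : Type*} [CommRing A] (a : Aˣ)
    (r : InertiaFiniteRep w ι A) : ((r.twist a⁻¹).twist a).r = r.r := by
  ext g : 1
  rw [twist_apply, twist_apply, smul_smul, ← Units.val_mul, inv_zpow, mul_inv_cancel, Units.val_one,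
    one_smul]

lemma InertiaFiniteRep.isFull_twist {A : Type*} [CommRing A] (a : Aˣ)
    {r : InertiaFiniteRep w ι A} (h : IsFull r.r) : IsFull (r.twist a).r := by
  rw [IsFull, eq_top_iff, ← h, Submodule.span_le]
  rintro _ ⟨g, rfl⟩
  have h1 : r.r g = ((a ^ (-frobVal g) : Aˣ) : A) • (r.twist a).r g := by
    rw [twist_apply, smul_smul, ← Units.val_mul, zpow_neg, inv_mul_cancel, Units.val_one, one_smul]
  rw [h1]
  exact Submodule.smul_mem _ _ (Submodule.subset_span ⟨g, rfl⟩)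

lemma InertiaFiniteRep.map_twist {A B : Type*} [CommRing A] [CommRing B] (f : A →+* B) (a : Aˣ)
    (r : InertiaFiniteRep w ι A) :
    ((r.twist a).map f).r = ((r.map f).twist (Units.map (f : A →* B) a)).r := by
  ext g : 1
  change ((r.twist a).r g).map f =
    ((Units.map (f : A →* B) a ^ frobVal g : Bˣ) : B) • (r.r g).map f
  rw [twist_apply]
  ext x y
  simp [← map_zpow]

lemma RepIso.twist {Ω : Type*} [Field Ω] (a : Ωˣ) {r : InertiaFiniteRep w ι Ω}
    {r' : InertiaFiniteRep w κ Ω} (h : RepIso r.r r'.r) : RepIso (r.twist a).r (r'.twist a).r := by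
  obtain ⟨P, Q, h1, h2, h3⟩ := h
  refine ⟨P, Q, h1, h2, fun g => ?_⟩
  rw [InertiaFiniteRep.twist_apply, InertiaFiniteRep.twist_apply, Matrix.mul_smul, h3,
    Matrix.smul_mul]

/-- If a positive power of Frobenius acts trivially, the image is finite. -/
lemma InertiaFiniteRep.finite_range {A : Type*} [CommRing A] (hφ : frobVal φ = 1)
    (r : InertiaFiniteRep w ι A) {k : ℕ} (hk : 0 < k) (h : r.r (φ ^ k) = 1) :
    (Set.range r.r).Finite := by
  refine (((Set.finite_Iio k).image fun j : ℕ => r.r φ ^ j).image2 (· * ·)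
    r.finite_inertia).subset ?_
  rintro _ ⟨g, rfl⟩
  have hu : r.r.toHomUnits φ ^ k = 1 := by
    rw [← map_pow]; exact Units.ext h
  have h1 : r.r.toHomUnits φ ^ frobVal g = r.r.toHomUnits φ ^ (frobVal g % k).toNat := by
    have h3 : ((frobVal g % k).toNat : ℤ) = frobVal g % k :=
      Int.toNat_of_nonneg (Int.emod_nonneg _ (by exact_mod_cast hk.ne'))
    rw [← zpow_natCast, h3]
    conv_lhs => rw [← Int.mul_ediv_add_emod (frobVal g) k, zpow_add, zpow_mul, zpow_natCast, hu,
      one_zpow, one_mul]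
  refine ⟨_, ⟨(frobVal g % k).toNat, ?_, rfl⟩, _, ⟨_, zpow_mul_mem_inertia hφ g, rfl⟩, ?_⟩
  · have := Int.emod_lt_of_pos (frobVal g) (by exact_mod_cast hk : (0 : ℤ) < k)
    simp only [Set.mem_Iio]
    omega
  · have h2 := congrArg Units.val h1
    rw [← map_zpow, Units.val_pow_eq_pow_val] at h2
    change r.r φ ^ (frobVal g % k).toNat * r.r (φ ^ (-frobVal g) * g) = r.r g
    change r.r (φ ^ frobVal g) = r.r φ ^ _ at h2
    rw [← h2, ← map_mul, ← mul_assoc, ← zpow_add]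
    simp

/-- Schur's lemma: some positive power of Frobenius acts as a scalar. -/
lemma InertiaFiniteRep.exists_pow_eq_smul_one {A : Type*} [CommRing A] (hφ : frobVal φ = 1)
    {r : InertiaFiniteRep w ι A} (h : IsFull r.r) :
    ∃ k : ℕ, 0 < k ∧ ∃ c : A, r.r (φ ^ k) = c • 1 := by
  have h1 : ∀ M ∈ r.r '' (inertia F w : Set (WeilGroup F w)), ∃ k : ℕ, 0 < k ∧
      r.r (φ ^ k) * M = M * r.r (φ ^ k) := by
    rintro _ ⟨τ, hτ, rfl⟩
    exact r.exists_pow_commute φ hτ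
  choose! k hk hkc using h1
  -- `φ ^ m` commutes with `r(I)`, hence with all of `r`, hence with all matrices.
  let S := r.finite_inertia.toFinset
  have hS : ∀ M, M ∈ S ↔ M ∈ r.r '' (inertia F w : Set (WeilGroup F w)) :=
    fun M => Set.Finite.mem_toFinset _
  refine ⟨∏ M ∈ S, k M, Finset.prod_pos fun M hM => hk M ((hS M).1 hM), ?_⟩
  set m := ∏ M ∈ S, k M
  have hI : ∀ τ ∈ inertia F w, Commute (r.r (φ ^ m)) (r.r τ) := by
    intro τ hτ
    obtain ⟨c, hc⟩ := Finset.dvd_prod_of_mem k ((hS (r.r τ)).2 ⟨τ, hτ, rfl⟩)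
    have h2 : Commute (r.r (φ ^ k (r.r τ))) (r.r τ) := hkc _ ⟨τ, hτ, rfl⟩
    have h3 : r.r (φ ^ m) = r.r (φ ^ k (r.r τ)) ^ c := by
      rw [← map_pow, ← pow_mul, ← hc]
    rw [h3]
    exact h2.pow_left c
  have hall : ∀ g, Commute (r.r (φ ^ m)) (r.r g) := by
    intro g
    have h2 : r.r g = r.r (φ ^ frobVal g) * r.r (φ ^ (-frobVal g) * g) := by
      rw [← map_mul, ← mul_assoc, ← zpow_add]; simp
    rw [h2]
    refine Commute.mul_right ?_ (hI _ (zpow_mul_mem_inertia hφ g))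
    rw [Commute, SemiconjBy, ← map_mul, ← map_mul, ← zpow_natCast, ← zpow_add, ← zpow_add, add_comm]
  have hM : ∀ M, Commute (r.r (φ ^ m)) M := by
    intro M
    have hM : M ∈ Submodule.span A (Set.range r.r) := by rw [h]; trivial
    induction hM using Submodule.span_induction with
    | mem x hx => obtain ⟨g, rfl⟩ := hx; exact hall g
    | zero => exact Commute.zero_right _
    | add x y _ _ hx hy => exact hx.add_right hy
    | smul a x _ hx => exact hx.smul_right a
  obtain ⟨c, hc⟩ := Matrix.mem_range_scalar_of_commute_single (M := r.r (φ ^ m))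
    fun i j _ => (hM _).symm
  exact ⟨c, by rw [← hc, Matrix.smul_one_eq_diagonal]; rfl⟩

lemma trace_sumWD_sp {Ω I : Type*} [Field Ω] [Fintype I] [DecidableEq I] {ι : I → Type*}
    [∀ i, Fintype (ι i)] [∀ i, DecidableEq (ι i)] (t : I → ℕ)
    (r : ∀ i, InertiaFiniteRep w (ι i) Ω) (g : WeilGroup F w) :
    ((sumWD fun i => sp (t i) (r i)).r g).trace =
      ∑ i, ∑ l : Fin (t i), normChar w Ω g ^ (l : ℕ) * ((r i).r g).trace := by
  change (Matrix.blockDiagonal' fun i => (sp (t i) (r i)).r g).trace = _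
  rw [Matrix.trace_blockDiagonal']
  refine Finset.sum_congr rfl fun i _ => ?_
  change (Matrix.kroneckerMap (· * ·) (Matrix.diagonal fun j : Fin (t i) =>
    normChar w Ω g ^ (j : ℕ)) ((r i).r g)).trace = _
  rw [Matrix.trace_kronecker, Matrix.trace_diagonal, Finset.sum_mul]

end Twist

/-! ### Descent to an algebraically closed subfield -/

section Descent

variable {G : Type*} [Group G] {K : Type*} [Field K]

/-- An irreducible representation with finite image is defined over any algebraically closed
subfield: the span of the orbit of a vector is a finite-dimensional stable space over the
subfield, and by Burnside's theorem an irreducible subspace of it spans the representation. -/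
theorem IsFull.exists_descent (L : Type*) [Field L] [IsAlgClosed L] [Algebra L K] {d : ℕ}
    (hd : 0 < d) {s : G →* Matrix (Fin d) (Fin d) K} (hs : IsFull s)
    (hfin : (Set.range s).Finite) :
    ∃ R : G →* Matrix (Fin d) (Fin d) L, IsFull R ∧
      RepIso s (PurityFamilies.mapRep (algebraMap L K) R) := by
  let ρ : G →* Module.End L (Fin d → K) :=
    { toFun := fun g => (Matrix.toLin' (s g)).restrictScalars L
      map_one' := by ext; simp
      map_mul' := fun g h => by
        refine LinearMap.ext fun v => ?_
        simp }
  have hρ : ∀ g v, ρ g v = (s g).mulVec v := fun g v => rfl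
  let v₀ : Fin d → K := Pi.single ⟨0, hd⟩ 1
  -- The orbit of a basis vector, which is finite.
  let S : Set (Fin d → K) := (fun M : Matrix (Fin d) (Fin d) K => M.mulVec v₀) '' Set.range s
  have hfinU : FiniteDimensional L (Submodule.span L S) :=
    FiniteDimensional.span_of_finite L (hfin.image _)
  have hst : IsStable ρ (Submodule.span L S) := by
    intro g v hv
    induction hv using Submodule.span_induction with
    | mem x hx =>
      obtain ⟨_, ⟨h, rfl⟩, rfl⟩ := hx
      refine Submodule.subset_span ⟨s (g * h), ⟨_, rfl⟩, ?_⟩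
      simp only
      rw [map_mul, hρ, Matrix.mulVec_mulVec]
    | zero => rw [map_zero]; exact zero_mem _
    | add x y _ _ hx hy => rw [map_add]; exact add_mem hx hy
    | smul a x _ hx => rw [map_smul]; exact Submodule.smul_mem _ _ hx
  have hv₀ : v₀ ∈ Submodule.span L S :=
    Submodule.subset_span ⟨s 1, ⟨1, rfl⟩, by simp⟩
  have hv₀' : v₀ ≠ 0 := by
    intro h0
    have := congrFun h0 ⟨0, hd⟩
    simp [v₀] at this
  obtain ⟨C, hCU, hCst, hC0, hCmin⟩ := exists_minimal_stable ρ hst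
    (fun h0 => hv₀' (by rw [h0] at hv₀; exact hv₀))
  have hfinC : FiniteDimensional L C := Submodule.finiteDimensional_of_le hCU
  obtain ⟨c, hcC⟩ : ∃ c, Module.finrank L C = c := ⟨_, rfl⟩
  have hc : 0 < c := by
    rw [← hcC]
    have : Nontrivial C := Submodule.nontrivial_iff_ne_bot.2 hC0
    exact Module.finrank_pos
  let b₀ := Module.finBasisOfFinrankEq L C hcC
  let b : Fin c → (Fin d → K) := fun i => (b₀ i : Fin d → K)
  have hb : LinearIndependent L b := b₀.linearIndependent.map' C.subtype (Submodule.ker_subtype C)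
  have hspan : Submodule.span L (Set.range b) = C := by
    have h1 : Set.range b = C.subtype '' Set.range b₀ := by rw [← Set.range_comp]; rfl
    rw [h1, Submodule.span_image, b₀.span_eq, Submodule.map_subtype_top]
  obtain ⟨R, hR⟩ := exists_coordinates ρ hb (by rw [hspan]; exact hCst)
  have hRirr : IsIrred R := isIrred_of_coordinates hc hb (by rw [hspan]; exact hCmin) hR
  -- The `L`-basis of the irreducible `L`-subspace, as an intertwiner over `K`.
  let P : Matrix (Fin d) (Fin c) K := Matrix.of fun x y => b y x
  have hP : ∀ g, P * PurityFamilies.mapRep (algebraMap L K) R g = s g * P := by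
    intro g
    ext x y
    have h1 := congrFun (hR g (Pi.single y 1)) x
    have h2 : ∑ z, (Pi.single y (1 : L) : Fin c → L) z • b z = b y := by
      rw [Finset.sum_eq_single y] <;> simp +contextual
    rw [h2, hρ] at h1
    rw [mapRep_apply, Matrix.mul_apply, Matrix.mul_apply]
    change _ = (s g).mulVec (b y) x
    rw [h1, Finset.sum_apply]
    refine Finset.sum_congr rfl fun z _ => ?_
    simp [P, Algebra.smul_def, mul_comm]
  have hP0 : P ≠ 0 := by
    intro h0
    have h1 : b ⟨0, hc⟩ = 0 := by
      ext x
      exact congrFun (congrFun h0 x) ⟨0, hc⟩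
    exact hb.ne_zero _ h1
  obtain ⟨Q, h1, h2⟩ := hs.exists_inverse (hRirr.isFull.mapRep (algebraMap L K)) hP hP0
  have hdc : d = c := by simpa using card_eq_of_inverse h1 h2
  subst hdc
  exact ⟨R, hRirr.isFull, P, Q, h1, h2, hP⟩

end Descent

/-! ### Irreducible representations over integrally closed rings -/

section IntegralModel

variable {F : Type*} [Field F] [NumberField F] {w : HeightOneSpectrum (𝓞 F)} {φ : WeilGroup F w}
  {K : Type*} [Field K] [CharZero K] [IsAlgClosed K]

/-- An irreducible representation for which the scalar by which a power of Frobenius acts is a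
unit of an integrally closed subring `A` is defined over `A`: an unramified twist has finite image,
hence is defined over the algebraic numbers. -/
theorem InertiaFiniteRep.exists_integral_model (hφ : frobVal φ = 1) {A : Subring K}
    (hA : ∀ n : ℕ, 0 < n → (n : K)⁻¹ ∈ A) (hint : ∀ x : K, IsIntegral A x → x ∈ A) {d : ℕ}
    (r : InertiaFiniteRep w (Fin d) K) (hr : IsIrred r.r) {k : ℕ} (hk : 0 < k) {c : K}
    (hc : r.r (φ ^ k) = c • 1) (hcA : c ∈ A) (hcA' : c⁻¹ ∈ A) :
    ∃ rA : InertiaFiniteRep w (Fin d) A, RepIso r.r (rA.map A.subtype).r ∧ IsFull rA.r ∧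
      Module.End.IsSemisimple (Matrix.toLin' ((rA.map A.subtype).r φ)) := by
  have hd : 0 < d := Fin.pos_iff_nonempty.2 hr.nonempty
  have hc0 : c ≠ 0 := by
    rintro rfl
    have h1 : r.r (φ ^ k) * r.r (φ ^ k)⁻¹ = 1 := by rw [← map_mul, mul_inv_cancel, map_one]
    rw [hc, zero_smul, zero_mul] at h1
    have := congrFun (congrFun h1 ⟨0, hd⟩) ⟨0, hd⟩
    simp at this
  -- The twist by `φ ↦ α⁻¹`, where `α ^ k = c`, has finite image.
  obtain ⟨α, hα⟩ := IsAlgClosed.exists_pow_nat_eq c hk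
  have hα0 : α ≠ 0 := by
    rintro rfl
    rw [zero_pow hk.ne'] at hα
    exact hc0 hα.symm
  have hαA : α ∈ A := hint _ (IsIntegral.of_pow hk (by
    rw [hα]; exact isIntegral_algebraMap (x := (⟨c, hcA⟩ : A))))
  have hαA' : α⁻¹ ∈ A := hint _ (IsIntegral.of_pow hk (by
    rw [inv_pow, hα]; exact isIntegral_algebraMap (x := (⟨c⁻¹, hcA'⟩ : A))))
  let αA : Aˣ := ⟨⟨α, hαA⟩, ⟨α⁻¹, hαA'⟩, Subtype.ext (mul_inv_cancel₀ hα0),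
    Subtype.ext (inv_mul_cancel₀ hα0)⟩
  let αK : Kˣ := Units.map (A.subtype : A →* K) αA
  have hαK : (αK : K) = α := rfl
  have hsφ : (r.twist αK⁻¹).r (φ ^ k) = 1 := by
    have h1 : frobVal (φ ^ k) = k := by
      have := frobVal_zpow φ k
      rwa [zpow_natCast, hφ, mul_one] at this
    rw [twist_apply, hc, h1, zpow_natCast, smul_smul, ← hα, ← hαK, ← Units.val_pow_eq_pow_val,
      ← Units.val_mul, ← mul_pow, inv_mul_cancel, one_pow, Units.val_one, one_smul]
  have hsfin := (r.twist αK⁻¹).finite_range hφ hk hsφ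
  have hLc : IsAlgClosed (algebraicClosure ℚ K) := (algebraicClosure.isAlgClosure ℚ K).isAlgClosed
  obtain ⟨R, hR, hiso⟩ := (isFull_twist αK⁻¹ hr.isFull).exists_descent (algebraicClosure ℚ K) hd
    hsfin
  have hRfin : (Set.range R).Finite := by
    have hinj : Function.Injective
        (fun M : Matrix (Fin d) (Fin d) (algebraicClosure ℚ K) =>
          M.map (algebraMap (algebraicClosure ℚ K) K)) :=
      Matrix.map_injective (algebraMap (algebraicClosure ℚ K) K).injective
    refine Set.Finite.of_finite_image ?_ hinj.injOn
    obtain ⟨P, Q, h1, h2, h3⟩ := hiso.symm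
    refine (hsfin.image fun M => P * M * Q).subset ?_
    rintro _ ⟨_, ⟨g, rfl⟩, rfl⟩
    exact ⟨_, ⟨g, rfl⟩, (RepIso.eq_conj h1 h3 g).symm⟩
  -- Algebraic numbers are integral over `ℚ ⊆ A`, hence lie in `A`.
  have hQA : ∀ x : algebraicClosure ℚ K, (x : K) ∈ A := by
    intro x
    refine hint _ ?_
    obtain ⟨f, hf, h0⟩ := ((mem_algebraicClosure_iff).1 x.2).isIntegral
    have hQ : ∀ q : ℚ, (q : K) ∈ A := by
      intro q
      rw [Rat.cast_def, div_eq_mul_inv]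
      exact A.mul_mem (intCast_mem _ _) (hA _ q.pos)
    let j : ℚ →+* A := (algebraMap ℚ K).codRestrict A hQ
    refine ⟨f.map j, hf.map _, ?_⟩
    rw [eval₂_map]
    exact h0
  let j : algebraicClosure ℚ K →+* A :=
    (algebraMap (algebraicClosure ℚ K) K).codRestrict A hQA
  let rL : InertiaFiniteRep w (Fin d) (algebraicClosure ℚ K) :=
    ⟨R, hRfin.subset (Set.image_subset_range _ _)⟩
  -- Twisting back by `φ ↦ α`.
  have hkey : RepIso r.r (((rL.map j).twist αA).map A.subtype).r := by
    rw [map_twist]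
    have h1 := RepIso.twist (r := r.twist αK⁻¹) (r' := (rL.map j).map A.subtype) αK hiso
    rwa [twist_inv_twist] at h1
  refine ⟨(rL.map j).twist αA, hkey, isFull_twist αA (hR.mapRep j), ?_⟩
  obtain ⟨P, Q, h1, h2, h3⟩ := hkey.symm
  have h4 : (((rL.map j).twist αA).map A.subtype).r φ ^ k = c • 1 := by
    rw [← map_pow, RepIso.eq_conj h1 h3, hc, Matrix.mul_smul, Matrix.mul_one, Matrix.smul_mul, h1]
  rw [isSemisimple_toLin'_iff]
  -- The image of `φ` is annihilated by the separable polynomial `X ^ k - c`.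
  refine ⟨X ^ k - C c, (separable_X_pow_sub_C c (by exact_mod_cast hk.ne') hc0).squarefree, ?_⟩
  simp only [map_sub, map_pow, aeval_X, aeval_C, h4, Algebra.algebraMap_eq_smul_one, sub_self]

/-- The constituents of a Weil–Deligne representation whose traces lie in an integrally closed
subring `A` are defined over `A`. -/
theorem exists_integral_models (hφ : frobVal φ = 1) {A : Subring K}
    (hA : ∀ n : ℕ, 0 < n → (n : K)⁻¹ ∈ A) (hint : ∀ x : K, IsIntegral A x → x ∈ A)
    {m : ℕ} {t d : Fin m → ℕ} (r : ∀ i, InertiaFiniteRep w (Fin (d i)) K) (ht : ∀ i, 0 < t i)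
    (hr : ∀ i, IsIrred (r i).r)
    (htr : ∀ g, ((sumWD fun i => sp (t i) (r i)).r g).trace ∈ A) (i : Fin m) :
    ∃ rA : InertiaFiniteRep w (Fin (d i)) A, RepIso (r i).r (rA.map A.subtype).r ∧ IsFull rA.r ∧
      Module.End.IsSemisimple (Matrix.toLin' ((rA.map A.subtype).r φ)) := by
  choose k hk c hc using fun i => InertiaFiniteRep.exists_pow_eq_smul_one hφ (hr i).isFull
  -- elements acting as scalars on all constituents act through elements of `A`
  have key : ∀ (g : WeilGroup F w) (b : Fin m → K), (∀ i, (r i).r g = b i • 1) → ∀ i, b i ∈ A := by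
    intro g b hb i
    -- The eigenvalues of `g`; their power sums are the traces of the powers of `g`.
    let β : (Σ i, Fin (t i) × Fin (d i)) → K := fun x => normChar w K g ^ (x.2.1 : ℕ) * b x.1
    have hβ : ∀ j : ℕ, ∑ x, β x ^ j = ((sumWD fun i => sp (t i) (r i)).r (g ^ j)).trace := by
      intro j
      rw [trace_sumWD_sp, Fintype.sum_sigma]
      refine Finset.sum_congr rfl fun i _ => ?_
      rw [Fintype.sum_prod_type]
      refine Finset.sum_congr rfl fun l _ => ?_
      rw [map_pow, map_pow (r i).r, hb, _root_.smul_pow, one_pow, Matrix.trace_smul,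
        Matrix.trace_one]
      simp only [β, Finset.sum_const, Finset.card_univ, Fintype.card_fin, smul_eq_mul,
        nsmul_eq_mul]
      ring
    have h1 := hint _ (isIntegral_of_power_sums A hA β (fun j _ => by rw [hβ]; exact htr _)
      ⟨i, ⟨⟨0, ht i⟩, ⟨0, Fin.pos_iff_nonempty.2 (hr i).nonempty⟩⟩⟩)
    simpa [β] using h1
  -- A common power of `φ` acting as a scalar on each constituent.
  set M := ∏ i, k i with hM
  choose e he using fun i => Finset.dvd_prod_of_mem k (Finset.mem_univ i)
  have hMs : ∀ i, (r i).r (φ ^ M) = (c i ^ e i) • 1 := by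
    intro i
    rw [hM, he, pow_mul, map_pow, hc, _root_.smul_pow, one_pow]
  have hMs' : ∀ i, (r i).r (φ ^ M)⁻¹ = (c i ^ e i)⁻¹ • 1 := by
    intro i
    have h1 : (r i).r (φ ^ M) * (r i).r (φ ^ M)⁻¹ = 1 := by rw [← map_mul, mul_inv_cancel, map_one]
    rw [hMs, Matrix.smul_mul, Matrix.one_mul] at h1
    have h0 : c i ^ e i ≠ 0 := by
      intro h0
      obtain ⟨y⟩ := (hr i).nonempty
      rw [h0, zero_smul] at h1
      simpa using congrFun (congrFun h1 y) y
    rw [← h1, smul_smul, inv_mul_cancel₀ h0, one_smul]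
  exact (r i).exists_integral_model hφ hA hint (hr i) (Finset.prod_pos fun i _ => hk i) (hMs i)
    (key _ _ hMs i) (key _ _ hMs' i)

end IntegralModel

/-! ### The monodromy filtration of a sum of `Sp_t(r)` -/

section Filtration

variable {F : Type*} [Field F] [NumberField F] {w : HeightOneSpectrum (𝓞 F)} {φ : WeilGroup F w}
  {Ω : Type*} [Field Ω] {I : Type*} [Fintype I] [DecidableEq I] {ι : I → Type*}
  [∀ i, Fintype (ι i)] [∀ i, DecidableEq (ι i)]

lemma sumWD_sp_r_mulVec (t : I → ℕ) (r : ∀ i, InertiaFiniteRep w (ι i) Ω) (g : WeilGroup F w)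
    (v : (Σ i, Fin (t i) × ι i) → Ω) (i : I) (l : Fin (t i)) (x : ι i) :
    ((sumWD fun i => sp (t i) (r i)).r g).mulVec v ⟨i, l, x⟩ =
      normChar w Ω g ^ (l : ℕ) * ((r i).r g).mulVec (fun y => v ⟨i, l, y⟩) x := by
  change (Matrix.blockDiagonal' fun i => (sp (t i) (r i)).r g).mulVec v ⟨i, l, x⟩ = _
  rw [Matrix.mulVec, dotProduct, Fintype.sum_sigma, Finset.sum_eq_single i]
  · rw [Fintype.sum_prod_type, Finset.sum_eq_single l]
    · rw [Matrix.mulVec, dotProduct, Finset.mul_sum]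
      refine Finset.sum_congr rfl fun y _ => ?_
      rw [Matrix.blockDiagonal'_apply_eq, sp_r_apply, if_pos rfl, mul_assoc]
    · intro l' _ hl'
      refine Finset.sum_eq_zero fun y _ => ?_
      rw [Matrix.blockDiagonal'_apply_eq, sp_r_apply, if_neg (Ne.symm hl'), zero_mul]
    · simp
  · intro i' _ hi'
    refine Finset.sum_eq_zero fun y _ => ?_
    rw [Matrix.blockDiagonal'_apply_ne _ _ _ (Ne.symm hi'), zero_mul]
  · simp

lemma sumWD_sp_N_mulVec (t : I → ℕ) (r : ∀ i, InertiaFiniteRep w (ι i) Ω)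
    (v : (Σ i, Fin (t i) × ι i) → Ω) (i : I) (l : Fin (t i)) (x : ι i) :
    (sumWD fun i => sp (t i) (r i)).N.mulVec v ⟨i, l, x⟩ =
      ∑ l' : Fin (t i), if (l : ℕ) = l' + 1 then v ⟨i, l', x⟩ else 0 := by
  change (Matrix.blockDiagonal' fun i => (sp (t i) (r i)).N).mulVec v ⟨i, l, x⟩ = _
  rw [Matrix.mulVec, dotProduct, Fintype.sum_sigma, Finset.sum_eq_single i]
  · rw [Fintype.sum_prod_type]
    refine Finset.sum_congr rfl fun l' _ => ?_
    simp only [Matrix.blockDiagonal'_apply_eq, sp_N_apply, ite_mul, one_mul, zero_mul]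
    by_cases h : (l : ℕ) = l' + 1 <;> simp [h]
  · intro i' _ hi'
    refine Finset.sum_eq_zero fun y _ => ?_
    rw [Matrix.blockDiagonal'_apply_ne _ _ _ (Ne.symm hi'), zero_mul]
  · simp

/-- `N ^ k` shifts every string by `k` places. -/
lemma sumWD_sp_N_pow_of_eq (t : I → ℕ) (r : ∀ i, InertiaFiniteRep w (ι i) Ω) (k : ℕ)
    (v : (Σ i, Fin (t i) × ι i) → Ω) (i : I) (l l' : Fin (t i)) (h : (l : ℕ) = l' + k) (x : ι i) :
    ((sumWD fun i => sp (t i) (r i)).N ^ k).mulVec v ⟨i, l, x⟩ = v ⟨i, l', x⟩ := by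
  induction k generalizing l with
  | zero => rw [pow_zero, Matrix.one_mulVec, Fin.ext (a := l) (b := l') h]
  | succ k ih =>
    have hl : (l' : ℕ) + k < t i := by have := l.2; omega
    rw [pow_succ', ← Matrix.mulVec_mulVec, sumWD_sp_N_mulVec, Finset.sum_eq_single ⟨l' + k, hl⟩]
    · rw [if_pos (by simp only; omega), ih _ rfl]
    · intro l'' _ hl''
      refine if_neg fun h' => hl'' (Fin.ext ?_)
      simp only
      omega
    · simp

lemma sumWD_sp_N_pow_of_lt (t : I → ℕ) (r : ∀ i, InertiaFiniteRep w (ι i) Ω) (k : ℕ)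
    (v : (Σ i, Fin (t i) × ι i) → Ω) (i : I) (l : Fin (t i)) (h : (l : ℕ) < k) (x : ι i) :
    ((sumWD fun i => sp (t i) (r i)).N ^ k).mulVec v ⟨i, l, x⟩ = 0 := by
  induction k generalizing l with
  | zero => omega
  | succ k ih =>
    rw [pow_succ', ← Matrix.mulVec_mulVec, sumWD_sp_N_mulVec]
    refine Finset.sum_eq_zero fun l' _ => ?_
    split_ifs with h'
    · exact ih _ (by omega)
    · rfl

/-- The rank of the powers of the monodromy operator counts the strings of given length. -/
lemma rank_sumWD_sp_N_pow (t : I → ℕ) (r : ∀ i, InertiaFiniteRep w (ι i) Ω) (k : ℕ) :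
    ((sumWD fun i => sp (t i) (r i)).N ^ k).rank = ∑ i, Fintype.card (ι i) * (t i - k) := by
  -- The kernel of `N ^ k` consists of the vectors vanishing in the places that `N ^ k` does not
  -- move out of their string; these places are indexed by `S`.
  let S : Type _ := {y : Σ i, Fin (t i) × ι i // (y.2.1 : ℕ) + k < t y.1}
  let B : ((Σ i, Fin (t i) × ι i) → Ω) →ₗ[Ω] (S → Ω) := LinearMap.funLeft Ω Ω Subtype.val
  have hB : Function.Surjective B :=
    LinearMap.funLeft_surjective_of_injective Ω Ω _ Subtype.val_injective
  have hker : LinearMap.ker ((sumWD fun i => sp (t i) (r i)).N ^ k).mulVecLin =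
      LinearMap.ker B := by
    ext v
    rw [LinearMap.mem_ker, LinearMap.mem_ker, Matrix.mulVecLin_apply]
    constructor
    · intro h
      funext y
      obtain ⟨⟨i, l, x⟩, hy⟩ := y
      change v ⟨i, l, x⟩ = 0
      rw [← sumWD_sp_N_pow_of_eq t r k v i ⟨l + k, hy⟩ l rfl x, h]
      rfl
    · intro h
      funext ⟨i, l, x⟩
      by_cases hl : (l : ℕ) < k
      · rw [sumWD_sp_N_pow_of_lt t r k v i l hl]; rfl
      · have hl' : (l : ℕ) - k < t i := by have := l.2; omega
        rw [sumWD_sp_N_pow_of_eq t r k v i l ⟨l - k, hl'⟩ (by simp only; omega) x]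
        exact congrFun h ⟨⟨i, ⟨l - k, hl'⟩, x⟩, by have := l.2; simp only; omega⟩
  have h1 := LinearMap.finrank_range_add_finrank_ker
    ((sumWD fun i => sp (t i) (r i)).N ^ k).mulVecLin
  have h2 := LinearMap.finrank_range_add_finrank_ker B
  rw [LinearMap.range_eq_top.2 hB, finrank_top, Module.finrank_fintype_fun_eq_card] at h2
  rw [hker] at h1
  have h3 : ((sumWD fun i => sp (t i) (r i)).N ^ k).rank = Fintype.card S := by
    rw [Matrix.rank]
    omega
  rw [h3, Fintype.card_subtype, Finset.card_filter, Fintype.sum_sigma]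
  refine Finset.sum_congr rfl fun i _ => ?_
  rw [Fintype.sum_prod_type]
  have h4 : ∀ l : Fin (t i), (∑ _y : ι i, if (l : ℕ) + k < t i then 1 else 0) =
      Fintype.card (ι i) * if (l : ℕ) + k < t i then 1 else 0 := fun l => by
    rw [Finset.sum_const, Finset.card_univ, smul_eq_mul]
  refine (Finset.sum_congr rfl fun l _ => (h4 l)).trans ?_
  rw [← Finset.mul_sum, Fin.sum_univ_eq_sum_range (fun l => if l + k < t i then 1 else 0),
    ← Finset.card_filter]
  congr 1
  have : (Finset.range (t i)).filter (fun l => l + k < t i) = Finset.range (t i - k) := by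
    ext l; simp; omega
  rw [this, Finset.card_range]

lemma mulVec_mem_monodromyFiltration {ι κ : Type*} [Fintype ι] [DecidableEq ι] [Fintype κ]
    [DecidableEq κ] {N : Matrix ι ι Ω} {N' : Matrix κ κ Ω} {P : Matrix ι κ Ω} (h : P * N' = N * P)
    {i : ℤ} {x : κ → Ω} (hx : x ∈ monodromyFiltration N' i) :
    P.mulVec x ∈ monodromyFiltration N i := by
  have hpow : ∀ k : ℕ, P * N' ^ k = N ^ k * P := by
    intro k
    induction k with
    | zero => rw [pow_zero, pow_zero, Matrix.mul_one, Matrix.one_mul]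
    | succ k ih =>
      rw [pow_succ, pow_succ, ← Matrix.mul_assoc, ih, Matrix.mul_assoc, h, ← Matrix.mul_assoc]
  have happ : ∀ (k : ℕ) (v : κ → Ω), (Matrix.toLin' N ^ k) (P.mulVec v) =
      P.mulVec ((Matrix.toLin' N' ^ k) v) := by
    intro k v
    rw [← Matrix.toLin'_pow, ← Matrix.toLin'_pow, Matrix.toLin'_apply, Matrix.toLin'_apply,
      Matrix.mulVec_mulVec, Matrix.mulVec_mulVec, hpow]
  suffices h' : monodromyFiltration N' i ≤
      (monodromyFiltration N i).comap (Matrix.toLin' P) from h' hx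
  refine iSup_le fun j => ?_
  rintro _ ⟨y, hy, rfl⟩
  refine Submodule.mem_iSup_of_mem j ⟨P.mulVec y, ?_, happ j y⟩
  have hy' : (Matrix.toLin' N' ^ (i + 2 * j + 1).toNat) y = 0 := hy
  change (Matrix.toLin' N ^ (i + 2 * j + 1).toNat) (P.mulVec y) = 0
  rw [happ, hy', Matrix.mulVec_zero]

lemma WeilDeligneRep.IsIso.isPure {ι κ : Type*} [Fintype ι] [DecidableEq ι] [Fintype κ]
    [DecidableEq κ] {D : WeilDeligneRep w ι Ω} {E : WeilDeligneRep w κ Ω} (h : D.IsIso E) {m : ℤ}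
    (hD : D.IsPure φ m) : E.IsPure φ m := by
  obtain ⟨P, Q, h1, h2, h3, h4⟩ := h
  have h4' : Q * D.N = E.N * Q := by
    calc Q * D.N = Q * D.N * (P * Q) := by rw [h1, Matrix.mul_one]
      _ = Q * (D.N * P) * Q := by simp only [Matrix.mul_assoc]
      _ = E.N * Q := by rw [← h4, ← Matrix.mul_assoc, h2, Matrix.one_mul]
  intro i α x hx hx' hα
  refine hD i α (P.mulVec x) (mulVec_mem_monodromyFiltration h4 hx) (fun h => hx' ?_) ?_
  · have := mulVec_mem_monodromyFiltration h4' h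
    rwa [Matrix.mulVec_mulVec, h2, Matrix.one_mulVec] at this
  · have := mulVec_mem_monodromyFiltration h4 hα
    rwa [Matrix.mulVec_sub, Matrix.mulVec_smul, Matrix.mulVec_mulVec, h3,
      ← Matrix.mulVec_mulVec] at this

/-- The `l`-th copy in `Sp_t(r)` lives in degree `t - 1 - 2 l` of the monodromy filtration. -/
lemma isWeilNumber_of_isPure {t : I → ℕ} {r : ∀ i, InertiaFiniteRep w (ι i) Ω} {m : ℤ}
    (h : (sumWD fun i => sp (t i) (r i)).IsPure φ m) {i : I} {v : ι i → Ω} (hv : v ≠ 0) {α : Ω}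
    (hα : ((r i).r φ).mulVec v = α • v) {l : ℕ} (hl : l < t i) :
    IsWeilNumber (resCard F w) (m + (t i - 1 - 2 * l)) (normChar w Ω φ ^ l * α) := by
  -- `x n` is the vector `v` in the `n`-th copy of `r i`, so that `N ^ k (x 0) = x k`.
  let x : ℕ → (Σ i, Fin (t i) × ι i) → Ω := fun n y =>
    if h : y.1 = i then (if (y.2.1 : ℕ) = n then v (h ▸ y.2.2) else 0) else 0
  have hx : ∀ n (l' : Fin (t i)) y, x n ⟨i, l', y⟩ = if (l' : ℕ) = n then v y else 0 :=
    fun n l' y => by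
    simp [x]
  have hx' : ∀ n i' (hi : i' ≠ i) l' y, x n ⟨i', l', y⟩ = 0 := fun n i' hi l' y => by
    simp [x, hi]
  set E := sumWD fun i => sp (t i) (r i) with hE
  have hEN : ∀ (k : ℕ) u, (Matrix.toLin' E.N ^ k) u = (E.N ^ k).mulVec u := fun k u => by
    rw [← Matrix.toLin'_pow, Matrix.toLin'_apply]
  have hNx : ∀ k, (E.N ^ k).mulVec (x 0) = x k := by
    intro k
    funext ⟨i', l', y⟩
    by_cases hi : i' = i
    · subst hi
      rw [hx]
      rcases lt_or_ge (l' : ℕ) k with hlk | hlk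
      · rw [sumWD_sp_N_pow_of_lt t r k _ i' l' hlk, if_neg (by omega)]
      · have hl'' : (l' : ℕ) - k < t i' := by have := l'.2; omega
        rw [sumWD_sp_N_pow_of_eq t r k _ i' l' ⟨l' - k, hl''⟩ (by simp only; omega), hx]
        congr 1
        simp only [eq_iff_iff]
        omega
    · rw [hx' _ _ hi]
      rcases lt_or_ge (l' : ℕ) k with hlk | hlk
      · rw [sumWD_sp_N_pow_of_lt t r k _ i' l' hlk]
      · have hl'' : (l' : ℕ) - k < t i' := by have := l'.2; omega
        rw [sumWD_sp_N_pow_of_eq t r k _ i' l' ⟨l' - k, hl''⟩ (by simp only; omega), hx' _ _ hi]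
  refine h _ _ (x l) ?_ ?_ ?_
  · refine Submodule.mem_iSup_of_mem l ⟨x 0, ?_, ?_⟩
    · have h1 : ((t i : ℤ) - 1 - 2 * l + 2 * l + 1).toNat = t i := by omega
      change (Matrix.toLin' E.N ^ _) (x 0) = 0
      rw [h1, hEN, hNx]
      funext ⟨i', l', y⟩
      by_cases hi : i' = i
      · subst hi
        rw [hx, if_neg (by have := l'.2; omega)]; rfl
      · rw [hx' _ _ hi]; rfl
    · rw [hEN, hNx]
  · -- elements of the previous step of the filtration have no component in the `l`-th copy
    obtain ⟨y, hy⟩ := Function.ne_iff.1 hv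
    intro hmem
    have hle : monodromyFiltration E.N ((t i : ℤ) - 1 - 2 * l - 1) ≤
        LinearMap.ker (LinearMap.proj (R := Ω) (φ := fun _ : (Σ i, Fin (t i) × ι i) => Ω)
          ⟨i, ⟨l, hl⟩, y⟩) := by
      refine iSup_le fun j => ?_
      rintro _ ⟨z, hz, rfl⟩
      replace hz : (Matrix.toLin' E.N ^ _) z = 0 := hz
      rw [LinearMap.mem_ker, LinearMap.proj_apply, hEN]
      rcases lt_or_ge l j with hlj | hlj
      · exact sumWD_sp_N_pow_of_lt t r j _ i _ hlj y
      · rw [hE, sumWD_sp_N_pow_of_eq t r j z i ⟨l, hl⟩ ⟨l - j, by omega⟩ (by simp only; omega)]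
        rw [hEN] at hz
        set k := ((t i : ℤ) - 1 - 2 * l - 1 + 2 * j + 1).toNat with hk
        have hlk : l - j + k < t i := by omega
        rw [← sumWD_sp_N_pow_of_eq t r k z i ⟨l - j + k, hlk⟩ ⟨l - j, by omega⟩ rfl, ← hE, hz]
        rfl
    have h0 := hle hmem
    rw [LinearMap.mem_ker, LinearMap.proj_apply, hx, if_pos rfl] at h0
    exact hy h0
  · have h0 : (E.r φ).mulVec (x l) - (normChar w Ω φ ^ l * α) • x l = 0 := by
      funext ⟨i', l', y⟩
      rw [Pi.sub_apply, hE, sumWD_sp_r_mulVec, Pi.smul_apply, Pi.zero_apply]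
      by_cases hi : i' = i
      · subst hi
        simp only [hx]
        by_cases hl' : (l' : ℕ) = l
        · simp only [if_pos hl']
          rw [hα, hl', Pi.smul_apply, smul_eq_mul, smul_eq_mul]
          ring
        · simp only [if_neg hl']
          have : ((r i').r φ).mulVec (fun _ => (0 : Ω)) = 0 := Matrix.mulVec_zero _
          rw [this]
          simp
      · simp only [hx' _ _ hi]
        have : ((r i').r φ).mulVec (fun _ => (0 : Ω)) = 0 := Matrix.mulVec_zero _
        rw [this]
        simp
    rw [h0]
    exact zero_mem _

end Filtration

/-! ### Rigidity of pure Weil–Deligne representations -/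

section Matching

variable {G : Type*} [Group G] {Ω : Type*} [Field Ω]

/-- Families of irreducible representations with the same sum of traces can be matched up to
isomorphism, so they have the same sums of isomorphism-invariant quantities. -/
theorem sum_eq_of_sum_trace_eq [CharZero Ω] {I J M : Type*} [AddCommMonoid M] {b : I → ℕ}
    {c : J → ℕ} (s : ∀ i, G →* Matrix (Fin (b i)) (Fin (b i)) Ω)
    (τ : ∀ j, G →* Matrix (Fin (c j)) (Fin (c j)) Ω)
    (hs : ∀ i, IsFull (s i)) (hτ : ∀ j, IsFull (τ j)) (hb : ∀ i, 0 < b i) (hc : ∀ j, 0 < c j)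
    (f : I → M) (f' : J → M) (hf : ∀ i j, RepIso (τ j) (s i) → f i = f' j)
    (A : Finset I) (B : Finset J)
    (h : ∀ g, ∑ i ∈ A, (s i g).trace = ∑ j ∈ B, (τ j g).trace) :
    ∑ i ∈ A, f i = ∑ j ∈ B, f' j := by
  classical
  induction A using Finset.induction_on generalizing B with
  | empty =>
    have h1 := h 1
    simp only [Finset.sum_empty, map_one, Matrix.trace_one, Fintype.card_fin] at h1
    have hB : B = ∅ := by
      by_contra hB
      obtain ⟨j, hj⟩ := Finset.nonempty_iff_ne_empty.2 hB
      have h2 : ∑ j ∈ B, c j = 0 := by exact_mod_cast h1.symm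
      exact (hc j).ne' (Finset.sum_eq_zero_iff.1 h2 j hj)
    rw [hB, Finset.sum_empty, Finset.sum_empty]
  | insert i A hi ih =>
    obtain ⟨j, hj, hij⟩ := exists_repIso_of_sum_trace_eq s τ _ B (fun i _ => hs i)
      (fun j _ => hτ j) h (Finset.mem_insert_self i A) (hb i)
    rw [Finset.sum_insert hi, ← Finset.add_sum_erase B f' hj, hf i j hij,
      ih (B.erase j) fun g => ?_]
    have h1 := h g
    rw [Finset.sum_insert hi, ← Finset.add_sum_erase B _ hj, hij.trace_eq g] at h1
    exact add_left_cancel h1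

end Matching

section Purity

variable {F : Type*} [Field F] [NumberField F] {w : HeightOneSpectrum (𝓞 F)} {φ : WeilGroup F w}
  {Ω : Type*} [Field Ω] [CharZero Ω] [IsAlgClosed Ω]

omit [IsAlgClosed Ω] in
/-- The weight of a Weil number is well defined, and multiplication by `q ^ (-l)` lowers it by
`2 l`. -/
lemma IsWeilNumber.weight_eq {q : ℕ} (hq : 1 < q) {a b : ℤ} {α : Ω} {l : ℕ}
    (h : IsWeilNumber q a α) (h' : IsWeilNumber q b ((q : Ω)⁻¹ ^ l * α)) : b = a - 2 * l := by
  let M := algebraicClosure ℚ Ω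
  have : Algebra.IsAlgebraic ℚ M := algebraicClosure.isAlgebraic ℚ Ω
  let e : M →ₐ[ℚ] ℂ := IsAlgClosed.lift
  have hα : α ∈ M := mem_algebraicClosure_iff.2
    ((IsFractionRing.isAlgebraic_iff ℤ ℚ Ω).1 h.1)
  let x : M := ⟨α, hα⟩
  have hw : ∀ {c : ℤ} {β : Ω} (hβ : β ∈ M), IsWeilNumber q c β →
      ‖e ⟨β, hβ⟩‖ = (q : ℝ) ^ ((c : ℝ) / 2) := by
    intro c β hβ hc
    have hle : Subfield.closure {β} ≤ M.toSubfield :=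
      Subfield.closure_le.2 (Set.singleton_subset_iff.2 hβ)
    exact hc.2.2 (e.toRingHom.comp (Subfield.inclusion hle))
  have hβ : (q : Ω)⁻¹ ^ l * α ∈ M := mul_mem (pow_mem (inv_mem (natCast_mem _ _)) _) hα
  have h1 : (⟨(q : Ω)⁻¹ ^ l * α, hβ⟩ : M) = (q : M)⁻¹ ^ l * x := Subtype.ext (by simp [x])
  have h2 := hw hβ h'
  rw [h1, map_mul, map_pow, map_inv₀, map_natCast, norm_mul, hw hα h, norm_pow, norm_inv,
    Complex.norm_natCast] at h2
  have hq0 : (0 : ℝ) < q := by exact_mod_cast (by omega : 0 < q)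
  rw [← Real.rpow_natCast, ← Real.rpow_neg_one, ← Real.rpow_mul hq0.le, ← Real.rpow_add hq0,
    Real.rpow_right_inj hq0 (by exact_mod_cast hq.ne')] at h2
  have h3 : (b : ℝ) = a - 2 * l := by linarith
  exact_mod_cast h3

/-- The twist of a representation by a power of the character `|Art⁻¹|`. -/
noncomputable def normTwist {ι Ω : Type*} [Fintype ι] [DecidableEq ι] [Field Ω] (l : ℕ)
    (ρ : WeilGroup F w →* Matrix ι ι Ω) : WeilGroup F w →* Matrix ι ι Ω where
  toFun g := normChar w Ω g ^ l • ρ g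
  map_one' := by simp
  map_mul' g h := by rw [map_mul, map_mul, mul_pow, smul_mul_smul_comm]

lemma normTwist_apply {ι Ω : Type*} [Fintype ι] [DecidableEq ι] [Field Ω] (l : ℕ)
    (ρ : WeilGroup F w →* Matrix ι ι Ω) (g : WeilGroup F w) :
    normTwist l ρ g = normChar w Ω g ^ l • ρ g := rfl

lemma IsFull.normTwist {ι Ω : Type*} [Fintype ι] [DecidableEq ι] [Field Ω] (l : ℕ)
    {ρ : WeilGroup F w →* Matrix ι ι Ω} (h : IsFull ρ) : IsFull (normTwist l ρ) := by
  rw [IsFull, eq_top_iff, ← h, Submodule.span_le]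
  rintro _ ⟨g, rfl⟩
  have h1 : ρ g = (normChar w Ω g ^ l)⁻¹ • PurityFamilies.normTwist l ρ g := by
    rw [normTwist_apply, smul_smul, inv_mul_cancel₀ (pow_ne_zero _ (normChar_ne_zero g)), one_smul]
  rw [h1]
  exact Submodule.smul_mem _ _ (Submodule.subset_span ⟨g, rfl⟩)

lemma RepIso.of_normTwist_zero {ι κ Ω : Type*} [Fintype ι] [DecidableEq ι] [Fintype κ]
    [DecidableEq κ] [Field Ω] {ρ : WeilGroup F w →* Matrix ι ι Ω}
    {τ : WeilGroup F w →* Matrix κ κ Ω} (h : RepIso (normTwist 0 ρ) (normTwist 0 τ)) :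
    RepIso ρ τ := by
  obtain ⟨P, Q, h1, h2, h3⟩ := h
  refine ⟨P, Q, h1, h2, fun g => ?_⟩
  have := h3 g
  rwa [normTwist_apply, normTwist_apply, pow_zero, one_smul, one_smul] at this

section Strings

variable {I J : Type*} [Fintype I] [DecidableEq I] [Fintype J] [DecidableEq J]
  {t d : I → ℕ} {t' d' : J → ℕ} {r : ∀ i, InertiaFiniteRep w (Fin (d i)) Ω}
  {r' : ∀ j, InertiaFiniteRep w (Fin (d' j)) Ω}

omit [IsAlgClosed Ω] [CharZero Ω] [DecidableEq J] [Fintype J] in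
/-- Purity, expressed through a constituent `τ` of the `l`-th copy of `r i`: the eigenvalues of
Frobenius on it determine its degree `t i - 1 - 2 l`. -/
lemma isWeilNumber_of_repIso {m : ℤ} (h : (sumWD fun i => sp (t i) (r i)).IsPure φ m)
    {κ : Type*} [Fintype κ] [DecidableEq κ] {τ : WeilGroup F w →* Matrix κ κ Ω} {i : I} {l : ℕ}
    (hl : l < t i) (hiso : RepIso (normTwist l (r i).r) τ) {v : κ → Ω} (hv : v ≠ 0) {β : Ω}
    (hβ : (τ φ).mulVec v = β • v) :
    IsWeilNumber (resCard F w) (m + (t i - 1 - 2 * l)) β := by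
  obtain ⟨P, Q, h1, h2, h3⟩ := hiso
  have hn : normChar w Ω φ ^ l ≠ 0 := pow_ne_zero _ (normChar_ne_zero φ)
  have hu : P.mulVec v ≠ 0 := by
    intro h0
    apply hv
    rw [← Matrix.one_mulVec v, ← h2, ← Matrix.mulVec_mulVec, h0, Matrix.mulVec_zero]
  have h4 : ((r i).r φ).mulVec (P.mulVec v) = ((normChar w Ω φ ^ l)⁻¹ * β) • P.mulVec v := by
    have h5 : (normTwist l (r i).r φ).mulVec (P.mulVec v) = β • P.mulVec v := by
      rw [Matrix.mulVec_mulVec, ← h3, ← Matrix.mulVec_mulVec, hβ, Matrix.mulVec_smul]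
    rw [normTwist_apply, Matrix.smul_mulVec] at h5
    rw [mul_smul, ← h5, smul_smul, inv_mul_cancel₀ hn, one_smul]
  have := isWeilNumber_of_isPure h hu h4 hl
  rwa [mul_inv_cancel_left₀ hn] at this

omit [IsAlgClosed Ω] [Fintype I] [Fintype J] in
/-- If the degrees in which a constituent occurs are determined by its isomorphism class, the
strings of two sums of `Sp_t(r)` with the same constituents can be matched: the start of a longest
string can only match the start of a string of the same length. -/
lemma exists_string_matching [Nonempty I] (hr : ∀ i, IsFull (r i).r) (hr' : ∀ j, IsFull (r' j).r)
    (hd : ∀ i, 0 < d i) (hd' : ∀ j, 0 < d' j) (ht : ∀ i, 0 < t i) (ht' : ∀ j, 0 < t' j)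
    (hdeg : ∀ i j (l : Fin (t i)) (l' : Fin (t' j)),
      RepIso (normTwist l (r i).r) (normTwist l' (r' j).r) →
        (t i - 1 - 2 * l : ℤ) = t' j - 1 - 2 * l') (A : Finset J) (B : Finset I)
    (h : ∀ g, ∑ j ∈ A, ∑ l : Fin (t' j), normChar w Ω g ^ (l : ℕ) * ((r' j).r g).trace =
      ∑ i ∈ B, ∑ l : Fin (t i), normChar w Ω g ^ (l : ℕ) * ((r i).r g).trace) :
    A.card = B.card ∧ ∃ f : J → I, (∀ j ∈ A, f j ∈ B) ∧ Set.InjOn f A ∧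
      ∀ j ∈ A, t (f j) = t' j ∧ RepIso (r (f j)).r (r' j).r := by
  induction hn : A.card generalizing A B with
  | zero =>
    have hA : A = ∅ := Finset.card_eq_zero.1 hn
    subst hA
    have h1 := h 1
    simp only [Finset.sum_empty, map_one, Matrix.trace_one, Fintype.card_fin, one_pow, one_mul,
      Finset.sum_const, Finset.card_univ, nsmul_eq_mul] at h1
    have hB : B = ∅ := by
      by_contra hB
      obtain ⟨i, hi⟩ := Finset.nonempty_iff_ne_empty.2 hB
      have h2 : ∑ i ∈ B, t i * d i = 0 := by exact_mod_cast h1.symm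
      exact (Nat.mul_pos (ht i) (hd i)).ne' (Finset.sum_eq_zero_iff.1 h2 i hi)
    subst hB
    exact ⟨rfl, fun _ => Classical.arbitrary I, by simp, by simp, by simp⟩
  | succ n ih =>
    have hA : A.Nonempty := Finset.card_pos.1 (by omega)
    obtain ⟨j, hj, hjmax⟩ := A.exists_max_image t' hA
    let s : ∀ x : Σ j, Fin (t' j), WeilGroup F w →* Matrix (Fin (d' x.1)) (Fin (d' x.1)) Ω :=
      fun x => normTwist x.2 (r' x.1).r
    let τ : ∀ x : Σ i, Fin (t i), WeilGroup F w →* Matrix (Fin (d x.1)) (Fin (d x.1)) Ω :=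
      fun x => normTwist x.2 (r x.1).r
    have hst : ∀ g, ∑ x ∈ A.sigma (fun _ => Finset.univ), (s x g).trace =
        ∑ x ∈ B.sigma (fun _ => Finset.univ), (τ x g).trace := by
      intro g
      rw [Finset.sum_sigma, Finset.sum_sigma]
      simpa only [s, τ, normTwist_apply, Matrix.trace_smul, smul_eq_mul] using h g
    obtain ⟨⟨i, l⟩, hi, hil⟩ := exists_repIso_of_sum_trace_eq s τ _ _
      (fun x _ => (hr' x.1).normTwist _) (fun x _ => (hr x.1).normTwist _) hst
      (i₀ := ⟨j, ⟨0, ht' j⟩⟩) (by simp [hj]) (hd' j)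
    have hiB : i ∈ B := by simpa using hi
    have h1 := hdeg i j l ⟨0, ht' j⟩ hil
    -- a longer string would give a constituent in a degree that does not occur
    have h2 : t i ≤ t' j := by
      obtain ⟨i', hi', himax⟩ := B.exists_max_image t ⟨i, hiB⟩
      obtain ⟨⟨j', l'⟩, hj', hjl⟩ := exists_repIso_of_sum_trace_eq τ s _ _
        (fun x _ => (hr x.1).normTwist _) (fun x _ => (hr' x.1).normTwist _) (fun g => (hst g).symm)
        (i₀ := ⟨i', ⟨0, ht i'⟩⟩) (by simp [hi']) (hd i')
      have hj'A : j' ∈ A := by simpa using hj'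
      have h3 := hdeg i' j' ⟨0, ht i'⟩ l' hjl.symm
      have h4 := hjmax j' hj'A
      have h5 := himax i hiB
      simp only at h3
      have h6 := l'.2
      by_contra hcon
      push_cast at h3
      omega
    simp only at h1
    push_cast at h1
    have hl0 : (l : ℕ) = 0 := by omega
    have hti : t i = t' j := by omega
    have hiso : RepIso (r i).r (r' j).r := by
      have hil' : RepIso (normTwist (l : ℕ) (r i).r) (normTwist 0 (r' j).r) := hil
      rw [hl0] at hil'
      exact hil'.of_normTwist_zero
    have hrest : ∀ g, ∑ j ∈ A.erase j, ∑ l : Fin (t' j),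
        normChar w Ω g ^ (l : ℕ) * ((r' j).r g).trace = ∑ i ∈ B.erase i, ∑ l : Fin (t i),
          normChar w Ω g ^ (l : ℕ) * ((r i).r g).trace := by
      intro g
      have h3 := h g
      rw [← Finset.add_sum_erase A _ hj, ← Finset.add_sum_erase B _ hiB, ← hiso.trace_eq g,
        hti] at h3
      exact add_left_cancel h3
    obtain ⟨hcard, f, hf1, hf2, hf3⟩ := ih (A.erase j) (B.erase i) hrest
      (by rw [Finset.card_erase_of_mem hj]; omega)
    obtain ⟨f', hj', hne⟩ : ∃ f' : J → I, f' j = i ∧ ∀ x, x ≠ j → f' x = f x :=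
      ⟨Function.update f j i, Function.update_self .., fun x hx => Function.update_of_ne hx ..⟩
    refine ⟨?_, f', ?_, ?_, ?_⟩
    · rw [Finset.card_erase_of_mem hiB] at hcard
      have := Finset.card_pos.2 ⟨i, hiB⟩
      omega
    · intro x hx
      by_cases hxj : x = j
      · rw [hxj, hj']; exact hiB
      · rw [hne x hxj]; exact Finset.mem_of_mem_erase (hf1 x (Finset.mem_erase.2 ⟨hxj, hx⟩))
    · intro x hx y hy hxy
      by_cases hxj : x = j <;> by_cases hyj : y = j
      · rw [hxj, hyj]
      · rw [hxj, hj', hne y hyj] at hxy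
        exact absurd hxy.symm (Finset.ne_of_mem_erase (hf1 y (Finset.mem_erase.2 ⟨hyj, hy⟩)))
      · rw [hyj, hj', hne x hxj] at hxy
        exact absurd hxy (Finset.ne_of_mem_erase (hf1 x (Finset.mem_erase.2 ⟨hxj, hx⟩)))
      · rw [hne x hxj, hne y hyj] at hxy
        exact hf2 (Finset.mem_coe.2 (Finset.mem_erase.2 ⟨hxj, hx⟩))
          (Finset.mem_coe.2 (Finset.mem_erase.2 ⟨hyj, hy⟩)) hxy
    · intro x hx
      by_cases hxj : x = j
      · subst hxj
        rw [hj']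
        exact ⟨hti, hiso⟩
      · rw [hne x hxj]
        exact hf3 x (Finset.mem_erase.2 ⟨hxj, hx⟩)

/-- The second moment of a string of length `n`, with degrees `n - 1 + c, n - 3 + c, …`. It is
smallest if the string is centred. -/
lemma three_mul_sum_sq (c : ℤ) (n : ℕ) :
    3 * ∑ l : Fin n, ((n - 1 + c : ℤ) - 2 * l) ^ 2 = 3 * n * c ^ 2 + n * (n - 1) * (n + 1) := by
  have key : ∀ (a : ℤ) (n : ℕ), 3 * ∑ l ∈ Finset.range n, (a - 2 * l) ^ 2 =
      3 * n * a ^ 2 - 6 * a * n * (n - 1) + 2 * (n - 1) * n * (2 * n - 1) := by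
    intro a n
    induction n with
    | zero => simp
    | succ n ih =>
      rw [Finset.sum_range_succ, mul_add, ih]
      push_cast
      ring
  rw [Fin.sum_univ_eq_sum_range (fun l => ((n - 1 + c : ℤ) - 2 * l) ^ 2), key]
  ring

/-- Three times the second moment of a centred string of length `t`, expressed through the ranks
`t - k` of the powers of its shift. -/
lemma sum_mul_truncated_sub {t n : ℕ} (h : t ≤ n) :
    ∑ k ∈ Finset.range n, 6 * (k : ℤ) * ((t - k : ℕ) : ℤ) = t * (t - 1) * (t + 1) := by
  have key : ∀ u ≤ t, ∑ k ∈ Finset.range u, 6 * (k : ℤ) * ((t - k : ℕ) : ℤ) =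
      3 * t * u * (u - 1) - (u - 1) * u * (2 * u - 1) := by
    intro u hu
    induction u with
    | zero => simp
    | succ u ih =>
      rw [Finset.sum_range_succ, ih (by omega), Nat.cast_sub (by omega)]
      push_cast
      ring
  rw [← Finset.sum_subset (Finset.range_subset_range.2 h), key t le_rfl]
  · ring
  · intro k _ hk
    rw [Finset.mem_range, not_lt] at hk
    rw [Nat.sub_eq_zero_of_le hk]
    simp

/-- A pure sum of `Sp_t(r)` has the smallest monodromy among the sums of `Sp_t(r)` with the same
traces: if the ranks of the powers of its monodromy operator do not exceed those of the other, the
two are isomorphic. The second moments of the degrees of the constituents are the same for both,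
while the ranks bound from below the part coming from the lengths of the strings; so the strings
on the other side are centred too. -/
theorem isIso_sumWD_sp_of_isPure [Nonempty J] (hφ : frobVal φ = 1) (hr : ∀ i, IsFull (r i).r)
    (hr' : ∀ j, IsFull (r' j).r) (hd : ∀ i, 0 < d i) (hd' : ∀ j, 0 < d' j) (ht : ∀ i, 0 < t i)
    (ht' : ∀ j, 0 < t' j) {m : ℤ} (hpure : (sumWD fun i => sp (t i) (r i)).IsPure φ m)
    (htr : ∀ g, ((sumWD fun i => sp (t i) (r i)).r g).trace =
      ((sumWD fun j => sp (t' j) (r' j)).r g).trace)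
    (hrank : ∀ k, ((sumWD fun i => sp (t i) (r i)).N ^ k).rank ≤
      ((sumWD fun j => sp (t' j) (r' j)).N ^ k).rank) :
    (sumWD fun j => sp (t' j) (r' j)).IsIso (sumWD fun i => sp (t i) (r i)) := by
  have hq : 1 < resCard F w := NumberField.HeightOneSpectrum.one_lt_absNorm w
  have hφq : normChar w Ω φ = (resCard F w : Ω)⁻¹ := by rw [normChar_apply, hφ, zpow_neg_one]
  simp only [trace_sumWD_sp] at htr
  let s : ∀ x : Σ j, Fin (t' j), WeilGroup F w →* Matrix (Fin (d' x.1)) (Fin (d' x.1)) Ω :=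
    fun x => normTwist x.2 (r' x.1).r
  let τ : ∀ x : Σ i, Fin (t i), WeilGroup F w →* Matrix (Fin (d x.1)) (Fin (d x.1)) Ω :=
    fun x => normTwist x.2 (r x.1).r
  have hst : ∀ g, ∑ x ∈ Finset.univ, (s x g).trace = ∑ x ∈ Finset.univ, (τ x g).trace := by
    intro g
    rw [Fintype.sum_sigma, Fintype.sum_sigma]
    simpa only [s, τ, normTwist_apply, Matrix.trace_smul, smul_eq_mul] using (htr g).symm
  -- `W j` is the degree of the first constituent of the string `j`, determined by the absolute
  -- values of its Frobenius eigenvalues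
  have hW : ∀ j, ∃ W : ℤ, ∀ i (l : Fin (t i)) (l' : Fin (t' j)),
      RepIso (normTwist l (r i).r) (normTwist l' (r' j).r) →
        (t i - 1 - 2 * l : ℤ) = W - 2 * l' := by
    intro j
    have : Nonempty (Fin (d' j)) := ⟨⟨0, hd' j⟩⟩
    obtain ⟨⟨i₀, l₀⟩, -, hil₀⟩ := exists_repIso_of_sum_trace_eq s τ _ _
      (fun x _ => (hr' x.1).normTwist _) (fun x _ => (hr x.1).normTwist _) hst
      (i₀ := ⟨j, ⟨0, ht' j⟩⟩) (Finset.mem_univ _) (hd' j)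
    obtain ⟨α, hα⟩ := Module.End.exists_eigenvalue (Matrix.toLin' ((r' j).r φ))
    obtain ⟨v, hv⟩ := hα.exists_hasEigenvector
    have hv1 : ((r' j).r φ).mulVec v = α • v := hv.apply_eq_smul
    have hvl : ∀ l : ℕ, (normTwist l (r' j).r φ).mulVec v = ((resCard F w : Ω)⁻¹ ^ l * α) • v := by
      intro l
      rw [normTwist_apply, Matrix.smul_mulVec, hv1, smul_smul, hφq]
    have h0 := isWeilNumber_of_repIso hpure l₀.2 hil₀ hv.2 (hvl 0)
    rw [pow_zero, one_mul] at h0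
    refine ⟨t i₀ - 1 - 2 * l₀, fun i l l' hiso => ?_⟩
    have h1 := isWeilNumber_of_repIso hpure l.2 hiso hv.2 (hvl l')
    have h2 := h0.weight_eq hq h1
    omega
  choose W hW using hW
  -- Both sides have the same constituents in the same degrees, hence the same second moment.
  have hmom := sum_eq_of_sum_trace_eq s τ (fun x => (hr' x.1).normTwist _)
    (fun x => (hr x.1).normTwist _) (fun x => hd' x.1) (fun x => hd x.1)
    (fun x => (d' x.1 : ℤ) * (W x.1 - 2 * x.2) ^ 2)
    (fun x => (d x.1 : ℤ) * (t x.1 - 1 - 2 * x.2) ^ 2) (by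
      rintro ⟨j, l'⟩ ⟨i, l⟩ hiso
      have h1 := hW j i l l' hiso
      obtain ⟨P, Q, h2, h3, -⟩ := hiso
      have h4 : d i = d' j := by simpa using card_eq_of_inverse h2 h3
      simp only
      rw [h1, h4]) Finset.univ Finset.univ hst
  rw [Fintype.sum_sigma, Fintype.sum_sigma] at hmom
  simp only [← Finset.mul_sum] at hmom
  have hE : ∑ j, (d' j : ℤ) * (3 * t' j * (W j - (t' j - 1)) ^ 2 + t' j * (t' j - 1) * (t' j + 1)) =
      ∑ i, (d i : ℤ) * (t i * (t i - 1) * (t i + 1)) := by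
    have h1 := congrArg (fun x => 3 * x) hmom
    simp only [Finset.mul_sum (a := (3 : ℤ)), mul_left_comm (3 : ℤ)] at h1
    simp only [← Finset.mul_sum] at h1
    refine Eq.trans (Finset.sum_congr rfl fun j _ => ?_) (h1.trans
      (Finset.sum_congr rfl fun i _ => ?_))
    · have := three_mul_sum_sq (W j - (t' j - 1)) (t' j)
      rw [← this]
      congr 3
      funext l
      ring
    · have := three_mul_sum_sq 0 (t i)
      simp only [add_zero] at this
      rw [this]
      ring
  -- The second moment of the pure side is at most that of the other side with its strings centred,
  -- by the inequality of ranks.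
  have hle : ∑ i, (d i : ℤ) * (t i * (t i - 1) * (t i + 1)) ≤
      ∑ j, (d' j : ℤ) * (t' j * (t' j - 1) * (t' j + 1)) := by
    let n := ∑ i, t i + ∑ j, t' j
    have hti : ∀ i, t i ≤ n := fun i => le_add_right
      (Finset.single_le_sum (f := t) (fun _ _ => Nat.zero_le _) (Finset.mem_univ i))
    have htj : ∀ j, t' j ≤ n := fun j => le_add_left
      (Finset.single_le_sum (f := t') (fun _ _ => Nat.zero_le _) (Finset.mem_univ j))
    have h1 : ∀ k, (∑ i, (d i : ℤ) * ((t i - k : ℕ) : ℤ)) ≤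
        ∑ j, (d' j : ℤ) * ((t' j - k : ℕ) : ℤ) := by
      intro k
      have := hrank k
      rw [rank_sumWD_sp_N_pow, rank_sumWD_sp_N_pow] at this
      simp only [Fintype.card_fin] at this
      exact_mod_cast this
    have h2 : ∑ k ∈ Finset.range n, 6 * (k : ℤ) * (∑ i, (d i : ℤ) * ((t i - k : ℕ) : ℤ)) ≤
        ∑ k ∈ Finset.range n, 6 * (k : ℤ) * (∑ j, (d' j : ℤ) * ((t' j - k : ℕ) : ℤ)) :=
      Finset.sum_le_sum fun k _ => mul_le_mul_of_nonneg_left (h1 k) (by positivity)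
    simp only [Finset.mul_sum, mul_left_comm _ ((d _ : ℕ) : ℤ), mul_left_comm _ ((d' _ : ℕ) : ℤ)]
      at h2
    rw [Finset.sum_comm, Finset.sum_comm (s := Finset.range n)] at h2
    simp only [← Finset.mul_sum] at h2
    simpa only [sum_mul_truncated_sub (hti _), sum_mul_truncated_sub (htj _)] using h2
  -- So there is no room for a shift: the strings of the other side are centred.
  have hW' : ∀ j, W j = t' j - 1 := by
    have h1 : ∑ j, (d' j : ℤ) * (3 * t' j * (W j - (t' j - 1)) ^ 2) ≤ 0 := by
      rw [Finset.sum_congr rfl fun j _ => mul_add _ _ _, Finset.sum_add_distrib] at hE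
      linarith
    have h0 : ∀ j ∈ Finset.univ, (0 : ℤ) ≤ d' j * (3 * t' j * (W j - (t' j - 1)) ^ 2) :=
      fun j _ => by positivity
    have h2 := (Finset.sum_eq_zero_iff_of_nonneg h0).1 (le_antisymm h1 (Finset.sum_nonneg h0))
    intro j
    have h3 := h2 j (Finset.mem_univ j)
    have h4 : (d' j : ℤ) ≠ 0 := by exact_mod_cast (hd' j).ne'
    have h5 : (t' j : ℤ) ≠ 0 := by exact_mod_cast (ht' j).ne'
    have h6 : (W j - (t' j - 1)) ^ 2 = 0 :=
      ((mul_eq_zero.1 h3).resolve_left h4 |> mul_eq_zero.1).resolve_left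
        (mul_ne_zero three_ne_zero h5)
    have := pow_eq_zero_iff (two_ne_zero) |>.1 h6
    omega
  have hI : Nonempty I := by
    obtain ⟨j⟩ := ‹Nonempty J›
    obtain ⟨⟨i, -⟩, -, -⟩ := exists_repIso_of_sum_trace_eq s τ _ _
      (fun x _ => (hr' x.1).normTwist _) (fun x _ => (hr x.1).normTwist _) hst
      (i₀ := ⟨j, ⟨0, ht' j⟩⟩) (Finset.mem_univ _) (hd' j)
    exact ⟨i⟩
  obtain ⟨hcard, f, -, hinj, hf⟩ := exists_string_matching hr hr' hd hd' ht ht'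
    (fun i j l l' h => by rw [← hW' j]; exact hW j i l l' h) Finset.univ Finset.univ
    (fun g => (htr g).symm)
  have hbij : Function.Bijective f := by
    rw [Fintype.bijective_iff_injective_and_card]
    exact ⟨fun x y h => hinj (by simp) (by simp) h, hcard⟩
  refine WeilDeligneRep.IsIso.trans (WeilDeligneRep.IsIso.sum fun j => ?_)
    (sumWD_reindex (Equiv.ofBijective f hbij) fun i => sp (t i) (r i))
  obtain ⟨h1, h2⟩ := hf j (Finset.mem_univ j)
  change (sp (t' j) (r' j)).IsIso (sp (t (f j)) (r (f j)))
  rw [h1]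
  exact sp_isIso _ h2.symm

end Strings

end Purity

/-! ### Minimal primes of Henselizations -/

section Henselization

section Monic

variable {A D : Type*} [CommRing A] (f : D → Polynomial A)

/-- The `A`-linear map on `MvPolynomial D A` reducing each power of the variable `x` modulo the
polynomial `f x`. -/
noncomputable def reduceMonic : MvPolynomial D A →ₗ[A] MvPolynomial D A :=
  (MvPolynomial.basisMonomials D A).constr A fun n : D →₀ ℕ =>
    n.prod fun x k => aeval (MvPolynomial.X x) ((Polynomial.X ^ k : Polynomial A) %ₘ f x)

lemma reduceMonic_monomial (n : D →₀ ℕ) :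
    reduceMonic f (MvPolynomial.monomial n 1) =
      n.prod fun x k => aeval (MvPolynomial.X x) ((Polynomial.X ^ k : Polynomial A) %ₘ f x) :=
  Module.Basis.constr_basis _ _ _ n

variable {f}

/-- Every element is congruent to its normal form. -/
lemma sub_reduceMonic_mem (p : MvPolynomial D A) :
    p - reduceMonic f p ∈ Ideal.span (Set.range fun x : D =>
      aeval (MvPolynomial.X x : MvPolynomial D A) (f x)) := by
  set I := Ideal.span (Set.range fun x : D => aeval (MvPolynomial.X x : MvPolynomial D A) (f x))
  induction p using MvPolynomial.induction_on' with
  | monomial n a =>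
    have h1 : MvPolynomial.monomial n a = a • MvPolynomial.monomial n (1 : A) := by
      rw [MvPolynomial.smul_monomial, smul_eq_mul, mul_one]
    rw [h1, map_smul, ← smul_sub]
    refine Submodule.smul_of_tower_mem I a ?_
    rw [← Ideal.Quotient.eq, reduceMonic_monomial, MvPolynomial.monomial_eq, map_one, one_mul,
      Finsupp.prod, Finsupp.prod, map_prod, map_prod]
    refine Finset.prod_congr rfl fun x _ => ?_
    rw [Ideal.Quotient.eq]
    have h2 : (MvPolynomial.X x : MvPolynomial D A) ^ n x -
        aeval (MvPolynomial.X x) ((Polynomial.X ^ n x : Polynomial A) %ₘ f x) =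
        aeval (MvPolynomial.X x) ((Polynomial.X ^ n x : Polynomial A) /ₘ f x) *
          aeval (MvPolynomial.X x : MvPolynomial D A) (f x) := by
      have h3 := congrArg (aeval (MvPolynomial.X x : MvPolynomial D A))
        (modByMonic_add_div (Polynomial.X ^ n x : Polynomial A) (f x))
      rw [map_add, map_mul, map_pow, aeval_X] at h3
      rw [← h3]
      ring
    rw [h2]
    exact I.mul_mem_left _ (Ideal.subset_span ⟨x, rfl⟩)
  | add p q hp hq =>
    have h1 : p + q - reduceMonic f (p + q) = (p - reduceMonic f p) + (q - reduceMonic f q) := by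
      rw [map_add]; ring
    rw [h1]
    exact I.add_mem hp hq

lemma reduceMonic_monomial_mul (hf : ∀ x, (f x).Monic) (hf1 : ∀ x, f x ≠ 1) {n : D →₀ ℕ} {x : D}
    (hx : n x = 0) (g : Polynomial A) :
    reduceMonic f (MvPolynomial.monomial n 1 * aeval (MvPolynomial.X x) g) =
      reduceMonic f (MvPolynomial.monomial n 1) * aeval (MvPolynomial.X x) (g %ₘ f x) := by
  classical
  induction g using Polynomial.induction_on' with
  | add p q hp hq => rw [map_add, mul_add, map_add, hp, hq, add_modByMonic, map_add, mul_add]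
  | monomial k a =>
    have h1 : (Polynomial.monomial k a : Polynomial A) = a • Polynomial.X ^ k := by
      rw [smul_X_eq_monomial]
    have h2 : MvPolynomial.monomial n (1 : A) * MvPolynomial.X x ^ k =
        MvPolynomial.monomial (n + Finsupp.single x k) 1 := by
      rw [MvPolynomial.X_pow_eq_monomial, MvPolynomial.monomial_mul, mul_one]
    rw [h1, map_smul, mul_smul_comm, map_smul, smul_modByMonic, map_smul, mul_smul_comm, map_pow,
      aeval_X, h2, reduceMonic_monomial, reduceMonic_monomial, Finsupp.prod_add_index_of_disjoint,
      Finsupp.prod_single_index]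
    · have : Nontrivial A := ⟨0, 1, fun h01 => hf1 x
        ((Polynomial.subsingleton_iff_subsingleton.2 (subsingleton_of_zero_eq_one h01)).elim _ _)⟩
      rw [pow_zero, (modByMonic_eq_self_iff (hf x)).2, map_one]
      rw [degree_one]
      exact (hf x).degree_pos.2 (hf1 x)
    · rw [Finset.disjoint_left]
      intro y hy hy'
      have := Finset.mem_singleton.1 (Finsupp.support_single_subset hy')
      subst this
      exact (Finsupp.mem_support_iff.1 hy) hx

/-- The normal form depends on the class of an element only. -/
lemma reduceMonic_eq_zero (hf : ∀ x, (f x).Monic) (hf1 : ∀ x, f x ≠ 1) {p : MvPolynomial D A}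
    (hp : p ∈ Ideal.span (Set.range fun x : D =>
      aeval (MvPolynomial.X x : MvPolynomial D A) (f x))) : reduceMonic f p = 0 := by
  suffices h : ∀ q, reduceMonic f (q * p) = 0 by simpa using h 1
  induction hp using Submodule.span_induction with
  | mem g hg =>
    obtain ⟨x, rfl⟩ := hg
    intro q
    induction q using MvPolynomial.induction_on' with
    | add p q hp hq => rw [add_mul, map_add, hp, hq, add_zero]
    | monomial n a =>
      have h1 : MvPolynomial.monomial n a = a • (MvPolynomial.monomial (n.erase x) (1 : A) *
          MvPolynomial.X x ^ n x) := by
        rw [MvPolynomial.X_pow_eq_monomial, MvPolynomial.monomial_mul, mul_one,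
          Finsupp.erase_add_single, MvPolynomial.smul_monomial, smul_eq_mul, mul_one]
      have h2 : (MvPolynomial.X x : MvPolynomial D A) ^ n x * aeval (MvPolynomial.X x) (f x) =
          aeval (MvPolynomial.X x) (Polynomial.X ^ n x * f x) := by
        rw [map_mul, map_pow, aeval_X]
      rw [h1, smul_mul_assoc, map_smul, mul_assoc, h2,
        reduceMonic_monomial_mul hf hf1 Finsupp.erase_same,
        (modByMonic_eq_zero_iff_dvd (hf x)).2 (dvd_mul_left _ _), map_zero, mul_zero, smul_zero]
  | zero => intro q; rw [mul_zero, map_zero]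
  | add a b _ _ ha hb => intro q; rw [mul_add, map_add, ha, hb, add_zero]
  | smul a b _ hb => intro q; rw [smul_eq_mul, ← mul_assoc, hb]

/-- Adjoining roots of monic polynomials to a domain creates no torsion, because every element has
a normal form. -/
theorem algebraMap_mem_nonZeroDivisors_of_monic [IsDomain A] (hf : ∀ x, (f x).Monic)
    (hf1 : ∀ x, f x ≠ 1) {a : A} (ha : a ≠ 0) :
    algebraMap A (MvPolynomial D A ⧸ Ideal.span (Set.range fun x : D =>
      aeval (MvPolynomial.X x : MvPolynomial D A) (f x))) a ∈ nonZeroDivisors _ := by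
  rw [mem_nonZeroDivisors_iff_right]
  intro y hy
  obtain ⟨p, rfl⟩ := Ideal.Quotient.mk_surjective y
  rw [mul_comm, ← Algebra.smul_def] at hy
  have h1 : a • p ∈ Ideal.span (Set.range fun x : D =>
      aeval (MvPolynomial.X x : MvPolynomial D A) (f x)) := Ideal.Quotient.eq_zero_iff_mem.1 hy
  have h2 := reduceMonic_eq_zero hf hf1 h1
  rw [map_smul, smul_eq_zero] at h2
  have h3 := sub_reduceMonic_mem (f := f) p
  rw [h2.resolve_left ha, sub_zero] at h3
  exact Ideal.Quotient.eq_zero_iff_mem.2 h3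

end Monic

lemma algebraMap_henselization (A : Type*) [CommRing A] [IsLocalRing A] (a : A) :
    algebraMap A (Henselization A) a = algebraMap (HenselRing A)
      (Localization.AtPrime (HenselRing.point A)) (algebraMap A (HenselRing A) a) :=
  IsScalarTower.algebraMap_apply A (HenselRing A) (Localization.AtPrime (HenselRing.point A)) a

/-- A domain `A` injects into the quotient of its Henselization by any minimal prime. The
Henselization is a localization of `HenselRing A`, which arises from `A` by adjoining roots of monic
polynomials, so nonzero elements of `A` are not zero divisors in it. -/
lemma algebraMap_notMem_of_mem_minimalPrimes {A : Type*} [CommRing A] [IsLocalRing A] [IsDomain A]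
    {a : A} (ha : a ≠ 0) {𝔞 : Ideal (Henselization A)} (h : 𝔞 ∈ minimalPrimes (Henselization A)) :
    algebraMap A (Henselization A) a ∉ 𝔞 := by
  intro hmem
  refine notMem_nonZeroDivisors_of_mem_mem_minimalPrimes hmem h ?_
  have h1 : algebraMap A (HenselRing A) a ∈ nonZeroDivisors (HenselRing A) := by
    refine algebraMap_mem_nonZeroDivisors_of_monic (fun x : HenselDatum A => x.2.1)
      (fun x hx => ?_) ha
    have h2 := x.2.2.1
    rw [hx, eval_one] at h2
    exact (IsLocalRing.maximalIdeal.isMaximal A).ne_top ((Ideal.eq_top_iff_one _).2 h2)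
  rw [algebraMap_henselization]
  exact IsLocalization.nonZeroDivisors_le_comap (HenselRing.point A).primeCompl
    (Localization.AtPrime (HenselRing.point A)) h1

variable {F : Type*} [Field F] [NumberField F] {w : HeightOneSpectrum (𝓞 F)}
  {p : ℕ} [Fact p.Prime] {𝒪 : Type u} [CommRing 𝒪] [Algebra ℤ_[p] 𝒪] {n : ℕ}
  {e : AlgebraicClosure F →ₐ[F] Kbar F w} {φ : WeilGroup F w}
  {z : RootSystem p w} {T : Fin n → GalGlobal F → 𝒪}

/-- The base of an element of the purity locus injects into the quotient of the Henselization by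
any minimal prime. -/
lemma PurityLocus.mk_comp_h_injective (x : PurityLocus.{u, v, _} e φ z T) {𝔞 : Ideal x.Rh}
    (h : 𝔞 ∈ minimalPrimes x.Rh) :
    Function.Injective ((Ideal.Quotient.mk 𝔞).comp x.h) := by
  rw [injective_iff_map_eq_zero]
  intro a ha
  by_contra h0
  have h1 : algebraMap x.R (Localization.AtPrime x.𝔭) a ≠ 0 := by
    rw [Ne, ← map_zero (algebraMap x.R (Localization.AtPrime x.𝔭)),
      (IsLocalization.injective (Localization.AtPrime x.𝔭)
        x.𝔭.primeCompl_le_nonZeroDivisors).eq_iff]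
    exact h0
  exact algebraMap_notMem_of_mem_minimalPrimes h1 h (Ideal.Quotient.eq_zero_iff_mem.1 ha)

end Henselization

/-! ### Fraction fields of integral closures -/

section Extension

variable {p : ℕ} {R : Type*} [CommRing R] [IsDomain R]

lemma intalVal_intalOf (a : R) : intalVal p R (intalOf p R a) = algebraMap R (Qbar R) a := rfl

lemma intalVal_injective : Function.Injective (intalVal p R) := Subtype.val_injective

/-- A homomorphism from `intal p R` to a field that is injective on `R` extends to the algebraic
closure of the fraction field of `R`. -/
theorem exists_extension {K : Type*} [Field K] (θ : intal p R →+* K)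
    (h : Function.Injective (θ.comp (intalOf p R))) :
    ∃ g : Qbar R →+* K, g.comp (intalVal p R) = θ := by
  let _ : Algebra R (intal p R) := (intalOf p R).toAlgebra
  let _ : Algebra (intal p R) (Qbar R) := (intalVal p R).toAlgebra
  have htower : IsScalarTower R (intal p R) (Qbar R) := IsScalarTower.of_algebraMap_eq fun _ => rfl
  have hfaith : FaithfulSMul (intal p R) (Qbar R) :=
    (faithfulSMul_iff_algebraMap_injective _ _).2 intalVal_injective
  have halg : Algebra.IsAlgebraic R (Qbar R) :=
    (IsFractionRing.comap_isAlgebraic_iff (K := FractionRing R)).2 inferInstance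
  -- Every element of `Qbar R` is a quotient of an element of `intal p R` by an element of `R`.
  have hfrac : IsFractionRing (intal p R) (Qbar R) := by
    refine IsFractionRing.of_field _ _ fun y => ?_
    obtain ⟨a, ha, hay⟩ := (halg.isAlgebraic y).exists_integral_multiple
    refine ⟨⟨a • y, Subring.subset_closure (Or.inl hay)⟩, intalOf p R a, ?_⟩
    have ha' : algebraMap R (Qbar R) a ≠ 0 := by
      rw [Ne, ← map_zero (algebraMap R (Qbar R)), algebraMap_Qbar_injective.eq_iff]
      exact ha
    change y = (a • y) / algebraMap R (Qbar R) a
    rw [Algebra.smul_def, mul_div_cancel_left₀ _ ha']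
  -- A nonzero element `y` of `intal p R` divides a nonzero element of `R`.
  have hinj : Function.Injective θ := by
    rw [injective_iff_map_eq_zero]
    intro y hy
    by_contra hy0
    have hdom : IsDomain (intal p R) := inferInstanceAs (IsDomain (intalSubring p R))
    have hyalg : IsAlgebraic R y :=
      (isAlgebraic_algebraMap_iff (intalVal_injective (p := p) (R := R))).1 (halg.isAlgebraic _)
    obtain ⟨a, ha, c, hc⟩ := hyalg.exists_nonzero_dvd (mem_nonZeroDivisors_of_ne_zero hy0)
    apply ha
    apply h
    rw [map_zero]
    change θ (algebraMap R (intal p R) a) = 0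
    rw [hc, map_mul, hy, zero_mul]
  exact ⟨IsFractionRing.lift hinj, RingHom.ext fun y => IsFractionRing.lift_algebraMap hinj y⟩

end Extension

/-! ### Weil–Deligne representations in families -/

section Families

variable {F : Type*} [Field F] [NumberField F] {w : HeightOneSpectrum (𝓞 F)} {φ : WeilGroup F w}
  {p : ℕ} [Fact p.Prime] {z : RootSystem p w}

lemma FrobSemisimpleWDIso.trace_eq {ι κ Ω : Type*} [Fintype ι] [DecidableEq ι] [Fintype κ]
    [DecidableEq κ] [Field Ω] [CharZero Ω] [Algebra ℤ_[p] Ω] (hφ : frobVal φ = 1)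
    {ρ : WeilGroup F w →* Matrix ι ι Ω} {E : WeilDeligneRep w κ Ω}
    (h : FrobSemisimpleWDIso φ z ρ E) (g : WeilGroup F w) : (ρ g).trace = (E.r g).trace := by
  obtain ⟨D, D', hD, hD', hE⟩ := h
  rw [hD.trace_eq, ← hD'.trace_eq hφ, hE.repIso.trace_eq]

lemma WeilDeligneRep.IsIso.rank_N_pow_le {ι κ Ω : Type*} [Fintype ι] [DecidableEq ι] [Fintype κ]
    [DecidableEq κ] [Field Ω] {D : WeilDeligneRep w ι Ω} {E : WeilDeligneRep w κ Ω} (h : D.IsIso E)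
    (k : ℕ) : (D.N ^ k).rank ≤ (E.N ^ k).rank := by
  obtain ⟨P, Q, h1, h2, -, h4⟩ := h
  have h5 : D.N ^ k * P = P * E.N ^ k := by
    induction k with
    | zero => rw [pow_zero, pow_zero, Matrix.mul_one, Matrix.one_mul]
    | succ k ih => rw [pow_succ', Matrix.mul_assoc, ih, ← Matrix.mul_assoc, ← h4,
        Matrix.mul_assoc, ← pow_succ']
  have h6 : D.N ^ k = P * (E.N ^ k * Q) := by
    rw [← Matrix.mul_assoc, ← h5, Matrix.mul_assoc, h1, Matrix.mul_one]
  rw [h6]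
  exact (Matrix.rank_mul_le_right _ _).trans (Matrix.rank_mul_le_left _ _)

lemma InertiaFiniteRep.map_map {ι A B C : Type*} [Fintype ι] [DecidableEq ι] [CommRing A]
    [CommRing B] [CommRing C] (f : A →+* B) (g : B →+* C) (r : InertiaFiniteRep w ι A) :
    (r.map f).map g = r.map (g.comp f) := rfl

variable {𝒪 : Type*} [CommRing 𝒪] [IsDomain 𝒪] [Algebra ℤ_[p] 𝒪]

lemma algebraMap_padicInt_Qbar_injective (h𝒪 : Function.Injective (algebraMap ℤ_[p] 𝒪)) :
    Function.Injective (algebraMap ℤ_[p] (Qbar 𝒪)) := by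
  rw [IsScalarTower.algebraMap_eq ℤ_[p] 𝒪 (Qbar 𝒪)]
  exact algebraMap_Qbar_injective.comp h𝒪

/-- The constituents of the Weil–Deligne representation attached to a monodromic representation
with traces in `𝒪` are defined over `intal p 𝒪`. -/
theorem IsMonodromic.exists_integral_strings (hw : (p : 𝓞 F) ∉ w.asIdeal) (hφ : frobVal φ = 1)
    (h𝒪 : Function.Injective (algebraMap ℤ_[p] 𝒪)) {ι : Type*} [Fintype ι] [DecidableEq ι]
    {σ : WeilGroup F w →* Matrix ι ι (Qbar 𝒪)} (hσ : IsMonodromic z σ) {T : WeilGroup F w → 𝒪}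
    (hT : ∀ g, algebraMap 𝒪 (Qbar 𝒪) (T g) = (σ g).trace) :
    ∃ (m : ℕ) (t d : Fin m → ℕ) (r : ∀ i, InertiaFiniteRep w (Fin (d i)) (intal p 𝒪)),
      (∀ i, 0 < t i) ∧ (∀ i, 0 < d i) ∧ (∀ i, IsFull (r i).r) ∧
      (∀ i, Module.End.IsSemisimple (Matrix.toLin' (((r i).map (intalVal p 𝒪)).r φ))) ∧
      FrobSemisimpleWDIso φ z σ (sumWD fun i => sp (t i) ((r i).map (intalVal p 𝒪))) := by
  have hinj := algebraMap_padicInt_Qbar_injective h𝒪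
  have hchar : CharZero (Qbar 𝒪) := charZero_of_injective hinj
  obtain ⟨N, hN⟩ := hσ
  obtain ⟨D, hD⟩ := hN.exists_isWDParametrization hw hφ hinj
  obtain ⟨D', hD'⟩ := D.exists_isFrobSemisimplification hφ
  obtain ⟨m, t, d, r, ht, hr, hiso⟩ := D'.exists_isIso_sumWD_sp hφ (hD'.isSemisimple hφ)
  have hp : (p : Qbar 𝒪) ≠ 0 := by exact_mod_cast (Fact.out : p.Prime).ne_zero
  choose rA h1 h2 h3 using exists_integral_models hφ
    (fun n hn => natCast_inv_mem_intalSubring h𝒪 hn)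
    (fun x hx => mem_intalSubring_of_isIntegral hp hx) r ht hr (fun g => by
      rw [← hiso.repIso.trace_eq, hD'.trace_eq hφ, ← hD.trace_eq, ← hT]
      exact (intalOf p 𝒪 (T g)).2)
  exact ⟨m, t, d, rA, ht, fun i => Fin.pos_iff_nonempty.2 (hr i).nonempty, h2, h3, D, D', hD, hD',
    hiso.trans (WeilDeligneRep.IsIso.sum fun i => sp_isIso (t i) (h1 i))⟩

/-- The traces of a sum of `Sp_t(r)` over a ring in which `q` is a unit. -/
lemma trace_sumWD_sp_map {A K : Type*} [CommRing A] [Field K] [CharZero K] {q : Aˣ}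
    (hq : (q : A) = resCard F w) {m : ℕ} {t d : Fin m → ℕ}
    (r : ∀ i, InertiaFiniteRep w (Fin (d i)) A) (f : A →+* K) (g : WeilGroup F w) :
    ((sumWD fun i => sp (t i) ((r i).map f)).r g).trace = f (∑ i, ∑ l : Fin (t i),
      ((q ^ (-frobVal g) : Aˣ) : A) ^ (l : ℕ) * ((r i).r g).trace) := by
  rw [trace_sumWD_sp, map_sum]
  refine Finset.sum_congr rfl fun i _ => ?_
  rw [map_sum]
  refine Finset.sum_congr rfl fun l _ => ?_
  have h1 : f ((q ^ (-frobVal g) : Aˣ) : A) = normChar w K g := by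
    have h2 := congrArg Units.val (map_zpow (Units.map (f : A →* K)) q (-frobVal g))
    rw [Units.val_zpow_eq_zpow_val] at h2
    rw [normChar_apply, ← map_natCast f, ← hq]
    exact h2
  rw [map_mul, map_pow, h1]
  congr 1
  exact (AddMonoidHom.map_trace (f : A →+ K) _).symm

variable {m : ℕ} {t d : Fin m → ℕ} {r : ∀ i, InertiaFiniteRep w (Fin (d i)) (intal p 𝒪)}
  {K : Type*} [Field K] [CharZero K]

/-- The traces of a sum of `Sp_t(r)` over `intal p 𝒪` are compatible with specialization. -/
lemma trace_specialization (h𝒪 : Function.Injective (algebraMap ℤ_[p] 𝒪))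
    (θ : intal p 𝒪 →+* K) {g : WeilGroup F w} {a : 𝒪}
    (h : ((sumWD fun i => sp (t i) ((r i).map (intalVal p 𝒪))).r g).trace =
      algebraMap 𝒪 (Qbar 𝒪) a) :
    ((sumWD fun i => sp (t i) ((r i).map θ)).r g).trace = θ (intalOf p 𝒪 a) := by
  have hchar : CharZero (Qbar 𝒪) := charZero_of_injective (algebraMap_padicInt_Qbar_injective h𝒪)
  have hq : 0 < resCard F w :=
    (NumberField.HeightOneSpectrum.one_lt_absNorm w).trans' one_pos
  obtain ⟨y, hy⟩ : ∃ y : intal p 𝒪, intalVal p 𝒪 y = (resCard F w : Qbar 𝒪)⁻¹ :=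
    ⟨⟨_, natCast_inv_mem_intalSubring h𝒪 hq⟩, rfl⟩
  have hqy : (resCard F w : intal p 𝒪) * y = 1 := intalVal_injective (by
    rw [map_mul, map_natCast, map_one, hy]
    exact mul_inv_cancel₀ (by exact_mod_cast hq.ne'))
  let q : (intal p 𝒪)ˣ := ⟨(resCard F w : intal p 𝒪), y, hqy, by rw [mul_comm, hqy]⟩
  rw [trace_sumWD_sp_map (q := q) rfl] at h ⊢
  rw [intalVal_injective (h.trans (intalVal_intalOf a).symm)]

section Fibres

variable [IsAlgClosed K] [Algebra ℤ_[p] K] {G : Type*} [Group G] {c : WeilGroup F w →* G}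
  {ι κ : Type*} [Fintype ι] [DecidableEq ι] [Fintype κ] [DecidableEq κ] {T : G → 𝒪}
  {σ : G →* Matrix ι ι (Qbar 𝒪)}

/-- At a pure specialization, the Weil–Deligne representation is the specialization of the sum of
`Sp_t(r)` describing the generic one. -/
theorem specialize_of_isPureRep (hw : (p : 𝓞 F) ∉ w.asIdeal) (hφ : frobVal φ = 1)
    (h𝒪 : Function.Injective (algebraMap ℤ_[p] 𝒪))
    (hT : ∀ g, algebraMap 𝒪 (Qbar 𝒪) (T g) = (σ g).trace) (ht : ∀ i, 0 < t i)
    (hd : ∀ i, 0 < d i) (hr : ∀ i, IsFull (r i).r)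
    (hE : FrobSemisimpleWDIso φ z (σ.comp c)
      (sumWD fun i => sp (t i) ((r i).map (intalVal p 𝒪))))
    (hinj : Function.Injective (algebraMap ℤ_[p] K)) (θ : intal p 𝒪 →+* K)
    {ρ : G →* Matrix κ κ K} (hρ : IsIrred ρ)
    (htr : ∀ g, θ (intalOf p 𝒪 (T g)) = (ρ g).trace) {k : ℤ} (hpure : IsPureRep φ z k (ρ.comp c)) :
    FrobSemisimpleWDIso φ z (ρ.comp c) (sumWD fun i => sp (t i) ((r i).map θ)) := by
  have hinj' := algebraMap_padicInt_Qbar_injective h𝒪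
  have hchar : CharZero (Qbar 𝒪) := charZero_of_injective hinj'
  have htrE : ∀ g, ((sumWD fun i => sp (t i) ((r i).map θ)).r g).trace = (ρ (c g)).trace := by
    intro g
    rw [trace_specialization h𝒪 θ (a := T (c g)), htr]
    rw [← hE.trace_eq hφ, hT]
    rfl
  obtain ⟨D, D', hD, hD', hp⟩ := hpure
  obtain ⟨m₀, t₀, d₀, r₀, ht₀, hr₀, hiso⟩ := D'.exists_isIso_sumWD_sp hφ (hD'.isSemisimple hφ)
  have hm : Nonempty (Fin m) := by
    by_contra hm
    rw [not_nonempty_iff] at hm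
    have h1 := htrE 1
    rw [trace_sumWD_sp, Fintype.sum_empty, map_one, map_one, Matrix.trace_one] at h1
    have := hρ.nonempty
    exact Fintype.card_ne_zero (α := κ) (by exact_mod_cast h1.symm)
  refine ⟨D, D', hD, hD', hiso.trans (WeilDeligneRep.IsIso.symm ?_)⟩
  refine isIso_sumWD_sp_of_isPure hφ (fun i => (hr₀ i).isFull) (fun i => (hr i).mapRep θ)
    (fun i => Fin.pos_iff_nonempty.2 (hr₀ i).nonempty) hd ht₀ ht (hiso.isPure hp) (fun g => ?_)
    (fun k => ?_)
  · rw [htrE, ← hiso.repIso.trace_eq, hD'.trace_eq hφ, ← hD.trace_eq]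
    rfl
  · -- the ranks of the powers of the monodromy operator drop under specialization
    obtain ⟨Dσ, Dσ', hDσ, hDσ', hisoσ⟩ := hE
    obtain ⟨τ, hτ⟩ := HasMonodromy.exists_rank_pow hw hφ hinj hinj' hD.1 hDσ.1
    have h1 := hρ.isFull.rank_le (θ.comp (intalOf p 𝒪)) (algebraMap_Qbar_injective (R := 𝒪)) htr hT
      ((MonoidAlgebra.single (c τ) 1 - 1) ^ k)
    simp only [map_pow, map_sub, map_one, intRep_single, one_smul] at h1
    calc ((sumWD fun i => sp (t₀ i) (r₀ i)).N ^ k).rank ≤ (D'.N ^ k).rank :=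
          hiso.symm.rank_N_pow_le k
      _ = ((ρ (c τ) - 1) ^ k).rank := by rw [hD'.1]; exact (hτ k).1
      _ ≤ ((σ (c τ) - 1) ^ k).rank := h1
      _ = (Dσ'.N ^ k).rank := by rw [hDσ'.1]; exact (hτ k).2.symm
      _ ≤ ((sumWD fun i => sp (t i) ((r i).map (intalVal p 𝒪))).N ^ k).rank :=
          hisoσ.rank_N_pow_le k
      _ = ((sumWD fun i => sp (t i) ((r i).map θ)).N ^ k).rank := by
          rw [rank_sumWD_sp_N_pow, rank_sumWD_sp_N_pow]

omit [IsAlgClosed K] in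
/-- At a specialization injective on `𝒪`, a semisimple representation is obtained from the generic
one by extension of scalars, and so is its Weil–Deligne representation. -/
theorem specialize_of_injective (h𝒪 : Function.Injective (algebraMap ℤ_[p] 𝒪))
    (hσ : IsIrred σ) (hT : ∀ g, algebraMap 𝒪 (Qbar 𝒪) (T g) = (σ g).trace)
    (hE : FrobSemisimpleWDIso φ z (σ.comp c)
      (sumWD fun i => sp (t i) ((r i).map (intalVal p 𝒪)))) (θ : intal p 𝒪 →+* K)
    (hθ : Function.Injective (θ.comp (intalOf p 𝒪)))
    (hθp : (θ.comp (intalOf p 𝒪)).comp (algebraMap ℤ_[p] 𝒪) = algebraMap ℤ_[p] K)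
    {τ : G →* Matrix κ κ K} (hτ : IsSemisimpleRep τ)
    (htr : ∀ g, (τ g).trace = θ (intalOf p 𝒪 (T g))) :
    FrobSemisimpleWDIso φ z (τ.comp c) (sumWD fun i => sp (t i) ((r i).map θ)) := by
  have hchar : CharZero (Qbar 𝒪) := charZero_of_injective (algebraMap_padicInt_Qbar_injective h𝒪)
  obtain ⟨f, hf⟩ := exists_extension θ hθ
  have hfO : ∀ a, f (algebraMap 𝒪 (Qbar 𝒪) a) = θ (intalOf p 𝒪 a) := fun a => by
    rw [← hf]; rfl
  have := hσ.nonempty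
  have h1 : RepIso τ (mapRep f σ) := repIso_of_trace_eq (hσ.isFull.mapRep f) hτ fun g => by
    rw [htr, ← hfO, hT]
    exact (AddMonoidHom.map_trace (f : Qbar 𝒪 →+ K) (σ g)).symm
  have h2 := (hE.baseChange f (by
    rw [IsScalarTower.algebraMap_eq ℤ_[p] 𝒪 (Qbar 𝒪), ← RingHom.comp_assoc, ← hθp]
    congr 1
    exact RingHom.ext hfO)).trans (baseChange_sumWD_sp f t fun i => (r i).map (intalVal p 𝒪))
  simp only [InertiaFiniteRep.map_map, hf] at h2
  exact h2.of_repIso (h1.comp c)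

end Fibres

/-- A sum of representations described by strings is described by the union of the strings,
enumerated in any order. -/
lemma FrobSemisimpleWDIso.sum_strings [Algebra ℤ_[p] K] {G : Type*} [Group G]
    {c : WeilGroup F w →* G} {n : ℕ} {b : Fin n → ℕ}
    {ρ : ∀ i, G →* Matrix (Fin (b i)) (Fin (b i)) K} {m : Fin n → ℕ}
    {t d : ∀ i, Fin (m i) → ℕ} {r : ∀ i l, InertiaFiniteRep w (Fin (d i l)) K}
    (h : ∀ i, FrobSemisimpleWDIso φ z ((ρ i).comp c) (sumWD fun l => sp (t i l) (r i l))) {M : ℕ}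
    (e : Fin M ≃ Σ i, Fin (m i)) :
    FrobSemisimpleWDIso φ z ((sumRep ρ).comp c)
      (sumWD fun a => sp (t (e a).1 (e a).2) (r (e a).1 (e a).2)) :=
  ((FrobSemisimpleWDIso.sum h).trans (sumWD_sigma fun i l => sp (t i l) (r i l))).trans
    (sumWD_reindex e fun x => sp (t x.1 x.2) (r x.1 x.2)).symm

end Families

/-! ### Elements of the purity locus -/

section Locus

variable {F : Type*} [Field F] [NumberField F] {w : HeightOneSpectrum (𝓞 F)}
  {p : ℕ} [Fact p.Prime] {𝒪 : Type u} [CommRing 𝒪] [IsDomain 𝒪] [Algebra ℤ_[p] 𝒪] {n : ℕ}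
  {e : AlgebraicClosure F →ₐ[F] Kbar F w} {φ : WeilGroup F w}
  {z : RootSystem p w} {Ti : Fin n → GalGlobal F → 𝒪} (x : PurityLocus.{u, v, _} e φ z Ti)
  {resL : intal p 𝒪 →+* intal p x.R} {i : Fin n}
  {m : ℕ} {t d : Fin m → ℕ} {r : ∀ i, InertiaFiniteRep w (Fin (d i)) (intal p 𝒪)}
  {ι κ : Type*} [Fintype ι] [DecidableEq ι] [Fintype κ] [DecidableEq κ]
  {σ : GalGlobal F →* Matrix ι ι (Qbar 𝒪)}

omit [IsDomain 𝒪] in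
lemma PurityLocus.algebraMap_closure_injective :
    Function.Injective (algebraMap ℤ_[p] (AlgebraicClosure x.𝔭.ResidueField)) := by
  rw [IsScalarTower.algebraMap_eq ℤ_[p] x.𝔭.ResidueField]
  exact (algebraMap x.𝔭.ResidueField _).injective.comp x.injective_residue

omit [IsDomain 𝒪] in
lemma PurityLocus.mk_h_algebraMap (𝔞 : Ideal x.Rh) (a : ℤ_[p]) :
    Ideal.Quotient.mk 𝔞 (x.h (algebraMap ℤ_[p] x.R a)) = algebraMap ℤ_[p] (x.Rh ⧸ 𝔞) a := by
  have h1 : algebraMap ℤ_[p] (Localization.AtPrime x.𝔭) a =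
      algebraMap x.R (Localization.AtPrime x.𝔭) (algebraMap ℤ_[p] x.R a) :=
    IsScalarTower.algebraMap_apply ..
  have h2 : algebraMap ℤ_[p] x.Rh a = algebraMap (Localization.AtPrime x.𝔭) x.Rh
      (algebraMap ℤ_[p] (Localization.AtPrime x.𝔭) a) :=
    IsScalarTower.algebraMap_apply ℤ_[p] (Localization.AtPrime x.𝔭)
      (Localization.AtPrime (HenselRing.point (Localization.AtPrime x.𝔭))) a
  rw [PurityLocus.h, RingHom.comp_apply, ← h1, ← h2]
  rfl

omit [IsDomain 𝒪] in
lemma PurityLocus.charZero_closure : CharZero (AlgebraicClosure x.𝔭.ResidueField) :=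
  charZero_of_injective x.algebraMap_closure_injective

omit [IsDomain 𝒪] in
lemma PurityLocus.algebraMap_injective : Function.Injective (algebraMap ℤ_[p] x.R) := by
  have h := x.injective_residue
  rw [IsScalarTower.algebraMap_eq ℤ_[p] x.R x.𝔭.ResidueField] at h
  rw [RingHom.coe_comp] at h
  exact Function.Injective.of_comp h

omit [IsDomain 𝒪] in
lemma PurityLocus.charZero_Qbar : CharZero (Qbar x.R) :=
  charZero_of_injective (algebraMap_padicInt_Qbar_injective x.algebraMap_injective)

omit [IsDomain 𝒪] in
lemma PurityLocus.charZero_Qbar_quotient {𝔞 : Ideal x.Rh} [𝔞.IsPrime]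
    (h𝔞 : 𝔞 ∈ minimalPrimes x.Rh) : CharZero (Qbar (x.Rh ⧸ 𝔞)) := by
  refine charZero_of_injective (algebraMap_padicInt_Qbar_injective (p := p) fun a b hab => ?_)
  rw [← x.mk_h_algebraMap, ← x.mk_h_algebraMap] at hab
  exact x.algebraMap_injective (x.mk_comp_h_injective h𝔞 hab)

/-- The residual representation at an element of the purity locus. -/
theorem PurityLocus.residual (hw : (p : 𝓞 F) ∉ w.asIdeal) (hφ : frobVal φ = 1)
    (h𝒪 : Function.Injective (algebraMap ℤ_[p] 𝒪))
    (hT : ∀ g, algebraMap 𝒪 (Qbar 𝒪) (Ti i g) = (σ g).trace) (ht : ∀ i, 0 < t i)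
    (hd : ∀ i, 0 < d i) (hr : ∀ i, IsFull (r i).r)
    (hE : FrobSemisimpleWDIso φ z (σ.comp (weilToGlobal e))
      (sumWD fun i => sp (t i) ((r i).map (intalVal p 𝒪))))
    (hresL : IsLift ((intalOf p x.R).comp (x.res : 𝒪 →+* x.R)) resL)
    {πL : intal p x.R →+* AlgebraicClosure x.𝔭.ResidueField}
    (hπL : IsLift (algebraMap x.R (AlgebraicClosure x.𝔭.ResidueField)) πL) :
    FrobSemisimpleWDIso φ z ((x.ρ i).comp (weilToGlobal e))
      (sumWD fun i => sp (t i) ((r i).map (πL.comp resL))) := by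
  have hchar := x.charZero_closure
  obtain ⟨k, hk⟩ := x.pure i
  refine specialize_of_isPureRep hw hφ h𝒪 hT ht hd hr hE x.algebraMap_closure_injective
    (πL.comp resL) (x.irreducible i) (fun g => ?_) hk
  rw [← x.trace, ← hπL]
  exact congrArg πL (RingHom.congr_fun hresL (Ti i g))

/-- Representations over the Henselization, at the generic point of an irreducible component. They
are irreducible because the residual representation is. -/
theorem PurityLocus.henselian (h𝒪 : Function.Injective (algebraMap ℤ_[p] 𝒪)) (hσ : IsIrred σ)
    (hT : ∀ g, algebraMap 𝒪 (Qbar 𝒪) (Ti i g) = (σ g).trace)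
    (hE : FrobSemisimpleWDIso φ z (σ.comp (weilToGlobal e))
      (sumWD fun i => sp (t i) ((r i).map (intalVal p 𝒪))))
    (hresL : IsLift ((intalOf p x.R).comp (x.res : 𝒪 →+* x.R)) resL)
    {ϱ : GalGlobal F →* Matrix κ κ x.Rh} (hϱ : ∀ g, (ϱ g).trace = x.h (x.res (Ti i g)))
    {𝔞 : Ideal x.Rh} [𝔞.IsPrime] (h𝔞 : 𝔞 ∈ minimalPrimes x.Rh)
    {hL : intal p x.R →+* intal p (x.Rh ⧸ 𝔞)}
    (hhL : IsLift ((intalOf p (x.Rh ⧸ 𝔞)).comp ((Ideal.Quotient.mk 𝔞).comp x.h)) hL) :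
    FrobSemisimpleWDIso φ z ((mapRep ((algebraMap (x.Rh ⧸ 𝔞) (Qbar (x.Rh ⧸ 𝔞))).comp
      (Ideal.Quotient.mk 𝔞)) ϱ).comp (weilToGlobal e))
      (sumWD fun i => sp (t i) ((r i).map ((intalVal p (x.Rh ⧸ 𝔞)).comp (hL.comp resL)))) := by
  have hRinj := x.mk_comp_h_injective h𝔞
  have hθ : ∀ a, (((intalVal p (x.Rh ⧸ 𝔞)).comp (hL.comp resL)).comp (intalOf p 𝒪)) a =
      algebraMap (x.Rh ⧸ 𝔞) (Qbar (x.Rh ⧸ 𝔞)) (((Ideal.Quotient.mk 𝔞).comp x.h) (x.res a)) := by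
    intro a
    have h1 : resL (intalOf p 𝒪 a) = intalOf p x.R (x.res a) := RingHom.congr_fun hresL a
    have h2 : hL (intalOf p x.R (x.res a)) =
      intalOf p (x.Rh ⧸ 𝔞) (((Ideal.Quotient.mk 𝔞).comp x.h) (x.res a)) :=
        RingHom.congr_fun hhL (x.res a)
    rw [← intalVal_intalOf (p := p), ← h2, ← h1]
    rfl
  have hθinj : Function.Injective
      (((intalVal p (x.Rh ⧸ 𝔞)).comp (hL.comp resL)).comp (intalOf p 𝒪)) := by
    intro a b hab
    rw [hθ, hθ] at hab
    exact x.res_injective (hRinj (algebraMap_Qbar_injective hab))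
  have hθp : (((intalVal p (x.Rh ⧸ 𝔞)).comp (hL.comp resL)).comp (intalOf p 𝒪)).comp
      (algebraMap ℤ_[p] 𝒪) = algebraMap ℤ_[p] (Qbar (x.Rh ⧸ 𝔞)) := by
    ext a
    rw [RingHom.comp_apply, hθ, AlgHom.commutes, RingHom.comp_apply, x.mk_h_algebraMap,
      ← IsScalarTower.algebraMap_apply]
  have hcharΩ := x.charZero_Qbar_quotient h𝔞
  have hcharκ := x.charZero_closure
  have hϱ' : ∀ g, ((algebraMap (x.Rh ⧸ 𝔞) (Qbar (x.Rh ⧸ 𝔞))).comp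
      ((Ideal.Quotient.mk 𝔞).comp x.h)) (x.res (Ti i g)) =
      (mapRep ((algebraMap (x.Rh ⧸ 𝔞) (Qbar (x.Rh ⧸ 𝔞))).comp
        (Ideal.Quotient.mk 𝔞)) ϱ g).trace := by
    intro g
    rw [RingHom.comp_apply, RingHom.comp_apply, ← hϱ]
    exact AddMonoidHom.map_trace (((algebraMap (x.Rh ⧸ 𝔞) (Qbar (x.Rh ⧸ 𝔞))).comp
      (Ideal.Quotient.mk 𝔞) : x.Rh →+* _) : x.Rh →+ Qbar (x.Rh ⧸ 𝔞)) (ϱ g)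
  have hinj := (algebraMap_Qbar_injective (R := x.Rh ⧸ 𝔞)).comp hRinj
  have hcard := card_eq_of_trace (T := fun g => x.res (Ti i g))
    (algebraMap x.R (AlgebraicClosure x.𝔭.ResidueField)) hinj (x.trace i) hϱ'
  have hfull := (x.irreducible i).isFull.of_specialization (T := fun g => x.res (Ti i g))
    (algebraMap x.R (AlgebraicClosure x.𝔭.ResidueField)) hinj (x.trace i) hϱ'
  have hne : Nonempty κ := by
    have := (x.irreducible i).nonempty
    rw [← Fintype.card_pos_iff] at this ⊢
    omega
  refine specialize_of_injective h𝒪 hσ hT hE _ hθinj hθp hfull.isIrred.isSemisimpleRep fun g => ?_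
  rw [← hϱ']
  exact (hθ (Ti i g)).symm

/-- Semisimple representations over the algebraic closure of the fraction field of the base of an
element of the purity locus. -/
theorem PurityLocus.generic (h𝒪 : Function.Injective (algebraMap ℤ_[p] 𝒪)) (hσ : IsIrred σ)
    (hT : ∀ g, algebraMap 𝒪 (Qbar 𝒪) (Ti i g) = (σ g).trace)
    (hE : FrobSemisimpleWDIso φ z (σ.comp (weilToGlobal e))
      (sumWD fun i => sp (t i) ((r i).map (intalVal p 𝒪))))
    (hresL : IsLift ((intalOf p x.R).comp (x.res : 𝒪 →+* x.R)) resL)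
    {τ : GalGlobal F →* Matrix κ κ (Qbar x.R)} (hτ : IsSemisimpleRep τ)
    (hτtr : ∀ g, (τ g).trace = algebraMap x.R (Qbar x.R) (x.res (Ti i g))) :
    FrobSemisimpleWDIso φ z (τ.comp (weilToGlobal e))
      (sumWD fun i => sp (t i) ((r i).map ((intalVal p x.R).comp resL))) := by
  have hθ : ∀ a, (((intalVal p x.R).comp resL).comp (intalOf p 𝒪)) a =
      algebraMap x.R (Qbar x.R) (x.res a) := fun a =>
    congrArg (intalVal p x.R) (RingHom.congr_fun hresL a)
  have hθinj : Function.Injective (((intalVal p x.R).comp resL).comp (intalOf p 𝒪)) := by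
    intro a b hab
    rw [hθ, hθ] at hab
    exact x.res_injective (algebraMap_Qbar_injective hab)
  have hθp : (((intalVal p x.R).comp resL).comp (intalOf p 𝒪)).comp (algebraMap ℤ_[p] 𝒪) =
      algebraMap ℤ_[p] (Qbar x.R) := by
    ext a
    rw [RingHom.comp_apply, hθ, AlgHom.commutes, ← IsScalarTower.algebraMap_apply]
  have hcharΩ := x.charZero_Qbar
  refine specialize_of_injective h𝒪 hσ hT hE _ hθinj hθp hτ fun g => ?_
  rw [hτtr]
  exact (hθ (Ti i g)).symm

end Locus

end PurityFamilies

theorem mainTheorem3 {F : Type*} [Field F] [NumberField F] (p : ℕ) [Fact p.Prime]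
    -- a finite place `w` of `F` not dividing `p`, an embedding of algebraic closures, a lift `φ`
    -- of the geometric Frobenius, and a compatible system `z` of `p`-power roots of unity
    (w : HeightOneSpectrum (𝓞 F)) (hw : (p : 𝓞 F) ∉ w.asIdeal)
    (e : AlgebraicClosure F →ₐ[F] Kbar F w)
    (φ : WeilGroup F w) (hφ : frobVal φ = 1) (z : RootSystem p w)
    -- a domain `𝒪` containing `ℤ_p`
    {𝒪 : Type u} [CommRing 𝒪] [IsDomain 𝒪] [Algebra ℤ_[p] 𝒪]
    (h𝒪 : Function.Injective (algebraMap ℤ_[p] 𝒪))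
    -- a pseudorepresentation `T = T_1 + ⋯ + T_n` of `G_F`
    {n : ℕ} (hn : 0 < n) (d : ℕ) (T : GalGlobal F → 𝒪) (hT : IsPseudorepresentation d T)
    (Ti : Fin n → GalGlobal F → 𝒪) (hsum : ∀ g, T g = ∑ i, Ti i g)
    -- `T_i` is the trace of the irreducible representation `σ_i`, monodromic at `w`
    (dσ : Fin n → ℕ) (σ : ∀ i, GalGlobal F →* Matrix (Fin (dσ i)) (Fin (dσ i)) (Qbar 𝒪))
    (hσ : ∀ i, IsIrred (σ i))
    (htr : ∀ i g, algebraMap 𝒪 (Qbar 𝒪) (Ti i g) = (σ i g).trace)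
    (hmono : ∀ i, IsMonodromic z ((σ i).comp (weilToGlobal e)))
    -- the irreducibility and purity locus is nonempty
    (hlocus : Nonempty (PurityLocus.{u, v, _} e φ z Ti)) :
    ∃ (m : ℕ) (t dr : Fin m → ℕ) (r : ∀ i, InertiaFiniteRep w (Fin (dr i)) (intal p 𝒪)),
      0 < m ∧ (∀ i, 0 < t i) ∧ Monotone t ∧
      (∀ i, ((r i).map (intalVal p 𝒪)).IsIrredFrobSemisimple φ) ∧
      (∀ g : WeilGroup F w, algebraMap 𝒪 (Qbar 𝒪) (T (weilToGlobal e g)) =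
        ∑ i, ∑ j ∈ Finset.Icc 1 (t i),
          intalVal p 𝒪 ((r i).r g).trace * normChar w (Qbar 𝒪) g ^ (j - 1)) ∧
      ∀ x : PurityLocus.{u, v, _} e φ z Ti,
        ∀ resL : intal p 𝒪 →+* intal p x.R,
          IsLift ((intalOf p x.R).comp (x.res : 𝒪 →+* x.R)) resL →
        -- the residual representations `ρ_i`
        (∀ πL : intal p x.R →+* AlgebraicClosure x.𝔭.ResidueField,
          IsLift (algebraMap x.R (AlgebraicClosure x.𝔭.ResidueField)) πL →
          FrobSemisimpleWDIso φ z ((sumRep x.ρ).comp (weilToGlobal e))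
            (sumWD fun i => sp (t i) ((r i).map (πL.comp resL)))) ∧
        -- lifts `ϱ_i` over the Henselization, modulo any minimal prime
        (∀ (dϱ : Fin n → ℕ) (ϱ : ∀ i, GalGlobal F →* Matrix (Fin (dϱ i)) (Fin (dϱ i)) x.Rh),
          (∀ i g, (ϱ i g).trace = x.h (x.res (Ti i g))) →
          ∀ (𝔞 : Ideal x.Rh) [𝔞.IsPrime], 𝔞 ∈ minimalPrimes x.Rh →
          ∀ hL : intal p x.R →+* intal p (x.Rh ⧸ 𝔞),
            IsLift ((intalOf p (x.Rh ⧸ 𝔞)).comp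
              ((Ideal.Quotient.mk 𝔞).comp x.h)) hL →
          FrobSemisimpleWDIso φ z
            ((sumRep fun i => mapRep ((algebraMap (x.Rh ⧸ 𝔞) (Qbar (x.Rh ⧸ 𝔞))).comp
              (Ideal.Quotient.mk 𝔞)) (ϱ i)).comp (weilToGlobal e))
            (sumWD fun i => sp (t i) ((r i).map
              ((intalVal p (x.Rh ⧸ 𝔞)).comp (hL.comp resL))))) ∧
        -- semisimple representations over the algebraic closure of the fraction field of `R`
        (∀ (dτ : Fin n → ℕ) (τ : ∀ i, GalGlobal F →* Matrix (Fin (dτ i)) (Fin (dτ i)) (Qbar x.R)),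
          (∀ i, IsSemisimpleRep (τ i)) →
          (∀ i g, (τ i g).trace = algebraMap x.R (Qbar x.R) (x.res (Ti i g))) →
          FrobSemisimpleWDIso φ z ((sumRep τ).comp (weilToGlobal e))
            (sumWD fun i => sp (t i) ((r i).map
              ((intalVal p x.R).comp resL)))) ∧
        -- the generic representations `σ_i`
        FrobSemisimpleWDIso φ z ((sumRep σ).comp (weilToGlobal e))
          (sumWD fun i => sp (t i) ((r i).map (intalVal p 𝒪))) := by
  have hinj := algebraMap_padicInt_Qbar_injective h𝒪
  have hchar : CharZero (Qbar 𝒪) := charZero_of_injective hinj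
  choose mm tt dd rr ht hd hr hss hE using fun i => (hmono i).exists_integral_strings hw hφ h𝒪
    (T := fun g => Ti i (weilToGlobal e g)) (fun g => htr i (weilToGlobal e g))
  -- `ε` enumerates the strings of all the `σ_i` by increasing length.
  let e₀ : Fin (Fintype.card (Σ i, Fin (mm i))) ≃ Σ i, Fin (mm i) := (Fintype.equivFin _).symm
  let ε : Fin (Fintype.card (Σ i, Fin (mm i))) ≃ Σ i, Fin (mm i) :=
    (Tuple.sort fun a => tt (e₀ a).1 (e₀ a).2).trans e₀
  have hmpos : ∀ i, 0 < mm i := by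
    intro i
    rw [Fin.pos_iff_nonempty]
    by_contra hm
    rw [not_nonempty_iff] at hm
    have h1 := (hE i).trace_eq hφ 1
    rw [trace_sumWD_sp, Fintype.sum_empty, map_one, Matrix.trace_one] at h1
    have := (hσ i).nonempty
    exact Fintype.card_ne_zero (α := Fin (dσ i)) (by exact_mod_cast h1)
  have hgen := FrobSemisimpleWDIso.sum_strings hE ε
  refine ⟨_, fun a => tt (ε a).1 (ε a).2, fun a => dd (ε a).1 (ε a).2,
    fun a => rr (ε a).1 (ε a).2, ?_, fun a => ht _ _, ?_, fun a => ⟨?_, hss _ _⟩, fun g => ?_,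
    fun x resL hresL => ⟨fun πL hπL => ?_, ?_, ?_, hgen⟩⟩
  · exact Fintype.card_pos_iff.2 ⟨⟨⟨0, hn⟩, ⟨0, hmpos _⟩⟩⟩
  · exact Tuple.monotone_sort fun a => tt (e₀ a).1 (e₀ a).2
  · have : Nonempty (Fin (dd (ε a).1 (ε a).2)) := ⟨⟨0, hd _ _⟩⟩
    exact ((hr (ε a).1 (ε a).2).mapRep (intalVal p 𝒪)).isIrred
  · have h1 := hgen.trace_eq hφ g
    rw [trace_sumWD_sp] at h1
    have h2 : (((sumRep σ).comp (weilToGlobal e)) g).trace =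
        algebraMap 𝒪 (Qbar 𝒪) (T (weilToGlobal e g)) := by
      rw [hsum, map_sum, MonoidHom.comp_apply, sumRep_apply, Matrix.trace_blockDiagonal']
      exact Finset.sum_congr rfl fun i _ => (htr i _).symm
    rw [← h2, h1]
    refine Finset.sum_congr rfl fun a _ => ?_
    rw [Fin.sum_univ_eq_sum_range (fun l => normChar w (Qbar 𝒪) g ^ l *
      (((rr (ε a).1 (ε a).2).map (intalVal p 𝒪)).r g).trace)]
    refine Finset.sum_nbij' (fun l => l + 1) (fun j => j - 1) (fun l hl => ?_) (fun j hj => ?_)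
      (fun l _ => rfl) (fun j hj => ?_) (fun l _ => ?_)
    · rw [Finset.mem_range] at hl
      exact Finset.mem_Icc.2 ⟨Nat.le_add_left 1 l, hl⟩
    · have := Finset.mem_Icc.1 hj
      exact Finset.mem_range.2 (by simp only at this; omega)
    · have := Finset.mem_Icc.1 hj
      omega
    · rw [mul_comm, Nat.add_sub_cancel]
      congr 1
      exact (AddMonoidHom.map_trace (intalVal p 𝒪 : intal p 𝒪 →+ Qbar 𝒪) _).symm
  · have hcharκ := x.charZero_closure
    exact FrobSemisimpleWDIso.sum_strings (ρ := x.ρ) (t := tt)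
      (r := fun i l => (rr i l).map (πL.comp resL))
      (fun i => x.residual hw hφ h𝒪 (htr i) (ht i) (hd i) (hr i) (hE i) hresL hπL) ε
  · intro dϱ ϱ hϱ 𝔞 _ h𝔞 hL hhL
    have hcharΩ := x.charZero_Qbar_quotient h𝔞
    exact FrobSemisimpleWDIso.sum_strings (t := tt)
      (ρ := fun i => mapRep ((algebraMap (x.Rh ⧸ 𝔞) (Qbar (x.Rh ⧸ 𝔞))).comp
        (Ideal.Quotient.mk 𝔞)) (ϱ i))
      (r := fun i l => (rr i l).map ((intalVal p (x.Rh ⧸ 𝔞)).comp (hL.comp resL)))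
      (fun i => x.henselian h𝒪 (hσ i) (htr i) (hE i) hresL (hϱ i) h𝔞 hhL) ε
  · intro dτ τ hτ hτtr
    have hcharΩ := x.charZero_Qbar
    exact FrobSemisimpleWDIso.sum_strings (ρ := τ) (t := tt)
      (r := fun i l => (rr i l).map ((intalVal p x.R).comp resL))
      (fun i => x.generic h𝒪 (hσ i) (htr i) (hE i) hresL (hτ i) (hτtr i)) ε
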